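/- Let $E$ be a complex elliptic curve with origin $0$, let $n\ge 3$, let $\operatorname{Sym}^nE=E^n/\mathfrak S_n$ be its $n$-th symmetric power, and let $\Sigma\colon \operatorname{Sym}^nE\to E$, $\{x_1,\dots,x_n\}\mapsto x_1+\dots+x_n$, be the sum map. Let $$D=\{\{y_1,\dots,y_n\}\in\Sigma^{-1}(0)\;:\; y_i=y_j\text{ for some } i\ne j\}\subset\Sigma^{-1}(0).$$ Then: 1. $D$ is an irreducible divisor in $\Sigma^{-1}(0)$, i.e. an irreducible closed subset of codimension one. 2. $D$ (with its reduced structure) is birational to the total space $\widetilde D$ of a (Zariski-locally trivial) $\mathbb P^{n-3}$-fibration $\widetilde D\to E$. 3. Every such $\widetilde D$ has $h^{1,0}(\widetilde D)=\dim_{\mathbb C} H^0(\widetilde D,\Omega^1_{\widetilde D})=1$. 4. $D$ is not rational, i.e. it is not birational to any projective space. -/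

import Mathlib

open Topology Filter
open scoped LinearAlgebra.Projectivization

noncomputable section

/-- A complex *space with functions* (the classical language for varieties): a topological space
with, for every point `p`, a notion of "the complex-valued function `f` is regular at `p`".
Regularity at `p` depends only on `f` near `p`, it is an open condition, regular functions form a
`ℂ`-algebra, and where a regular function does not vanish it does not vanish nearby and its inverse
is regular.  The sheaf of regular functions on an open set `U` consists of the functions that are
regular at all points of `U`; functions are written as total functions, but only the germ
matters. -/
structure SpaceWithFunctions where
  carrier : Type
  top : TopologicalSpace carrier
  RegAt : (carrier → ℂ) → carrier → Prop
  regAt_congr : ∀ {f g : carrier → ℂ} {p : carrier}, f =ᶠ[𝓝 p] g → RegAt f p → RegAt g p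
  eventually_regAt : ∀ {f : carrier → ℂ} {p : carrier}, RegAt f p → ∀ᶠ q in 𝓝 p, RegAt f q
  regAt_const : ∀ (c : ℂ) (p : carrier), RegAt (fun _ => c) p
  regAt_add : ∀ {f g : carrier → ℂ} {p : carrier}, RegAt f p → RegAt g p → RegAt (f + g) p
  regAt_mul : ∀ {f g : carrier → ℂ} {p : carrier}, RegAt f p → RegAt g p → RegAt (f * g) p
  regAt_inv : ∀ {f : carrier → ℂ} {p : carrier}, RegAt f p → f p ≠ 0 →
    (∀ᶠ q in 𝓝 p, f q ≠ 0) ∧ RegAt f⁻¹ p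

namespace SpaceWithFunctions

instance : CoeSort SpaceWithFunctions Type := ⟨carrier⟩

instance instTop (X : SpaceWithFunctions) : TopologicalSpace X := X.top

/-- `f` is regular on the set `U`, i.e. at each of its points. -/
def RegOn (X : SpaceWithFunctions) (f : X → ℂ) (U : Set X) : Prop := ∀ p ∈ U, X.RegAt f p

/-- Morphisms: continuous maps that pull back regular functions to regular functions. -/
def IsMorphism (X Y : SpaceWithFunctions) (φ : X → Y) : Prop :=
  Continuous φ ∧ ∀ (f : Y → ℂ) (p : X), Y.RegAt f (φ p) → X.RegAt (f ∘ φ) p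

/-- A bijection that is an isomorphism of spaces with functions. -/
def IsIso (X Y : SpaceWithFunctions) (φ : X ≃ Y) : Prop :=
  IsMorphism X Y φ ∧ IsMorphism Y X φ.symm

/-! ### Spaces whose regular functions are local fractions -/

/-- Data of domains `U j` and spaces of functions `A j` (thought of as given on `U j`), closed under
products. -/
structure FractionData (S : Type) where
  J : Type
  U : J → Set S
  A : J → Submodule ℂ (S → ℂ)
  one : ∃ j, U j = Set.univ ∧ (1 : S → ℂ) ∈ A j
  mul : ∀ i j, ∃ k, U k = U i ∩ U j ∧ ∀ a ∈ A i, ∀ b ∈ A j, a * b ∈ A k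

namespace FractionData

variable {S : Type} (d : FractionData S)

/-- The basic set on which the fractions with denominator `h ∈ A j` are defined. -/
def basic (j : d.J) (h : S → ℂ) : Set S := {x | x ∈ d.U j ∧ h x ≠ 0}

/-- The topology generated by all basic sets. -/
def topology : TopologicalSpace S :=
  TopologicalSpace.generateFrom {V | ∃ j, ∃ h ∈ d.A j, V = d.basic j h}

/-- `f` agrees with a fraction `g / h`, with `g h ∈ A j`, on a basic set around `p`. -/
def RegAt (f : S → ℂ) (p : S) : Prop :=
  ∃ j, ∃ g ∈ d.A j, ∃ h ∈ d.A j, p ∈ d.basic j h ∧ ∀ x ∈ d.basic j h, f x = g x / h x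

lemma basic_inter {i j : d.J} {a b : S → ℂ} (ha : a ∈ d.A i) (hb : b ∈ d.A j) :
    ∃ k, (∀ a ∈ d.A i, ∀ b ∈ d.A j, a * b ∈ d.A k) ∧
      a * b ∈ d.A k ∧ d.basic k (a * b) = d.basic i a ∩ d.basic j b := by
  obtain ⟨k, hk, hm⟩ := d.mul i j
  refine ⟨k, hm, hm a ha b hb, ?_⟩
  ext x
  simp only [basic, hk, Set.mem_inter_iff, Set.mem_setOf_eq, Pi.mul_apply, mul_ne_zero_iff]
  tauto

lemma isBasis : @TopologicalSpace.IsTopologicalBasis S d.topology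
    {V | ∃ j, ∃ h ∈ d.A j, V = d.basic j h} := by
  let _ := d.topology
  refine ⟨?_, ?_, rfl⟩
  · rintro _ ⟨i, a, ha, rfl⟩ _ ⟨j, b, hb, rfl⟩ x hx
    obtain ⟨k, -, hab, he⟩ := d.basic_inter ha hb
    exact ⟨_, ⟨k, _, hab, rfl⟩, he ▸ hx, he.le⟩
  · obtain ⟨j, hj, h1⟩ := d.one
    refine Set.eq_univ_of_forall fun x => Set.mem_sUnion.2 ⟨_, ⟨j, 1, h1, rfl⟩, ?_⟩
    simp [basic, hj]

/-- The space with functions defined by local fractions. -/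
def toSpace : SpaceWithFunctions where
  carrier := S
  top := d.topology
  RegAt := d.RegAt
  regAt_congr := by
    let _ := d.topology
    rintro f f' p hff ⟨i, g, hg, h, hh, hp, hf⟩
    obtain ⟨_, ⟨j, b, hb, rfl⟩, hpb, hsub⟩ := d.isBasis.mem_nhds_iff.1 hff
    obtain ⟨k, hm, hab, he⟩ := d.basic_inter hh hb
    refine ⟨k, g * b, hm g hg b hb, h * b, hab, he ▸ ⟨hp, hpb⟩, fun x hx => ?_⟩
    rw [he] at hx
    rw [← (show f x = f' x from hsub hx.2), hf x hx.1, Pi.mul_apply, Pi.mul_apply,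
      mul_div_mul_right _ _ hx.2.2]
  eventually_regAt := by
    let _ := d.topology
    rintro f p ⟨i, g, hg, h, hh, hp, hf⟩
    filter_upwards [(d.isBasis.isOpen ⟨i, h, hh, rfl⟩).mem_nhds hp] with q hq
    exact ⟨i, g, hg, h, hh, hq, hf⟩
  regAt_const := by
    intro c p
    obtain ⟨j, hj, h1⟩ := d.one
    exact ⟨j, c • 1, (d.A j).smul_mem c h1, 1, h1, by simp [basic, hj], by simp⟩
  regAt_add := by
    rintro f f' p ⟨i, g, hg, h, hh, hp, hf⟩ ⟨j, g', hg', h', hh', hp', hf'⟩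
    obtain ⟨k, hm, hab, he⟩ := d.basic_inter hh hh'
    refine ⟨k, g * h' + h * g', (d.A k).add_mem (hm _ hg _ hh') (hm _ hh _ hg'), h * h', hab,
      he ▸ ⟨hp, hp'⟩, fun x hx => ?_⟩
    rw [he] at hx
    have h1 := hx.1.2
    have h2 := hx.2.2
    simp only [Pi.add_apply, Pi.mul_apply, hf x hx.1, hf' x hx.2]
    field_simp
  regAt_mul := by
    rintro f f' p ⟨i, g, hg, h, hh, hp, hf⟩ ⟨j, g', hg', h', hh', hp', hf'⟩
    obtain ⟨k, hm, hab, he⟩ := d.basic_inter hh hh'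
    refine ⟨k, g * g', hm _ hg _ hg', h * h', hab, he ▸ ⟨hp, hp'⟩, fun x hx => ?_⟩
    rw [he] at hx
    simp only [Pi.mul_apply, hf x hx.1, hf' x hx.2, div_mul_div_comm]
  regAt_inv := by
    let _ := d.topology
    rintro f p ⟨i, g, hg, h, hh, hp, hf⟩ hfp
    have hgp : p ∈ d.basic i g := ⟨hp.1, fun h0 => hfp (by rw [hf p hp, h0, zero_div])⟩
    obtain ⟨k, hm, hab, he⟩ := d.basic_inter hg hh
    constructor
    · filter_upwards [(d.isBasis.isOpen ⟨k, _, hab, rfl⟩).mem_nhds (he ▸ ⟨hgp, hp⟩)] with q hq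
      rw [he] at hq
      rw [hf q hq.2]
      exact div_ne_zero hq.1.2 hq.2.2
    · refine ⟨k, h * h, ?_, g * h, hab, he ▸ ⟨hgp, hp⟩, fun x hx => ?_⟩
      · exact hm h hh h hh
      · rw [he] at hx
        rw [Pi.inv_apply, hf x hx.2, inv_div, Pi.mul_apply, Pi.mul_apply,
          mul_div_mul_right _ _ hx.2.2]

end FractionData

/-! ### Constructions -/

/-- The initial structure on `S` along a family of maps `φ i : S → Y i`: on `⋂ (φ i)⁻¹ (U i)`, with
`U i ⊆ Y i` open, take the algebra generated by the `f ∘ φ i` with `f` regular on `U i`; the regular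
functions are the local fractions of such functions. -/
def initialData {S ι : Type} (Y : ι → SpaceWithFunctions) (φ : ∀ i, S → Y i) :
    FractionData S where
  J := ∀ i, TopologicalSpace.Opens (Y i)
  U j := {x | ∀ i, φ i x ∈ j i}
  A j := Subalgebra.toSubmodule
    (Algebra.adjoin ℂ {g | ∃ i, ∃ f, (Y i).RegOn f (j i) ∧ g = f ∘ φ i})
  one := ⟨⊤, by ext; simp, one_mem (Algebra.adjoin ℂ _)⟩
  mul i j := by
    refine ⟨i ⊓ j, ?_, ?_⟩
    · ext x
      simp [forall_and]
    · intro a ha b hb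
      rw [Subalgebra.mem_toSubmodule] at ha hb ⊢
      refine mul_mem (Algebra.adjoin_mono ?_ ha) (Algebra.adjoin_mono ?_ hb)
      · rintro _ ⟨l, f, hf, rfl⟩
        exact ⟨l, f, fun p hp => hf p hp.1, rfl⟩
      · rintro _ ⟨l, f, hf, rfl⟩
        exact ⟨l, f, fun p hp => hf p hp.2, rfl⟩

/-- The structure induced on `S` by a map to a space with functions.  For an injective map the open
sets are the preimages of open sets and the regular functions are the functions which extend locally
to regular functions on `Y`. -/
def induced {S : Type} (Y : SpaceWithFunctions) (φ : S → Y) : SpaceWithFunctions :=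
  (initialData (fun _ : Unit => Y) (fun _ => φ)).toSpace

/-- A subset with its induced structure (of an open or closed subspace, for example). -/
def sub (Y : SpaceWithFunctions) (Z : Set Y) : SpaceWithFunctions :=
  induced Y (Subtype.val : Z → Y)

/-- The power `Xⁿ` in the category of spaces with functions: the Zariski topology, not the product
topology. -/
def power (X : SpaceWithFunctions) (n : ℕ) : SpaceWithFunctions :=
  (initialData (fun _ : Fin n => X) (fun i (x : Fin n → X) => x i)).toSpace

/-- The product `X × Y` in the category of spaces with functions. -/
def prod (X Y : SpaceWithFunctions) : SpaceWithFunctions :=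
  (initialData (fun b : Bool => cond b X Y)
    (fun b (p : X × Y) => match b with
      | true => p.1
      | false => p.2)).toSpace

/-- The quotient structure along a map `q : X → S`: a set is open if its preimage is open, and `f`
is regular on an open set if `f ∘ q` is regular on its preimage. -/
def quotient (X : SpaceWithFunctions) {S : Type} (q : X → S) : SpaceWithFunctions where
  carrier := S
  top := X.top.coinduced q
  RegAt f s := ∃ V : Set S, IsOpen (q ⁻¹' V) ∧ s ∈ V ∧ X.RegOn (f ∘ q) (q ⁻¹' V)
  regAt_congr := by
    let _ : TopologicalSpace S := X.top.coinduced q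
    rintro f g s hfg ⟨V, hV, hs, hf⟩
    obtain ⟨V', hsub, hV', hs'⟩ := mem_nhds_iff.1 hfg
    have hO : IsOpen (q ⁻¹' (V ∩ V')) := hV.inter (isOpen_coinduced.1 hV')
    refine ⟨V ∩ V', hO, ⟨hs, hs'⟩, fun x hx => X.regAt_congr ?_ (hf x hx.1)⟩
    filter_upwards [hO.mem_nhds hx] with y hy
    exact hsub hy.2
  eventually_regAt := by
    let _ : TopologicalSpace S := X.top.coinduced q
    rintro f s ⟨V, hV, hs, hf⟩
    have hV' : IsOpen V := isOpen_coinduced.2 hV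
    filter_upwards [hV'.mem_nhds hs] with t ht
    exact ⟨V, hV, ht, hf⟩
  regAt_const c s := ⟨Set.univ, isOpen_univ, trivial, fun x _ => X.regAt_const c x⟩
  regAt_add := by
    rintro f g s ⟨V, hV, hs, hf⟩ ⟨V', hV', hs', hg⟩
    exact ⟨V ∩ V', hV.inter hV', ⟨hs, hs'⟩, fun x hx => X.regAt_add (hf x hx.1) (hg x hx.2)⟩
  regAt_mul := by
    rintro f g s ⟨V, hV, hs, hf⟩ ⟨V', hV', hs', hg⟩
    exact ⟨V ∩ V', hV.inter hV', ⟨hs, hs'⟩, fun x hx => X.regAt_mul (hf x hx.1) (hg x hx.2)⟩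
  regAt_inv := by
    let _ : TopologicalSpace S := X.top.coinduced q
    rintro f s ⟨V, hV, hs, hf⟩ hfs
    have hO : IsOpen (q ⁻¹' (V ∩ {t | f t ≠ 0})) := by
      rw [isOpen_iff_eventually]
      rintro x ⟨hx, hx0⟩
      exact (hV.eventually_mem hx).and (X.regAt_inv (hf x hx) hx0).1
    refine ⟨?_, V ∩ {t | f t ≠ 0}, hO, ⟨hs, hfs⟩, fun x hx => (X.regAt_inv (hf x hx.1) hx.2).2⟩
    have hO' : IsOpen (V ∩ {t | f t ≠ 0}) := isOpen_coinduced.2 hO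
    filter_upwards [hO'.mem_nhds ⟨hs, hfs⟩] with t ht
    exact ht.2

/-- Projective space `ℙʳ`: locally, regular functions are quotients of two homogeneous polynomials of
the same degree, evaluated at homogeneous coordinates. -/
def projData (r : ℕ) : FractionData (ℙ ℂ (Fin (r + 1) → ℂ)) where
  J := ℕ
  U _ := Set.univ
  A d := (MvPolynomial.homogeneousSubmodule (Fin (r + 1)) ℂ d).map
    (LinearMap.pi fun p : ℙ ℂ (Fin (r + 1) → ℂ) => (MvPolynomial.aeval p.rep).toLinearMap)
  one := ⟨0, rfl, 1, MvPolynomial.isHomogeneous_one _ _, by ext; simp⟩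
  mul i j := by
    refine ⟨i + j, by simp, ?_⟩
    rintro _ ⟨a, ha, rfl⟩ _ ⟨b, hb, rfl⟩
    exact ⟨a * b, MvPolynomial.IsHomogeneous.mul ha hb, by ext; simp⟩

/-- The projective space `ℙʳ` over `ℂ`, as a variety. -/
def proj (r : ℕ) : SpaceWithFunctions := (projData r).toSpace

/-! ### Birational geometry -/

/-- `X` and `Y` are birational: they have isomorphic dense open subspaces. -/
def Birational (X Y : SpaceWithFunctions) : Prop :=
  ∃ (U : Set X) (V : Set Y), IsOpen U ∧ Dense U ∧ IsOpen V ∧ Dense V ∧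
    ∃ φ : X.sub U ≃ Y.sub V, IsIso (X.sub U) (Y.sub V) φ

/-- `X` is rational: birational to a projective space. -/
def IsRational (X : SpaceWithFunctions) : Prop := ∃ m, Birational X (proj m)

/-- The morphism `π : X → B` is a `ℙʳ`-fibration: locally over `B` it is isomorphic to the projection
`U × ℙʳ → U`. -/
def IsProjectiveFibration (r : ℕ) (X B : SpaceWithFunctions) (π : X → B) : Prop :=
  IsMorphism X B π ∧ ∀ b : B, ∃ U : Set B, IsOpen U ∧ b ∈ U ∧
    ∃ φ : X.sub (π ⁻¹' U) ≃ (B.sub U).prod (proj r),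
      IsIso (X.sub (π ⁻¹' U)) ((B.sub U).prod (proj r)) φ ∧
      ∀ (x : X) (hx : x ∈ π ⁻¹' U), (φ (⟨x, hx⟩ : π ⁻¹' U)).1 = (⟨π x, hx⟩ : U)

/-- `Z` is an irreducible divisor of `X`: an irreducible closed subset of codimension one. -/
def IsIrreducibleDivisor (X : SpaceWithFunctions) (Z : Set X) : Prop :=
  ∃ (hi : IsIrreducible Z) (hc : IsClosed Z),
    Order.coheight (⟨Z, hi, hc⟩ : TopologicalSpace.IrreducibleCloseds X) = 1

/-! ### Differential forms -/

/-- The algebra of functions that are regular at `p`. -/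
def regRing (X : SpaceWithFunctions) (p : X) : Subalgebra ℂ (X → ℂ) where
  carrier := {f | X.RegAt f p}
  mul_mem' := X.regAt_mul
  add_mem' := X.regAt_add
  algebraMap_mem' c := X.regAt_const c p

/-- The Zariski tangent space at `p`: the point derivations at `p`.  (A point derivation vanishes on
functions that vanish near `p`, so these are the point derivations of the local ring at `p`.) -/
def TangentSpace (X : SpaceWithFunctions) (p : X) : Submodule ℂ (Module.Dual ℂ (X.regRing p)) where
  carrier := {v | ∀ f g : X.regRing p, v (f * g) = f.1 p * v g + g.1 p * v f}
  zero_mem' := by simp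
  add_mem' := by
    intro v w hv hw f g
    simp only [LinearMap.add_apply, hv f g, hw f g]
    ring
  smul_mem' := by
    intro c v hv f g
    simp only [LinearMap.smul_apply, hv f g, smul_eq_mul]
    ring

/-- The differential at `p` of a function that is regular at `p`, a covector at `p`. -/
def differential (X : SpaceWithFunctions) (p : X) (f : X.regRing p) :
    Module.Dual ℂ (X.TangentSpace p) :=
  (LinearMap.applyₗ f).comp (X.TangentSpace p).subtype

/-- `ω` is, in a neighbourhood of `p`, of the form `∑ᵢ fᵢ dgᵢ` with regular `fᵢ`, `gᵢ`. -/
def IsRegularForm (X : SpaceWithFunctions) (ω : ∀ p : X, Module.Dual ℂ (X.TangentSpace p)) (p : X) :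
    Prop :=
  ∃ (m : ℕ) (f g : Fin m → X → ℂ), ∀ᶠ q in 𝓝 p,
    (∀ i, X.RegAt (f i) q) ∧ ∃ hg : ∀ i, X.RegAt (g i) q,
      ω q = ∑ i, f i q • X.differential q ⟨g i, hg i⟩

/-- The space of global regular `1`-forms, for a smooth variety `X` the space `H⁰(X, Ω¹)`:
families of covectors that are locally of the form `∑ᵢ fᵢ dgᵢ`. -/
def oneForms (X : SpaceWithFunctions) :
    Submodule ℂ (∀ p : X, Module.Dual ℂ (X.TangentSpace p)) where
  carrier := {ω | ∀ p, X.IsRegularForm ω p}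
  zero_mem' p := ⟨0, Fin.elim0, Fin.elim0, Eventually.of_forall fun q =>
    ⟨fun i => i.elim0, fun i => i.elim0, by simp⟩⟩
  add_mem' := by
    intro ω η hω hη p
    obtain ⟨m, f, g, h⟩ := hω p
    obtain ⟨m', f', g', h'⟩ := hη p
    refine ⟨m + m', Fin.append f f', Fin.append g g', ?_⟩
    filter_upwards [h, h'] with q ⟨hf, hg, e⟩ ⟨hf', hg', e'⟩
    refine ⟨fun i => ?_, fun i => ?_, ?_⟩
    · refine Fin.addCases (fun i => ?_) (fun i => ?_) i <;> simp [hf, hf']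
    · refine Fin.addCases (fun i => ?_) (fun i => ?_) i <;> simp [hg, hg']
    · rw [Pi.add_apply, e, e', Fin.sum_univ_add]
      simp
  smul_mem' := by
    intro c ω hω p
    obtain ⟨m, f, g, h⟩ := hω p
    refine ⟨m, fun i => (fun _ => c) * f i, g, ?_⟩
    filter_upwards [h] with q ⟨hf, hg, e⟩
    refine ⟨fun i => X.regAt_mul (X.regAt_const c q) (hf i), hg, ?_⟩
    rw [Pi.smul_apply, e, Finset.smul_sum]
    simp [mul_smul]

/-- The Hodge number `h^{1,0}` of a smooth projective variety. -/
def hodgeNumberOneZero (X : SpaceWithFunctions) : ℕ := Module.finrank ℂ X.oneForms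

end SpaceWithFunctions

/-! ### The elliptic curve, its symmetric powers, and the divisor -/

open SpaceWithFunctions

variable (W : WeierstrassCurve ℂ)

/-- The embedding of a Weierstrass curve in the projective plane, `(x, y) ↦ [x : y : 1]`, with the
point at infinity going to `[0 : 1 : 0]`. -/
def toPlane : W.toAffine.Point → proj 2
  | .zero => Projectivization.mk ℂ (![0, 1, 0] : Fin 3 → ℂ) fun h => by simpa using congr_fun h 1
  | .some x y _ => Projectivization.mk ℂ (![x, y, 1] : Fin 3 → ℂ) fun h => by
      simpa using congr_fun h 2

/-- The elliptic curve `E` as a variety. -/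
def ellipticCurve : SpaceWithFunctions := induced (proj 2) (toPlane W)

/-- The quotient map `Eⁿ → Symⁿ E`, `(x₁, …, xₙ) ↦ {x₁, …, xₙ}`. -/
def toSym (n : ℕ) (x : Fin n → W.toAffine.Point) : Sym W.toAffine.Point n :=
  ⟨Multiset.map x Finset.univ.val, by simp⟩

/-- The symmetric power `Symⁿ E = Eⁿ / 𝔖ₙ`, as a variety. -/
def symPower (n : ℕ) : SpaceWithFunctions := ((ellipticCurve W).power n).quotient (toSym W n)

/-- The sum map `Σ : Symⁿ E → E`, for the group law of `E`. -/
def symSum (n : ℕ) (s : Sym W.toAffine.Point n) : W.toAffine.Point := (s : Multiset _).sum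

/-- The fibre `Σ⁻¹(0)` in `Symⁿ E`. -/
def zeroFibre (n : ℕ) : SpaceWithFunctions :=
  (symPower W n).sub {s : Sym W.toAffine.Point n | symSum W n s = 0}

/-- The subset `D` of `Σ⁻¹(0)`: the `{y₁, …, yₙ}` with `yᵢ = yⱼ` for some `i ≠ j`. -/
def diagonalDivisor (n : ℕ) : Set (zeroFibre W n) :=
  {s : {s : Sym W.toAffine.Point n // symSum W n s = 0} |
    ∃ y : Fin n → W.toAffine.Point, toSym W n y = s.1 ∧ ∃ i j, i ≠ j ∧ y i = y j}

end

/-! Maps are tested pointwise, on germs, and through charts (`IsChart`): open sets on which the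
topology and the regular functions are given by fractions of a fixed algebra, so that a morphism
only has to pull back generators of that algebra.

Divisor. Σ⁻¹(0) and D are images of powers of E, hence irreducible: an entry of a tuple of sum zero
is determined by the others, and a repeated entry can be moved to two fixed places (`zeroFibreMk`,
`diagonalMk`). For the codimension, Σ⁻¹(0) is parametrized by a power of E so that D comes from the
divisor where the first coordinate is a fixed point c. A nonzero function is not divisible by all
powers of a local parameter at c, by Krull's intersection theorem. Hence a proper closed subset lies
inside this divisor near some point of it (`exists_nhds_inter_subset`), and no irreducible closed
set lies strictly between D and Σ⁻¹(0) (`eq_of_diagonalDivisor_subset`).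

Birational model. A general point of D is {P, P, x₃, …, xₙ} with x₃ + … + xₙ = −2P. Together with 2P
the points x₃, …, xₙ are n − 1 points of sum zero, and by Abel's theorem these are the zeros of a
function whose only pole is one of order n − 1 at the origin; it is unique up to scaling. The
functions of pole order at most n − 1 that vanish at 2P form a space of dimension n − 2, so P and
the coefficients of the function give a map from D to E × ℙⁿ⁻³. The coefficients solve a linear
system, so this map is regular. Its inverse is regular because it only involves symmetric functions
of the zeros, and these are expressed by the coefficients of the norm of the function
(`birational_diagonalSpace`). The case n = 3 is treated directly.

Forms. By Liouville's theorem on lines, projective space has only constant functions and no forms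
(`proj_const`, `proj_form_eq_zero`). On E, global functions are constant, so every form is a
multiple of the invariant one (`exists_eq_smul_invariantForm`). A form on a ℙʳ-fibration over E
therefore kills vertical vectors, and its value on a lift of a tangent vector of E does not depend
on the point of the fibre. So it comes from E, and h^{1,0} = 1 (`hodgeNumberOneZero_eq_one`).

Non-rationality. A rational map from projective space to E is locally constant at a general point.
On a line it is a solution of the Weierstrass equation in rational functions, and these are constant
by a degree count for a Wronskian (`ratio_const`, `eventually_xCoord_eq`). If D were rational, a
slice E × {p} would map to projective space and back to E by the identity on a nonempty open set,
which is impossible (`not_isRational`). -/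

namespace SpaceWithFunctions

variable {X Y Z : SpaceWithFunctions}

/-! ### Regular functions -/

lemma regAt_neg {f : X → ℂ} {p : X} (hf : X.RegAt f p) : X.RegAt (-f) p :=
  (X.regRing p).neg_mem hf

lemma regAt_sub {f g : X → ℂ} {p : X} (hf : X.RegAt f p) (hg : X.RegAt g p) :
    X.RegAt (f - g) p :=
  (X.regRing p).sub_mem hf hg

lemma regAt_pow {f : X → ℂ} {p : X} (hf : X.RegAt f p) (k : ℕ) : X.RegAt (f ^ k) p :=
  (X.regRing p).pow_mem hf k

lemma regAt_sum {ι : Type*} {s : Finset ι} {f : ι → X → ℂ} {p : X}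
    (hf : ∀ i ∈ s, X.RegAt (f i) p) : X.RegAt (∑ i ∈ s, f i) p :=
  (X.regRing p).sum_mem hf

lemma regAt_prod {ι : Type*} {s : Finset ι} {f : ι → X → ℂ} {p : X}
    (hf : ∀ i ∈ s, X.RegAt (f i) p) : X.RegAt (∏ i ∈ s, f i) p :=
  (X.regRing p).prod_mem hf

lemma eventually_ne_zero {f : X → ℂ} {p : X} (hf : X.RegAt f p) (h : f p ≠ 0) :
    ∀ᶠ q in 𝓝 p, f q ≠ 0 := (X.regAt_inv hf h).1

/-- A quotient is regular where its denominator does not vanish. The relation is kept free of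
division, as it usually comes from a polynomial identity. -/
lemma regAt_of_mul_eq {f g h : X → ℂ} {p : X} (hg : X.RegAt g p) (hh : X.RegAt h p)
    (h0 : h p ≠ 0) (he : ∀ᶠ q in 𝓝 p, f q * h q = g q) : X.RegAt f p := by
  refine X.regAt_congr ?_ (X.regAt_mul hg (X.regAt_inv hh h0).2)
  filter_upwards [he, eventually_ne_zero hh h0] with q hq hq0
  rw [Pi.mul_apply, Pi.inv_apply, ← hq, mul_inv_cancel_right₀ hq0]

lemma regAt_div {f g : X → ℂ} {p : X} (hf : X.RegAt f p) (hg : X.RegAt g p) (h0 : g p ≠ 0) :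
    X.RegAt (fun q => f q / g q) p := by
  refine regAt_of_mul_eq hf hg h0 ?_
  filter_upwards [eventually_ne_zero hg h0] with q hq
  exact div_mul_cancel₀ _ hq

/-! ### Morphisms at a point -/

/-- `φ` is a morphism near `p`, as far as germs at `p` can tell. -/
def IsMorphismAt (X Y : SpaceWithFunctions) (φ : X → Y) (p : X) : Prop :=
  ContinuousAt φ p ∧ ∀ f : Y → ℂ, Y.RegAt f (φ p) → X.RegAt (f ∘ φ) p

lemma isMorphism_iff {φ : X → Y} : IsMorphism X Y φ ↔ ∀ p, IsMorphismAt X Y φ p :=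
  ⟨fun h p => ⟨h.1.continuousAt, fun f hf => h.2 f p hf⟩,
    fun h => ⟨continuous_iff_continuousAt.2 fun p => (h p).1, fun f p hf => (h p).2 f hf⟩⟩

namespace IsMorphismAt

protected lemma id (p : X) : IsMorphismAt X X id p := ⟨continuousAt_id, fun _ h => h⟩

protected lemma const (y : Y) (p : X) : IsMorphismAt X Y (fun _ => y) p :=
  ⟨continuousAt_const, fun f _ => X.regAt_const (f y) p⟩

protected lemma comp {ψ : Y → Z} {φ : X → Y} {p : X} (hψ : IsMorphismAt Y Z ψ (φ p))
    (hφ : IsMorphismAt X Y φ p) : IsMorphismAt X Z (ψ ∘ φ) p :=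
  ⟨hψ.1.comp hφ.1, fun f hf => hφ.2 _ (hψ.2 f hf)⟩

protected lemma congr {φ ψ : X → Y} {p : X} (hφ : IsMorphismAt X Y φ p) (h : φ =ᶠ[𝓝 p] ψ) :
    IsMorphismAt X Y ψ p := by
  refine ⟨hφ.1.congr h, fun f hf => X.regAt_congr (f := f ∘ φ) ?_ (hφ.2 f ?_)⟩
  · filter_upwards [h] with q hq
    simp [hq]
  · rwa [h.self_of_nhds]

end IsMorphismAt

/-! ### Local fractions and initial structures -/

lemma FractionData.mem_nhds_toSpace {S : Type} (d : FractionData S) {p : d.toSpace} {s : Set S} :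
    s ∈ @nhds d.toSpace _ p ↔ ∃ j, ∃ h ∈ d.A j, p ∈ d.basic j h ∧ d.basic j h ⊆ s := by
  let _ := d.topology
  refine (d.isBasis.mem_nhds_iff (a := p)).trans ⟨?_, ?_⟩
  · rintro ⟨_, ⟨j, h, hh, rfl⟩, hp, hs⟩
    exact ⟨j, h, hh, hp, hs⟩
  · rintro ⟨j, h, hh, hp, hs⟩
    exact ⟨_, ⟨j, h, hh, rfl⟩, hp, hs⟩

/-- It suffices to test numerators and denominators: a basic set is cut out by some h with h ∘ ψ
regular, and nonvanishing of a regular function is an open condition. -/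
lemma FractionData.isMorphismAt_toSpace {S : Type} (d : FractionData S) {ψ : X → d.toSpace} {p : X}
    (hU : ∀ j, ψ p ∈ d.U j → ∀ᶠ q in 𝓝 p, ψ q ∈ d.U j)
    (hA : ∀ j, ψ p ∈ d.U j → ∀ h ∈ d.A j, X.RegAt (h ∘ ψ) p) :
    IsMorphismAt X d.toSpace ψ p := by
  constructor
  · intro s hs
    obtain ⟨j, h, hh, hp, hsub⟩ := d.mem_nhds_toSpace.1 hs
    have h2 := eventually_ne_zero (hA j hp.1 h hh) hp.2
    exact ((hU j hp.1).and h2).mono fun q hq => hsub ⟨hq.1, hq.2⟩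
  · rintro f ⟨j, g, hg, h, hh, hp, hf⟩
    refine regAt_of_mul_eq (hA j hp.1 g hg) (hA j hp.1 h hh) hp.2 ?_
    filter_upwards [hU j hp.1, eventually_ne_zero (hA j hp.1 h hh) hp.2] with q h1 h2
    rw [Function.comp_apply, hf _ ⟨h1, h2⟩]
    exact div_mul_cancel₀ _ h2

lemma exists_opens_regOn {f : X → ℂ} {p : X} (hf : X.RegAt f p) :
    ∃ N : TopologicalSpace.Opens X, p ∈ N ∧ X.RegOn f N := by
  obtain ⟨t, ht, hto, hpt⟩ := eventually_nhds_iff.1 (X.eventually_regAt hf)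
  exact ⟨⟨t, hto⟩, hpt, ht⟩

section Initial

variable {S ι : Type} {Y : ι → SpaceWithFunctions} {φ : ∀ i, S → Y i}

lemma isMorphismAt_initial_proj (i : ι) (p : (initialData Y φ).toSpace) :
    IsMorphismAt (initialData Y φ).toSpace (Y i) (φ i) p := by
  classical
  -- The family of open sets that imposes N on the i-th coordinate and no condition on the others.
  have key : ∀ N : TopologicalSpace.Opens (Y i), ∃ j : ∀ i, TopologicalSpace.Opens (Y i),
      j i = N ∧ (initialData Y φ).U j = {x | φ i x ∈ N} := by
    intro N
    refine ⟨Function.update ⊤ i N, by simp, ?_⟩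
    ext x
    constructor
    · intro h
      simpa using h i
    · intro h k
      rcases eq_or_ne k i with rfl | hk
      · simpa using h
      · simp [hk]
  constructor
  · intro s hs
    obtain ⟨t, hts, hto, hpt⟩ := mem_nhds_iff.1 hs
    obtain ⟨j, -, hj⟩ := key ⟨t, hto⟩
    refine (initialData Y φ).mem_nhds_toSpace.2 ⟨j, 1, one_mem (Algebra.adjoin ℂ _), ?_, ?_⟩
    · exact ⟨hj.symm ▸ hpt, one_ne_zero⟩
    · rintro x ⟨hx, -⟩
      rw [hj] at hx
      exact hts hx
  · intro f hf
    obtain ⟨N, hpN, hN⟩ := exists_opens_regOn hf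
    obtain ⟨j, hji, hj⟩ := key N
    refine ⟨j, f ∘ φ i, Algebra.subset_adjoin ⟨i, f, hji.symm ▸ hN, rfl⟩, 1,
      one_mem (Algebra.adjoin ℂ _), ⟨hj.symm ▸ hpN, one_ne_zero⟩, fun x _ => (div_one _).symm⟩

/-- The universal property of the initial structure. Finiteness of ι makes the simultaneous
conditions on all coordinates open. -/
lemma isMorphismAt_initial [Finite ι] {ψ : X → (initialData Y φ).toSpace} {p : X}
    (h : ∀ i, IsMorphismAt X (Y i) (fun q => φ i (ψ q)) p) :
    IsMorphismAt X (initialData Y φ).toSpace ψ p := by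
  apply FractionData.isMorphismAt_toSpace
  · intro j hj
    refine (eventually_all (ι := ι)).2 fun i => ?_
    exact (h i).1 ((j i).isOpen.mem_nhds (hj i))
  · intro j hj a ha
    change a ∈ Algebra.adjoin ℂ _ at ha
    induction ha using Algebra.adjoin_induction with
    | mem x hx =>
      obtain ⟨i, f, hf, rfl⟩ := hx
      exact (h i).2 f (hf _ (hj i))
    | algebraMap r => exact X.regAt_const r p
    | add x y _ _ hx hy => exact X.regAt_add hx hy
    | mul x y _ _ hx hy => exact X.regAt_mul hx hy

end Initial

/-! ### Charts -/

/-- `O` is an open subset on which the functions in `A` are regular, such that the topology and the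
regular functions on `O` are given by fractions of elements of `A`. -/
structure IsChart (X : SpaceWithFunctions) (O : Set X) (A : Subalgebra ℂ (X → ℂ)) : Prop where
  isOpen : IsOpen O
  reg : ∀ a ∈ A, X.RegOn a O
  exists_basic : ∀ p ∈ O, ∀ s ∈ 𝓝 p, ∃ h ∈ A, h p ≠ 0 ∧ ∀ q ∈ O, h q ≠ 0 → q ∈ s
  exists_frac : ∀ p ∈ O, ∀ f, X.RegAt f p →
    ∃ g ∈ A, ∃ h ∈ A, h p ≠ 0 ∧ ∀ q ∈ O, f q * h q = g q

lemma IsChart.congr {O O' : Set X} {A A' : Subalgebra ℂ (X → ℂ)} (h : IsChart X O A) (hO : O = O')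
    (hA : A = A') : IsChart X O' A' := by
  subst hO hA
  exact h

/-- Open sets and regular functions on O are fractions of elements of A, so A is all that a map has
to pull back. -/
lemma IsChart.isMorphismAt {O : Set Y} {A : Subalgebra ℂ (Y → ℂ)} (hY : IsChart Y O A) {φ : X → Y}
    {p : X} (hp : ∀ᶠ q in 𝓝 p, φ q ∈ O) (hA : ∀ a ∈ A, X.RegAt (a ∘ φ) p) :
    IsMorphismAt X Y φ p := by
  constructor
  · intro s hs
    obtain ⟨h, hh, h0, hsub⟩ := hY.exists_basic _ hp.self_of_nhds s hs
    exact (hp.and (eventually_ne_zero (hA h hh) h0)).mono fun q hq => hsub _ hq.1 hq.2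
  · intro f hf
    obtain ⟨g, hg, h, hh, h0, he⟩ := hY.exists_frac _ hp.self_of_nhds f hf
    refine regAt_of_mul_eq (hA g hg) (hA h hh) h0 ?_
    filter_upwards [hp] with q hq
    exact he _ hq

lemma regAt_comp_of_adjoin {G : Set (Y → ℂ)} {φ : X → Y} {p : X}
    (hG : ∀ a ∈ G, X.RegAt (a ∘ φ) p) : ∀ a ∈ Algebra.adjoin ℂ G, X.RegAt (a ∘ φ) p := by
  intro a ha
  induction ha using Algebra.adjoin_induction with
  | mem x hx => exact hG x hx
  | algebraMap r => exact X.regAt_const r p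
  | add x y _ _ hx hy => exact X.regAt_add hx hy
  | mul x y _ _ hx hy => exact X.regAt_mul hx hy

lemma IsChart.isMorphismAt_adjoin {O : Set Y} {G : Set (Y → ℂ)}
    (hY : IsChart Y O (Algebra.adjoin ℂ G)) {φ : X → Y} {p : X} (hp : ∀ᶠ q in 𝓝 p, φ q ∈ O)
    (hG : ∀ a ∈ G, X.RegAt (a ∘ φ) p) : IsMorphismAt X Y φ p :=
  hY.isMorphismAt hp (regAt_comp_of_adjoin hG)

/-- Near a point of the chart, a function regular on an open set of `Y i` is a fraction of chart
functions. Clearing these denominators turns the local fractions of the initial structure into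
fractions of polynomials in pulled back chart functions. -/
lemma isChart_initial {S ι : Type} [Finite ι] {Y : ι → SpaceWithFunctions} {φ : ∀ i, S → Y i}
    {O : ∀ i, Set (Y i)} {A : ∀ i, Subalgebra ℂ (Y i → ℂ)} (h : ∀ i, IsChart (Y i) (O i) (A i)) :
    IsChart (initialData Y φ).toSpace {x | ∀ i, φ i x ∈ O i}
      (Algebra.adjoin ℂ {g | ∃ i, ∃ a ∈ A i, g = a ∘ φ i}) := by
  cases nonempty_fintype ι
  set B := Algebra.adjoin ℂ {g : S → ℂ | ∃ i, ∃ a ∈ A i, g = a ∘ φ i} with hB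
  have hmem : ∀ i, ∀ a ∈ A i, a ∘ φ i ∈ B := fun i a ha => Algebra.subset_adjoin ⟨i, a, ha, rfl⟩
  have key : ∀ p : S, (∀ i, φ i p ∈ O i) → ∀ j, (∀ i, φ i p ∈ j i) →
      ∀ a ∈ (initialData Y φ).A j,
      ∃ g ∈ B, ∃ h ∈ B, h p ≠ 0 ∧ ∀ q : S, (∀ i, φ i q ∈ O i) → a q * h q = g q := by
    intro p hp j hj a ha
    change a ∈ Algebra.adjoin ℂ _ at ha
    induction ha using Algebra.adjoin_induction with
    | mem x hx =>
      obtain ⟨i, f, hf, rfl⟩ := hx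
      obtain ⟨g, hg, k, hk, k0, he⟩ := (h i).exists_frac _ (hp i) f (hf _ (hj i))
      exact ⟨_, hmem i g hg, _, hmem i k hk, k0, fun q hq => he _ (hq i)⟩
    | algebraMap r =>
      exact ⟨_, B.algebraMap_mem r, 1, one_mem _, one_ne_zero, fun q _ => by simp⟩
    | add x y _ _ hx hy =>
      obtain ⟨g, hg, k, hk, k0, he⟩ := hx
      obtain ⟨g', hg', k', hk', k0', he'⟩ := hy
      refine ⟨g * k' + g' * k, add_mem (mul_mem hg hk') (mul_mem hg' hk), k * k', mul_mem hk hk',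
        mul_ne_zero k0 k0', fun q hq => ?_⟩
      simp only [Pi.add_apply, Pi.mul_apply, ← he q hq, ← he' q hq]
      ring
    | mul x y _ _ hx hy =>
      obtain ⟨g, hg, k, hk, k0, he⟩ := hx
      obtain ⟨g', hg', k', hk', k0', he'⟩ := hy
      refine ⟨g * g', mul_mem hg hg', k * k', mul_mem hk hk',
        mul_ne_zero k0 k0', fun q hq => ?_⟩
      simp only [Pi.mul_apply, ← he q hq, ← he' q hq]
      ring
  -- One function whose nonvanishing confines a point of the chart to the domain of j.
  have hcut : ∀ p : S, (∀ i, φ i p ∈ O i) → ∀ j : ∀ i, TopologicalSpace.Opens (Y i),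
      (∀ i, φ i p ∈ j i) → ∃ b ∈ B, b p ≠ 0 ∧
        ∀ q : S, (∀ i, φ i q ∈ O i) → b q ≠ 0 → ∀ i, φ i q ∈ j i := by
    intro p hp j hj
    choose b hb b0 hs using fun i =>
      (h i).exists_basic _ (hp i) (j i) ((j i).isOpen.mem_nhds (hj i))
    refine ⟨∏ i, b i ∘ φ i, prod_mem fun i _ => hmem i _ (hb i), ?_, fun q hq hq0 i => ?_⟩
    · rw [Finset.prod_apply]
      exact Finset.prod_ne_zero_iff.2 fun i _ => b0 i
    · rw [Finset.prod_apply] at hq0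
      exact hs i _ (hq i) (Finset.prod_ne_zero_iff.1 hq0 i (Finset.mem_univ i))
  refine ⟨?_, ?_, ?_, ?_⟩
  · have : {x : (initialData Y φ).toSpace | ∀ i, φ i x ∈ O i} =
        ⋂ i, {x : (initialData Y φ).toSpace | φ i x ∈ O i} := Set.ofPred_forall _
    refine this ▸ isOpen_iInter_of_finite fun i => (h i).isOpen.preimage
      (continuous_iff_continuousAt.2 fun p => isMorphismAt_initial_proj (φ := φ) i p |>.1)
  · intro a ha p hp
    induction ha using Algebra.adjoin_induction with
    | mem x hx =>
      obtain ⟨i, f, hf, rfl⟩ := hx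
      exact (isMorphismAt_initial_proj i p).2 _ ((h i).reg f hf _ (hp i))
    | algebraMap r => exact regAt_const _ r p
    | add x y _ _ hx hy => exact regAt_add _ hx hy
    | mul x y _ _ hx hy => exact regAt_mul _ hx hy
  · intro p hp s hs
    obtain ⟨j, a, ha, hpa, hsub⟩ := (initialData Y φ).mem_nhds_toSpace.1 hs
    obtain ⟨g, hg, k, hk, k0, he⟩ := key p hp j hpa.1 a ha
    obtain ⟨b, hb, b0, hbs⟩ := hcut p hp j hpa.1
    refine ⟨g * b, mul_mem hg hb, mul_ne_zero ?_ b0, fun q hq hq0 => hsub ⟨?_, ?_⟩⟩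
    · rw [← he p hp]
      exact mul_ne_zero hpa.2 k0
    · exact hbs q hq (right_ne_zero_of_mul hq0)
    · refine left_ne_zero_of_mul (b := k q) ?_
      rw [he q hq]
      exact left_ne_zero_of_mul hq0
  · rintro p hp f ⟨j, a, ha, c, hc, hpc, hf⟩
    obtain ⟨g, hg, k, hk, k0, he⟩ := key p hp j hpc.1 a ha
    obtain ⟨g', hg', k', hk', k0', he'⟩ := key p hp j hpc.1 c hc
    obtain ⟨b, hb, b0, hbs⟩ := hcut p hp j hpc.1
    have hg'0 : g' p ≠ 0 := by
      rw [← he' p hp]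
      exact mul_ne_zero hpc.2 k0'
    -- With a = g / k and c = g' / k', the fraction a / c is g k' / (g' k). The extra factors g' and
    -- b make both sides vanish where c may be zero or the point may leave the domain of j, so that
    -- the identity holds on the whole chart.
    refine ⟨g * k' * g' * b, mul_mem (mul_mem (mul_mem hg hk') hg') hb, g' * g' * k * b,
      mul_mem (mul_mem (mul_mem hg' hg') hk) hb,
      mul_ne_zero (mul_ne_zero (mul_ne_zero hg'0 hg'0) k0) b0, fun q hq => ?_⟩
    change f q * (g' q * g' q * k q * b q) = g q * k' q * g' q * b q
    rcases eq_or_ne (b q) 0 with hbq | hbq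
    · rw [hbq, mul_zero, mul_zero, mul_zero]
    rcases eq_or_ne (g' q) 0 with hgq | hgq
    · rw [hgq]; ring
    have hcq : c q ≠ 0 := by
      intro h0
      apply hgq
      rw [← he' q hq, h0, zero_mul]
    have h1 : f q * c q = a q := by rw [hf q ⟨hbs q hq hbq, hcq⟩, div_mul_cancel₀ _ hcq]
    linear_combination (g' q * b q * k q * k' q) * h1 - f q * g' q * k q * b q * he' q hq +
      k' q * g' q * b q * he q hq

lemma adjoin_comp_adjoin {S ι : Type} {Y : ι → SpaceWithFunctions} {φ : ∀ i, S → Y i}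
    (G : ∀ i, Set (Y i → ℂ)) :
    Algebra.adjoin ℂ {g | ∃ i, ∃ a ∈ Algebra.adjoin ℂ (G i), g = a ∘ φ i} =
      Algebra.adjoin ℂ {g | ∃ i, ∃ a ∈ G i, g = a ∘ φ i} := by
  refine le_antisymm (Algebra.adjoin_le ?_) (Algebra.adjoin_mono ?_)
  · rintro _ ⟨i, a, ha, rfl⟩
    induction ha using Algebra.adjoin_induction with
    | mem x hx => exact Algebra.subset_adjoin ⟨i, x, hx, rfl⟩
    | algebraMap r => exact Subalgebra.algebraMap_mem _ r
    | add x y _ _ hx hy => exact add_mem hx hy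
    | mul x y _ _ hx hy => exact mul_mem hx hy
  · rintro _ ⟨i, a, ha, rfl⟩
    exact ⟨i, a, Algebra.subset_adjoin ha, rfl⟩

/-! ### Induced structures, products and powers -/

lemma isMorphismAt_induced {S : Type} {φ : S → Y} (p : induced Y φ) :
    IsMorphismAt (induced Y φ) Y φ p :=
  isMorphismAt_initial_proj (Y := fun _ : Unit => Y) (φ := fun _ => φ) () p

lemma isMorphismAt_into_induced {S : Type} {φ : S → Y} {ψ : X → induced Y φ} {p : X}
    (h : IsMorphismAt X Y (fun q => φ (ψ q)) p) : IsMorphismAt X (induced Y φ) ψ p :=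
  isMorphismAt_initial (Y := fun _ : Unit => Y) (φ := fun _ => φ) fun _ => h

lemma isMorphismAt_val {A : Set Y} (p : Y.sub A) : IsMorphismAt (Y.sub A) Y Subtype.val p :=
  isMorphismAt_induced p

lemma isMorphismAt_into_sub {A : Set Y} {ψ : X → Y.sub A} {p : X}
    (h : IsMorphismAt X Y (fun q => (ψ q).1) p) : IsMorphismAt X (Y.sub A) ψ p :=
  isMorphismAt_into_induced h

/-- The algebra generated by pulled back functions consists of pulled back functions, so numerator
and denominator extend separately. -/
lemma exists_extension {S : Type} {φ : S → Y} {f : S → ℂ} {p : S}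
    (hf : (induced Y φ).RegAt f p) :
    ∃ F : Y → ℂ, Y.RegAt F (φ p) ∧ ∃ N : Set Y, IsOpen N ∧ φ p ∈ N ∧
      ∀ q, φ q ∈ N → f q = F (φ q) := by
  obtain ⟨j, g, hg, h, hh, hp, he⟩ := hf
  have key : ∀ a ∈ (initialData (fun _ : Unit => Y) (fun _ => φ)).A j,
      ∃ F : Y → ℂ, Y.RegOn F (j ()) ∧ a = F ∘ φ := by
    intro a ha
    change a ∈ Algebra.adjoin ℂ _ at ha
    induction ha using Algebra.adjoin_induction with
    | mem x hx =>
      obtain ⟨⟨⟩, f, hf, rfl⟩ := hx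
      exact ⟨f, hf, rfl⟩
    | algebraMap r => exact ⟨fun _ => r, fun q _ => Y.regAt_const r q, rfl⟩
    | add x y _ _ hx hy =>
      obtain ⟨F, hF, rfl⟩ := hx
      obtain ⟨G, hG, rfl⟩ := hy
      exact ⟨F + G, fun q hq => Y.regAt_add (hF q hq) (hG q hq), rfl⟩
    | mul x y _ _ hx hy =>
      obtain ⟨F, hF, rfl⟩ := hx
      obtain ⟨G, hG, rfl⟩ := hy
      exact ⟨F * G, fun q hq => Y.regAt_mul (hF q hq) (hG q hq), rfl⟩
  obtain ⟨G, hG, rfl⟩ := key g hg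
  obtain ⟨H, hH, rfl⟩ := key h hh
  have hpj : φ p ∈ j () := hp.1 ()
  refine ⟨fun y => G y / H y, regAt_div (hG _ hpj) (hH _ hpj) hp.2, ?_⟩
  have := ((j ()).isOpen.mem_nhds hpj)
  obtain ⟨t, ht, hto, hpt⟩ :=
    mem_nhds_iff.1 (inter_mem this (eventually_ne_zero (hH _ hpj) hp.2))
  exact ⟨t, hto, hpt, fun q hq => he q ⟨fun _ => (ht hq).1, (ht hq).2⟩⟩

lemma mem_nhds_induced_iff {S : Type} {φ : S → Y} {s : Set S} {p : S} :
    s ∈ @nhds (induced Y φ) _ p ↔ ∃ N : Set Y, IsOpen N ∧ φ p ∈ N ∧ φ ⁻¹' N ⊆ s := by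
  constructor
  · intro hs
    obtain ⟨t, ht, hto, hpt⟩ := mem_nhds_iff.1 hs
    classical
    -- The indicator function of t is regular at p, being 1 near p. Where its extension F is defined
    -- and nonzero, preimages lie in t.
    have hreg : (induced Y φ).RegAt (fun q => if q ∈ t then 1 else 0) p := by
      refine regAt_congr _ (f := fun _ => 1) ?_ ((induced Y φ).regAt_const 1 p)
      filter_upwards [hto.mem_nhds hpt] with q hq
      rw [if_pos hq]
    obtain ⟨F, hF, N, hN, hpN, he⟩ := exists_extension hreg
    have hFp : F (φ p) ≠ 0 := by
      rw [← he p hpN, if_pos hpt]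
      exact one_ne_zero
    obtain ⟨M, hM, hMo, hpM⟩ :=
      mem_nhds_iff.1 (inter_mem (hN.mem_nhds hpN) (eventually_ne_zero hF hFp))
    refine ⟨M, hMo, hpM, fun q hq => ht ?_⟩
    by_contra hqt
    have h1 := he q (hM hq).1
    rw [if_neg hqt] at h1
    exact (hM hq).2 h1.symm
  · rintro ⟨N, hN, hpN, hsub⟩
    exact mem_of_superset ((isMorphismAt_induced (φ := φ) p).1 (hN.mem_nhds hpN)) hsub

lemma isOpen_induced_iff' {S : Type} {φ : S → Y} {s : Set S} :
    @IsOpen (induced Y φ) _ s ↔ ∃ N : Set Y, IsOpen N ∧ φ ⁻¹' N = s := by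
  constructor
  · intro hs
    refine ⟨⋃₀ {N | IsOpen N ∧ φ ⁻¹' N ⊆ s}, isOpen_sUnion fun N hN => hN.1, ?_⟩
    ext q
    constructor
    · rintro ⟨N, hN, hq⟩
      exact hN.2 hq
    · intro hq
      obtain ⟨N, hN, hqN, hsub⟩ := mem_nhds_induced_iff.1 (hs.mem_nhds hq)
      exact ⟨N, ⟨hN, hsub⟩, hqN⟩
  · rintro ⟨N, hN, rfl⟩
    exact hN.preimage (continuous_iff_continuousAt.2 fun p => (isMorphismAt_induced (φ := φ) p).1)

lemma isOpen_sub_iff {A : Set Y} {s : Set (Y.sub A)} :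
    IsOpen s ↔ ∃ N : Set Y, IsOpen N ∧ Subtype.val ⁻¹' N = s :=
  isOpen_induced_iff'

lemma isClosed_sub_iff {A : Set Y} {s : Set (Y.sub A)} :
    IsClosed s ↔ ∃ N : Set Y, IsClosed N ∧ Subtype.val ⁻¹' N = s := by
  rw [← isOpen_compl_iff, isOpen_sub_iff]
  constructor
  · rintro ⟨N, hN, h⟩
    exact ⟨Nᶜ, hN.isClosed_compl, (congrArg compl h).trans (compl_compl s)⟩
  · rintro ⟨N, hN, rfl⟩
    exact ⟨Nᶜ, hN.isOpen_compl, rfl⟩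

lemma isChart_induced {S : Type} {φ : S → Y} {O : Set Y} {A : Subalgebra ℂ (Y → ℂ)}
    (h : IsChart Y O A) :
    IsChart (induced Y φ) (φ ⁻¹' O) (Algebra.adjoin ℂ {g | ∃ a ∈ A, g = a ∘ φ}) := by
  have := isChart_initial (Y := fun _ : Unit => Y) (φ := fun _ => φ) (O := fun _ => O)
    (A := fun _ => A) (fun _ => h)
  have h1 : {x : S | Unit → φ x ∈ O} = φ ⁻¹' O := Set.ext fun x => ⟨fun h => h (), fun h _ => h⟩
  have h2 : {g : S → ℂ | ∃ _ : Unit, ∃ a ∈ A, g = a ∘ φ} = {g | ∃ a ∈ A, g = a ∘ φ} :=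
    Set.ext fun x => ⟨fun ⟨_, h⟩ => h, fun h => ⟨(), h⟩⟩
  exact IsChart.congr (X := induced Y φ) this h1 (congrArg (Algebra.adjoin ℂ) h2)

lemma isMorphismAt_power_proj (n : ℕ) (i : Fin n) (p : X.power n) :
    IsMorphismAt (X.power n) X (fun x : Fin n → X => x i) p :=
  isMorphismAt_initial_proj (Y := fun _ : Fin n => X) (φ := fun i (x : Fin n → X) => x i) i p

lemma isMorphismAt_into_power {n : ℕ} {ψ : X → Fin n → Y} {p : X}
    (h : ∀ i, IsMorphismAt X Y (fun q => ψ q i) p) : IsMorphismAt X (Y.power n) ψ p :=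
  isMorphismAt_initial (Y := fun _ : Fin n => Y) (φ := fun i (x : Fin n → Y) => x i) h

lemma isMorphismAt_fst (p : X.prod Y) : IsMorphismAt (X.prod Y) X (Prod.fst : X × Y → X) p :=
  isMorphismAt_initial_proj (Y := fun b : Bool => cond b X Y)
    (φ := fun b (p : X × Y) => match b with
      | true => p.1
      | false => p.2) true p

lemma isMorphismAt_snd (p : X.prod Y) : IsMorphismAt (X.prod Y) Y (Prod.snd : X × Y → Y) p :=
  isMorphismAt_initial_proj (Y := fun b : Bool => cond b X Y)
    (φ := fun b (p : X × Y) => match b with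
      | true => p.1
      | false => p.2) false p

lemma isMorphismAt_into_prod {ψ : Z → X × Y} {p : Z}
    (h1 : IsMorphismAt Z X (fun q => (ψ q).1) p) (h2 : IsMorphismAt Z Y (fun q => (ψ q).2) p) :
    IsMorphismAt Z (X.prod Y) ψ p :=
  isMorphismAt_initial (Y := fun b : Bool => cond b X Y)
    (φ := fun b (p : X × Y) => match b with
      | true => p.1
      | false => p.2) (by rintro (_ | _); exacts [h2, h1])

lemma isChart_power {n : ℕ} {O : Set X} {G : Set (X → ℂ)} (h : IsChart X O (Algebra.adjoin ℂ G)) :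
    IsChart (X.power n) {x : Fin n → X | ∀ i, x i ∈ O}
      (Algebra.adjoin ℂ {g | ∃ i : Fin n, ∃ a ∈ G, g = fun x : Fin n → X => a (x i)}) := by
  have := isChart_initial (Y := fun _ : Fin n => X) (φ := fun i (x : Fin n → X) => x i)
    (fun _ => h)
  have e := adjoin_comp_adjoin (Y := fun _ : Fin n => X) (φ := fun i (x : Fin n → X) => x i)
    (fun _ => G)
  exact IsChart.congr (X := X.power n) this rfl e

lemma isChart_prod {O : Set X} {G : Set (X → ℂ)} {O' : Set Y} {G' : Set (Y → ℂ)}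
    (h : IsChart X O (Algebra.adjoin ℂ G)) (h' : IsChart Y O' (Algebra.adjoin ℂ G')) :
    IsChart (X.prod Y) {x : X × Y | x.1 ∈ O ∧ x.2 ∈ O'}
      (Algebra.adjoin ℂ ({g | ∃ a ∈ G, g = fun x : X × Y => a x.1} ∪
        {g | ∃ a ∈ G', g = fun x : X × Y => a x.2})) := by
  let Yb : Bool → SpaceWithFunctions := fun b => cond b X Y
  let φ : ∀ b, X × Y → Yb b := fun b (p : X × Y) => match b with
      | true => p.1
      | false => p.2
  let Ob : ∀ b, Set (Yb b) := fun b => match b with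
      | true => O
      | false => O'
  let Gb : ∀ b, Set (Yb b → ℂ) := fun b => match b with
      | true => G
      | false => G'
  have := isChart_initial (Y := Yb) (φ := φ) (O := Ob) (A := fun b => Algebra.adjoin ℂ (Gb b))
    (by rintro (_ | _); exacts [h', h])
  have h1 : {x : X × Y | ∀ i, φ i x ∈ Ob i} = {x : X × Y | x.1 ∈ O ∧ x.2 ∈ O'} :=
    Set.ext fun x => ⟨fun h => ⟨h true, h false⟩, by rintro ⟨h, h'⟩ (_ | _); exacts [h', h]⟩
  have h2 : {g : X × Y → ℂ | ∃ i, ∃ a ∈ Gb i, g = a ∘ φ i} =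
      {g | ∃ a ∈ G, g = fun x : X × Y => a x.1} ∪
        {g | ∃ a ∈ G', g = fun x : X × Y => a x.2} := by
    ext g
    constructor
    · rintro ⟨_ | _, a, ha, rfl⟩
      exacts [Or.inr ⟨a, ha, rfl⟩, Or.inl ⟨a, ha, rfl⟩]
    · rintro (⟨a, ha, rfl⟩ | ⟨a, ha, rfl⟩)
      exacts [⟨true, a, ha, rfl⟩, ⟨false, a, ha, rfl⟩]
  exact IsChart.congr (X := X.prod Y) this h1
    ((adjoin_comp_adjoin (φ := φ) Gb).trans (congrArg (Algebra.adjoin ℂ) h2))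

end SpaceWithFunctions

namespace SpaceWithFunctions

/-! ### Projective space -/

lemma eval_smul_of_isHomogeneous {σ : Type*} {F : MvPolynomial σ ℂ} {d : ℕ}
    (hF : F.IsHomogeneous d) (c : ℂ) (v : σ → ℂ) :
    MvPolynomial.eval (c • v) F = c ^ d * MvPolynomial.eval v F := by
  rw [MvPolynomial.eval_eq, MvPolynomial.eval_eq, Finset.mul_sum]
  refine Finset.sum_congr rfl fun m hm => ?_
  have h : ∑ i ∈ m.support, m i = d := by
    have := hF (MvPolynomial.mem_support_iff.1 hm)
    simpa [Finsupp.weight_apply, Finsupp.sum] using this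
  simp only [Pi.smul_apply, smul_eq_mul, mul_pow, Finset.prod_mul_distrib,
    Finset.prod_pow_eq_pow_sum, h]
  ring

/-- The ratio of two homogeneous coordinates. -/
noncomputable def projRatio {r : ℕ} (i j : Fin (r + 1)) (p : ℙ ℂ (Fin (r + 1) → ℂ)) : ℂ := p.rep j / p.rep i

/-- The ratio does not depend on the representative, so any homogeneous coordinates may replace
`rep`. -/
lemma projRatio_mk {r : ℕ} (i j : Fin (r + 1)) (v : Fin (r + 1) → ℂ) (hv : v ≠ 0) :
    projRatio i j (Projectivization.mk ℂ v hv) = v j / v i := by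
  obtain ⟨a, ha⟩ := Projectivization.exists_smul_eq_mk_rep ℂ v hv
  rw [projRatio, ← ha]
  exact mul_div_mul_left _ _ a.ne_zero

lemma rep_mk_ne_zero_iff {r : ℕ} (i : Fin (r + 1)) (v : Fin (r + 1) → ℂ) (hv : v ≠ 0) :
    (Projectivization.mk ℂ v hv).rep i ≠ 0 ↔ v i ≠ 0 := by
  obtain ⟨a, ha⟩ := Projectivization.exists_smul_eq_mk_rep ℂ v hv
  rw [← ha]
  exact mul_ne_zero_iff_left a.ne_zero

lemma mem_projData_A {r d : ℕ} {a : ℙ ℂ (Fin (r + 1) → ℂ) → ℂ} :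
    a ∈ (projData r).A d ↔ ∃ F : MvPolynomial (Fin (r + 1)) ℂ, F.IsHomogeneous d ∧
      a = fun p => MvPolynomial.eval p.rep F := by
  constructor
  · rintro ⟨F, hF, rfl⟩
    exact ⟨F, hF, rfl⟩
  · rintro ⟨F, hF, rfl⟩
    exact ⟨F, hF, rfl⟩

/-- Dehomogenization: up to a power of the i-th coordinate, a form is a polynomial in the ratios.
The powers cancel in fractions of equal degree. -/
lemma eval_rep {r d : ℕ} {F : MvPolynomial (Fin (r + 1)) ℂ} (hF : F.IsHomogeneous d)
    {i : Fin (r + 1)} {p : ℙ ℂ (Fin (r + 1) → ℂ)} (hp : p.rep i ≠ 0) :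
    MvPolynomial.eval p.rep F =
      p.rep i ^ d * MvPolynomial.eval (fun j => projRatio i j p) F := by
  rw [← eval_smul_of_isHomogeneous hF]
  congr 2
  ext j
  exact (mul_div_cancel₀ _ hp).symm

lemma eval_mem_adjoin {S σ : Type*} (G : σ → S → ℂ) (F : MvPolynomial σ ℂ) :
    (fun p => MvPolynomial.eval (fun j => G j p) F) ∈ Algebra.adjoin ℂ (Set.range G) := by
  have : (fun p => MvPolynomial.eval (fun j => G j p) F) = MvPolynomial.aeval G F := by
    ext p
    have h := MvPolynomial.comp_aeval (R := ℂ) G (Pi.evalAlgHom ℂ (fun _ : S => ℂ) p)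
    exact (DFunLike.congr_fun h F).symm
  rw [this, Algebra.adjoin_range_eq_range_aeval]
  exact ⟨F, rfl⟩

lemma isChart_proj {r : ℕ} (i : Fin (r + 1)) :
    IsChart (proj r) {p : ℙ ℂ (Fin (r + 1) → ℂ) | p.rep i ≠ 0}
      (Algebra.adjoin ℂ (Set.range (projRatio i))) := by
  have hX : ∀ j : Fin (r + 1), (fun p : ℙ ℂ (Fin (r + 1) → ℂ) => p.rep j) ∈ (projData r).A (1 : ℕ) :=
    fun j => mem_projData_A.2 ⟨MvPolynomial.X j, MvPolynomial.isHomogeneous_X _ _, by simp⟩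
  refine ⟨?_, ?_, ?_, ?_⟩
  · refine isOpen_iff_mem_nhds.2 fun p hp => (projData r).mem_nhds_toSpace.2
      ⟨(1 : ℕ), _, hX i, ⟨trivial, hp⟩, fun q hq => hq.2⟩
  · intro a ha p hp
    induction ha using Algebra.adjoin_induction with
    | mem x hx =>
      obtain ⟨j, rfl⟩ := hx
      exact ⟨(1 : ℕ), _, hX j, _, hX i, ⟨trivial, hp⟩, fun q _ => rfl⟩
    | algebraMap r => exact regAt_const _ r p
    | add x y _ _ hx hy => exact regAt_add _ hx hy
    | mul x y _ _ hx hy => exact regAt_mul _ hx hy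
  · intro p hp s hs
    obtain ⟨d, a, ha, hpa, hsub⟩ := (projData r).mem_nhds_toSpace.1 hs
    obtain ⟨F, hF, rfl⟩ := mem_projData_A.1 ha
    refine ⟨_, eval_mem_adjoin (projRatio i) F, fun h0 => hpa.2 ?_,
      fun q hq h0 => hsub ⟨trivial, ?_⟩⟩
    · change MvPolynomial.eval _ F = 0
      rw [eval_rep hF hp]
      exact mul_eq_zero_of_right _ h0
    · change MvPolynomial.eval _ F ≠ 0
      rw [eval_rep hF hq]
      exact mul_ne_zero (pow_ne_zero _ hq) h0
  · rintro p hp f ⟨d, a, ha, b, hb, hpb, hf⟩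
    obtain ⟨F, hF, rfl⟩ := mem_projData_A.1 ha
    obtain ⟨G, hG, rfl⟩ := mem_projData_A.1 hb
    have hG' := eval_mem_adjoin (projRatio i) G
    have h0 : MvPolynomial.eval (fun j => projRatio i j p) G ≠ 0 := by
      intro h0
      apply hpb.2
      change MvPolynomial.eval _ G = 0
      rw [eval_rep hG hp, h0, mul_zero]
    -- The fraction F / G is written as F G / G², so that both sides of the identity vanish where G
    -- does.
    refine ⟨_, mul_mem (eval_mem_adjoin (projRatio i) F) hG', _, mul_mem hG' hG',
      mul_ne_zero h0 h0, fun q hq => ?_⟩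
    change f q * (MvPolynomial.eval (fun j => projRatio i j q) G *
      MvPolynomial.eval (fun j => projRatio i j q) G) =
      MvPolynomial.eval (fun j => projRatio i j q) F *
      MvPolynomial.eval (fun j => projRatio i j q) G
    rcases eq_or_ne (MvPolynomial.eval (fun j => projRatio i j q) G) 0 with h1 | h1
    · rw [h1, mul_zero, mul_zero, mul_zero]
    · have h2 := hf q ⟨trivial, by
        change MvPolynomial.eval _ G ≠ 0
        rw [eval_rep hG hq]
        exact mul_ne_zero (pow_ne_zero _ hq) h1⟩
      simp only [eval_rep hF hq, eval_rep hG hq] at h2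
      rw [mul_div_mul_left _ _ (pow_ne_zero d hq)] at h2
      rw [h2, ← mul_assoc, div_mul_cancel₀ _ h1]

lemma exists_rep_ne_zero {r : ℕ} (p : ℙ ℂ (Fin (r + 1) → ℂ)) : ∃ i, p.rep i ≠ 0 := by
  by_contra! h
  exact p.rep_nonzero (funext h)

end SpaceWithFunctions

open SpaceWithFunctions

/-! ### Charts of the elliptic curve -/

section Charts

variable (W : WeierstrassCurve ℂ)

/-- The coordinate `x`, with the value `0` at infinity. -/
def xCoord : W.toAffine.Point → ℂ
  | .zero => 0
  | .some x _ _ => x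

/-- The coordinate `y`, with the value `0` at infinity. -/
def yCoord : W.toAffine.Point → ℂ
  | .zero => 0
  | .some _ y _ => y

/-- The coordinate `x / y`, which is a local parameter at infinity. -/
noncomputable def uCoord (P : W.toAffine.Point) : ℂ := xCoord W P / yCoord W P

/-- The coordinate `1 / y` at infinity. -/
noncomputable def wCoord (P : W.toAffine.Point) : ℂ := (yCoord W P)⁻¹

@[simp] lemma xCoord_zero : xCoord W 0 = 0 := rfl
@[simp] lemma yCoord_zero : yCoord W 0 = 0 := rfl
@[simp] lemma uCoord_zero : uCoord W 0 = 0 := by simp [uCoord]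
@[simp] lemma wCoord_zero : wCoord W 0 = 0 := by simp [wCoord]
@[simp] lemma xCoord_some {x y : ℂ} (h) : xCoord W (.some x y h) = x := rfl
@[simp] lemma yCoord_some {x y : ℂ} (h) : yCoord W (.some x y h) = y := rfl

variable {W}

lemma nonsingular_coords {P : W.toAffine.Point} (hP : P ≠ 0) :
    W.toAffine.Nonsingular (xCoord W P) (yCoord W P) := by
  rcases P with _ | ⟨x, y, h⟩
  · exact absurd rfl hP
  · exact h

lemma some_coords {P : W.toAffine.Point} (hP : P ≠ 0) :
    WeierstrassCurve.Affine.Point.some _ _ (nonsingular_coords hP) = P := by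
  rcases P with _ | ⟨x, y, h⟩
  · exact absurd rfl hP
  · rfl

lemma equation_coords {P : W.toAffine.Point} (hP : P ≠ 0) :
    yCoord W P ^ 2 + W.a₁ * xCoord W P * yCoord W P + W.a₃ * yCoord W P =
      xCoord W P ^ 3 + W.a₂ * xCoord W P ^ 2 + W.a₄ * xCoord W P + W.a₆ :=
  (WeierstrassCurve.Affine.equation_iff _ _).1 (nonsingular_coords hP).1

lemma ext_coords {P Q : W.toAffine.Point} (hP : P ≠ 0) (hQ : Q ≠ 0)
    (hx : xCoord W P = xCoord W Q) (hy : yCoord W P = yCoord W Q) : P = Q := by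
  rw [← some_coords hP, ← some_coords hQ]
  simp [hx, hy]

variable (W)

/-- The algebra of polynomials in `x` and `y`. -/
noncomputable def affineAlg : Subalgebra ℂ (W.toAffine.Point → ℂ) :=
  Algebra.adjoin ℂ {xCoord W, yCoord W}

/-- The algebra of polynomials in `x / y` and `1 / y`. -/
noncomputable def infAlg : Subalgebra ℂ (W.toAffine.Point → ℂ) := Algebra.adjoin ℂ {uCoord W, wCoord W}

lemma toPlane_zero : toPlane W 0 =
    Projectivization.mk ℂ (![0, 1, 0] : Fin 3 → ℂ) fun h => by simpa using congr_fun h 1 := rfl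

lemma toPlane_some {x y : ℂ} (h) : toPlane W (.some x y h) =
    Projectivization.mk ℂ (![x, y, 1] : Fin 3 → ℂ) fun h => by simpa using congr_fun h 2 := rfl

lemma projRatio_two_toPlane (j : Fin 3) (P : W.toAffine.Point) (hP : P ≠ 0) :
    projRatio 2 j (toPlane W P) = ![xCoord W P, yCoord W P, 1] j := by
  rcases P with _ | ⟨x, y, h⟩
  · exact absurd rfl hP
  · rw [toPlane_some]
    refine (projRatio_mk _ _ _ _).trans ?_
    simp

lemma projRatio_one_toPlane (j : Fin 3) (P : W.toAffine.Point) (hP : P = 0 ∨ yCoord W P ≠ 0) :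
    projRatio 1 j (toPlane W P) = ![uCoord W P, 1, wCoord W P] j := by
  rcases P with _ | ⟨x, y, h⟩
  · change projRatio 1 j (toPlane W 0) = ![uCoord W 0, 1, wCoord W 0] j
    rw [toPlane_zero]
    refine (projRatio_mk _ _ _ _).trans ?_
    fin_cases j <;> simp
  · have hy : y ≠ 0 := by simpa using hP
    rw [toPlane_some]
    refine (projRatio_mk _ _ _ _).trans ?_
    fin_cases j <;> simp [uCoord, wCoord, hy]

end Charts

/-! ### Changing the algebra of a chart -/

section

variable {X : SpaceWithFunctions}

/-- Only the restrictions to O matter. This is needed because x, y, u and w take default values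
outside the charts where they are meaningful. -/
lemma SpaceWithFunctions.IsChart.change {O : Set X} {A B : Subalgebra ℂ (X → ℂ)}
    (h : IsChart X O A) (hAB : ∀ a ∈ A, ∃ b ∈ B, ∀ q ∈ O, a q = b q)
    (hBA : ∀ b ∈ B, ∃ a ∈ A, ∀ q ∈ O, a q = b q) : IsChart X O B := by
  refine ⟨h.isOpen, fun b hb p hp => ?_, fun p hp s hs => ?_, fun p hp f hf => ?_⟩
  · obtain ⟨a, ha, hab⟩ := hBA b hb
    refine X.regAt_congr ?_ (h.reg a ha p hp)
    filter_upwards [h.isOpen.mem_nhds hp] with q hq using hab q hq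
  · obtain ⟨a, ha, a0, has⟩ := h.exists_basic p hp s hs
    obtain ⟨b, hb, hab⟩ := hAB a ha
    exact ⟨b, hb, hab p hp ▸ a0, fun q hq h0 => has q hq (hab q hq ▸ h0)⟩
  · obtain ⟨g, hg, k, hk, k0, he⟩ := h.exists_frac p hp f hf
    obtain ⟨b, hb, hgb⟩ := hAB g hg
    obtain ⟨c, hc, hkc⟩ := hAB k hk
    refine ⟨b, hb, c, hc, hkc p hp ▸ k0, fun q hq => ?_⟩
    rw [← hkc q hq, ← hgb q hq, he q hq]

lemma exists_adjoin_eqOn {S : Type*} {G : Set (S → ℂ)} {B : Subalgebra ℂ (S → ℂ)} {O : Set S}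
    (h : ∀ a ∈ G, ∃ b ∈ B, ∀ q ∈ O, a q = b q) :
    ∀ a ∈ Algebra.adjoin ℂ G, ∃ b ∈ B, ∀ q ∈ O, a q = b q := by
  intro a ha
  induction ha using Algebra.adjoin_induction with
  | mem x hx => exact h x hx
  | algebraMap r => exact ⟨_, B.algebraMap_mem r, fun q _ => rfl⟩
  | add x y _ _ hx hy =>
    obtain ⟨b, hb, hxb⟩ := hx
    obtain ⟨c, hc, hyc⟩ := hy
    exact ⟨b + c, add_mem hb hc, fun q hq => by rw [Pi.add_apply, hxb q hq, hyc q hq]; rfl⟩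
  | mul x y _ _ hx hy =>
    obtain ⟨b, hb, hxb⟩ := hx
    obtain ⟨c, hc, hyc⟩ := hy
    exact ⟨b * c, mul_mem hb hc, fun q hq => by rw [Pi.mul_apply, hxb q hq, hyc q hq]; rfl⟩

lemma SpaceWithFunctions.IsChart.change_adjoin {O : Set X} {G H : Set (X → ℂ)}
    (h : IsChart X O (Algebra.adjoin ℂ G))
    (hAB : ∀ a ∈ G, ∃ b ∈ Algebra.adjoin ℂ H, ∀ q ∈ O, a q = b q)
    (hBA : ∀ b ∈ H, ∃ a ∈ Algebra.adjoin ℂ G, ∀ q ∈ O, b q = a q) :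
    IsChart X O (Algebra.adjoin ℂ H) := by
  refine h.change (exists_adjoin_eqOn hAB) fun b hb => ?_
  obtain ⟨a, ha, h⟩ := exists_adjoin_eqOn hBA b hb
  exact ⟨a, ha, fun q hq => (h q hq).symm⟩

end

section Charts

variable (W : WeierstrassCurve ℂ)

lemma isChart_toPlane (i : Fin 3) :
    IsChart (ellipticCurve W) {P : W.toAffine.Point | (toPlane W P).rep i ≠ 0}
      (Algebra.adjoin ℂ {g | ∃ j, g = fun P : W.toAffine.Point => projRatio i j (toPlane W P)}) := by
  refine (isChart_induced (φ := toPlane W) (isChart_proj i)).congr rfl ?_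
  have := adjoin_comp_adjoin (Y := fun _ : Unit => proj 2) (φ := fun _ => toPlane W)
    (fun _ => Set.range (projRatio i))
  have h2 : {g : W.toAffine.Point → ℂ | ∃ _ : Unit, ∃ a ∈ Algebra.adjoin ℂ (Set.range
      (projRatio i)), g = a ∘ toPlane W} = {g | ∃ a ∈ Algebra.adjoin ℂ (Set.range
      (projRatio i)), g = a ∘ toPlane W} :=
    Set.ext fun x => ⟨fun ⟨_, h⟩ => h, fun h => ⟨(), h⟩⟩
  have h3 : {g : W.toAffine.Point → ℂ | ∃ _ : Unit, ∃ a ∈ (Set.range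
      (projRatio i)), g = a ∘ toPlane W} =
        {g | ∃ j, g = fun P : W.toAffine.Point => projRatio i j (toPlane W P)} := by
    ext g
    constructor
    · rintro ⟨-, _, ⟨j, rfl⟩, rfl⟩
      exact ⟨j, rfl⟩
    · rintro ⟨j, rfl⟩
      exact ⟨(), _, ⟨j, rfl⟩, rfl⟩
  exact ((congrArg (Algebra.adjoin ℂ) h2).symm.trans this).trans (congrArg (Algebra.adjoin ℂ) h3)

lemma isChart_affine : IsChart (ellipticCurve W) {P : W.toAffine.Point | P ≠ 0} (affineAlg W) := by
  have hO : {P : W.toAffine.Point | (toPlane W P).rep 2 ≠ 0} = {P | P ≠ 0} := by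
    ext P
    rcases P with _ | ⟨x, y, h⟩
    · refine ⟨fun h => absurd ?_ ((rep_mk_ne_zero_iff (r := 2) _ _ _).1 h), fun h => absurd rfl h⟩
      simp
    · exact ⟨fun _ => WeierstrassCurve.Affine.Point.some_ne_zero h, fun _ => (rep_mk_ne_zero_iff (r := 2) _ _ _).2 (by simp)⟩
  refine ((isChart_toPlane W 2).congr hO rfl).change_adjoin ?_ ?_
  · rintro _ ⟨j, rfl⟩
    refine ⟨fun P => ![xCoord W P, yCoord W P, 1] j, ?_, fun P hP => projRatio_two_toPlane W j P hP⟩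
    fin_cases j
    · exact Algebra.subset_adjoin (Or.inl rfl)
    · exact Algebra.subset_adjoin (Or.inr rfl)
    · exact one_mem _
  · rintro _ (rfl | rfl)
    · exact ⟨_, Algebra.subset_adjoin ⟨0, rfl⟩, fun P hP => (projRatio_two_toPlane W 0 P hP).symm⟩
    · exact ⟨_, Algebra.subset_adjoin ⟨1, rfl⟩, fun P hP => (projRatio_two_toPlane W 1 P hP).symm⟩

lemma isChart_inf : IsChart (ellipticCurve W)
    {P : W.toAffine.Point | P = 0 ∨ yCoord W P ≠ 0} (infAlg W) := by
  have hO : {P : W.toAffine.Point | (toPlane W P).rep 1 ≠ 0} = {P | P = 0 ∨ yCoord W P ≠ 0} := by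
    ext P
    rcases P with _ | ⟨x, y, h⟩
    · exact ⟨fun h => Or.inl rfl, fun h => (rep_mk_ne_zero_iff (r := 2) _ _ _).2 (by simp)⟩
    · refine ((rep_mk_ne_zero_iff (r := 2) _ _ _)).trans ?_
      simp
  refine ((isChart_toPlane W 1).congr hO rfl).change_adjoin ?_ ?_
  · rintro _ ⟨j, rfl⟩
    refine ⟨fun P => ![uCoord W P, 1, wCoord W P] j, ?_, fun P hP => projRatio_one_toPlane W j P hP⟩
    fin_cases j
    · exact Algebra.subset_adjoin (Or.inl rfl)
    · exact one_mem _
    · exact Algebra.subset_adjoin (Or.inr rfl)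
  · rintro _ (rfl | rfl)
    · exact ⟨_, Algebra.subset_adjoin ⟨0, rfl⟩, fun P hP => (projRatio_one_toPlane W 0 P hP).symm⟩
    · exact ⟨_, Algebra.subset_adjoin ⟨2, rfl⟩, fun P hP => (projRatio_one_toPlane W 2 P hP).symm⟩

end Charts

/-! ### The coordinate ring as functions on the affine curve -/

section CoordinateRing

variable (W : WeierstrassCurve ℂ)

lemma xCoord_mem : xCoord W ∈ affineAlg W := Algebra.subset_adjoin (Or.inl rfl)
lemma yCoord_mem : yCoord W ∈ affineAlg W := Algebra.subset_adjoin (Or.inr rfl)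
lemma uCoord_mem : uCoord W ∈ infAlg W := Algebra.subset_adjoin (Or.inl rfl)
lemma wCoord_mem : wCoord W ∈ infAlg W := Algebra.subset_adjoin (Or.inr rfl)

open WeierstrassCurve.Affine (CoordinateRing)
open Polynomial

variable {W}

/-- Evaluation of elements of the coordinate ring at a point different from the origin. -/
noncomputable def evalHom {P : W.toAffine.Point} (hP : P ≠ 0) : W.toAffine.CoordinateRing →+* ℂ :=
  AdjoinRoot.evalEval (nonsingular_coords hP).1

lemma evalHom_smul_basis {P : W.toAffine.Point} (hP : P ≠ 0) (p q : ℂ[X]) :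
    evalHom hP (p • 1 + q • CoordinateRing.mk W.toAffine X) =
      p.eval (xCoord W P) + q.eval (xCoord W P) * yCoord W P := by
  have h : p • 1 + q • CoordinateRing.mk W.toAffine X =
      CoordinateRing.mk W.toAffine (C p + C q * X) := by
    rw [CoordinateRing.smul, CoordinateRing.smul, map_add, map_mul, mul_one]
  rw [h]
  refine (AdjoinRoot.evalEval_mk _ _).trans ?_
  simp [evalEval_C, evalEval_X]

lemma evalHom_algebraMap {P : W.toAffine.Point} (hP : P ≠ 0) (c : ℂ) :
    evalHom hP (algebraMap ℂ W.toAffine.CoordinateRing c) = c := by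
  have := evalHom_smul_basis hP (C c) 0
  simp only [zero_smul, add_zero, eval_C, eval_zero, zero_mul] at this
  have h : algebraMap ℂ W.toAffine.CoordinateRing c = (C c : ℂ[X]) • 1 := by
    rw [CoordinateRing.smul, mul_one]
    rfl
  rw [h, this]

lemma neg_ne_zero_point {P : W.toAffine.Point} (hP : P ≠ 0) : -P ≠ 0 := neg_ne_zero.2 hP

lemma xCoord_neg (P : W.toAffine.Point) : xCoord W (-P) = xCoord W P := by
  rcases P with _ | ⟨x, y, h⟩ <;> rfl

lemma yCoord_neg {P : W.toAffine.Point} (hP : P ≠ 0) :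
    yCoord W (-P) = -yCoord W P - W.a₁ * xCoord W P - W.a₃ := by
  rcases P with _ | ⟨x, y, h⟩
  · exact absurd rfl hP
  · rfl

/-- The conjugate of y over ℂ[x] is −y − a₁x − a₃, which is the y-coordinate of −P. -/
lemma eval_norm {P : W.toAffine.Point} (hP : P ≠ 0) (ρ : W.toAffine.CoordinateRing) :
    (Algebra.norm ℂ[X] ρ).eval (xCoord W P) =
      evalHom hP ρ * evalHom (neg_ne_zero_point hP) ρ := by
  obtain ⟨p, q, rfl⟩ := CoordinateRing.exists_smul_basis_eq ρ
  rw [CoordinateRing.norm_smul_basis, evalHom_smul_basis, evalHom_smul_basis, xCoord_neg,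
    yCoord_neg hP]
  have := equation_coords hP
  simp only [eval_sub, eval_pow, eval_mul, eval_add, eval_C, eval_X]
  linear_combination (q.eval (xCoord W P)) ^ 2 * this

lemma eq_or_eq_neg_of_xCoord_eq {P Q : W.toAffine.Point} (hP : P ≠ 0) (hQ : Q ≠ 0)
    (h : xCoord W P = xCoord W Q) : P = Q ∨ P = -Q := by
  rw [← some_coords hP, ← some_coords hQ]
  exact WeierstrassCurve.Affine.Point.X_eq_iff.1 h

lemma finite_xCoord_fiber (x : ℂ) : {P : W.toAffine.Point | P ≠ 0 ∧ xCoord W P = x}.Finite := by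
  by_cases h : ∃ Q : W.toAffine.Point, Q ≠ 0 ∧ xCoord W Q = x
  · obtain ⟨Q, hQ, rfl⟩ := h
    refine (Set.toFinite {Q, -Q}).subset ?_
    rintro P ⟨hP, hx⟩
    exact eq_or_eq_neg_of_xCoord_eq hP hQ hx
  · refine Set.finite_empty.subset fun P hP => h ⟨P, hP⟩

/-- Zeros of ρ lie over the roots of its norm, a nonzero polynomial in x, and only finitely many
points lie over a given x. -/
lemma finite_zeros {ρ : W.toAffine.CoordinateRing} (hρ : ρ ≠ 0) :
    {P : W.toAffine.Point | ∃ hP : P ≠ 0, evalHom hP ρ = 0}.Finite := by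
  have hN : Algebra.norm ℂ[X] ρ ≠ 0 := by
    rwa [Algebra.norm_ne_zero_iff_of_basis (CoordinateRing.basis W.toAffine)]
  refine ((Algebra.norm ℂ[X] ρ).roots.toFinset.finite_toSet.biUnion fun x _ =>
    finite_xCoord_fiber (W := W) x).subset ?_
  rintro P ⟨hP, h0⟩
  refine Set.mem_biUnion (x := xCoord W P) ?_ ⟨hP, rfl⟩
  simp [hN, eval_norm hP, h0]

/-- Values at the origin are conventions. Away from it the functions come from the coordinate ring,
where ideals and norms are available. -/
lemma exists_ring_of_mem_affineAlg {a : W.toAffine.Point → ℂ} (ha : a ∈ affineAlg W) :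
    ∃ ρ : W.toAffine.CoordinateRing, ∀ P (hP : P ≠ 0), a P = evalHom hP ρ := by
  induction ha using Algebra.adjoin_induction with
  | mem x hx =>
    rcases hx with rfl | rfl
    · exact ⟨X • 1 + (0 : ℂ[X]) • CoordinateRing.mk W.toAffine X, fun P hP => by
        rw [evalHom_smul_basis]; simp⟩
    · exact ⟨(0 : ℂ[X]) • 1 + (1 : ℂ[X]) • CoordinateRing.mk W.toAffine X, fun P hP => by
        rw [evalHom_smul_basis]; simp⟩
  | algebraMap r => exact ⟨algebraMap ℂ _ r, fun P hP => (evalHom_algebraMap hP r).symm⟩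
  | add x y _ _ hx hy =>
    obtain ⟨ρ, hρ⟩ := hx
    obtain ⟨σ, hσ⟩ := hy
    exact ⟨ρ + σ, fun P hP => by rw [map_add, ← hρ, ← hσ]; rfl⟩
  | mul x y _ _ hx hy =>
    obtain ⟨ρ, hρ⟩ := hx
    obtain ⟨σ, hσ⟩ := hy
    exact ⟨ρ * σ, fun P hP => by rw [map_mul, ← hρ, ← hσ]; rfl⟩

variable (W) in
lemma exists_xCoord_eq [W.IsElliptic] (x : ℂ) : ∃ P : W.toAffine.Point, P ≠ 0 ∧ xCoord W P = x := by
  obtain ⟨s, hs⟩ := IsAlgClosed.exists_eq_mul_self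
    ((W.a₁ * x + W.a₃) ^ 2 + 4 * (x ^ 3 + W.a₂ * x ^ 2 + W.a₄ * x + W.a₆))
  have h : W.toAffine.Equation x ((s - (W.a₁ * x + W.a₃)) / 2) := by
    rw [WeierstrassCurve.Affine.equation_iff]
    field_simp
    linear_combination -hs
  exact ⟨.some _ _ (WeierstrassCurve.Affine.equation_iff_nonsingular.1 h),
    WeierstrassCurve.Affine.Point.some_ne_zero _, rfl⟩

variable (W) in
lemma infinite_point [W.IsElliptic] : Infinite W.toAffine.Point := by
  choose P hP hx using exists_xCoord_eq W
  exact Infinite.of_injective P fun x y h => by rw [← hx x, ← hx y, h]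

/-! ### Behaviour at infinity in the classical topology -/

/-- Since y² grows like x³, y outgrows every multiple of x; hence x / y and 1 / y tend to 0 as x
tends to infinity. -/
lemma exists_bound_yCoord (K : ℝ) (hK : 0 < K) :
    ∃ R : ℝ, 1 ≤ R ∧ ∀ P : W.toAffine.Point, R < ‖xCoord W P‖ →
      K * ‖xCoord W P‖ ≤ ‖yCoord W P‖ := by
  -- If |y| < K |x| and |x| ≥ 1, every term of the equation other than x³ is at most a constant
  -- times |x|². The bound R is the sum of these constants; the summand 1 guarantees |x| ≥ 1.
  refine ⟨K ^ 2 + ‖W.a₁‖ * K + ‖W.a₃‖ * K + ‖W.a₂‖ + ‖W.a₄‖ + ‖W.a₆‖ + 1, ?_, fun P hR => ?_⟩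
  · have : 0 ≤ K ^ 2 + ‖W.a₁‖ * K + ‖W.a₃‖ * K + ‖W.a₂‖ + ‖W.a₄‖ + ‖W.a₆‖ := by positivity
    linarith
  have hx1 : 1 ≤ ‖xCoord W P‖ := by
    have : 0 ≤ K ^ 2 + ‖W.a₁‖ * K + ‖W.a₃‖ * K + ‖W.a₂‖ + ‖W.a₄‖ + ‖W.a₆‖ := by positivity
    linarith
  have hP : P ≠ 0 := by
    rintro rfl
    simp at hx1
    linarith
  by_contra! hy
  have e : xCoord W P ^ 3 = yCoord W P ^ 2 + W.a₁ * xCoord W P * yCoord W P + W.a₃ * yCoord W P -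
    W.a₂ * xCoord W P ^ 2 - W.a₄ * xCoord W P - W.a₆ := by
    linear_combination -equation_coords hP
  set x := xCoord W P
  set y := yCoord W P
  have h1 : ‖x‖ ^ 3 ≤ ‖y‖ ^ 2 + ‖W.a₁‖ * ‖x‖ * ‖y‖ + ‖W.a₃‖ * ‖y‖ + ‖W.a₂‖ * ‖x‖ ^ 2 +
      ‖W.a₄‖ * ‖x‖ + ‖W.a₆‖ := by
    have h := congrArg norm e
    rw [norm_pow] at h
    rw [h]
    refine (norm_sub_le _ _).trans (add_le_add ((norm_sub_le _ _).trans (add_le_add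
      ((norm_sub_le _ _).trans (add_le_add ((norm_add_le _ _).trans (add_le_add
        ((norm_add_le _ _).trans (add_le_add ?_ ?_)) ?_)) ?_)) ?_)) le_rfl) <;> simp
  have hx0 : 0 ≤ ‖x‖ := norm_nonneg x
  have hy0 := norm_nonneg y
  have g1 : ‖y‖ ^ 2 ≤ K ^ 2 * ‖x‖ ^ 2 := by
    rw [← mul_pow]
    exact pow_le_pow_left₀ hy0 hy.le 2
  have g2 : ‖W.a₁‖ * ‖x‖ * ‖y‖ ≤ ‖W.a₁‖ * K * ‖x‖ ^ 2 := by
    calc _ ≤ ‖W.a₁‖ * ‖x‖ * (K * ‖x‖) := by gcongr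
      _ = _ := by ring
  have g0 : ‖x‖ ≤ ‖x‖ ^ 2 := by nlinarith
  have g00 : 1 ≤ ‖x‖ ^ 2 := by nlinarith
  have g3 : ‖W.a₃‖ * ‖y‖ ≤ ‖W.a₃‖ * K * ‖x‖ ^ 2 := by
    calc _ ≤ ‖W.a₃‖ * (K * ‖x‖ ^ 2) := by gcongr; exact hy.le.trans (by gcongr)
      _ = _ := by ring
  have g4 : ‖W.a₄‖ * ‖x‖ ≤ ‖W.a₄‖ * ‖x‖ ^ 2 := by gcongr
  have g5 : ‖W.a₆‖ ≤ ‖W.a₆‖ * ‖x‖ ^ 2 := le_mul_of_one_le_right (norm_nonneg _) g00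
  have : ‖x‖ * ‖x‖ ^ 2 ≤ (K ^ 2 + ‖W.a₁‖ * K + ‖W.a₃‖ * K + ‖W.a₂‖ + ‖W.a₄‖ + ‖W.a₆‖) *
      ‖x‖ ^ 2 := by nlinarith
  have := le_of_mul_le_mul_right this (by positivity)
  linarith

variable (W) in
/-- The filter of points tending to the origin in the classical topology. -/
noncomputable def atInfinity : Filter W.toAffine.Point := comap (xCoord W) (cocompact ℂ)

instance [W.IsElliptic] : (atInfinity W).NeBot := by
  refine comap_neBot_iff_compl_range.2 fun h => ?_
  have : (Set.range (xCoord W))ᶜ = ∅ := by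
    refine Set.compl_empty_iff.2 (Set.eq_univ_of_forall fun x => ?_)
    obtain ⟨P, -, hP⟩ := exists_xCoord_eq W x
    exact ⟨P, hP⟩
  rw [this] at h
  exact (cocompact ℂ).empty_notMem h

lemma eventually_atInfinity_lt (R : ℝ) : ∀ᶠ P in atInfinity W, R < ‖xCoord W P‖ :=
  (tendsto_norm_cocompact_atTop.comp tendsto_comap).eventually_gt_atTop R

lemma eventually_atInfinity_ne_zero : ∀ᶠ P in atInfinity W, yCoord W P ≠ 0 := by
  obtain ⟨R, hR, h⟩ := exists_bound_yCoord (W := W) 1 one_pos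
  filter_upwards [eventually_atInfinity_lt R] with P hP h0
  have := h P hP
  rw [h0, norm_zero] at this
  linarith

lemma tendsto_uCoord : Tendsto (uCoord W) (atInfinity W) (𝓝 0) := by
  rw [Metric.tendsto_nhds]
  intro ε hε
  obtain ⟨R, hR, h⟩ := exists_bound_yCoord (W := W) (2 / ε) (by positivity)
  filter_upwards [eventually_atInfinity_lt R, eventually_atInfinity_ne_zero] with P hP h0
  have h1 := h P hP
  have hy : 0 < ‖yCoord W P‖ := norm_pos_iff.2 h0
  rw [dist_zero_right, uCoord, norm_div, div_lt_iff₀ hy]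
  have hx : 0 < ‖xCoord W P‖ := by linarith
  have : ε * (2 / ε * ‖xCoord W P‖) ≤ ε * ‖yCoord W P‖ := by gcongr
  have h2 : ε * (2 / ε * ‖xCoord W P‖) = 2 * ‖xCoord W P‖ := by field_simp
  linarith

lemma tendsto_wCoord : Tendsto (wCoord W) (atInfinity W) (𝓝 0) := by
  rw [Metric.tendsto_nhds]
  intro ε hε
  obtain ⟨R, hR, h⟩ := exists_bound_yCoord (W := W) (2 / ε) (by positivity)
  filter_upwards [eventually_atInfinity_lt R, eventually_atInfinity_ne_zero] with P hP h0
  have h1 := h P hP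
  have hy : 0 < ‖yCoord W P‖ := norm_pos_iff.2 h0
  rw [dist_zero_right, wCoord, norm_inv, inv_lt_comm₀ hy hε]
  have : 2 / ε * 1 ≤ 2 / ε * ‖xCoord W P‖ := by gcongr; linarith
  have h2 : ε⁻¹ < 2 / ε * 1 := by
    rw [mul_one, lt_div_iff₀ hε, inv_mul_cancel₀ hε.ne']
    norm_num
  linarith

lemma tendsto_of_mem_infAlg {a : W.toAffine.Point → ℂ} (ha : a ∈ infAlg W) :
    Tendsto a (atInfinity W) (𝓝 (a 0)) := by
  induction ha using Algebra.adjoin_induction with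
  | mem x hx =>
    rcases hx with rfl | rfl
    · simpa using tendsto_uCoord
    · simpa using tendsto_wCoord
  | algebraMap r => exact tendsto_const_nhds
  | add x y _ _ hx hy => exact hx.add hy
  | mul x y _ _ hx hy => exact hx.mul hy

/-- Functions regular at the origin are also continuous there in the classical sense, because u and
w tend to their values 0. -/
lemma tendsto_of_regAt {f : W.toAffine.Point → ℂ} (hf : (ellipticCurve W).RegAt f (0 : W.toAffine.Point)) :
    Tendsto f (atInfinity W) (𝓝 (f 0)) := by
  obtain ⟨g, hg, h, hh, h0, he⟩ := (isChart_inf W).exists_frac _ (Or.inl rfl) f hf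
  have hh' := tendsto_of_mem_infAlg hh
  have hlim := (tendsto_of_mem_infAlg hg).div hh' h0
  have : g (0 : W.toAffine.Point) / h (0 : W.toAffine.Point) = f 0 := by
    rw [← he (0 : W.toAffine.Point) (Or.inl rfl), mul_div_cancel_right₀ _ h0]
  rw [this] at hlim
  refine hlim.congr' ?_
  filter_upwards [eventually_atInfinity_ne_zero, hh'.eventually_ne h0] with P hP hP0
  change g P / h P = f P
  rw [← he P (Or.inr hP), mul_div_cancel_right₀ _ hP0]

/-! ### The Zariski topology of the elliptic curve is the cofinite topology -/

lemma finite_compl_of_affine {U : Set (ellipticCurve W)} (hU : IsOpen U) {P : W.toAffine.Point} (hP : P ≠ 0)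
    (hPU : P ∈ U) : Uᶜ.Finite := by
  obtain ⟨h, hh, h0, hsub⟩ := (isChart_affine W).exists_basic P hP U (hU.mem_nhds hPU)
  obtain ⟨ρ, hρ⟩ := exists_ring_of_mem_affineAlg hh
  have hρ0 : ρ ≠ 0 := by
    rintro rfl
    exact h0 (by rw [hρ P hP, map_zero])
  refine ((finite_zeros hρ0).union (Set.finite_singleton 0)).subset fun Q hQ => ?_
  by_cases hQ0 : Q = (0 : W.toAffine.Point)
  · exact Or.inr hQ0
  · refine Or.inl ⟨hQ0, ?_⟩
    by_contra h1
    exact hQ (hsub Q hQ0 (by rwa [hρ Q hQ0]))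

lemma finite_compl_of_isOpen [W.IsElliptic] {U : Set (ellipticCurve W)} (hU : IsOpen U)
    (hne : U.Nonempty) : Uᶜ.Finite := by
  obtain ⟨P, hPU⟩ := hne
  by_cases hP : P = (0 : W.toAffine.Point)
  · subst hP
    obtain ⟨h, hh, h0, hsub⟩ := (isChart_inf W).exists_basic _ (Or.inl rfl) U (hU.mem_nhds hPU)
    -- A neighbourhood of the origin contains an affine point, since the function cutting it out
    -- stays nonzero along points tending to the origin. This reduces the claim to the affine case.
    obtain ⟨Q, hQ, hQ0⟩ := (((tendsto_of_mem_infAlg hh).eventually_ne h0).and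
      eventually_atInfinity_ne_zero).exists
    refine finite_compl_of_affine hU (P := Q) ?_ (hsub Q (Or.inr hQ0) hQ)
    rintro rfl
    exact hQ0 rfl
  · exact finite_compl_of_affine hU hP hPU

lemma regAt_xCoord {P : W.toAffine.Point} (hP : P ≠ 0) : (ellipticCurve W).RegAt (xCoord W) P :=
  (isChart_affine W).reg _ (xCoord_mem W) _ hP

lemma regAt_yCoord {P : W.toAffine.Point} (hP : P ≠ 0) : (ellipticCurve W).RegAt (yCoord W) P :=
  (isChart_affine W).reg _ (yCoord_mem W) _ hP

lemma eventually_ne_zero_point {P : W.toAffine.Point} (hP : P ≠ 0) :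
    ∀ᶠ Q : W.toAffine.Point in @nhds (ellipticCurve W) _ P, Q ≠ 0 :=
  (isChart_affine W).isOpen.mem_nhds hP

lemma isClosed_singleton_point (P : W.toAffine.Point) :
    IsClosed ({P} : Set (ellipticCurve W)) := by
  rw [← isOpen_compl_iff, isOpen_iff_mem_nhds]
  intro Q hQ
  have hQP : Q ≠ P := hQ
  by_cases hQ0 : Q = (0 : W.toAffine.Point)
  · subst hQ0
    have hP : P ≠ 0 := hQP.symm
    have hu : uCoord W ∈ infAlg W := Algebra.subset_adjoin (Or.inl rfl)
    have hw : wCoord W ∈ infAlg W := Algebra.subset_adjoin (Or.inr rfl)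
    have h1 : (fun R => wCoord W R - wCoord W P) ∈ infAlg W :=
      (infAlg W).sub_mem hw ((infAlg W).algebraMap_mem (wCoord W P))
    by_cases hy : yCoord W P = 0
    · filter_upwards [(isChart_inf W).isOpen.mem_nhds (Or.inl rfl)] with R hR
      rintro rfl
      rcases hR with hR | hR
      exacts [hP hR, hR hy]
    · filter_upwards [eventually_ne_zero ((isChart_inf W).reg _ h1 _ (Or.inl rfl))
        (by simpa [wCoord] using hy)] with R hR
      rintro rfl
      exact hR (sub_self _)
  · by_cases hP : P = 0
    · subst hP
      exact eventually_ne_zero_point hQ0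
    have hx := regAt_sub (regAt_xCoord hQ0) ((ellipticCurve W).regAt_const (xCoord W P) Q)
    have hy := regAt_sub (regAt_yCoord hQ0) ((ellipticCurve W).regAt_const (yCoord W P) Q)
    by_cases hxe : xCoord W Q = xCoord W P
    · have hye : yCoord W Q ≠ yCoord W P := fun h => hQP (ext_coords hQ0 hP hxe h)
      filter_upwards [eventually_ne_zero hy (sub_ne_zero.2 hye)] with R hR
      rintro rfl
      exact hR (sub_self _)
    · filter_upwards [eventually_ne_zero hx (sub_ne_zero.2 hxe)] with R hR
      rintro rfl
      exact hR (sub_self _)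

lemma isOpen_of_finite_compl {U : Set (ellipticCurve W)} (hU : Uᶜ.Finite) : IsOpen U := by
  rw [← isClosed_compl_iff]
  have := hU.isClosed_biUnion (f := fun P => ({P} : Set (ellipticCurve W)))
    fun P _ => isClosed_singleton_point P
  rwa [Set.biUnion_of_singleton] at this

end CoordinateRing

/-! ### The group law of the elliptic curve is given by morphisms -/

section GroupLaw

variable {W : WeierstrassCurve ℂ} {X : SpaceWithFunctions}

lemma isMorphismAt_of_affine {φ : X → W.toAffine.Point} {p : X} (h0 : ∀ᶠ q in 𝓝 p, φ q ≠ 0)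
    (hx : X.RegAt (fun q => xCoord W (φ q)) p) (hy : X.RegAt (fun q => yCoord W (φ q)) p) :
    IsMorphismAt X (ellipticCurve W) φ p := by
  refine (isChart_affine W).isMorphismAt_adjoin h0 ?_
  rintro _ (rfl | rfl)
  exacts [hx, hy]

lemma isMorphismAt_of_inf {φ : X → W.toAffine.Point} {p : X}
    (h0 : ∀ᶠ q in 𝓝 p, φ q = 0 ∨ yCoord W (φ q) ≠ 0)
    (hx : X.RegAt (fun q => uCoord W (φ q)) p) (hy : X.RegAt (fun q => wCoord W (φ q)) p) :
    IsMorphismAt X (ellipticCurve W) φ p := by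
  refine (isChart_inf W).isMorphismAt_adjoin h0 ?_
  rintro _ (rfl | rfl)
  exacts [hx, hy]

lemma eventually_comp_ne_zero {φ : X → W.toAffine.Point} {p : X}
    (hφ : IsMorphismAt X (ellipticCurve W) φ p) (h : φ p ≠ 0) : ∀ᶠ q in 𝓝 p, φ q ≠ 0 :=
  hφ.1.eventually (eventually_ne_zero_point h)

lemma SpaceWithFunctions.IsMorphismAt.regAt_xCoord {φ : X → W.toAffine.Point} {p : X}
    (hφ : IsMorphismAt X (ellipticCurve W) φ p) (h : φ p ≠ 0) :
    X.RegAt (fun q => xCoord W (φ q)) p := hφ.2 _ (_root_.regAt_xCoord h)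

lemma SpaceWithFunctions.IsMorphismAt.regAt_yCoord {φ : X → W.toAffine.Point} {p : X}
    (hφ : IsMorphismAt X (ellipticCurve W) φ p) (h : φ p ≠ 0) :
    X.RegAt (fun q => yCoord W (φ q)) p := hφ.2 _ (_root_.regAt_yCoord h)

/-- The slope of the line through two points. -/
noncomputable def lineSlope (P Q : W.toAffine.Point) : ℂ :=
  (yCoord W P - yCoord W Q) / (xCoord W P - xCoord W Q)

lemma add_coords {P Q : W.toAffine.Point} (hP : P ≠ 0) (hQ : Q ≠ 0)
    (hx : xCoord W P ≠ xCoord W Q) :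
    P + Q ≠ 0 ∧
    xCoord W (P + Q) = lineSlope P Q ^ 2 + W.a₁ * lineSlope P Q - W.a₂ - xCoord W P - xCoord W Q ∧
    yCoord W (P + Q) = -(lineSlope P Q * (xCoord W (P + Q) - xCoord W P) + yCoord W P) -
      W.a₁ * xCoord W (P + Q) - W.a₃ := by
  rcases P with _ | ⟨x₁, y₁, h₁⟩
  · exact absurd rfl hP
  rcases Q with _ | ⟨x₂, y₂, h₂⟩
  · exact absurd rfl hQ
  simp only [xCoord_some] at hx
  rw [WeierstrassCurve.Affine.Point.add_of_X_ne hx]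
  refine ⟨WeierstrassCurve.Affine.Point.some_ne_zero _, ?_, ?_⟩
  · rw [xCoord_some, WeierstrassCurve.Affine.slope_of_X_ne hx]
    rfl
  · rw [yCoord_some, xCoord_some, WeierstrassCurve.Affine.slope_of_X_ne hx]
    rfl

/-- The chord formula: if the x-coordinates differ at p they differ nearby, so the slope is regular.
-/
lemma isMorphismAt_add_of_ne {φ ψ : X → W.toAffine.Point} {p : X}
    (hφ : IsMorphismAt X (ellipticCurve W) φ p) (hψ : IsMorphismAt X (ellipticCurve W) ψ p)
    (hP : φ p ≠ 0) (hQ : ψ p ≠ 0) (hx : xCoord W (φ p) ≠ xCoord W (ψ p)) :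
    IsMorphismAt X (ellipticCurve W) (fun q => φ q + ψ q) p := by
  have x1 := hφ.regAt_xCoord hP
  have y1 := hφ.regAt_yCoord hP
  have x2 := hψ.regAt_xCoord hQ
  have y2 := hψ.regAt_yCoord hQ
  have hd := regAt_sub x1 x2
  have hev : ∀ᶠ q in 𝓝 p, φ q ≠ 0 ∧ ψ q ≠ 0 ∧ xCoord W (φ q) ≠ xCoord W (ψ q) := by
    filter_upwards [eventually_comp_ne_zero hφ hP, eventually_comp_ne_zero hψ hQ,
      eventually_ne_zero hd (sub_ne_zero.2 hx)] with q h1 h2 h3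
    exact ⟨h1, h2, sub_ne_zero.1 h3⟩
  have hs : X.RegAt (fun q => lineSlope (φ q) (ψ q)) p :=
    regAt_div (regAt_sub y1 y2) hd (sub_ne_zero.2 hx)
  have hX : X.RegAt (fun q => xCoord W (φ q + ψ q)) p := by
    refine X.regAt_congr ?_ (regAt_sub (regAt_sub (regAt_sub (X.regAt_add (regAt_pow hs 2)
      (X.regAt_mul (X.regAt_const W.a₁ p) hs)) (X.regAt_const W.a₂ p)) x1) x2)
    filter_upwards [hev] with q hq
    exact (add_coords hq.1 hq.2.1 hq.2.2).2.1.symm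
  refine isMorphismAt_of_affine (hev.mono fun q hq => (add_coords hq.1 hq.2.1 hq.2.2).1) hX ?_
  refine X.regAt_congr ?_ (regAt_sub (regAt_sub (regAt_neg (X.regAt_add (X.regAt_mul hs
    (regAt_sub hX x1)) y1)) (X.regAt_mul (X.regAt_const W.a₁ p) hX)) (X.regAt_const W.a₃ p))
  filter_upwards [hev] with q hq
  exact (add_coords hq.1 hq.2.1 hq.2.2).2.2.symm

lemma eventually_of_finite {s : Set W.toAffine.Point} (hs : s.Finite) {P : W.toAffine.Point} (hP : P ∉ s) :
    ∀ᶠ Q : W.toAffine.Point in @nhds (ellipticCurve W) _ P, Q ∉ s :=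
  (isOpen_of_finite_compl (W := W) (U := sᶜ) ((compl_compl s).symm ▸ hs)).mem_nhds hP

lemma regAt_uCoord_zero : (ellipticCurve W).RegAt (uCoord W) (0 : W.toAffine.Point) :=
  (isChart_inf W).reg _ (uCoord_mem W) _ (Or.inl rfl)

lemma regAt_wCoord_zero : (ellipticCurve W).RegAt (wCoord W) (0 : W.toAffine.Point) :=
  (isChart_inf W).reg _ (wCoord_mem W) _ (Or.inl rfl)

/-- Near the origin, `w = u³ ε` for a regular function `ε` with `ε(0) = 1`. -/
lemma exists_unit_at_zero : ∃ ε : W.toAffine.Point → ℂ,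
    (ellipticCurve W).RegAt ε (0 : W.toAffine.Point) ∧ ε 0 = 1 ∧
    ∀ᶠ P : W.toAffine.Point in @nhds (ellipticCurve W) _ (0 : W.toAffine.Point),
      wCoord W P = uCoord W P ^ 3 * ε P := by
  have hu := regAt_uCoord_zero (W := W)
  have hw := regAt_wCoord_zero (W := W)
  have c := (ellipticCurve W).regAt_const
  -- Dividing the Weierstrass equation by y³ gives w (1 + a₁u + a₃w − a₂u² − a₄uw − a₆w²) = u³. The
  -- function ε is the inverse of the bracket.
  have hD := regAt_sub (regAt_sub (regAt_sub (regAt_add _ (regAt_add _ (c 1 _)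
    (regAt_mul _ (c W.a₁ _) hu)) (regAt_mul _ (c W.a₃ _) hw)) (regAt_mul _ (c W.a₂ _) (regAt_pow hu 2)))
    (regAt_mul _ (c W.a₄ _) (regAt_mul _ hu hw))) (regAt_mul _ (c W.a₆ _) (regAt_pow hw 2))
  have h0 : (1 + W.a₁ * uCoord W 0 + W.a₃ * wCoord W 0 - W.a₂ * uCoord W 0 ^ 2 -
      W.a₄ * (uCoord W 0 * wCoord W 0) - W.a₆ * wCoord W 0 ^ 2) ≠ 0 := by simp
  refine ⟨_, ((ellipticCurve W).regAt_inv hD h0).2, ?_, ?_⟩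
  · change (1 + W.a₁ * uCoord W 0 + W.a₃ * wCoord W 0 - W.a₂ * uCoord W 0 ^ 2 -
      W.a₄ * (uCoord W 0 * wCoord W 0) - W.a₆ * wCoord W 0 ^ 2)⁻¹ = 1
    simp
  · filter_upwards [eventually_ne_zero hD h0, (isChart_inf W).isOpen.mem_nhds (Or.inl rfl)]
      with P hP hP'
    change W.toAffine.Point at P
    change (1 + W.a₁ * uCoord W P + W.a₃ * wCoord W P - W.a₂ * uCoord W P ^ 2 -
      W.a₄ * (uCoord W P * wCoord W P) - W.a₆ * wCoord W P ^ 2) ≠ 0 at hP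
    change wCoord W P = uCoord W P ^ 3 * (1 + W.a₁ * uCoord W P + W.a₃ * wCoord W P -
      W.a₂ * uCoord W P ^ 2 - W.a₄ * (uCoord W P * wCoord W P) - W.a₆ * wCoord W P ^ 2)⁻¹
    rw [eq_mul_inv_iff_mul_eq₀ hP]
    rcases hP' with rfl | hy
    · simp
    · have hP0 : P ≠ 0 := by
        rintro rfl
        exact hy rfl
      have := equation_coords hP0
      simp only [uCoord, wCoord]
      field_simp
      linear_combination this

/-- In the chord formula x and y have poles at the origin. Rewritten in 1 / (x − x_d) and (y − y_d)
/ (x − x_d)², which are regular and vanish at the origin, it becomes polynomial. -/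
lemma isMorphismAt_translate_zero {d : W.toAffine.Point} (hd : d ≠ 0) :
    IsMorphismAt (ellipticCurve W) (ellipticCurve W) (fun P : W.toAffine.Point => P + d)
      (0 : W.toAffine.Point) := by
  obtain ⟨ε, hε, hε0, hwε⟩ := exists_unit_at_zero (W := W)
  have hu := regAt_uCoord_zero (W := W)
  have hw := regAt_wCoord_zero (W := W)
  have c := (ellipticCurve W).regAt_const
  set xd := xCoord W d
  set yd := yCoord W d
  have hden := regAt_sub (c 1 _) (regAt_mul _ (c xd _) (regAt_mul _ (regAt_pow hu 2) hε))
  have hden0 : (1 - xd * (uCoord W 0 ^ 2 * ε 0)) ≠ 0 := by simp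
  -- As u² ε = 1 / x near the origin, s is 1 / (x − x_d), and t is (y − y_d) / (x − x_d)². Written
  -- in u, w and ε, both also make sense at the origin itself.
  let s : W.toAffine.Point → ℂ := fun P => uCoord W P ^ 2 * ε P /
    (1 - xd * (uCoord W P ^ 2 * ε P))
  let t : W.toAffine.Point → ℂ := fun P => (1 - yd * wCoord W P) * (uCoord W P * ε P) /
    (1 - xd * (uCoord W P ^ 2 * ε P)) ^ 2
  have hs : (ellipticCurve W).RegAt s (0 : W.toAffine.Point) :=
    regAt_div (regAt_mul _ (regAt_pow hu 2) hε) hden hden0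
  have ht : (ellipticCurve W).RegAt t (0 : W.toAffine.Point) :=
    regAt_div (regAt_mul _ (regAt_sub (c 1 _) (regAt_mul _ (c yd _) hw)) (regAt_mul _ hu hε))
      (regAt_pow hden 2) (pow_ne_zero 2 hden0)
  have hs0 : s 0 = 0 := by simp [s]
  have ht0 : t 0 = 0 := by simp [t]
  have hev : ∀ᶠ P : W.toAffine.Point in @nhds (ellipticCurve W) _ (0 : W.toAffine.Point),
      P = 0 ∨ (P ≠ 0 ∧ xCoord W P ≠ xd ∧ s P * (xCoord W P - xd) = 1 ∧
        t P * (xCoord W P - xd) ^ 2 = yCoord W P - yd) := by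
    filter_upwards [hwε, eventually_ne_zero hden hden0, (isChart_inf W).isOpen.mem_nhds (Or.inl rfl),
      eventually_of_finite (finite_xCoord_fiber (W := W) xd) fun h => h.1 rfl] with P h1 h2 h3 h4
    change W.toAffine.Point at P
    change wCoord W P = uCoord W P ^ 3 * ε P at h1
    by_cases hP : P = 0
    · exact Or.inl hP
    have hy : yCoord W P ≠ 0 := h3.resolve_left hP
    have hx : xCoord W P - xd ≠ 0 := sub_ne_zero.2 fun h => h4 ⟨hP, h⟩
    change 1 - xd * (uCoord W P ^ 2 * ε P) ≠ 0 at h2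
    have e1 : uCoord W P ^ 2 * ε P * xCoord W P = 1 := by
      have : xCoord W P = uCoord W P * yCoord W P := by rw [uCoord, div_mul_cancel₀ _ hy]
      rw [this]
      calc _ = (uCoord W P ^ 3 * ε P) * yCoord W P := by ring
        _ = 1 := by rw [← h1, wCoord, inv_mul_cancel₀ hy]
    have hwy : wCoord W P * yCoord W P = 1 := inv_mul_cancel₀ hy
    have huy : uCoord W P * yCoord W P = xCoord W P := div_mul_cancel₀ _ hy
    refine Or.inr ⟨hP, sub_ne_zero.1 hx, ?_, ?_⟩
    · rw [div_mul_eq_mul_div, div_eq_one_iff_eq h2]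
      linear_combination e1
    · rw [div_mul_eq_mul_div, div_eq_iff (pow_ne_zero 2 h2)]
      have e2 : (1 - xd * (uCoord W P ^ 2 * ε P)) * xCoord W P = xCoord W P - xd := by
        linear_combination -xd * e1
      have e3 : uCoord W P * ε P * xCoord W P ^ 2 = yCoord W P := by
        rw [← huy] at e1 ⊢
        linear_combination yCoord W P * e1
      have hxx : xCoord W P ≠ 0 := by
        intro h
        rw [h, mul_zero] at e1
        exact zero_ne_one e1
      refine mul_right_cancel₀ (pow_ne_zero 2 hxx) ?_
      rw [← e2]
      linear_combination ((1 - xd * (uCoord W P ^ 2 * ε P)) ^ 2 * xCoord W P ^ 2) *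
        ((1 - yd * wCoord W P) * e3 - yd * hwy)
  clear_value s t
  -- The coefficients of the curve after moving d to (0, 0): the equation becomes Y² + a₁XY + a3 Y =
  -- X³ + a2 X² + a4 X.
  set a2 := W.a₂ + 3 * xd with ha2
  set a3 := 2 * yd + W.a₁ * xd + W.a₃ with ha3
  set a4 := 3 * xd ^ 2 + 2 * W.a₂ * xd + W.a₄ - W.a₁ * yd with ha4
  have hX : (ellipticCurve W).RegAt (fun P => a4 * s P - a3 * t P + xd) (0 : W.toAffine.Point) :=
    regAt_add _ (regAt_sub (regAt_mul _ (c a4 _) hs) (regAt_mul _ (c a3 _) ht)) (c xd _)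
  have hY : (ellipticCurve W).RegAt (fun P => -(a4 * t P - a3 * (1 + a2 * s P + a4 * s P ^ 2 -
      W.a₁ * t P - a3 * (t P * s P)) + yd) - W.a₁ * (a4 * s P - a3 * t P + xd) - W.a₃)
      (0 : W.toAffine.Point) :=
    regAt_sub (regAt_sub (regAt_neg (regAt_add _ (regAt_sub (regAt_mul _ (c a4 _) ht)
      (regAt_mul _ (c a3 _) (regAt_sub (regAt_sub (regAt_add _ (regAt_add _ (c 1 _)
      (regAt_mul _ (c a2 _) hs)) (regAt_mul _ (c a4 _) (regAt_pow hs 2)))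
      (regAt_mul _ (c W.a₁ _) ht)) (regAt_mul _ (c a3 _) (regAt_mul _ ht hs))))) (c yd _)))
      (regAt_mul _ (c W.a₁ _) hX)) (c W.a₃ _)
  have hne : ∀ᶠ P : W.toAffine.Point in @nhds (ellipticCurve W) _ (0 : W.toAffine.Point),
      P + d ≠ 0 := by
    filter_upwards [eventually_of_finite (Set.finite_singleton (-d)) (P := 0)
      (fun h => hd (by simpa using h.symm))] with P hP h
    exact hP (eq_neg_of_add_eq_zero_left h)
  have key : ∀ P : W.toAffine.Point, (P ≠ 0 ∧ xCoord W P ≠ xd ∧ s P * (xCoord W P - xd) = 1 ∧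
        t P * (xCoord W P - xd) ^ 2 = yCoord W P - yd) →
      a4 * s P - a3 * t P + xd = xCoord W (P + d) ∧
      -(a4 * t P - a3 * (1 + a2 * s P + a4 * s P ^ 2 -
      W.a₁ * t P - a3 * (t P * s P)) + yd) - W.a₁ * (a4 * s P - a3 * t P + xd) - W.a₃ =
        yCoord W (P + d) := by
    rintro P ⟨hP, hx, h1, h2⟩
    obtain ⟨-, e1, e2⟩ := add_coords hP hd hx
    have hx' : xCoord W P - xd ≠ 0 := sub_ne_zero.2 hx
    have eP := equation_coords hP
    have ed := equation_coords hd
    change yd ^ 2 + W.a₁ * xd * yd + W.a₃ * yd = xd ^ 3 + W.a₂ * xd ^ 2 + W.a₄ * xd + W.a₆ at ed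
    obtain ⟨Xc, hXc⟩ : ∃ Xc, Xc = xCoord W P - xd := ⟨_, rfl⟩
    obtain ⟨Yc, hYc⟩ : ∃ Yc, Yc = yCoord W P - yd := ⟨_, rfl⟩
    rw [← hXc] at h1 h2 hx'
    rw [← hYc] at h2
    have hsl : lineSlope P d = t P * Xc := by
      change (yCoord W P - yd) / (xCoord W P - xd) = _
      rw [← hXc, ← hYc, ← h2]
      field_simp
    -- The moved equation divided by X³, with s = 1 / X and t = Y / X².
    have eC : t P ^ 2 * Xc = 1 + a2 * s P + a4 * s P ^ 2 - W.a₁ * t P - a3 * (t P * s P) := by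
      have hxP : xCoord W P = Xc + xd := by rw [hXc]; ring
      have hyP : yCoord W P = t P * Xc ^ 2 + yd := by rw [h2, hYc]; ring
      rw [hxP, hyP] at eP
      have : t P ^ 2 * Xc ^ 3 = Xc ^ 2 + a2 * Xc + a4 - W.a₁ * t P * Xc ^ 2 - a3 * t P * Xc := by
        refine mul_right_cancel₀ hx' ?_
        rw [ha2, ha3, ha4]
        linear_combination eP - ed
      refine mul_right_cancel₀ (pow_ne_zero 2 hx') ?_
      linear_combination this - (a2 * Xc + a4 * (s P * Xc + 1) - a3 * t P * Xc) * h1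
    have ex : a4 * s P - a3 * t P + xd = xCoord W (P + d) := by
      rw [e1, hsl]
      change _ = _ - xd
      have hxP : xCoord W P = Xc + xd := by rw [hXc]; ring
      rw [hxP]
      have h3 : t P ^ 2 * Xc ^ 2 = Xc + a2 + a4 * s P - W.a₁ * (t P * Xc) - a3 * t P := by
        linear_combination Xc * eC + (a2 + a4 * s P - a3 * t P) * h1
      rw [mul_pow, h3, ha2]
      ring
    refine ⟨ex, ?_⟩
    rw [e2, ← ex, hsl]
    have hyP : yCoord W P = t P * Xc ^ 2 + yd := by rw [h2, hYc]; ring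
    have hxP : xCoord W P = Xc + xd := by rw [hXc]; ring
    rw [hyP, hxP, ← eC]
    linear_combination (a4 * t P) * h1
  refine isMorphismAt_of_affine hne (regAt_congr _ ?_ hX) (regAt_congr _ ?_ hY)
  · filter_upwards [hev] with P hP
    change W.toAffine.Point at P
    rcases hP with rfl | hP
    · rw [hs0, ht0, zero_add]
      ring
    · exact (key P hP).1
  · filter_upwards [hev] with P hP
    change W.toAffine.Point at P
    rcases hP with rfl | hP
    · rw [hs0, ht0, zero_add, ha3]
      change _ = yd
      ring
    · exact (key P hP).2

lemma yCoord_ne_of_ne_neg {c : W.toAffine.Point} (hc : c ≠ 0) (h : c ≠ -c) :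
    yCoord W (-c) ≠ yCoord W c := fun e =>
  h (ext_coords hc (neg_ne_zero_point hc) (xCoord_neg c).symm e.symm)

/-- Here the image is the origin, so u and w are used as coordinates. The inverse slope ξ is regular
at −c, because y(−c) ≠ y(c), and it vanishes there. Near −c, but off it, x(P + c) ξ² = N and y(P +
c) ξ³ = −M, where M is 1 at −c. -/
lemma isMorphismAt_translate_neg {c : W.toAffine.Point} (hc : c ≠ 0) (h2 : c ≠ -c) :
    IsMorphismAt (ellipticCurve W) (ellipticCurve W) (fun P : W.toAffine.Point => P + c)
      (-c : W.toAffine.Point) := by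
  have hc' := neg_ne_zero_point hc
  have k := (ellipticCurve W).regAt_const
  have hx := regAt_xCoord hc'
  have hy := regAt_yCoord hc'
  have hden := regAt_sub hy (k (yCoord W c) _)
  have hden0 : yCoord W (-c) - yCoord W c ≠ 0 := sub_ne_zero.2 (yCoord_ne_of_ne_neg hc h2)
  let ξ : W.toAffine.Point → ℂ := fun P => (xCoord W P - xCoord W c) / (yCoord W P - yCoord W c)
  have hξ : (ellipticCurve W).RegAt ξ (-c : W.toAffine.Point) :=
    regAt_div (regAt_sub hx (k _ _)) hden hden0
  have hξ0 : ξ (-c) = 0 := by simp [ξ, xCoord_neg]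
  let N : W.toAffine.Point → ℂ := fun P => 1 + W.a₁ * ξ P -
    (W.a₂ + xCoord W P + xCoord W c) * ξ P ^ 2
  have hN : (ellipticCurve W).RegAt N (-c : W.toAffine.Point) :=
    regAt_sub (regAt_add _ (k 1 _) (regAt_mul _ (k W.a₁ _) hξ))
      (regAt_mul _ (regAt_add _ (regAt_add _ (k W.a₂ _) hx) (k (xCoord W c) _)) (regAt_pow hξ 2))
  let M : W.toAffine.Point → ℂ := fun P => N P - xCoord W c * ξ P ^ 2 + yCoord W c * ξ P ^ 3 +
    W.a₁ * (ξ P * N P) + W.a₃ * ξ P ^ 3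
  have hM : (ellipticCurve W).RegAt M (-c : W.toAffine.Point) :=
    regAt_add _ (regAt_add _ (regAt_add _ (regAt_sub hN (regAt_mul _ (k (xCoord W c) _)
      (regAt_pow hξ 2))) (regAt_mul _ (k (yCoord W c) _) (regAt_pow hξ 3)))
      (regAt_mul _ (k W.a₁ _) (regAt_mul _ hξ hN))) (regAt_mul _ (k W.a₃ _) (regAt_pow hξ 3))
  have hM0 : M (-c) ≠ 0 := by simp [M, N, hξ0]
  have hev : ∀ᶠ P : W.toAffine.Point in @nhds (ellipticCurve W) _ (-c : W.toAffine.Point),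
      P = -c ∨ (P + c ≠ 0 ∧ yCoord W (P + c) ≠ 0 ∧ uCoord W (P + c) = -(ξ P * N P / M P) ∧
        wCoord W (P + c) = -(ξ P ^ 3 / M P)) := by
    filter_upwards [eventually_ne_zero_point hc', eventually_ne_zero hden hden0,
      eventually_ne_zero hM hM0, eventually_of_finite (Set.finite_singleton c) (P := -c)
        (fun h => h2 h.symm)] with P h3 h4 h5 h6
    change W.toAffine.Point at P
    by_cases hP : P = -c
    · exact Or.inl hP
    have hne : xCoord W P ≠ xCoord W c := fun h =>
      (eq_or_eq_neg_of_xCoord_eq h3 hc h).elim h6 hP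
    have h4' : yCoord W P - yCoord W c ≠ 0 := h4
    obtain ⟨a1, a2, a3⟩ := add_coords h3 hc hne
    have hξP : ξ P ≠ 0 := div_ne_zero (sub_ne_zero.2 hne) h4'
    have hsl : lineSlope P c * ξ P = 1 := by
      have := sub_ne_zero.2 hne
      simp only [lineSlope, ξ]
      field_simp
    have e1 : xCoord W (P + c) * ξ P ^ 2 = N P := by
      rw [a2]
      simp only [N]
      linear_combination (lineSlope P c * ξ P + 1 + W.a₁ * ξ P) * hsl
    have e0 : lineSlope P c * (xCoord W (P + c) - xCoord W P) + yCoord W P =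
        lineSlope P c * (xCoord W (P + c) - xCoord W c) + yCoord W c := by
      have : lineSlope P c * (xCoord W P - xCoord W c) = yCoord W P - yCoord W c :=
        div_mul_cancel₀ _ (sub_ne_zero.2 hne)
      linear_combination -this
    have e2 : yCoord W (P + c) * ξ P ^ 3 = -M P := by
      rw [a3, e0]
      simp only [M]
      rw [← e1]
      linear_combination (-(xCoord W (P + c) - xCoord W c) * ξ P ^ 2) * hsl
    have hyne : yCoord W (P + c) ≠ 0 := by
      intro h
      rw [h, zero_mul, eq_comm, neg_eq_zero] at e2
      exact h5 e2
    refine Or.inr ⟨a1, hyne, ?_, ?_⟩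
    · rw [uCoord, ← e1, ← neg_neg (M P), ← e2]
      field_simp
    · rw [wCoord, ← neg_neg (M P), ← e2]
      field_simp
  refine isMorphismAt_of_inf ?_ (regAt_congr _ ?_ (regAt_neg (regAt_div (regAt_mul _ hξ hN) hM hM0)))
    (regAt_congr _ ?_ (regAt_neg (regAt_div (regAt_pow hξ 3) hM hM0)))
  · filter_upwards [hev] with P hP
    rcases hP with rfl | hP
    · exact Or.inl (neg_add_cancel c)
    · exact Or.inr hP.2.1
  · filter_upwards [hev] with P hP
    rcases hP with rfl | hP
    · rw [neg_add_cancel, uCoord_zero]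
      change -(ξ (-c) * N (-c) / M (-c)) = 0
      rw [hξ0]
      simp
    · exact hP.2.2.1.symm
  · filter_upwards [hev] with P hP
    rcases hP with rfl | hP
    · rw [neg_add_cancel, wCoord_zero]
      change -(ξ (-c) ^ 3 / M (-c)) = 0
      rw [hξ0]
      simp
    · exact hP.2.2.2.symm

/-- The affine 2-torsion points are zeros of 2y + a₁x + a₃, a nonzero element of the coordinate
ring. -/
lemma finite_two_torsion : {P : W.toAffine.Point | P = -P}.Finite := by
  let ρ : W.toAffine.CoordinateRing :=
    (Polynomial.C W.a₁ * Polynomial.X + Polynomial.C W.a₃) • 1 + (2 : Polynomial ℂ) •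
      WeierstrassCurve.Affine.CoordinateRing.mk W.toAffine Polynomial.X
  have hρ : ρ ≠ 0 := fun h => by
    have := (WeierstrassCurve.Affine.CoordinateRing.smul_basis_eq_zero h).2
    exact two_ne_zero this
  refine ((finite_zeros hρ).union (Set.finite_singleton 0)).subset fun P hP => ?_
  by_cases hP0 : P = 0
  · exact Or.inr hP0
  · refine Or.inl ⟨hP0, ?_⟩
    have h := congrArg (yCoord W) (show P = -P from hP)
    rw [yCoord_neg hP0] at h
    rw [evalHom_smul_basis]
    simp
    linear_combination h

/-- Two solutions differ by a 2-torsion point. -/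
lemma finite_add_self_eq (a : W.toAffine.Point) : {P : W.toAffine.Point | P + P = a}.Finite := by
  by_cases h : ∃ Q : W.toAffine.Point, Q + Q = a
  · obtain ⟨Q, rfl⟩ := h
    refine (finite_two_torsion.preimage (f := fun P : W.toAffine.Point => P - Q)
      (sub_left_injective.injOn)).subset fun P hP => ?_
    change P - Q = -(P - Q)
    have : P + P = Q + Q := hP
    rw [neg_sub, sub_eq_sub_iff_add_eq_add, this]
  · refine Set.finite_empty.subset fun P hP => h ⟨P, hP⟩

variable [W.IsElliptic]

lemma exists_notMem_of_finite {s : Set W.toAffine.Point} (hs : s.Finite) : ∃ P, P ∉ s :=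
  have := infinite_point W
  hs.exists_notMem

/-- Translation by c is translation by d followed by translation by c − d. For d outside a finite
set, the chord formula covers the first step, and it or `isMorphismAt_translate_neg` covers the
second. -/
lemma isMorphismAt_translate (c P : W.toAffine.Point) :
    IsMorphismAt (ellipticCurve W) (ellipticCurve W) (fun P : W.toAffine.Point => P + c) P := by
  have generic : ∀ {c P : W.toAffine.Point}, c ≠ 0 → P ≠ 0 → P ≠ c → P ≠ -c →
      IsMorphismAt (ellipticCurve W) (ellipticCurve W) (fun P : W.toAffine.Point => P + c) P :=
    fun {c P} hc hP h1 h2 => isMorphismAt_add_of_ne (X := ellipticCurve W) (φ := fun P => P)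
      (ψ := fun _ => c) (IsMorphismAt.id (X := ellipticCurve W) P)
      (IsMorphismAt.const (X := ellipticCurve W) (Y := ellipticCurve W) c P) hP hc
      fun h => (eq_or_eq_neg_of_xCoord_eq hP hc h).elim h1 h2
  have split : ∀ d : W.toAffine.Point, (fun P : W.toAffine.Point => P + c) =
      (fun P => P + (c - d)) ∘ (fun P => P + d) := fun d => by
    ext P
    simp
  by_cases hc : c = 0
  · subst hc
    exact (IsMorphismAt.id (X := ellipticCurve W) P).congr (Eventually.of_forall fun Q =>
      (add_zero (M := W.toAffine.Point) Q).symm)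
  by_cases hP : P = 0
  · subst hP
    exact isMorphismAt_translate_zero hc
  by_cases hPc : P = -c
  · obtain ⟨d, hd⟩ := exists_notMem_of_finite ((Set.toFinite {0, P, -P, c}).union
      (finite_add_self_eq (c + c)))
    simp only [Set.mem_union, Set.mem_insert_iff, Set.mem_singleton_iff, Set.mem_ofPred_eq,
      not_or] at hd
    rw [split d]
    refine IsMorphismAt.comp (Y := ellipticCurve W) ?_
      (generic hd.1.1 hP (Ne.symm hd.1.2.1) fun h => hd.1.2.2.1 (by rw [h, neg_neg]))
    have : P + d = -(c - d) := by rw [hPc]; abel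
    change IsMorphismAt (ellipticCurve W) (ellipticCurve W) _ (P + d)
    rw [this]
    refine isMorphismAt_translate_neg (sub_ne_zero.2 (Ne.symm hd.1.2.2.2)) fun h => hd.2 ?_
    rw [neg_sub, sub_eq_sub_iff_add_eq_add] at h
    exact h.symm
  · obtain ⟨d, hd⟩ := exists_notMem_of_finite ((Set.toFinite {0, P, -P, c}).union
      (finite_add_self_eq (c - P)))
    simp only [Set.mem_union, Set.mem_insert_iff, Set.mem_singleton_iff, Set.mem_ofPred_eq,
      not_or] at hd
    rw [split d]
    refine IsMorphismAt.comp (Y := ellipticCurve W) ?_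
      (generic hd.1.1 hP (Ne.symm hd.1.2.1) fun h => hd.1.2.2.1 (by rw [h, neg_neg]))
    refine generic (sub_ne_zero.2 (Ne.symm hd.1.2.2.2))
      (fun h => hd.1.2.2.1 (eq_neg_of_add_eq_zero_right h)) (fun h => hd.2 ?_) fun h => hPc ?_
    · have e : P + d + d = c := by rw [h, sub_add_cancel]
      rw [← e]
      abel
    · have e : P + d = -(c - d) := h
      rw [neg_sub, sub_eq_add_neg, add_comm] at e
      exact add_left_cancel e

/-- The summands are translated by constants a and b so that their values at p become affine with
distinct x-coordinates. There the chord formula applies, and the sum is translated back by −a − b.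
-/
lemma SpaceWithFunctions.IsMorphismAt.add {φ ψ : X → W.toAffine.Point} {p : X}
    (hφ : IsMorphismAt X (ellipticCurve W) φ p) (hψ : IsMorphismAt X (ellipticCurve W) ψ p) :
    IsMorphismAt X (ellipticCurve W) (fun q => φ q + ψ q) p := by
  obtain ⟨a, ha⟩ := exists_notMem_of_finite (Set.finite_singleton (-φ p))
  obtain ⟨b, hb⟩ := exists_notMem_of_finite
    (Set.toFinite {-ψ p, φ p + a - ψ p, -(φ p + a) - ψ p})
  simp only [Set.mem_insert_iff, Set.mem_singleton_iff, not_or] at ha hb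
  have hφ' := (isMorphismAt_translate a (φ p)).comp hφ
  have hψ' := (isMorphismAt_translate b (ψ p)).comp hψ
  have h1 : φ p + a ≠ 0 := fun h => ha (eq_neg_of_add_eq_zero_right h)
  have h2 : ψ p + b ≠ 0 := fun h => hb.1 (eq_neg_of_add_eq_zero_right h)
  have := isMorphismAt_add_of_ne hφ' hψ' h1 h2 fun h => by
    rcases eq_or_eq_neg_of_xCoord_eq h1 h2 h with h | h
    · exact hb.2.1 (by rw [h]; abel)
    · exact hb.2.2 (by rw [h]; abel)
  refine ((isMorphismAt_translate (-a - b) _).comp this).congr (Eventually.of_forall fun q => ?_)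
  change φ q + a + (ψ q + b) + (-a - b) = φ q + ψ q
  abel

lemma isMorphismAt_neg (P : W.toAffine.Point) :
    IsMorphismAt (ellipticCurve W) (ellipticCurve W) (fun P : W.toAffine.Point => -P) P := by
  have affine : ∀ {P : W.toAffine.Point}, P ≠ 0 →
      IsMorphismAt (ellipticCurve W) (ellipticCurve W) (fun P : W.toAffine.Point => -P) P := by
    intro P hP
    have hx := regAt_xCoord hP
    have hy := regAt_yCoord hP
    have k := (ellipticCurve W).regAt_const
    have hev := eventually_ne_zero_point hP
    refine isMorphismAt_of_affine (hev.mono fun Q hQ => neg_ne_zero_point hQ)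
      (regAt_congr _ (Eventually.of_forall fun Q => (xCoord_neg Q).symm) hx)
      (regAt_congr _ ?_ (regAt_sub (regAt_sub (regAt_neg hy) (regAt_mul _ (k W.a₁ _) hx)) (k W.a₃ _)))
    filter_upwards [hev] with Q hQ
    exact (yCoord_neg hQ).symm
  by_cases hP : P = 0
  · subst hP
    obtain ⟨c, hc⟩ := exists_notMem_of_finite (W := W) (Set.finite_singleton 0)
    -- Near the origin, −Q = −(Q + c) + c reduces to the affine case.
    have h1 := (affine (P := 0 + c) (by rwa [zero_add])).comp
      (isMorphismAt_translate c (0 : W.toAffine.Point))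
    refine (h1.add (IsMorphismAt.const (Y := ellipticCurve W) c _)).congr (Eventually.of_forall fun (Q : W.toAffine.Point) => ?_)
    change -(Q + c) + c = -Q
    abel
  · exact affine hP

lemma SpaceWithFunctions.IsMorphismAt.neg {φ : X → W.toAffine.Point} {p : X}
    (hφ : IsMorphismAt X (ellipticCurve W) φ p) :
    IsMorphismAt X (ellipticCurve W) (fun q => -φ q) p :=
  (isMorphismAt_neg (φ p)).comp hφ

lemma SpaceWithFunctions.IsMorphismAt.sub {φ ψ : X → W.toAffine.Point} {p : X}
    (hφ : IsMorphismAt X (ellipticCurve W) φ p) (hψ : IsMorphismAt X (ellipticCurve W) ψ p) :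
    IsMorphismAt X (ellipticCurve W) (fun q => φ q - ψ q) p := by
  simp only [sub_eq_add_neg]
  exact hφ.add hψ.neg

lemma SpaceWithFunctions.IsMorphismAt.sum {ι : Type*} {s : Finset ι} {φ : ι → X → W.toAffine.Point}
    {p : X} (hφ : ∀ i ∈ s, IsMorphismAt X (ellipticCurve W) (φ i) p) :
    IsMorphismAt X (ellipticCurve W) (fun q => (∑ i ∈ s, φ i q : W.toAffine.Point)) p := by
  classical
  induction s using Finset.induction_on with
  | empty => exact IsMorphismAt.const (Y := ellipticCurve W) (0 : W.toAffine.Point) p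
  | insert a s ha ih =>
    simp only [Finset.sum_insert ha]
    exact (hφ a (Finset.mem_insert_self a s)).add
      (ih fun i hi => hφ i (Finset.mem_insert_of_mem hi))

end GroupLaw

/-! ### Irreducibility of powers and products -/

section Irreducible

variable {X Y : SpaceWithFunctions}

lemma SpaceWithFunctions.continuous_of_isMorphismAt {φ : X → Y} (h : ∀ p, IsMorphismAt X Y φ p) :
    Continuous φ := (isMorphism_iff.2 h).1

lemma SpaceWithFunctions.isMorphismAt_update {n : ℕ} (x : Fin n → X) (a : Fin n) (p : X) :
    IsMorphismAt X (X.power n) (fun t => Function.update x a t) p := by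
  refine isMorphismAt_into_power fun i => ?_
  by_cases h : i = a
  · subst h
    exact (IsMorphismAt.id p).congr (Eventually.of_forall fun t => by simp)
  · exact (IsMorphismAt.const (x i) p).congr (Eventually.of_forall fun t => by simp [h])

instance SpaceWithFunctions.preirreducibleSpace_power [PreirreducibleSpace X] (n : ℕ) :
    PreirreducibleSpace (X.power n) := by
  refine ⟨?_⟩
  rintro U V hU hV ⟨x, -, hx⟩ ⟨y, -, hy⟩
  rw [Set.univ_inter]
  -- Points of U and V are made to agree in one more coordinate at a time: varying that coordinate,
  -- U and V each give a nonempty open set of values in X, and these two sets meet.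
  have key : ∀ s : Finset (Fin n), ∃ x' y' : Fin n → X, x' ∈ U ∧ y' ∈ V ∧ ∀ i ∈ s, x' i = y' i := by
    intro s
    induction s using Finset.induction_on with
    | empty => exact ⟨x, y, hx, hy, by simp⟩
    | insert a s ha ih =>
      obtain ⟨x', y', hx', hy', he⟩ := ih
      obtain ⟨t, ht, ht'⟩ := nonempty_preirreducible_inter
        (hU.preimage (continuous_of_isMorphismAt (isMorphismAt_update x' a)))
        (hV.preimage (continuous_of_isMorphismAt (isMorphismAt_update y' a)))
        ⟨x' a, show Function.update x' a (x' a) ∈ U from (Function.update_eq_self a x').symm ▸ hx'⟩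
        ⟨y' a, show Function.update y' a (y' a) ∈ V from (Function.update_eq_self a y').symm ▸ hy'⟩
      refine ⟨_, _, ht, ht', fun i hi => ?_⟩
      change Function.update x' a t i = Function.update y' a t i
      by_cases h : i = a
      · subst h
        simp
      · rw [Function.update_of_ne h, Function.update_of_ne h]
        exact he i ((Finset.mem_insert.1 hi).resolve_left h)
  obtain ⟨x', y', hx', hy', he⟩ := key Finset.univ
  obtain rfl : x' = y' := funext fun i => he i (Finset.mem_univ i)
  exact ⟨x', hx', hy'⟩

lemma SpaceWithFunctions.isMorphismAt_mk_left (y : Y) (p : X) :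
    IsMorphismAt X (X.prod Y) (fun t => (t, y)) p :=
  isMorphismAt_into_prod (IsMorphismAt.id p) (IsMorphismAt.const y p)

lemma SpaceWithFunctions.isMorphismAt_mk_right (x : X) (p : Y) :
    IsMorphismAt Y (X.prod Y) (fun t => (x, t)) p :=
  isMorphismAt_into_prod (IsMorphismAt.const x p) (IsMorphismAt.id p)

instance SpaceWithFunctions.preirreducibleSpace_prod [PreirreducibleSpace X] [PreirreducibleSpace Y] :
    PreirreducibleSpace (X.prod Y) := by
  refine ⟨?_⟩
  rintro U V hU hV ⟨⟨x, y⟩, -, hx⟩ ⟨⟨x', y'⟩, -, hy⟩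
  rw [Set.univ_inter]
  obtain ⟨t, ht, ht'⟩ := nonempty_preirreducible_inter
    (hU.preimage (continuous_of_isMorphismAt (isMorphismAt_mk_left y)))
    (hV.preimage (continuous_of_isMorphismAt (isMorphismAt_mk_left y'))) ⟨x, hx⟩ ⟨x', hy⟩
  obtain ⟨s, hs, hs'⟩ := nonempty_preirreducible_inter
    (hU.preimage (continuous_of_isMorphismAt (isMorphismAt_mk_right t)))
    (hV.preimage (continuous_of_isMorphismAt (isMorphismAt_mk_right t))) ⟨y, ht⟩ ⟨y', ht'⟩
  exact ⟨(t, s), hs, hs'⟩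

instance SpaceWithFunctions.preirreducibleSpace_proj (r : ℕ) : PreirreducibleSpace (proj r) := by
  refine ⟨?_⟩
  rintro U V hU hV ⟨x, -, hx⟩ ⟨y, -, hy⟩
  rw [Set.univ_inter]
  obtain ⟨i, f, hf, hfx, hfU⟩ := (projData r).mem_nhds_toSpace.1 (hU.mem_nhds hx)
  obtain ⟨j, g, hg, hgy, hgV⟩ := (projData r).mem_nhds_toSpace.1 (hV.mem_nhds hy)
  obtain ⟨F, hF, rfl⟩ := mem_projData_A.1 hf
  obtain ⟨G, hG, rfl⟩ := mem_projData_A.1 hg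
  have hF0 : F ≠ 0 := by
    rintro rfl
    exact hfx.2 (by simp)
  have hG0 : G ≠ 0 := by
    rintro rfl
    exact hgy.2 (by simp)
  -- The factor X₀ only ensures that v is nonzero, since F and G may be constants.
  obtain ⟨v, hv⟩ : ∃ v, MvPolynomial.eval v (F * G * MvPolynomial.X 0) ≠ 0 := by
    by_contra! h
    refine mul_ne_zero (mul_ne_zero hF0 hG0) (MvPolynomial.X_ne_zero (0 : Fin (r + 1)))
      (MvPolynomial.funext fun v => ?_)
    rw [h v, map_zero]
  rw [map_mul, map_mul, MvPolynomial.eval_X] at hv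
  have hv0 : v ≠ 0 := by
    rintro rfl
    exact hv (by simp)
  obtain ⟨a, ha⟩ := Projectivization.exists_smul_eq_mk_rep ℂ v hv0
  have he : ∀ {d : ℕ} {F : MvPolynomial (Fin (r + 1)) ℂ}, F.IsHomogeneous d →
      MvPolynomial.eval v F ≠ 0 →
      MvPolynomial.eval (Projectivization.mk ℂ v hv0).rep F ≠ 0 := fun hF h => by
    rw [← ha, Units.smul_def, eval_smul_of_isHomogeneous hF]
    exact mul_ne_zero (pow_ne_zero _ a.ne_zero) h
  exact ⟨Projectivization.mk ℂ v hv0,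
    hfU ⟨trivial, he hF fun h => hv (by simp [h])⟩, hgV ⟨trivial, he hG fun h => hv (by simp [h])⟩⟩

variable {W : WeierstrassCurve ℂ} [W.IsElliptic]

instance preirreducibleSpace_ellipticCurve : PreirreducibleSpace (ellipticCurve W) := by
  refine ⟨?_⟩
  rintro U V hU hV ⟨x, -, hx⟩ ⟨y, -, hy⟩
  rw [Set.univ_inter]
  obtain ⟨P, hP⟩ := exists_notMem_of_finite (W := W)
    ((finite_compl_of_isOpen hU ⟨x, hx⟩).union (finite_compl_of_isOpen hV ⟨y, hy⟩))
  exact ⟨P, by_contra fun h => hP (Or.inl h), by_contra fun h => hP (Or.inr h)⟩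

end Irreducible

/-! ### The quotient map to the symmetric power -/

section Sym

variable {W : WeierstrassCurve ℂ} {n : ℕ}

lemma toSym_comp_perm (σ : Equiv.Perm (Fin n)) (x : Fin n → W.toAffine.Point) :
    toSym W n (x ∘ σ) = toSym W n x := by
  refine Subtype.ext ?_
  change Multiset.map (x ∘ σ) Finset.univ.val = Multiset.map x Finset.univ.val
  rw [← Multiset.map_map, Multiset.map_univ_val_equiv]

lemma toSym_eq_iff {x y : Fin n → W.toAffine.Point} :
    toSym W n x = toSym W n y ↔ ∃ σ : Equiv.Perm (Fin n), y ∘ σ = x := by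
  classical
  constructor
  · intro h
    have h' : Multiset.map x Finset.univ.val = Multiset.map y Finset.univ.val :=
      congrArg Subtype.val h
    -- Equal multisets have fibres of equal size over each value; matching the fibres gives the
    -- permutation.
    have e : ∀ a, Nonempty ({i // x i = a} ≃ {i // y i = a}) := fun a => by
      refine ⟨Fintype.equivOfCardEq ?_⟩
      have := congrArg (Multiset.count a) h'
      rw [Multiset.count_map, Multiset.count_map] at this
      rw [Fintype.card_subtype, Fintype.card_subtype]
      simp only [eq_comm (a := a)] at this
      exact this
    exact ⟨Equiv.ofFiberEquiv fun a => (e a).some, funext fun i => Equiv.ofFiberEquiv_map _ i⟩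
  · rintro ⟨σ, rfl⟩
    exact toSym_comp_perm σ y

lemma toSym_surjective : Function.Surjective (toSym W n) := by
  rintro ⟨s, hs⟩
  obtain ⟨l, rfl⟩ := Quot.exists_rep s
  have hl : l.length = n := hs
  subst hl
  refine ⟨l.get, Subtype.ext ?_⟩
  change Multiset.map l.get Finset.univ.val = (l : Multiset _)
  rw [Fin.univ_val_map, List.ofFn_get]

lemma symSum_toSym (x : Fin n → W.toAffine.Point) : symSum W n (toSym W n x) = ∑ i, x i := rfl

lemma isMorphismAt_coord (i : Fin n) (x : Fin n → W.toAffine.Point) :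
    IsMorphismAt ((ellipticCurve W).power n) (ellipticCurve W)
      (fun x : Fin n → W.toAffine.Point => x i) x :=
  isMorphismAt_power_proj (X := ellipticCurve W) n i x

lemma isMorphismAt_comp_perm (σ : Equiv.Perm (Fin n)) (x : Fin n → W.toAffine.Point) :
    IsMorphismAt ((ellipticCurve W).power n) ((ellipticCurve W).power n)
      (fun x : Fin n → W.toAffine.Point => x ∘ σ) x :=
  isMorphismAt_into_power (Y := ellipticCurve W) fun i => isMorphismAt_coord (σ i) x

lemma continuous_toSym : Continuous (X := (ellipticCurve W).power n) (Y := symPower W n) (toSym W n) :=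
  continuous_coinduced_rng

lemma isMorphismAt_toSym (x : Fin n → W.toAffine.Point) :
    IsMorphismAt ((ellipticCurve W).power n) (symPower W n) (toSym W n) x :=
  ⟨continuous_toSym.continuousAt, fun _ ⟨_, _, hs, hf⟩ => hf _ hs⟩

lemma isOpen_symPower_iff {s : Set (Sym W.toAffine.Point n)} :
    @IsOpen (symPower W n) _ s ↔ @IsOpen ((ellipticCurve W).power n) _ (toSym W n ⁻¹' s) :=
  isOpen_coinduced

lemma isClosed_symPower_iff {s : Set (Sym W.toAffine.Point n)} :
    @IsClosed (symPower W n) _ s ↔ @IsClosed ((ellipticCurve W).power n) _ (toSym W n ⁻¹' s) :=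
  isClosed_coinduced

/-- The quotient map is open: the saturation of U is the union of its images under the permutations.
-/
lemma isOpen_image_toSym {U : Set (Fin n → W.toAffine.Point)}
    (hU : @IsOpen ((ellipticCurve W).power n) _ U) : @IsOpen (symPower W n) _ (toSym W n '' U) := by
  refine isOpen_symPower_iff.2 ?_
  have : toSym W n ⁻¹' (toSym W n '' U) =
      ⋃ σ : Equiv.Perm (Fin n), (fun x : Fin n → W.toAffine.Point => x ∘ σ) ⁻¹' U := by
    ext x
    simp only [Set.mem_preimage, Set.mem_image, Set.mem_iUnion]
    constructor
    · rintro ⟨y, hy, h⟩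
      obtain ⟨σ, rfl⟩ := toSym_eq_iff.1 h
      exact ⟨σ, hy⟩
    · rintro ⟨σ, h⟩
      exact ⟨_, h, toSym_comp_perm σ x⟩
  refine (congrArg (@IsOpen ((ellipticCurve W).power n) _) this).mpr ?_
  exact isOpen_iUnion fun σ => hU.preimage (continuous_of_isMorphismAt
    (X := (ellipticCurve W).power n) (Y := (ellipticCurve W).power n) (isMorphismAt_comp_perm σ))

lemma exists_perm_of_ne {i j k l : Fin n} (hij : i ≠ j) (hkl : k ≠ l) :
    ∃ σ : Equiv.Perm (Fin n), σ k = i ∧ σ l = j := by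
  refine ⟨(Equiv.swap l ((Equiv.swap k i).symm j)).trans (Equiv.swap k i), ?_, ?_⟩
  · rw [Equiv.trans_apply, Equiv.swap_apply_of_ne_of_ne hkl, Equiv.swap_apply_left]
    intro h
    have := (Equiv.symm_apply_eq _).1 h.symm
    rw [Equiv.swap_apply_left] at this
    exact hij this.symm
  · rw [Equiv.trans_apply, Equiv.swap_apply_left, Equiv.apply_symm_apply]

/-- The points of `Eⁿ` with sum zero. -/
noncomputable def prependNegSum {k : ℕ} (y : Fin k → W.toAffine.Point) : Fin (k + 1) → W.toAffine.Point :=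
  Fin.cons (-∑ i, y i) y

lemma sum_prependNegSum {k : ℕ} (y : Fin k → W.toAffine.Point) : ∑ i, prependNegSum y i = 0 := by
  simp [prependNegSum, Fin.sum_univ_succ]

lemma prependNegSum_succ_comp {k : ℕ} {x : Fin (k + 1) → W.toAffine.Point} (hx : ∑ i, x i = 0) :
    prependNegSum (fun i => x i.succ) = x := by
  ext i
  refine Fin.cases ?_ (fun i => ?_) i
  · rw [Fin.sum_univ_succ] at hx
    exact (eq_neg_of_add_eq_zero_left hx).symm
  · rfl

/-- The point of `Σ⁻¹(0)` with given coordinates except one. -/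
noncomputable def zeroFibreMk {k : ℕ} (y : Fin k → W.toAffine.Point) : zeroFibre W (k + 1) :=
  (⟨toSym W (k + 1) (prependNegSum y), sum_prependNegSum y⟩ :
    {s : Sym W.toAffine.Point (k + 1) // symSum W (k + 1) s = 0})

lemma zeroFibreMk_surjective {k : ℕ} : Function.Surjective (zeroFibreMk (W := W) (k := k)) := by
  rintro ⟨s, hs⟩
  obtain ⟨x, rfl⟩ := toSym_surjective s
  exact ⟨fun i => x i.succ, Subtype.ext (congrArg (toSym W (k + 1)) (prependNegSum_succ_comp hs))⟩

lemma mem_diagonalDivisor_iff {s : zeroFibre W n} {x : Fin n → W.toAffine.Point}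
    (hx : toSym W n x = s.1) : s ∈ diagonalDivisor W n ↔ ∃ i j, i ≠ j ∧ x i = x j := by
  constructor
  · rintro ⟨y, hy, i, j, hij, h⟩
    obtain ⟨σ, rfl⟩ := toSym_eq_iff.1 (hy.trans hx.symm)
    exact ⟨σ i, σ j, σ.injective.ne hij, h⟩
  · rintro ⟨i, j, hij, h⟩
    exact ⟨x, hx, i, j, hij, h⟩

lemma isOpen_ne_zero {X : SpaceWithFunctions} {φ : X → W.toAffine.Point}
    (h : ∀ x, IsMorphismAt X (ellipticCurve W) φ x) : IsOpen {x | φ x ≠ 0} :=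
  (isClosed_singleton_point (0 : W.toAffine.Point)).isOpen_compl.preimage
    (continuous_of_isMorphismAt h)

variable [W.IsElliptic]

lemma isMorphismAt_prependNegSum {k : ℕ} (y : Fin k → W.toAffine.Point) :
    IsMorphismAt ((ellipticCurve W).power k) ((ellipticCurve W).power (k + 1)) prependNegSum y := by
  refine isMorphismAt_into_power (Y := ellipticCurve W) fun i => ?_
  refine Fin.cases ?_ (fun i => ?_) i
  · exact (IsMorphismAt.sum (W := W) (X := (ellipticCurve W).power k) (s := Finset.univ)
      (φ := fun i (y : Fin k → W.toAffine.Point) => y i)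
      fun i _ => isMorphismAt_coord i y).neg
  · exact isMorphismAt_coord i y

lemma isMorphismAt_zeroFibreMk {k : ℕ} (y : Fin k → W.toAffine.Point) :
    IsMorphismAt ((ellipticCurve W).power k) (zeroFibre W (k + 1)) zeroFibreMk y :=
  isMorphismAt_into_sub ((isMorphismAt_toSym _).comp (isMorphismAt_prependNegSum y))

instance irreducibleSpace_zeroFibre (k : ℕ) : IrreducibleSpace (zeroFibre W (k + 1)) := by
  have h : IsPreirreducible (Set.univ : Set (zeroFibre W (k + 1))) := by
    have := PreirreducibleSpace.isPreirreducible_univ (X := (ellipticCurve W).power k)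
    have := this.image zeroFibreMk (continuous_of_isMorphismAt isMorphismAt_zeroFibreMk).continuousOn
    have e : zeroFibreMk '' (Set.univ : Set (Fin k → W.toAffine.Point)) = Set.univ := by
      rw [Set.image_univ, zeroFibreMk_surjective.range_eq]
    exact e ▸ this
  exact { isPreirreducible_univ := h, toNonempty := ⟨zeroFibreMk fun _ => 0⟩ }

/-- The preimage in Eⁿ is the finite union of the sets where x i = x j, each of which is the
preimage of the origin under a difference of coordinates. -/
lemma isClosed_diagonalDivisor : IsClosed (diagonalDivisor W n) := by
  have hc : ∀ i j : Fin n, @IsClosed ((ellipticCurve W).power n) _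
      {x : Fin n → W.toAffine.Point | x i = x j} := fun i j => by
    have h := (isClosed_singleton_point (0 : W.toAffine.Point)).preimage
      (continuous_of_isMorphismAt (X := (ellipticCurve W).power n) (Y := ellipticCurve W)
      fun x => (isMorphismAt_coord i x).sub
        (isMorphismAt_coord j x))
    convert! h using 1
    ext x
    exact (sub_eq_zero (G := W.toAffine.Point)).symm
  refine isClosed_sub_iff.2 ⟨{s : Sym W.toAffine.Point n | ∃ y : Fin n → W.toAffine.Point,
    toSym W n y = s ∧ ∃ i j, i ≠ j ∧ y i = y j}, ?_, rfl⟩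
  refine isClosed_symPower_iff.2 ?_
  have : (toSym W n ⁻¹' {s : Sym W.toAffine.Point n | ∃ y : Fin n → W.toAffine.Point,
      toSym W n y = s ∧ ∃ i j, i ≠ j ∧ y i = y j}) =
      ⋃ (i : Fin n) (j : Fin n) (_ : i ≠ j), {x : Fin n → W.toAffine.Point | x i = x j} := by
    ext x
    simp only [Set.mem_iUnion]
    constructor
    · rintro ⟨y, hy, i, j, hij, h⟩
      obtain ⟨σ, rfl⟩ := toSym_eq_iff.1 hy
      exact ⟨σ i, σ j, σ.injective.ne hij, h⟩
    · rintro ⟨i, j, hij, h⟩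
      exact ⟨x, rfl, i, j, hij, h⟩
  refine (congrArg (@IsClosed ((ellipticCurve W).power n) _) this).mpr ?_
  exact isClosed_iUnion_of_finite fun i => isClosed_iUnion_of_finite fun j =>
    isClosed_iUnion_of_finite fun _ => hc i j

lemma one_ne_two_fin (k : ℕ) : (1 : Fin (k + 3)) ≠ 2 := fun h =>
  zero_ne_one (α := Fin (k + 2)) (Fin.succ_injective _ h)

/-- A parametrization of the diagonal divisor. -/
noncomputable def diagonalMk {k : ℕ} (w : Fin (k + 1) → W.toAffine.Point) : zeroFibre W (k + 3) :=
  zeroFibreMk (Fin.cons (w 0) w)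

/-- The two equal entries can be moved to places 1 and 2; place 0 is reserved for the entry
determined by the sum. -/
lemma range_diagonalMk (k : ℕ) :
    Set.range (diagonalMk (W := W) (k := k)) = diagonalDivisor W (k + 3) := by
  ext s
  constructor
  · rintro ⟨w, rfl⟩
    exact (mem_diagonalDivisor_iff rfl).2 ⟨1, 2, one_ne_two_fin k, rfl⟩
  · rintro ⟨y, hy, i, j, hij, h⟩
    obtain ⟨σ, hi, hj⟩ := exists_perm_of_ne hij (one_ne_two_fin k)
    have hs : ∑ i, (y ∘ σ) i = 0 := by
      rw [← symSum_toSym, toSym_comp_perm, hy]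
      exact s.2
    refine ⟨fun i => (y ∘ σ) i.succ.succ, Subtype.ext ?_⟩
    rw [← hy, ← toSym_comp_perm σ y]
    refine congrArg (toSym W (k + 3)) (Eq.trans ?_ (prependNegSum_succ_comp hs))
    congr 1
    ext i
    refine Fin.cases ?_ (fun i => ?_) i
    · change y (σ 2) = y (σ 1)
      rw [hi, hj, h]
    · rfl

lemma isMorphismAt_diagonalMk {k : ℕ} (w : Fin (k + 1) → W.toAffine.Point) :
    IsMorphismAt ((ellipticCurve W).power (k + 1)) (zeroFibre W (k + 3)) diagonalMk w := by
  refine (isMorphismAt_zeroFibreMk _).comp (isMorphismAt_into_power (Y := ellipticCurve W)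
    fun i => ?_)
  refine Fin.cases ?_ (fun i => ?_) i
  · exact isMorphismAt_coord 0 w
  · exact isMorphismAt_coord i w

lemma isIrreducible_diagonalDivisor (k : ℕ) : IsIrreducible (diagonalDivisor W (k + 3)) := by
  refine ⟨⟨diagonalMk fun _ => 0, range_diagonalMk (W := W) k ▸ Set.mem_range_self _⟩, ?_⟩
  have := PreirreducibleSpace.isPreirreducible_univ (X := (ellipticCurve W).power (k + 1))
  have := this.image diagonalMk (continuous_of_isMorphismAt isMorphismAt_diagonalMk).continuousOn
  have e : diagonalMk '' (Set.univ : Set (Fin (k + 1) → W.toAffine.Point)) =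
      diagonalDivisor W (k + 3) := by
    rw [Set.image_univ, range_diagonalMk]
  exact e ▸ this

/-- Finitely many conditions `φ ≠ 0` which can be satisfied can be satisfied simultaneously. -/
lemma isOpen_and_nonempty_forall_ne_zero {X : SpaceWithFunctions} [PreirreducibleSpace X] [Nonempty X]
    {ι : Type*} (s : Finset ι) (φ : ι → X → W.toAffine.Point)
    (h : ∀ i ∈ s, ∀ x, IsMorphismAt X (ellipticCurve W) (φ i) x) (hne : ∀ i ∈ s, ∃ x, φ i x ≠ 0) :
    IsOpen {x | ∀ i ∈ s, φ i x ≠ 0} ∧ {x | ∀ i ∈ s, φ i x ≠ 0}.Nonempty := by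
  classical
  induction s using Finset.induction_on with
  | empty => simp
  | insert a s ha ih =>
    obtain ⟨h1, h2⟩ := ih (fun i hi => h i (Finset.mem_insert_of_mem hi))
      fun i hi => hne i (Finset.mem_insert_of_mem hi)
    simp only [Finset.forall_mem_insert]
    have ho := isOpen_ne_zero (h a (Finset.mem_insert_self a s))
    exact ⟨ho.inter h1, nonempty_preirreducible_inter ho h1 (hne a (Finset.mem_insert_self a s)) h2⟩

instance nonempty_power (k : ℕ) : Nonempty ((ellipticCurve W).power k) :=
  ⟨fun _ => (0 : W.toAffine.Point)⟩

/-- A tuple with one nonzero free entry separates any two given places. To separate place 0 from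
another one, the entry goes to a third place, for which k + 2 ≥ 2 leaves room. -/
lemma exists_prependNegSum_sub_ne_zero {k : ℕ} {i j : Fin (k + 3)} (hij : i ≠ j) :
    ∃ y : Fin (k + 2) → W.toAffine.Point, prependNegSum y i - prependNegSum y j ≠ 0 := by
  obtain ⟨P, hP⟩ := exists_notMem_of_finite (W := W) (Set.finite_singleton 0)
  have hs : ∀ (l j : Fin (k + 2)), prependNegSum (Pi.single l P : Fin (k + 2) → W.toAffine.Point)
      j.succ = if j = l then P else 0 := fun l j => Pi.single_apply l P j
  have hz : ∀ l : Fin (k + 2), prependNegSum (Pi.single l P : Fin (k + 2) → W.toAffine.Point) 0 = -P :=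
    fun l => congrArg Neg.neg (Finset.sum_pi_single' l P Finset.univ |>.trans (by simp))
  have h0 : ∀ j : Fin (k + 2), ∃ y : Fin (k + 2) → W.toAffine.Point,
      prependNegSum y 0 - prependNegSum y j.succ ≠ 0 := fun j => by
    obtain ⟨l, hl⟩ := exists_ne j
    refine ⟨Pi.single l P, ?_⟩
    rw [hz, hs, if_neg hl.symm, sub_zero]
    exact neg_ne_zero.2 hP
  induction i using Fin.cases with
  | zero =>
    obtain ⟨j, rfl⟩ := Fin.exists_succ_eq.2 hij.symm
    exact h0 j
  | succ i =>
    induction j using Fin.cases with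
    | zero =>
      obtain ⟨y, hy⟩ := h0 i
      exact ⟨y, fun h => hy (by rw [← neg_sub, h, neg_zero])⟩
    | succ j =>
      have hij' : j ≠ i := fun h => hij (congrArg _ h.symm)
      refine ⟨Pi.single i P, ?_⟩
      rw [hs, hs, if_pos rfl, if_neg hij', sub_zero]
      exact hP

/-- The conditions that two given entries differ are open and satisfiable on an irreducible space,
so some tuple of sum zero has distinct entries. -/
lemma diagonalDivisor_ne_univ (k : ℕ) : diagonalDivisor W (k + 3) ≠ Set.univ := by
  intro huniv
  obtain ⟨y, hy⟩ := (isOpen_and_nonempty_forall_ne_zero (W := W)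
    (X := (ellipticCurve W).power (k + 2)) (Finset.univ.filter fun a : Fin (k + 3) × Fin (k + 3) =>
      a.1 ≠ a.2) (fun a y => prependNegSum y a.1 - prependNegSum y a.2)
    (fun a _ y => ((isMorphismAt_coord a.1 _).comp (isMorphismAt_prependNegSum y)).sub
      ((isMorphismAt_coord a.2 _).comp (isMorphismAt_prependNegSum y)))
    fun a ha => exists_prependNegSum_sub_ne_zero (Finset.mem_filter.1 ha).2).2
  obtain ⟨i, j, hij, h⟩ := (mem_diagonalDivisor_iff (s := zeroFibreMk y) rfl).1
    (huniv ▸ Set.mem_univ _)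
  exact hy (i, j) (Finset.mem_filter.2 ⟨Finset.mem_univ _, hij⟩) (sub_eq_zero.2 h)

end Sym

/-! ### The diagonal has codimension one -/

section Codimension

variable {W : WeierstrassCurve ℂ}

lemma comp_mem_of_mem_adjoin {S T : Type*} {G : Set (T → ℂ)} {φ : S → T}
    {B : Subalgebra ℂ (S → ℂ)} (h : ∀ a ∈ G, a ∘ φ ∈ B) : ∀ a ∈ Algebra.adjoin ℂ G, a ∘ φ ∈ B := by
  intro a ha
  induction ha using Algebra.adjoin_induction with
  | mem x hx => exact h x hx
  | algebraMap r => exact B.algebraMap_mem r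
  | add x y _ _ hx hy => exact B.add_mem hx hy
  | mul x y _ _ hx hy => exact B.mul_mem hx hy

variable (W) in
/-- The algebra of polynomials in the coordinates of `k` affine points. -/
noncomputable def affinePowerAlg (k : ℕ) : Subalgebra ℂ ((Fin k → W.toAffine.Point) → ℂ) :=
  Algebra.adjoin ℂ {g | ∃ i : Fin k, ∃ a ∈ ({xCoord W, yCoord W} : Set (W.toAffine.Point → ℂ)),
    g = fun x => a (x i)}

lemma isChart_affinePower (k : ℕ) : IsChart ((ellipticCurve W).power k)
    {x : Fin k → W.toAffine.Point | ∀ i, x i ≠ 0} (affinePowerAlg W k) :=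
  isChart_power (isChart_affine W)

lemma xCoord_mem_affinePowerAlg {k : ℕ} (i : Fin k) :
    (fun x => xCoord W (x i)) ∈ affinePowerAlg W k :=
  Algebra.subset_adjoin ⟨i, _, Or.inl rfl, rfl⟩

lemma yCoord_mem_affinePowerAlg {k : ℕ} (i : Fin k) :
    (fun x => yCoord W (x i)) ∈ affinePowerAlg W k :=
  Algebra.subset_adjoin ⟨i, _, Or.inr rfl, rfl⟩

/-- Dividing by `x - x(c)` after multiplication with `y - y(-c)`. -/
lemma exists_mul_sub_eq {k : ℕ} {c : W.toAffine.Point} (hc : c ≠ 0)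
    {h : (Fin (k + 1) → W.toAffine.Point) → ℂ} (hh : h ∈ affinePowerAlg W (k + 1)) :
    (fun x => h (Function.update x 0 c)) ∈ affinePowerAlg W (k + 1) ∧
    ∃ g ∈ affinePowerAlg W (k + 1), ∀ x : Fin (k + 1) → W.toAffine.Point, x 0 ≠ 0 →
      (yCoord W (x 0) - yCoord W (-c)) * (h x - h (Function.update x 0 c)) =
        (xCoord W (x 0) - xCoord W c) * g x := by
  set A := affinePowerAlg W (k + 1)
  have hconst : ∀ z : ℂ, (fun _ => z) ∈ A := fun z => A.algebraMap_mem z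
  have hX : (fun x : Fin (k + 1) → W.toAffine.Point => xCoord W (x 0)) ∈ A :=
    xCoord_mem_affinePowerAlg 0
  have hY : (fun x : Fin (k + 1) → W.toAffine.Point => yCoord W (x 0)) ∈ A :=
    yCoord_mem_affinePowerAlg 0
  have hu : (fun x : Fin (k + 1) → W.toAffine.Point => yCoord W (x 0) - yCoord W (-c)) ∈ A :=
    A.sub_mem hY (hconst _)
  induction hh using Algebra.adjoin_induction with
  | mem a ha =>
    obtain ⟨i, a, ha, rfl⟩ := ha
    induction i using Fin.cases with
    | succ i =>
      simp only [Function.update_of_ne (Fin.succ_ne_zero i)]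
      exact ⟨Algebra.subset_adjoin ⟨_, a, ha, rfl⟩, 0, A.zero_mem, fun x _ => by simp⟩
    | zero =>
      simp only [Function.update_self]
      refine ⟨hconst _, ?_⟩
      rcases ha with rfl | rfl
      · refine ⟨_, hu, fun x _ => by ring⟩
      -- Subtracting the Weierstrass equations of the variable point and of c shows that (y − y(c))
      -- (y − y(−c)) is x − x(c) times this polynomial.
      · refine ⟨_, A.sub_mem (A.add_mem (A.add_mem (A.add_mem (A.mul_mem hX hX)
          (A.mul_mem hX (hconst (xCoord W c)))) (hconst (xCoord W c ^ 2 + W.a₄)))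
          (A.mul_mem (hconst W.a₂) (A.add_mem hX (hconst (xCoord W c)))))
          (A.mul_mem (hconst W.a₁) hY), fun x hx => ?_⟩
        rw [yCoord_neg hc]
        have e1 := equation_coords hx
        have e2 := equation_coords hc
        simp only [Pi.sub_apply, Pi.add_apply, Pi.mul_apply]
        linear_combination e1 - e2
  | algebraMap r => exact ⟨hconst r, 0, A.zero_mem, fun x _ => by simp [Pi.algebraMap_apply]⟩
  | add a b _ _ ha hb =>
    obtain ⟨ha, g, hg, hag⟩ := ha
    obtain ⟨hb, g', hg', hbg⟩ := hb
    refine ⟨A.add_mem ha hb, _, A.add_mem hg hg', fun x hx => ?_⟩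
    simp only [Pi.add_apply]
    linear_combination hag x hx + hbg x hx
  | mul a b haA hbA ha hb =>
    obtain ⟨ha, g, hg, hag⟩ := ha
    obtain ⟨hb, g', hg', hbg⟩ := hb
    -- The product rule for difference quotients.
    refine ⟨A.mul_mem ha hb, _, A.add_mem (A.mul_mem hbA hg) (A.mul_mem ha hg'), fun x hx => ?_⟩
    simp only [Pi.add_apply, Pi.mul_apply]
    linear_combination b x * hag x hx + a (Function.update x 0 c) * hbg x hx

variable [W.IsElliptic]

lemma eq_zero_of_evalHom {ρ : W.toAffine.CoordinateRing}
    (h : ∀ P (hP : P ≠ 0), evalHom (W := W) hP ρ = 0) : ρ = 0 := by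
  by_contra h0
  have := infinite_point W
  refine Set.infinite_univ (α := W.toAffine.Point)
    (((finite_zeros h0).union (Set.finite_singleton 0)).subset fun P _ => ?_)
  by_cases hP : P = 0
  · exact Or.inr hP
  · exact Or.inl ⟨hP, h P hP⟩

/-- A function on the affine curve cannot be divisible by arbitrary powers of a local parameter. -/
lemma eq_zero_of_forall_pow {c : W.toAffine.Point} (hc : c ≠ 0) (hc2 : c ≠ -c)
    {φ : W.toAffine.Point → ℂ} (hφ : φ ∈ affineAlg W)
    (h : ∀ N : ℕ, ∃ ψ ∈ affineAlg W, ∀ P : W.toAffine.Point, P ≠ 0 →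
      (yCoord W P - yCoord W (-c)) ^ N * φ P = (xCoord W P - xCoord W c) ^ N * ψ P) :
    ∀ P, P ≠ 0 → φ P = 0 := by
  obtain ⟨ρ, hρ⟩ := exists_ring_of_mem_affineAlg hφ
  obtain ⟨u, hu⟩ := exists_ring_of_mem_affineAlg (W := W)
    (sub_mem (yCoord_mem W) ((affineAlg W).algebraMap_mem (yCoord W (-c))))
  obtain ⟨t, ht⟩ := exists_ring_of_mem_affineAlg (W := W)
    (sub_mem (xCoord_mem W) ((affineAlg W).algebraMap_mem (xCoord W c)))
  let I := RingHom.ker (evalHom hc)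
  have hI : I.IsMaximal := RingHom.ker_isMaximal_of_surjective _ fun z => ⟨_, evalHom_algebraMap hc z⟩
  have htI : t ∈ I := by
    rw [RingHom.mem_ker, ← ht c hc]
    exact sub_self _
  have huI : u ∉ I := by
    rw [RingHom.mem_ker, ← hu c hc]
    exact sub_ne_zero.2 (yCoord_ne_of_ne_neg hc hc2).symm
  -- Since y − y(−c) is a unit modulo each power of the maximal ideal of c, ρ lies in all these
  -- powers, and Krull's intersection theorem gives ρ = 0.
  have hsup : Ideal.span {u} ⊔ I = ⊤ := hI.out.2 _ (lt_of_le_not_ge le_sup_right fun h =>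
    huI (h (Ideal.mem_sup_left (Ideal.mem_span_singleton_self u))))
  have hmem : ρ ∈ ⨅ N : ℕ, I ^ N := by
    refine Ideal.mem_iInf.2 fun N => ?_
    obtain ⟨ψ, hψ, hN⟩ := h N
    obtain ⟨σ, hσ⟩ := exists_ring_of_mem_affineAlg hψ
    have he : u ^ N * ρ = t ^ N * σ := by
      rw [← sub_eq_zero]
      refine eq_zero_of_evalHom fun P hP => ?_
      rw [map_sub, map_mul, map_mul, map_pow, map_pow, ← hu P hP, ← ht P hP, ← hρ P hP, ← hσ P hP]
      exact sub_eq_zero.2 (hN P hP)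
    have h1 := Ideal.pow_sup_pow_eq_top (m := N) (n := N) hsup
    rw [Ideal.span_singleton_pow] at h1
    obtain ⟨a, ha, b, hb, hab⟩ := Submodule.mem_sup.1 (h1 ▸ Submodule.mem_top : (1 : W.toAffine.CoordinateRing) ∈ _)
    obtain ⟨d, rfl⟩ := Ideal.mem_span_singleton'.1 ha
    have : ρ = d * (t ^ N * σ) + b * ρ := by
      rw [← he, ← mul_assoc, ← add_mul, hab, one_mul]
    rw [this]
    exact Ideal.add_mem _ (Ideal.mul_mem_left _ _ (Ideal.mul_mem_right _ _ (Ideal.pow_mem_pow htI N)))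
      (Ideal.mul_mem_right _ _ hb)
  have : IsNoetherianRing W.toAffine.CoordinateRing :=
    inferInstanceAs (IsNoetherianRing (AdjoinRoot _))
  rw [Ideal.iInf_pow_eq_bot_of_isDomain _ hI.ne_top, Ideal.mem_bot] at hmem
  subst hmem
  intro P hP
  rw [hρ P hP, map_zero]

/-- A proper closed subset of a power of `E` is, near some point of the divisor where the first
coordinate is `c`, contained in this divisor. -/
lemma exists_nhds_inter_subset {k : ℕ} {c : W.toAffine.Point} (hc : c ≠ 0) (hc2 : c ≠ -c)
    {C : Set (Fin (k + 1) → W.toAffine.Point)} (hC : @IsClosed ((ellipticCurve W).power (k + 1)) _ C)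
    (hne : C ≠ Set.univ) :
    ∃ N : Set (Fin (k + 1) → W.toAffine.Point), @IsOpen ((ellipticCurve W).power (k + 1)) _ N ∧
      (∃ p ∈ N, p 0 = c) ∧ ∀ q ∈ C ∩ N, q 0 = c := by
  have hch := isChart_affinePower (W := W) (k + 1)
  set A := affinePowerAlg W (k + 1)
  obtain ⟨p, hpO, hpC⟩ := nonempty_preirreducible_inter hch.isOpen hC.isOpen_compl
    ⟨fun _ => c, fun _ => hc⟩ (Set.nonempty_compl.2 hne)
  change Fin (k + 1) → W.toAffine.Point at p
  obtain ⟨h, hh, h0, hsub⟩ := hch.exists_basic p hpO _ (hC.isOpen_compl.mem_nhds hpC)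
  have hv : ∀ q ∈ C, (∀ i, q i ≠ 0) → h q = 0 := fun q hq hqO => by
    by_contra h'
    exact hsub q hqO h' hq
  -- Suppose that every function vanishing on C off the locus x(q 0) = x(c) also vanished on the
  -- divisor q 0 = c. Then h could be divided by x − x(c) indefinitely, up to powers of y − y(−c),
  -- contradicting `eq_zero_of_forall_pow`. In the other case, a function violating this defines N.
  by_cases hall : ∀ h ∈ A, (∀ q ∈ C, (∀ i, q i ≠ 0) → xCoord W (q 0) ≠ xCoord W c → h q = 0) →
      ∀ q : Fin (k + 1) → W.toAffine.Point, (∀ i, q i ≠ 0) → q 0 = c → h q = 0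
  · exfalso
    have hN : ∀ N : ℕ, ∃ g ∈ A, (∀ q ∈ C, (∀ i, q i ≠ 0) → xCoord W (q 0) ≠ xCoord W c → g q = 0) ∧
        ∀ q : Fin (k + 1) → W.toAffine.Point, (∀ i, q i ≠ 0) →
          (yCoord W (q 0) - yCoord W (-c)) ^ N * h q = (xCoord W (q 0) - xCoord W c) ^ N * g q := by
      intro N
      induction N with
      | zero => exact ⟨h, hh, fun q hq hqO _ => hv q hq hqO, fun q _ => by simp⟩
      | succ N ih =>
        obtain ⟨g, hg, hgv, he⟩ := ih
        obtain ⟨-, g', hg', hgg⟩ := exists_mul_sub_eq hc hg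
        have hr : ∀ q : Fin (k + 1) → W.toAffine.Point, (∀ i, q i ≠ 0) →
            g (Function.update q 0 c) = 0 := fun q hq => by
          refine hall g hg hgv _ (fun i => ?_) (Function.update_self _ _ _)
          by_cases hi : i = 0
          · subst hi
            simpa using hc
          · simpa [hi] using hq i
        refine ⟨g', hg', fun q hq hqO hqx => ?_, fun q hq => ?_⟩
        · have := hgg q (hqO 0)
          rw [hgv q hq hqO hqx, hr q hqO, sub_zero, mul_zero, eq_comm, mul_eq_zero] at this
          exact this.resolve_left (sub_ne_zero.2 hqx)
        · have := hgg q (hq 0)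
          rw [hr q hq, sub_zero] at this
          linear_combination (yCoord W (q 0) - yCoord W (-c)) * he q hq +
            (xCoord W (q 0) - xCoord W c) ^ N * this
    -- Fixing all coordinates of p but the first leads to the statement in one variable.
    have hslice : ∀ g ∈ A, g ∘ (fun P => Function.update p 0 P) ∈ affineAlg W := by
      refine comp_mem_of_mem_adjoin ?_
      rintro _ ⟨i, a, ha, rfl⟩
      induction i using Fin.cases with
      | zero =>
        have e : (fun x : Fin (k + 1) → W.toAffine.Point => a (x 0)) ∘
            (fun P => Function.update p 0 P) = a := by
          ext P
          simp
        rw [e]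
        exact Algebra.subset_adjoin ha
      | succ i =>
        have e : (fun x : Fin (k + 1) → W.toAffine.Point => a (x i.succ)) ∘
            (fun P => Function.update p 0 P) = fun _ => a (p i.succ) := by
          ext P
          simp
        rw [e]
        exact (affineAlg W).algebraMap_mem _
    have hup : ∀ P : W.toAffine.Point, P ≠ 0 → ∀ i, Function.update p 0 P i ≠ 0 := fun P hP i => by
      by_cases hi : i = 0
      · subst hi
        simpa using hP
      · simpa [hi] using hpO i
    have := eq_zero_of_forall_pow hc hc2 (hslice h hh) (fun N => by
      obtain ⟨g, hg, -, he⟩ := hN N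
      refine ⟨_, hslice g hg, fun P hP => ?_⟩
      have := he _ (hup P hP)
      rwa [Function.update_self] at this) (p 0) (hpO 0)
    exact h0 ((congrArg h (Function.update_eq_self (0 : Fin (k + 1)) p)).symm.trans this)
  · push Not at hall
    obtain ⟨g, hg, hgv, q, hqO, hqc, hq⟩ := hall
    -- Where q 0 ≠ −c, equality of x(q 0) and x(c) forces q 0 = c.
    have hopen : @IsOpen ((ellipticCurve W).power (k + 1)) _
        {q : Fin (k + 1) → W.toAffine.Point | (∀ i, q i ≠ 0) ∧ g q ≠ 0 ∧ q 0 - -c ≠ 0} := by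
      refine isOpen_iff_eventually.2 ?_
      rintro x ⟨h1, h2, h3⟩
      have e1 := hch.isOpen.eventually_mem h1
      have e2 := eventually_ne_zero (hch.reg g hg x h1) h2
      have e3 := (isOpen_ne_zero (W := W) (X := (ellipticCurve W).power (k + 1)) fun x =>
        (isMorphismAt_coord 0 x).sub
          (IsMorphismAt.const (X := (ellipticCurve W).power (k + 1)) (Y := ellipticCurve W)
            (-c : W.toAffine.Point) x)).eventually_mem h3
      exact e1.and (e2.and e3)
    refine ⟨_, hopen, ⟨q, ⟨hqO, hq, ?_⟩, hqc⟩, ?_⟩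
    · rw [hqc]
      exact sub_ne_zero.2 hc2
    · rintro x ⟨hxC, hxO, hxg, hxc⟩
      by_contra hx0
      refine hxg (hgv x hxC hxO fun hx => ?_)
      exact (eq_or_eq_neg_of_xCoord_eq (hxO 0) hc hx).elim hx0 (sub_ne_zero.1 hxc)

/-- The map `b` puts t 1 + t 0 − c and t 1 in places 1 and 2, so t 0 = c describes the coincidence
of these entries, and `π` recovers t from the tuple. Applied to the preimage of Z,
`exists_nhds_inter_subset` places a nonempty open part of Z inside D. -/
lemma eq_of_diagonalDivisor_subset (k : ℕ) {Z : Set (zeroFibre W (k + 3))} (hZ : IsClosed Z)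
    (hi : IsPreirreducible Z) (hD : diagonalDivisor W (k + 3) ⊆ Z) (hne : Z ≠ Set.univ) :
    Z = diagonalDivisor W (k + 3) := by
  -- At an affine point that is not 2-torsion, x − x(c) is a local parameter.
  obtain ⟨c, hc⟩ := exists_notMem_of_finite ((finite_two_torsion (W := W)).union (Set.finite_singleton 0))
  have hc0 : c ≠ 0 := fun h => hc (Or.inr h)
  have hc2 : c ≠ -c := fun h => hc (Or.inl h)
  let s : (Fin (k + 2) → W.toAffine.Point) → Fin (k + 2) → W.toAffine.Point := fun t =>
    Function.update t 0 (t 1 + t 0 - c)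
  have hsm : ∀ t, IsMorphismAt ((ellipticCurve W).power (k + 2)) ((ellipticCurve W).power (k + 2)) s t := by
    intro t
    refine isMorphismAt_into_power (Y := ellipticCurve W) fun i => ?_
    by_cases hi : i = 0
    · subst hi
      exact (((isMorphismAt_coord (W := W) 1 t).add (isMorphismAt_coord 0 t)).sub
        (IsMorphismAt.const (X := (ellipticCurve W).power (k + 2)) (Y := ellipticCurve W) c t)).congr
        (Eventually.of_forall fun (t : Fin (k + 2) → W.toAffine.Point) => by simp [s]; rfl)
    · exact (isMorphismAt_coord (W := W) i t).congr
        (Eventually.of_forall fun (t : Fin (k + 2) → W.toAffine.Point) => by simp [s, hi]; rfl)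
  let b : (Fin (k + 2) → W.toAffine.Point) → zeroFibre W (k + 3) := fun t => zeroFibreMk (s t)
  have hbc : Continuous (X := (ellipticCurve W).power (k + 2)) b := continuous_of_isMorphismAt
    (X := (ellipticCurve W).power (k + 2)) fun t => (isMorphismAt_zeroFibreMk _).comp (hsm t)
  let π : (Fin (k + 3) → W.toAffine.Point) → Fin (k + 2) → W.toAffine.Point := fun x i =>
    if i = 0 then x 1 - x 2 + c else x i.succ
  have hπm : ∀ x, IsMorphismAt ((ellipticCurve W).power (k + 3)) ((ellipticCurve W).power (k + 2)) π x := by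
    intro x
    refine isMorphismAt_into_power (Y := ellipticCurve W) fun i => ?_
    by_cases hi : i = 0
    · exact (((isMorphismAt_coord (W := W) 1 x).sub (isMorphismAt_coord 2 x)).add
        (IsMorphismAt.const (X := (ellipticCurve W).power (k + 3)) (Y := ellipticCurve W) c x)).congr
        (Eventually.of_forall fun (t : Fin (k + 3) → W.toAffine.Point) => by simp [π, hi]; rfl)
    · exact (isMorphismAt_coord (W := W) i.succ x).congr 
        (Eventually.of_forall fun (t : Fin (k + 3) → W.toAffine.Point) => by simp [π, hi]; rfl)
  have hsπ : ∀ x : Fin (k + 3) → W.toAffine.Point, s (π x) = fun i => x i.succ := by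
    intro x
    ext i
    by_cases hi : i = 0
    · subst hi
      have : (1 : Fin (k + 2)).succ = 2 := rfl
      simp only [s, π, Function.update_self, if_pos, this, one_ne_zero, if_false]
      abel
    · simp [s, π, hi]
  have hsurj : ∀ x : Fin (k + 3) → W.toAffine.Point, ∑ i, x i = 0 →
      (b (π x)).1 = toSym W (k + 3) x := fun x hx => by
    change toSym W (k + 3) (prependNegSum (s (π x))) = _
    rw [hsπ, prependNegSum_succ_comp hx]
  have hCne : b ⁻¹' Z ≠ Set.univ := by
    intro h
    refine hne (Set.eq_univ_of_forall ?_)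
    rintro ⟨z, hz⟩
    obtain ⟨x, rfl⟩ := toSym_surjective z
    have h1 : b (π x) ∈ Z := (Set.ext_iff.1 h (π x)).2 trivial
    have h2 : b (π x) = ⟨toSym W (k + 3) x, hz⟩ := Subtype.ext (hsurj x hz)
    exact h2 ▸ h1
  obtain ⟨N, hN, ⟨p, hpN, hpc⟩, hsub⟩ := exists_nhds_inter_subset hc0 hc2 (hZ.preimage hbc) hCne
  have hO : @IsOpen (zeroFibre W (k + 3)) _ (Subtype.val ⁻¹' (toSym W (k + 3) '' (π ⁻¹' N))) :=
    isOpen_sub_iff.2 ⟨_, isOpen_image_toSym (hN.preimage (continuous_of_isMorphismAt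
      (X := (ellipticCurve W).power (k + 3)) (Y := (ellipticCurve W).power (k + 2)) hπm)), rfl⟩
  have hπs : π (prependNegSum (s p)) = p := by
    ext i
    by_cases hi : i = 0
    · subst hi
      change s p 0 - s p 1 + c = p 0
      have : s p 1 = p 1 := by simp [s]
      have : s p 0 = p 1 + p 0 - c := by simp [s]
      simp [*]
    · have : s p i = p i := by simp [s, hi]
      simp [π, hi, prependNegSum, this]
  have hpO : b p ∈ Subtype.val ⁻¹' (toSym W (k + 3) '' (π ⁻¹' N)) :=
    ⟨prependNegSum (s p), by rwa [Set.mem_preimage, hπs], rfl⟩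
  have hpD : b p ∈ diagonalDivisor W (k + 3) := by
    refine (mem_diagonalDivisor_iff rfl).2 ⟨1, 2, one_ne_two_fin k, ?_⟩
    change s p 0 = s p 1
    simp [s, hpc]
  -- A nonempty open part of the irreducible set Z is dense in it, and D is closed.
  refine (Set.Subset.antisymm hD ?_).symm
  refine (subset_closure_inter_of_isPreirreducible_of_isOpen hi hO ⟨b p, hD hpD, hpO⟩).trans
    (closure_minimal ?_ isClosed_diagonalDivisor)
  rintro ⟨z, hz⟩ ⟨hzZ, x, hxN, rfl⟩
  have h2 : b (π x) = ⟨toSym W (k + 3) x, hz⟩ := Subtype.ext (hsurj x hz)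
  have h3 := hsub (π x) ⟨show b (π x) ∈ Z from h2 ▸ hzZ, hxN⟩
  refine (mem_diagonalDivisor_iff rfl).2 ⟨1, 2, one_ne_two_fin k, ?_⟩
  have h4 : x 1 - x 2 + c = c := h3
  exact sub_eq_zero.1 (add_eq_right.1 h4)

theorem isIrreducibleDivisor_diagonalDivisor (k : ℕ) :
    (zeroFibre W (k + 3)).IsIrreducibleDivisor (diagonalDivisor W (k + 3)) := by
  refine ⟨isIrreducible_diagonalDivisor k, isClosed_diagonalDivisor, le_antisymm ?_ ?_⟩
  · refine (Order.coheight_le_coe_iff (n := 1)).2 fun Z hZ => ?_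
    have hmax : IsMax Z := by
      have : Z.carrier = Set.univ := by
        by_contra hne
        have := eq_of_diagonalDivisor_subset k Z.isClosed' Z.isIrreducible'.2 hZ.le hne
        exact hZ.not_ge this.le
      intro Y _ x _
      exact (Set.ext_iff.1 this x).2 trivial
    rw [Order.coheight_eq_zero.2 hmax]
    exact zero_lt_one
  · rw [Order.one_le_iff_ne_zero, Order.coheight_ne_zero]
    intro hmax
    refine diagonalDivisor_ne_univ (W := W) k (Set.eq_univ_of_forall fun x => ?_)
    exact hmax (b := ⟨Set.univ, (irreducibleSpace_zeroFibre (W := W) (k + 2)).isIrreducible_univ,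
      isClosed_univ⟩) (fun x _ => Set.mem_univ x) (Set.mem_univ x)

end Codimension

/-! ### Symmetric functions -/

section SymChart

variable {W : WeierstrassCurve ℂ} {n : ℕ}

lemma affinePowerAlg_comp_perm {a : (Fin n → W.toAffine.Point) → ℂ} (ha : a ∈ affinePowerAlg W n)
    (σ : Equiv.Perm (Fin n)) : (fun x => a (x ∘ σ)) ∈ affinePowerAlg W n := by
  refine comp_mem_of_mem_adjoin (φ := fun x : Fin n → W.toAffine.Point => x ∘ σ) ?_ a ha
  rintro _ ⟨i, a, ha, rfl⟩
  exact Algebra.subset_adjoin ⟨σ i, a, ha, rfl⟩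

/-- The sum over all permutations, as a function on the symmetric power. -/
noncomputable def symmetrize (a : (Fin n → W.toAffine.Point) → ℂ) (s : Sym W.toAffine.Point n) : ℂ :=
  ∑ σ : Equiv.Perm (Fin n), a (Function.surjInv toSym_surjective s ∘ σ)

lemma symmetrize_toSym (a : (Fin n → W.toAffine.Point) → ℂ) (x : Fin n → W.toAffine.Point) :
    symmetrize a (toSym W n x) = ∑ σ : Equiv.Perm (Fin n), a (x ∘ σ) := by
  obtain ⟨τ, hτ⟩ := toSym_eq_iff.1 (Function.surjInv_eq (toSym_surjective (W := W)) (toSym W n x))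
  rw [symmetrize, ← hτ]
  exact Fintype.sum_equiv (Equiv.mulLeft τ) _ _ fun σ => rfl

variable (W n) in
/-- The algebra of functions on the symmetric power that are polynomials in the coordinates of
`n` affine points. -/
noncomputable def symAlg : Subalgebra ℂ (Sym W.toAffine.Point n → ℂ) where
  carrier := {b | b ∘ toSym W n ∈ affinePowerAlg W n}
  mul_mem' := (affinePowerAlg W n).mul_mem
  add_mem' := (affinePowerAlg W n).add_mem
  algebraMap_mem' c := (affinePowerAlg W n).algebraMap_mem c

lemma symmetrize_mem {a : (Fin n → W.toAffine.Point) → ℂ} (ha : a ∈ affinePowerAlg W n) :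
    symmetrize a ∈ symAlg W n := by
  have : symmetrize a ∘ toSym W n = ∑ σ : Equiv.Perm (Fin n), fun x => a (x ∘ σ) := by
    ext x
    rw [Function.comp_apply, symmetrize_toSym, Finset.sum_apply]
  change symmetrize a ∘ toSym W n ∈ affinePowerAlg W n
  rw [this]
  exact (affinePowerAlg W n).sum_mem fun σ _ => affinePowerAlg_comp_perm ha σ

/-- For each σ that moves x, some coordinate function minus a constant vanishes at x ∘ σ and not at
x; the product over all σ has the required zeros. -/
lemma exists_separating {x : Fin n → W.toAffine.Point} (hx : ∀ i, x i ≠ 0) :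
    ∃ e ∈ affinePowerAlg W n, e x ≠ 0 ∧
      ∀ σ : Equiv.Perm (Fin n), x ∘ σ ≠ x → e (x ∘ σ) = 0 := by
  have h1 : ∀ σ : Equiv.Perm (Fin n), ∃ a ∈ affinePowerAlg W n, a x ≠ 0 ∧
      (x ∘ σ ≠ x → a (x ∘ σ) = 0) := fun σ => by
    by_cases h : x ∘ σ = x
    · exact ⟨1, (affinePowerAlg W n).one_mem, one_ne_zero, fun h' => absurd h h'⟩
    · obtain ⟨i, hi⟩ := Function.ne_iff.1 h
      by_cases hxx : xCoord W (x i) = xCoord W (x (σ i))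
      · refine ⟨_, (affinePowerAlg W n).sub_mem (yCoord_mem_affinePowerAlg i)
          ((affinePowerAlg W n).algebraMap_mem (yCoord W (x (σ i)))), fun h0 => hi ?_,
          fun _ => sub_self _⟩
        exact (ext_coords (hx i) (hx _) hxx (sub_eq_zero.1 h0)).symm
      · exact ⟨_, (affinePowerAlg W n).sub_mem (xCoord_mem_affinePowerAlg i)
          ((affinePowerAlg W n).algebraMap_mem (xCoord W (x (σ i)))), sub_ne_zero.2 hxx,
          fun _ => sub_self _⟩
  choose a ha ha0 hav using h1
  refine ⟨∏ σ, a σ, (affinePowerAlg W n).prod_mem fun σ _ => ha σ, ?_, fun σ hσ => ?_⟩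
  · rw [Finset.prod_apply]
    exact Finset.prod_ne_zero_iff.2 fun σ _ => ha0 σ
  · rw [Finset.prod_apply]
    exact Finset.prod_eq_zero (Finset.mem_univ σ) (hav σ hσ)

/-- Only the permutations fixing x contribute, all with the value e x * h x, and their number is a
nonzero integer. -/
lemma symmetrize_mul_ne_zero {x : Fin n → W.toAffine.Point} {e h : (Fin n → W.toAffine.Point) → ℂ}
    (he : e x ≠ 0) (hev : ∀ σ : Equiv.Perm (Fin n), x ∘ σ ≠ x → e (x ∘ σ) = 0) (h0 : h x ≠ 0) :
    symmetrize (e * h) (toSym W n x) ≠ 0 := by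
  classical
  rw [symmetrize_toSym]
  have : ∀ σ : Equiv.Perm (Fin n), (e * h) (x ∘ σ) = if x ∘ σ = x then e x * h x else 0 := by
    intro σ
    split_ifs with hσ
    · rw [hσ, Pi.mul_apply]
    · rw [Pi.mul_apply, hev σ hσ, zero_mul]
  rw [Finset.sum_congr rfl fun σ _ => this σ, ← Finset.sum_filter, Finset.sum_const, nsmul_eq_mul]
  refine mul_ne_zero (Nat.cast_ne_zero.2 (Finset.card_ne_zero.2 ⟨1, ?_⟩)) (mul_ne_zero he h0)
  simp

/-- Summation over permutations makes numerators and denominators symmetric. The separating factor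
keeps the sum from vanishing at the given point. -/
lemma isChart_symPower : IsChart (symPower W n)
    {s : Sym W.toAffine.Point n | ∀ x, toSym W n x = s → ∀ i, x i ≠ 0} (symAlg W n) := by
  have hch := isChart_affinePower (W := W) n
  have hO : toSym W n ⁻¹' {s : Sym W.toAffine.Point n | ∀ x, toSym W n x = s → ∀ i, x i ≠ 0} =
      {x : Fin n → W.toAffine.Point | ∀ i, x i ≠ 0} := by
    ext x
    refine ⟨fun h => h x rfl, fun h y hy i => ?_⟩
    obtain ⟨σ, rfl⟩ := toSym_eq_iff.1 hy
    exact h _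
  have hOo := isOpen_symPower_iff.2 ((congrArg (@IsOpen ((ellipticCurve W).power n) _) hO).mpr
    hch.isOpen)
  refine ⟨hOo, fun a ha s hs => ?_, fun s hs V hV => ?_, fun s hs f hf => ?_⟩
  · refine ⟨_, isOpen_symPower_iff.1 hOo, hs, fun x hx => ?_⟩
    exact hch.reg _ ha x (hO.le hx)
  · obtain ⟨x, rfl⟩ := toSym_surjective s
    have hx : ∀ i, x i ≠ 0 := hs x rfl
    obtain ⟨h, hh, h0, hsub⟩ := hch.exists_basic x hx _
      (continuous_toSym.continuousAt.preimage_mem_nhds hV)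
    obtain ⟨e, he, he0, hev⟩ := exists_separating hx
    refine ⟨_, symmetrize_mem (mul_mem he hh), symmetrize_mul_ne_zero he0 hev h0, fun t ht h1 => ?_⟩
    obtain ⟨y, rfl⟩ := toSym_surjective t
    rw [symmetrize_toSym] at h1
    obtain ⟨σ, -, hσ⟩ := Finset.exists_ne_zero_of_sum_ne_zero h1
    have := hsub (y ∘ σ) (fun i => ht y rfl _) (right_ne_zero_of_mul hσ)
    change toSym W n (y ∘ σ) ∈ V at this
    rwa [toSym_comp_perm] at this
  · obtain ⟨x, rfl⟩ := toSym_surjective s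
    have hx : ∀ i, x i ≠ 0 := hs x rfl
    obtain ⟨g, hg, h, hh, h0, hfr⟩ := hch.exists_frac x hx _ ((isMorphismAt_toSym x).2 f hf)
    obtain ⟨e, he, he0, hev⟩ := exists_separating hx
    refine ⟨_, symmetrize_mem (mul_mem he hg), _, symmetrize_mem (mul_mem he hh),
      symmetrize_mul_ne_zero he0 hev h0, fun t ht => ?_⟩
    obtain ⟨y, rfl⟩ := toSym_surjective t
    rw [symmetrize_toSym, symmetrize_toSym, Finset.mul_sum]
    refine Finset.sum_congr rfl fun σ _ => ?_
    have := hfr (y ∘ σ) fun i => ht y rfl _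
    change f (toSym W n (y ∘ σ)) * _ = _ at this
    rw [toSym_comp_perm] at this
    change f (toSym W n y) * (e (y ∘ σ) * h (y ∘ σ)) = e (y ∘ σ) * g (y ∘ σ)
    rw [← this]
    ring

variable (W n) in
/-- The diagonal divisor with its reduced structure. -/
noncomputable abbrev diagonalSpace : SpaceWithFunctions := (zeroFibre W n).sub (diagonalDivisor W n)

/-- The class in the symmetric power of a point of the diagonal divisor. -/
noncomputable def diagonalVal (s : diagonalSpace W n) : Sym W.toAffine.Point n := s.1.1

lemma isMorphismAt_diagonalVal (s : diagonalSpace W n) :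
    IsMorphismAt (diagonalSpace W n) (symPower W n) diagonalVal s :=
  (isMorphismAt_val _).comp (isMorphismAt_val s)

lemma isMorphismAt_into_diagonalSpace {X : SpaceWithFunctions} {φ : X → diagonalSpace W n} {p : X}
    (h : IsMorphismAt X (symPower W n) (fun q => diagonalVal (φ q)) p) :
    IsMorphismAt X (diagonalSpace W n) φ p :=
  isMorphismAt_into_sub (isMorphismAt_into_sub h)

lemma diagonalVal_injective : Function.Injective (diagonalVal (W := W) (n := n)) :=
  Subtype.val_injective.comp Subtype.val_injective

/-- The point of the diagonal divisor defined by a tuple. -/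
noncomputable def diagonalPt {k : ℕ} (x : Fin (k + 2) → W.toAffine.Point) (h0 : ∑ i, x i = 0) (h1 : x 0 = x 1) :
    diagonalSpace W (k + 2) :=
  (⟨(⟨toSym W (k + 2) x, h0⟩ : {s : Sym W.toAffine.Point (k + 2) // symSum W (k + 2) s = 0}),
    x, rfl, 0, 1, zero_ne_one, h1⟩ : {s // s ∈ diagonalDivisor W (k + 2)})

/-- The `x`-coordinates of the entries of a tuple are distinct, except perhaps those of the first
two. -/
noncomputable def DistinctExcept {k : ℕ} (x : Fin (k + 2) → W.toAffine.Point) : Prop :=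
  ∀ i j : Fin (k + 2), i < j → ¬(i = 0 ∧ j = 1) → xCoord W (x i) ≠ xCoord W (x j)

/-- This turns the genericity condition into the nonvanishing of one function, which can serve as a
factor in fractions. -/
lemma exists_distinctExcept_fun (k : ℕ) : ∃ δ ∈ affinePowerAlg W (k + 2),
    ∀ x : Fin (k + 2) → W.toAffine.Point, δ x ≠ 0 ↔ DistinctExcept x := by
  classical
  refine ⟨∏ a ∈ Finset.univ.filter fun a : Fin (k + 2) × Fin (k + 2) =>
    a.1 < a.2 ∧ ¬(a.1 = 0 ∧ a.2 = 1), ((fun x => xCoord W (x a.1)) - fun x => xCoord W (x a.2)),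
    Subalgebra.prod_mem _ fun a _ => Subalgebra.sub_mem _ (xCoord_mem_affinePowerAlg a.1)
      (xCoord_mem_affinePowerAlg a.2), fun x => ?_⟩
  rw [Finset.prod_apply, Finset.prod_ne_zero_iff]
  constructor
  · intro h i j hij h01
    exact sub_ne_zero.1 (h (i, j) (Finset.mem_filter.2 ⟨Finset.mem_univ _, hij, h01⟩))
  · intro h a ha
    exact sub_ne_zero.2 (h a.1 a.2 (Finset.mem_filter.1 ha).2.1 (Finset.mem_filter.1 ha).2.2)

/-- Any coincidence of entries must be the one that the definition allows. -/
lemma DistinctExcept.eq {k : ℕ} {x : Fin (k + 2) → W.toAffine.Point} (h : DistinctExcept x)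
    {i j : Fin (k + 2)} (hij : i ≠ j) (he : x i = x j) : x 0 = x 1 := by
  rcases lt_or_gt_of_ne hij with hlt | hlt
  · by_contra h'
    refine h i j hlt (fun h0 => h' ?_) (by rw [he])
    rw [← h0.1, ← h0.2, he]
  · by_contra h'
    refine h j i hlt (fun h0 => h' ?_) (by rw [he])
    rw [← h0.1, ← h0.2, he]

/-- A function on the diagonal divisor is regular if it is regular as a function of suitably ordered
tuples. -/
lemma regAt_diagonalSpace {k : ℕ} {f : diagonalSpace W (k + 2) → ℂ}
    {x : Fin (k + 2) → W.toAffine.Point} (hx : ∀ i, x i ≠ 0) (hd : DistinctExcept x)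
    {s : diagonalSpace W (k + 2)} (hs : toSym W (k + 2) x = diagonalVal s)
    {φ : (Fin (k + 2) → W.toAffine.Point) → ℂ} (hφ : ((ellipticCurve W).power (k + 2)).RegAt φ x)
    (he : ∀ᶠ y : Fin (k + 2) → W.toAffine.Point in @nhds ((ellipticCurve W).power (k + 2)) _ x,
      ∀ t, toSym W (k + 2) y = diagonalVal t → y 0 = y 1 → f t = φ y) :
    (diagonalSpace W (k + 2)).RegAt f s := by
  have hch := isChart_affinePower (W := W) (k + 2)
  obtain ⟨g, hg, h, hh, h0, hfr⟩ := hch.exists_frac x hx φ hφ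
  obtain ⟨l, hl, hl0, hsub⟩ := hch.exists_basic x hx _ he
  obtain ⟨e, hem, he0, hev⟩ := exists_separating hx
  obtain ⟨δ, hδ, hδ0⟩ := exists_distinctExcept_fun (W := W) k
  have hs' : diagonalVal s ∈ {s : Sym W.toAffine.Point (k + 2) |
      ∀ x, toSym W (k + 2) x = s → ∀ i, x i ≠ 0} := by
    intro y hy i
    obtain ⟨σ, rfl⟩ := toSym_eq_iff.1 (hy.trans hs.symm)
    exact hx _
  -- Numerator and denominator are symmetrized with weights: e vanishes at the reorderings of x
  -- other than x, l confines tuples to the neighbourhood where `he` holds, and δ forces the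
  -- repeated pair into places 0 and 1.
  have hG := (isMorphismAt_diagonalVal s).2 _ (isChart_symPower.reg _
    (symmetrize_mem (mul_mem hem (mul_mem (mul_mem hl hδ) hg))) _ hs')
  have hH := (isMorphismAt_diagonalVal s).2 _ (isChart_symPower.reg _
    (symmetrize_mem (mul_mem hem (mul_mem (mul_mem hl hδ) hh))) _ hs')
  refine regAt_of_mul_eq hG hH ?_ ?_
  · change symmetrize _ (diagonalVal s) ≠ 0
    rw [← hs]
    exact symmetrize_mul_ne_zero he0 hev (mul_ne_zero (mul_ne_zero hl0 ((hδ0 x).2 hd)) h0)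
  · filter_upwards [(isMorphismAt_diagonalVal s).1.eventually
      (isChart_symPower.isOpen.eventually_mem hs')] with t ht
    obtain ⟨y, hy⟩ := toSym_surjective (diagonalVal t)
    change f t * symmetrize _ (diagonalVal t) = symmetrize _ (diagonalVal t)
    rw [← hy, symmetrize_toSym, symmetrize_toSym,
      Finset.mul_sum]
    refine Finset.sum_congr rfl fun σ _ => ?_
    have hyσ : toSym W (k + 2) (y ∘ σ) = diagonalVal t := (toSym_comp_perm σ y).trans hy
    have hO : ∀ i, (y ∘ σ) i ≠ 0 := fun i => ht y hy _
    change f t * (e (y ∘ σ) * (l (y ∘ σ) * δ (y ∘ σ) * h (y ∘ σ))) =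
      e (y ∘ σ) * (l (y ∘ σ) * δ (y ∘ σ) * g (y ∘ σ))
    by_cases h1 : l (y ∘ σ) = 0
    · rw [h1]
      ring
    by_cases h2 : δ (y ∘ σ) = 0
    · rw [h2]
      ring
    obtain ⟨i, j, hij, hyij⟩ := (mem_diagonalDivisor_iff hyσ).1 t.2
    have h3 : f t = φ (y ∘ σ) := hsub _ hO h1 t hyσ (((hδ0 _).1 h2).eq hij hyij)
    have h4 : φ (y ∘ σ) * h (y ∘ σ) = g (y ∘ σ) := hfr _ hO
    rw [h3]
    linear_combination (e (y ∘ σ) * (l (y ∘ σ) * δ (y ∘ σ))) * h4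

end SymChart

/-! ### Abel's theorem for points with distinct `x`-coordinates -/

section Abel

open WeierstrassCurve.Affine (CoordinateRing)
open Polynomial

variable {W : WeierstrassCurve ℂ}

/-- The ideal of an affine point. -/
noncomputable def pointIdeal {P : W.toAffine.Point} (hP : P ≠ 0) : Ideal W.toAffine.CoordinateRing :=
  RingHom.ker (evalHom hP)

lemma evalHom_surjective {P : W.toAffine.Point} (hP : P ≠ 0) : Function.Surjective (evalHom hP) :=
  fun z => ⟨_, evalHom_algebraMap hP z⟩

lemma evalHom_mk {P : W.toAffine.Point} (hP : P ≠ 0) (g : ℂ[X][X]) :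
    evalHom hP (CoordinateRing.mk W.toAffine g) = g.evalEval (xCoord W P) (yCoord W P) :=
  AdjoinRoot.evalEval_mk _ g

lemma XYIdeal_eq_pointIdeal {P : W.toAffine.Point} (hP : P ≠ 0) :
    CoordinateRing.XYIdeal W.toAffine (xCoord W P) (C (yCoord W P)) = pointIdeal hP := by
  have hmax : (CoordinateRing.XYIdeal W.toAffine (xCoord W P) (C (yCoord W P))).IsMaximal := by
    refine Ideal.Quotient.maximal_of_isField _ ?_
    have e := CoordinateRing.quotientXYIdealEquiv (W' := W.toAffine) (x := xCoord W P)
      (y := C (yCoord W P)) (nonsingular_coords hP).1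
    exact MulEquiv.isField (Field.toIsField ℂ) e.toMulEquiv
  have hker : pointIdeal hP ≠ ⊤ :=
    (RingHom.ker_isMaximal_of_surjective _ (evalHom_surjective hP)).ne_top
  refine hmax.eq_of_le hker ?_
  rw [CoordinateRing.XYIdeal, Ideal.span_le]
  rintro _ (rfl | rfl)
  · change evalHom hP _ = 0
    rw [CoordinateRing.XClass, evalHom_mk]
    simp [evalEval]
  · change evalHom hP _ = 0
    rw [CoordinateRing.YClass, evalHom_mk]
    simp [evalEval]

/-- The vertical line through P meets the affine curve exactly in P and −P, with multiplicity. -/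
lemma pointIdeal_mul_neg {P : W.toAffine.Point} (hP : P ≠ 0) :
    pointIdeal hP * pointIdeal (neg_ne_zero_point hP) =
      Ideal.span {algebraMap ℂ[X] W.toAffine.CoordinateRing (X - C (xCoord W P))} := by
  rw [← XYIdeal_eq_pointIdeal, ← XYIdeal_eq_pointIdeal, mul_comm, xCoord_neg, yCoord_neg hP]
  have := CoordinateRing.XYIdeal_neg_mul (nonsingular_coords hP)
  rw [WeierstrassCurve.Affine.negY] at this
  exact this

variable {ι : Type*} [Fintype ι] {w : ι → W.toAffine.Point}

lemma prod_pointIdeal_mul_neg (hw : ∀ i, w i ≠ 0) :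
    (∏ i, pointIdeal (hw i)) * ∏ i, pointIdeal (neg_ne_zero_point (hw i)) =
      Ideal.span {algebraMap ℂ[X] W.toAffine.CoordinateRing (∏ i, (X - C (xCoord W (w i))))} := by
  rw [← Finset.prod_mul_distrib, Finset.prod_congr rfl fun i _ => pointIdeal_mul_neg (hw i),
    Ideal.prod_span_singleton, map_prod]

/-- The map from points to the class group of the coordinate ring is an injective homomorphism that
sends an affine point to the class of its ideal. -/
lemma sum_eq_zero_iff_isPrincipal (hw : ∀ i, w i ≠ 0) :
    ∑ i, w i = 0 ↔ ∃ f ≠ 0, ∏ i, pointIdeal (hw i) = Ideal.span {f} := by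
  have hprod : (((∏ i, CoordinateRing.XYIdeal' (W := W.toAffine) (nonsingular_coords (hw i)) :
      (FractionalIdeal (nonZeroDivisors W.toAffine.CoordinateRing) W.toAffine.FunctionField)ˣ)) :
      FractionalIdeal (nonZeroDivisors W.toAffine.CoordinateRing) W.toAffine.FunctionField) =
        ((∏ i, pointIdeal (hw i) : Ideal W.toAffine.CoordinateRing) :
          FractionalIdeal (nonZeroDivisors W.toAffine.CoordinateRing) W.toAffine.FunctionField) := by
    refine Eq.trans ?_ (map_prod (FractionalIdeal.coeIdealHom
      (nonZeroDivisors W.toAffine.CoordinateRing) W.toAffine.FunctionField)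
      (fun i => pointIdeal (hw i)) Finset.univ).symm
    rw [Units.coe_prod]
    refine Finset.prod_congr rfl fun i _ => ?_
    change _ = ((pointIdeal (hw i) : Ideal W.toAffine.CoordinateRing) : FractionalIdeal
      (nonZeroDivisors W.toAffine.CoordinateRing) W.toAffine.FunctionField)
    rw [CoordinateRing.XYIdeal'_eq, XYIdeal_eq_pointIdeal]
  have h := ClassGroup.mk_eq_one_of_coe_ideal hprod
  rw [← h, map_prod]
  have hc : WeierstrassCurve.Affine.Point.toClass (∑ i, w i) =
      Additive.ofMul (∏ i, ClassGroup.mk W.toAffine.FunctionField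
        (CoordinateRing.XYIdeal' (W := W.toAffine) (nonsingular_coords (hw i)))) := by
    rw [map_sum, ofMul_prod]
    refine Finset.sum_congr rfl fun i _ => ?_
    conv_lhs => rw [← some_coords (hw i)]
    rfl
  rw [← WeierstrassCurve.Affine.Point.toClass_eq_zero, hc]
  exact Iff.rfl

variable (W) in
/-- The norm of `A + B y`. -/
noncomputable def normPoly (A B : ℂ[X]) : ℂ[X] :=
  A ^ 2 - A * B * (C W.a₁ * X + C W.a₃) - B ^ 2 * (X ^ 3 + C W.a₂ * X ^ 2 + C W.a₄ * X + C W.a₆)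

lemma normPoly_eq_norm (A B : ℂ[X]) :
    Algebra.norm ℂ[X] (A • 1 + B • CoordinateRing.mk W.toAffine X) = normPoly W A B :=
  CoordinateRing.norm_smul_basis A B

lemma normPoly_ne_zero {A B : ℂ[X]} (h : ¬(A = 0 ∧ B = 0)) : normPoly W A B ≠ 0 := by
  rw [← normPoly_eq_norm, Algebra.norm_ne_zero_iff_of_basis (CoordinateRing.basis W.toAffine)]
  exact fun h' => h (CoordinateRing.smul_basis_eq_zero h')

lemma eval_normPoly_eq_zero {A B : ℂ[X]} {P : W.toAffine.Point} (hP : P ≠ 0)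
    (h : A.eval (xCoord W P) + B.eval (xCoord W P) * yCoord W P = 0) :
    (normPoly W A B).eval (xCoord W P) = 0 := by
  rw [← normPoly_eq_norm, eval_norm hP, evalHom_smul_basis, h, zero_mul]

lemma prod_dvd_of_eval_eq_zero {x : ι → ℂ} (hx : Function.Injective x) {N : ℂ[X]}
    (h : ∀ i, N.eval (x i) = 0) : ∏ i, (X - C (x i)) ∣ N :=
  Finset.prod_dvd_of_coprime (fun i _ j _ hij => pairwise_coprime_X_sub_C hx hij)
    fun i _ => dvd_iff_isRoot.2 (h i)

/-- Let f and g generate the products of the ideals of the points and of their negatives. Up to a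
unit, f g is d = ∏ (x − x(w i)), so the norms of f and g have product d² up to a unit. As both norms
are divisible by d, the norm of f is a constant multiple of d. -/
lemma exists_of_sum_eq_zero (hw : ∀ i, w i ≠ 0) (hx : Function.Injective fun i => xCoord W (w i))
    (hsum : ∑ i, w i = 0) : ∃ A B : ℂ[X], (∃ u : ℂ, u ≠ 0 ∧
      normPoly W A B = C u * ∏ i, (X - C (xCoord W (w i)))) ∧
      ∀ i, A.eval (xCoord W (w i)) + B.eval (xCoord W (w i)) * yCoord W (w i) = 0 := by
  obtain ⟨f, hf0, hf⟩ := (sum_eq_zero_iff_isPrincipal hw).1 hsum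
  have hsum' : ∑ i, -w i = 0 := by rw [Finset.sum_neg_distrib, hsum, neg_zero]
  obtain ⟨g, hg0, hg⟩ := (sum_eq_zero_iff_isPrincipal fun i => neg_ne_zero_point (hw i)).1 hsum'
  have hfv : ∀ i, evalHom (hw i) f = 0 := fun i => by
    have : f ∈ ∏ i, pointIdeal (hw i) := hf ▸ Ideal.mem_span_singleton_self f
    exact Ideal.prod_le_inf.trans (Finset.inf_le (Finset.mem_univ i)) this
  have hgv : ∀ i, evalHom (neg_ne_zero_point (hw i)) g = 0 := fun i => by
    have : g ∈ ∏ i, pointIdeal (neg_ne_zero_point (hw i)) := hg ▸ Ideal.mem_span_singleton_self g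
    exact Ideal.prod_le_inf.trans (Finset.inf_le (Finset.mem_univ i)) this
  set d := ∏ i, (X - C (xCoord W (w i)))
  have hd0 : d ≠ 0 := Finset.prod_ne_zero_iff.2 fun i _ => X_sub_C_ne_zero _
  have hdf : d ∣ Algebra.norm ℂ[X] f := prod_dvd_of_eval_eq_zero hx fun i => by
    rw [eval_norm (hw i), hfv, zero_mul]
  have hdg : d ∣ Algebra.norm ℂ[X] g := prod_dvd_of_eval_eq_zero hx fun i => by
    rw [eval_norm (hw i), hgv, mul_zero]
  have hfg := prod_pointIdeal_mul_neg hw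
  rw [hf, hg, Ideal.span_singleton_mul_span_singleton, Ideal.span_singleton_eq_span_singleton] at hfg
  obtain ⟨u, hu⟩ := hfg
  have hN : Algebra.norm ℂ[X] f * Algebra.norm ℂ[X] g * Algebra.norm ℂ[X] (u : W.toAffine.CoordinateRing)
      = d * d := by
    rw [← map_mul, ← map_mul, hu, Algebra.norm_algebraMap_of_basis (CoordinateRing.basis W.toAffine),
      Fintype.card_fin, sq]
  obtain ⟨a, ha⟩ := hdf
  obtain ⟨b, hb⟩ := hdg
  have ha1 : IsUnit a := by
    have : a * (b * Algebra.norm ℂ[X] (u : W.toAffine.CoordinateRing)) = 1 := by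
      refine mul_left_cancel₀ (mul_ne_zero hd0 hd0) ?_
      rw [ha, hb] at hN
      linear_combination hN
    exact IsUnit.of_mul_eq_one _ this
  obtain ⟨c, hc, hca⟩ := Polynomial.isUnit_iff.1 ha1
  obtain ⟨A, B, rfl⟩ := CoordinateRing.exists_smul_basis_eq f
  refine ⟨A, B, ⟨c, hc.ne_zero, ?_⟩, fun i => ?_⟩
  · rw [← normPoly_eq_norm, ha, hca, mul_comm]
  · rw [← evalHom_smul_basis (hw i), hfv]

/-- Distinct x-coordinates make the ideals pairwise coprime, so their product is their intersection.
-/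
lemma mem_prod_pointIdeal (hw : ∀ i, w i ≠ 0) (hx : Function.Injective fun i => xCoord W (w i))
    {f : W.toAffine.CoordinateRing} (hf : ∀ i, evalHom (hw i) f = 0) : f ∈ ∏ i, pointIdeal (hw i) := by
  have hmax : ∀ i, (pointIdeal (hw i)).IsMaximal := fun i =>
    RingHom.ker_isMaximal_of_surjective _ (evalHom_surjective (hw i))
  rw [Ideal.prod_eq_iInf_of_pairwise_isCoprime]
  · exact (Submodule.mem_iInf _).2 fun i => (Submodule.mem_iInf _).2 fun _ => hf i
  · intro i _ j _ hij
    rw [Function.onFun, Ideal.isCoprime_iff_sup_eq]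
    refine Ideal.IsMaximal.coprime_of_ne (hmax i) (hmax j) fun h => hij (hx ?_)
    have h1 : algebraMap ℂ[X] W.toAffine.CoordinateRing (X - C (xCoord W (w i))) ∈ pointIdeal (hw i) := by
      rw [← XYIdeal_eq_pointIdeal]
      exact Ideal.subset_span (Or.inl rfl)
    rw [h] at h1
    have h2 : evalHom (hw j) (CoordinateRing.mk W.toAffine (C (X - C (xCoord W (w i))))) = 0 := h1
    rw [evalHom_mk] at h2
    simp only [evalEval, eval_C, eval_sub, eval_X] at h2
    exact (sub_eq_zero.1 h2).symm

/-- The converse direction. If g is the conjugate of f, then f g generates the product of the ideals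
of all points and their negatives. Cancelling g shows that f generates the product of the ideals of
the points. -/
lemma sum_eq_zero_of_normPoly (hw : ∀ i, w i ≠ 0) (hx : Function.Injective fun i => xCoord W (w i))
    {A B : ℂ[X]} {u : ℂ} (hu : u ≠ 0) (hN : normPoly W A B = C u * ∏ i, (X - C (xCoord W (w i))))
    (hf : ∀ i, A.eval (xCoord W (w i)) + B.eval (xCoord W (w i)) * yCoord W (w i) = 0) :
    ∑ i, w i = 0 := by
  set f : W.toAffine.CoordinateRing := A • 1 + B • CoordinateRing.mk W.toAffine X with hfdef
  set g : W.toAffine.CoordinateRing := CoordinateRing.mk W.toAffine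
    (C A + C B * (-(X : ℂ[X][X]) - C (C W.a₁ * X + C W.a₃))) with hgdef
  have hd0 : ∏ i, (X - C (xCoord W (w i))) ≠ (0 : ℂ[X]) :=
    Finset.prod_ne_zero_iff.2 fun i _ => X_sub_C_ne_zero _
  have hfg : f * g = algebraMap ℂ[X] W.toAffine.CoordinateRing (normPoly W A B) := by
    rw [← normPoly_eq_norm]
    refine Eq.trans ?_ (CoordinateRing.coe_norm_smul_basis A B).symm
    rw [map_mul, hfdef, CoordinateRing.smul, CoordinateRing.smul, map_add, map_mul, mul_one]
  have hfg0 : f * g ≠ 0 := by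
    rw [hfg, hN]
    refine (map_ne_zero_iff _ (FaithfulSMul.algebraMap_injective ℂ[X] W.toAffine.CoordinateRing)).2 ?_
    exact mul_ne_zero (C_ne_zero.2 hu) hd0
  have hfJ := mem_prod_pointIdeal hw hx (f := f) fun i => by
    rw [hfdef, evalHom_smul_basis]
    exact hf i
  have hgJ := mem_prod_pointIdeal (w := fun i => -w i) (fun i => neg_ne_zero_point (hw i))
    (by simpa only [xCoord_neg] using hx) (f := g) fun i => by
      rw [hgdef, evalHom_mk]
      simp only [evalEval, eval_add, eval_mul, eval_C, eval_sub, eval_neg, eval_X, xCoord_neg,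
        yCoord_neg (hw i)]
      linear_combination hf i
  refine (sum_eq_zero_iff_isPrincipal hw).2 ⟨f, left_ne_zero_of_mul hfg0, le_antisymm ?_ ?_⟩
  · intro a ha
    have h1 : a * g ∈ Ideal.span {algebraMap ℂ[X] W.toAffine.CoordinateRing
        (∏ i, (X - C (xCoord W (w i))))} := by
      rw [← prod_pointIdeal_mul_neg hw]
      exact Ideal.mul_mem_mul ha hgJ
    have h2 : algebraMap ℂ[X] W.toAffine.CoordinateRing (∏ i, (X - C (xCoord W (w i)))) =
        algebraMap ℂ[X] W.toAffine.CoordinateRing (C u⁻¹) * (f * g) := by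
      rw [hfg, hN, ← map_mul, ← mul_assoc, ← C_mul, inv_mul_cancel₀ hu, C_1, one_mul]
    obtain ⟨b, hb⟩ := Ideal.mem_span_singleton'.1 h1
    refine Ideal.mem_span_singleton'.2 ⟨b * algebraMap ℂ[X] W.toAffine.CoordinateRing (C u⁻¹), ?_⟩
    refine mul_right_cancel₀ (right_ne_zero_of_mul hfg0) ?_
    rw [← hb, h2]
    ring
  · rw [Ideal.span_singleton_le_iff_mem]
    exact hfJ

end Abel

/-! ### Functions on the curve with a pole of bounded order at the origin -/

section Sections

open WeierstrassCurve.Affine (CoordinateRing)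
open Polynomial

variable {W : WeierstrassCurve ℂ}

variable (W) in
/-- The functions `x, y, x², x y, x³, …`, of pole order `2, 3, 4, …` at the origin. -/
noncomputable def poleFn (j : ℕ) (P : W.toAffine.Point) : ℂ :=
  if Even j then xCoord W P ^ (j / 2 + 1) else xCoord W P ^ (j / 2) * yCoord W P

/-- The part without `y` and without constant term of a combination of the functions `poleFn`. -/
noncomputable def evenPart (r : ℕ) (d : ℕ → ℂ) : ℂ[X] :=
  ∑ l ∈ Finset.range (r + 1), C (d (2 * l)) * X ^ (l + 1)

/-- The coefficient of `y` of a combination of the functions `poleFn`. -/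
noncomputable def oddPart (r : ℕ) (d : ℕ → ℂ) : ℂ[X] :=
  ∑ l ∈ Finset.range (r + 1), C (d (2 * l + 1)) * X ^ l

lemma coeff_evenPart_succ {r : ℕ} {d : ℕ → ℂ} (hd : ∀ j, r < j → d j = 0) (l : ℕ) :
    (evenPart r d).coeff (l + 1) = d (2 * l) := by
  simp only [evenPart, finsetSum_coeff, coeff_C_mul, coeff_X_pow, add_left_inj, mul_ite, mul_one,
    mul_zero, Finset.sum_ite_eq, Finset.mem_range]
  split_ifs with h
  · rfl
  · exact (hd _ (by omega)).symm

lemma coeff_evenPart_zero (r : ℕ) (d : ℕ → ℂ) : (evenPart r d).coeff 0 = 0 := by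
  simp [evenPart, finsetSum_coeff, coeff_X_pow]

lemma coeff_oddPart {r : ℕ} {d : ℕ → ℂ} (hd : ∀ j, r < j → d j = 0) (l : ℕ) :
    (oddPart r d).coeff l = d (2 * l + 1) := by
  simp only [oddPart, finsetSum_coeff, coeff_C_mul, coeff_X_pow, mul_ite, mul_one,
    mul_zero, Finset.sum_ite_eq, Finset.mem_range]
  split_ifs with h
  · rfl
  · exact (hd _ (by omega)).symm

lemma sum_range_two_mul (g : ℕ → ℂ) (n : ℕ) : ∑ j ∈ Finset.range (2 * n), g j =
    ∑ l ∈ Finset.range n, g (2 * l) + ∑ l ∈ Finset.range n, g (2 * l + 1) := by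
  induction n with
  | zero => simp
  | succ n ih =>
    rw [show 2 * (n + 1) = 2 * n + 1 + 1 by ring, Finset.sum_range_succ, Finset.sum_range_succ, ih,
      Finset.sum_range_succ, Finset.sum_range_succ]
    ring

lemma sum_poleFn {r : ℕ} {d : ℕ → ℂ} (hd : ∀ j, r < j → d j = 0) (P : W.toAffine.Point) :
    ∑ j ∈ Finset.range (r + 1), d j * poleFn W j P =
      (evenPart r d).eval (xCoord W P) + (oddPart r d).eval (xCoord W P) * yCoord W P := by
  have h1 : ∑ j ∈ Finset.range (r + 1), d j * poleFn W j P =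
      ∑ j ∈ Finset.range (2 * (r + 1)), d j * poleFn W j P := by
    refine Finset.sum_subset (Finset.range_mono (by omega)) fun j _ hj => ?_
    rw [hd j (by simpa [Nat.lt_succ_iff] using hj), zero_mul]
  rw [h1, sum_range_two_mul, evenPart, oddPart, eval_finsetSum, eval_finsetSum, Finset.sum_mul]
  congr 1
  · refine Finset.sum_congr rfl fun l _ => ?_
    simp [poleFn]
  · refine Finset.sum_congr rfl fun l _ => ?_
    have h2 : (2 * l + 1) / 2 = l := by omega
    simp [poleFn, h2, mul_assoc]

variable (W) in
/-- The part without `y` of the combination of the functions `poleFn - poleFn Q`. -/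
noncomputable def secA (r : ℕ) (d : ℕ → ℂ) (Q : W.toAffine.Point) : ℂ[X] :=
  evenPart r d - C (∑ j ∈ Finset.range (r + 1), d j * poleFn W j Q)

lemma eval_sec {r : ℕ} {d : ℕ → ℂ} (hd : ∀ j, r < j → d j = 0) (P Q : W.toAffine.Point) :
    (secA W r d Q).eval (xCoord W P) + (oddPart r d).eval (xCoord W P) * yCoord W P =
      ∑ j ∈ Finset.range (r + 1), d j * (poleFn W j P - poleFn W j Q) := by
  simp only [mul_sub, Finset.sum_sub_distrib]
  rw [sum_poleFn hd P, secA, eval_sub, eval_C]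
  ring

lemma coeff_secA_succ {r : ℕ} {d : ℕ → ℂ} (hd : ∀ j, r < j → d j = 0) (Q : W.toAffine.Point) (l : ℕ) :
    (secA W r d Q).coeff (l + 1) = d (2 * l) := by
  rw [secA, coeff_sub, coeff_evenPart_succ hd, coeff_C_succ, sub_zero]

/-- The degrees 2 deg A and 2 deg B + 3 have different parity, so leading terms cannot cancel. The
result is the pole order of A + B y at the origin. -/
lemma degree_normPoly (A B : ℂ[X]) :
    (normPoly W A B).degree = max (2 • A.degree) (2 • B.degree + 3) := by
  rw [← normPoly_eq_norm, CoordinateRing.degree_norm_smul_basis]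

/-- The monomials x^(l + 1) and x^l y have pole orders 2l + 2 and 2l + 3, so the hypotheses exclude
pole orders from s + 2 on. -/
lemma degree_normPoly_lt {A B : ℂ[X]} {s : ℕ} (hA : ∀ l, s ≤ 2 * l → A.coeff (l + 1) = 0)
    (hB : ∀ l, s ≤ 2 * l + 1 → B.coeff l = 0) : (normPoly W A B).degree < ((s + 2 : ℕ) : WithBot ℕ) := by
  rw [degree_normPoly, max_lt_iff]
  constructor
  · by_cases h0 : A = 0
    · subst h0
      simp only [degree_zero]
      exact WithBot.bot_lt_coe _
    · rw [degree_eq_natDegree h0, ← Nat.cast_smul_eq_nsmul (WithBot ℕ)]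
      have hlead : A.coeff A.natDegree ≠ 0 := leadingCoeff_ne_zero.2 h0
      have : 2 * A.natDegree < s + 2 := by
        by_contra! h
        obtain ⟨l, hl⟩ : ∃ l, A.natDegree = l + 1 := ⟨A.natDegree - 1, by omega⟩
        exact hlead (hl ▸ hA l (by omega))
      simpa only [smul_eq_mul] using (by exact_mod_cast this)
  · by_cases h0 : B = 0
    · subst h0
      simp only [degree_zero]
      exact WithBot.bot_lt_coe _
    · rw [degree_eq_natDegree h0, ← Nat.cast_smul_eq_nsmul (WithBot ℕ)]
      have hlead : B.coeff B.natDegree ≠ 0 := leadingCoeff_ne_zero.2 h0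
      have : 2 * B.natDegree + 3 < s + 2 := by
        by_contra! h
        exact hlead (hB _ (by omega))
      simpa only [smul_eq_mul] using (by exact_mod_cast this)

lemma natDegree_normPoly_sec {r : ℕ} {d : ℕ → ℂ} (hd : ∀ j, r < j → d j = 0) (hr : d r ≠ 0)
    (Q : W.toAffine.Point) : (normPoly W (secA W r d Q) (oddPart r d)).natDegree = r + 2 := by
  refine natDegree_eq_of_degree_eq_some (le_antisymm ?_ ?_)
  · have := degree_normPoly_lt (W := W) (s := r + 1) (fun l hl => by rw [coeff_secA_succ hd Q, hd _ (by omega)])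
      fun l hl => by rw [coeff_oddPart hd, hd _ (by omega)]
    exact Order.le_of_lt_succ (by exact_mod_cast this)
  · rw [degree_normPoly]
    rcases Nat.even_or_odd' r with ⟨t, rfl | rfl⟩
    · refine le_trans ?_ (le_max_left _ _)
      have h1 : (secA W (2 * t) d Q).coeff (t + 1) ≠ 0 := by rwa [coeff_secA_succ hd]
      have h2 := le_degree_of_ne_zero h1
      have h3 : ((2 * t + 2 : ℕ) : WithBot ℕ) = 2 • ((t + 1 : ℕ) : WithBot ℕ) := by
        rw [← Nat.cast_smul_eq_nsmul (WithBot ℕ), smul_eq_mul]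
        push_cast
        ring
      rw [h3]
      exact nsmul_le_nsmul_right h2 2
    · refine le_trans ?_ (le_max_right _ _)
      have h1 : (oddPart (2 * t + 1) d).coeff t ≠ 0 := by rwa [coeff_oddPart hd]
      have h2 := le_degree_of_ne_zero h1
      have h3 : ((2 * t + 1 + 2 : ℕ) : WithBot ℕ) = 2 • ((t : ℕ) : WithBot ℕ) + 3 := by
        rw [← Nat.cast_smul_eq_nsmul (WithBot ℕ), smul_eq_mul]
        push_cast
        ring
      rw [h3]
      gcongr

/-- A combination of the functions `poleFn - poleFn Q` that vanishes at too many points is zero. -/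
lemma eq_zero_of_eval_sec {r : ℕ} {d : ℕ → ℂ} (hd : ∀ j, r ≤ j → d j = 0) {Q : W.toAffine.Point}
    {w : Fin (r + 2) → W.toAffine.Point} (hw : ∀ i, w i ≠ 0)
    (hx : Function.Injective fun i => xCoord W (w i))
    (hv : ∀ i, ∑ j ∈ Finset.range (r + 1), d j * (poleFn W j (w i) - poleFn W j Q) = 0) : d = 0 := by
  have hd' : ∀ j, r < j → d j = 0 := fun j hj => hd j hj.le
  -- The pole order is at most r + 1, while the norm vanishes at r + 2 distinct values of x.
  have hN : normPoly W (secA W r d Q) (oddPart r d) = 0 := by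
    refine Polynomial.eq_zero_of_degree_lt_of_eval_index_eq_zero (s := (Finset.univ : Finset (Fin (r + 2))))
      (v := fun i => xCoord W (w i)) hx.injOn ?_
      fun i _ => eval_normPoly_eq_zero (hw i) ((eval_sec hd' _ _).trans (hv i))
    rw [Finset.card_univ, Fintype.card_fin]
    exact degree_normPoly_lt (s := r) (fun l hl => by rw [coeff_secA_succ hd' Q, hd _ hl])
      fun l hl => by rw [coeff_oddPart hd', hd _ hl]
  obtain ⟨hA, hB⟩ : secA W r d Q = 0 ∧ oddPart r d = 0 := by
    by_contra h
    exact normPoly_ne_zero h hN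
  ext j
  rcases Nat.even_or_odd' j with ⟨t, rfl | rfl⟩
  · rw [← coeff_secA_succ hd' Q t, hA, coeff_zero, Pi.zero_apply]
  · rw [← coeff_oddPart hd' t, hB, coeff_zero, Pi.zero_apply]

/-- The norm has degree r + 2 and vanishes at the r + 2 distinct numbers x(w i), which leaves only a
constant factor. -/
lemma normPoly_sec_eq {r : ℕ} {d : ℕ → ℂ} (hd : ∀ j, r < j → d j = 0) (hr : d r ≠ 0)
    {Q : W.toAffine.Point} {w : Fin (r + 2) → W.toAffine.Point} (hw : ∀ i, w i ≠ 0)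
    (hx : Function.Injective fun i => xCoord W (w i))
    (hv : ∀ i, ∑ j ∈ Finset.range (r + 1), d j * (poleFn W j (w i) - poleFn W j Q) = 0) :
    ∃ u : ℂ, u ≠ 0 ∧ normPoly W (secA W r d Q) (oddPart r d) = C u * ∏ i, (X - C (xCoord W (w i))) := by
  have hdeg := natDegree_normPoly_sec (W := W) hd hr Q
  have hN0 : normPoly W (secA W r d Q) (oddPart r d) ≠ 0 := by
    intro h
    rw [h, natDegree_zero] at hdeg
    omega
  obtain ⟨q, hq⟩ := prod_dvd_of_eval_eq_zero hx
    (N := normPoly W (secA W r d Q) (oddPart r d)) fun i =>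
      eval_normPoly_eq_zero (hw i) ((eval_sec hd _ _).trans (hv i))
  have hq0 : q ≠ 0 := by
    rintro rfl
    exact hN0 (by rw [hq, mul_zero])
  have hmon : (∏ i, (X - C (xCoord W (w i)))).Monic := monic_prod_X_sub_C _ _
  have h1 : q.natDegree = 0 := by
    have h2 := congrArg natDegree hq
    rw [hdeg, hmon.natDegree_mul' hq0, natDegree_finsetProd_X_sub_C_eq_card, Finset.card_univ,
      Fintype.card_fin] at h2
    omega
  rw [eq_C_of_natDegree_eq_zero h1] at hq hq0
  exact ⟨q.coeff 0, fun h => hq0 (by rw [h, C_0]), by rw [hq, mul_comm]⟩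

/-- Points with sum zero are the zeros of a combination of the functions `poleFn - poleFn Q`. -/
lemma exists_coeff_of_sum_eq_zero {r : ℕ} {w : Fin (r + 2) → W.toAffine.Point} (hw : ∀ i, w i ≠ 0)
    (hx : Function.Injective fun i => xCoord W (w i)) (hsum : ∑ i, w i = 0) :
    ∃ d : ℕ → ℂ, (∀ j, r < j → d j = 0) ∧ d r = 1 ∧
      ∀ i, ∑ j ∈ Finset.range (r + 1), d j * (poleFn W j (w i) - poleFn W j (w 0)) = 0 := by
  obtain ⟨A, B, ⟨u, hu, hN⟩, hv⟩ := exists_of_sum_eq_zero hw hx hsum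
  have hdeg : (normPoly W A B).degree = ((r + 2 : ℕ) : WithBot ℕ) := by
    rw [hN, degree_C_mul hu, degree_eq_natDegree (monic_prod_X_sub_C _ _).ne_zero,
      natDegree_finsetProd_X_sub_C_eq_card, Finset.card_univ, Fintype.card_fin]
  have hmax := degree_normPoly (W := W) A B
  rw [hdeg] at hmax
  have hA : ∀ l, r < 2 * l → A.coeff (l + 1) = 0 := fun l hl => by
    by_contra h
    have h1 := (nsmul_le_nsmul_right (le_degree_of_ne_zero h) 2).trans ((le_max_left _ _).trans hmax.ge)
    rw [← Nat.cast_smul_eq_nsmul (WithBot ℕ), smul_eq_mul] at h1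
    have h2 : 2 * (l + 1) ≤ r + 2 := by exact_mod_cast h1
    omega
  have hB : ∀ l, r < 2 * l + 1 → B.coeff l = 0 := fun l hl => by
    by_contra h
    have h1 := (add_le_add_left (nsmul_le_nsmul_right (le_degree_of_ne_zero h) 2) 3).trans
      ((le_max_right _ _).trans hmax.ge)
    rw [← Nat.cast_smul_eq_nsmul (WithBot ℕ), smul_eq_mul] at h1
    have h2 : 2 * l + 3 ≤ r + 2 := by exact_mod_cast h1
    omega
  -- Even indices carry the coefficients of A without the constant one, odd indices those of B.
  let d : ℕ → ℂ := fun j => if Even j then A.coeff (j / 2 + 1) else B.coeff (j / 2)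
  have hde : ∀ l, d (2 * l) = A.coeff (l + 1) := fun l => by simp [d]
  have hdo : ∀ l, d (2 * l + 1) = B.coeff l := fun l => by
    have h2 : (2 * l + 1) / 2 = l := by omega
    simp [d, h2]
  have hd : ∀ j, r < j → d j = 0 := fun j hj => by
    rcases Nat.even_or_odd' j with ⟨t, rfl | rfl⟩
    · rw [hde, hA t hj]
    · rw [hdo, hB t hj]
  -- Otherwise the norm would have degree less than r + 2.
  have hr : d r ≠ 0 := fun h => by
    have hd' : ∀ j, r ≤ j → d j = 0 := fun j hj => by
      rcases hj.eq_or_lt with rfl | hj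
      exacts [h, hd j hj]
    have := degree_normPoly_lt (W := W) (A := A) (B := B) (s := r) (fun l hl => by rw [← hde, hd' _ hl])
      fun l hl => by rw [← hdo, hd' _ hl]
    exact this.ne hdeg
  have hAe : A = evenPart r d + C (A.coeff 0) := by
    ext l
    rcases l with _ | l
    · simp [coeff_evenPart_zero]
    · rw [coeff_add, coeff_evenPart_succ hd, hde, coeff_C_succ, add_zero]
  have hBe : B = oddPart r d := by
    ext l
    rw [coeff_oddPart hd, hdo]
  -- The sum takes the same value, minus the constant coefficient of A, at all the points; so it
  -- drops out in differences with the value at w 0.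
  have hv' : ∀ i, ∑ j ∈ Finset.range (r + 1), d j * poleFn W j (w i) = -A.coeff 0 := fun i => by
    have h1 := hv i
    rw [hAe, hBe, eval_add, eval_C] at h1
    rw [sum_poleFn hd]
    linear_combination h1
  refine ⟨fun j => d j / d r, fun j hj => by simp only [hd j hj, zero_div], div_self hr, fun i => ?_⟩
  have h1 : ∑ j ∈ Finset.range (r + 1), d j / d r * (poleFn W j (w i) - poleFn W j (w 0)) =
      (∑ j ∈ Finset.range (r + 1), d j * poleFn W j (w i) -
        ∑ j ∈ Finset.range (r + 1), d j * poleFn W j (w 0)) / d r := by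
    rw [← Finset.sum_sub_distrib, Finset.sum_div]
    refine Finset.sum_congr rfl fun j _ => ?_
    ring
  rw [h1, hv', hv', sub_self, zero_div]

/-- If the norm polynomial has no multiple zeros, the coefficient of `y` does not vanish at its
zeros. -/
lemma eval_ne_zero_of_separable {A B : ℂ[X]} (h : (normPoly W A B).Separable) {x : ℂ}
    (hx : (normPoly W A B).eval x = 0) : B.eval x ≠ 0 := by
  intro hB
  -- If A and B both vanish at x, the norm, being quadratic in A and B, is divisible by the square
  -- of X − x.
  have hA : A.eval x = 0 := by
    simpa [normPoly, hB] using hx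
  obtain ⟨A', rfl⟩ := dvd_iff_isRoot.2 hA
  obtain ⟨B', rfl⟩ := dvd_iff_isRoot.2 hB
  have h1 : (X - C x) * (X - C x) ∣ normPoly W ((X - C x) * A') ((X - C x) * B') :=
    ⟨normPoly W A' B', by simp only [normPoly]; ring⟩
  exact (not_isUnit_X_sub_C x) (h.squarefree _ h1)

variable [W.IsElliptic]

/-- The norm at x is B(x)² times the Weierstrass equation evaluated at y = −A(x) / B(x). -/
lemma exists_point_of_normPoly {A B : ℂ[X]} {x : ℂ} (hx : (normPoly W A B).eval x = 0)
    (hB : B.eval x ≠ 0) : ∃ P : W.toAffine.Point, P ≠ 0 ∧ xCoord W P = x ∧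
      A.eval x + B.eval x * yCoord W P = 0 := by
  have h : W.toAffine.Equation x (-A.eval x / B.eval x) := by
    rw [WeierstrassCurve.Affine.equation_iff]
    simp only [normPoly, eval_sub, eval_mul, eval_add, eval_pow, eval_C, eval_X] at hx
    field_simp
    linear_combination hx
  refine ⟨.some _ _ (WeierstrassCurve.Affine.equation_iff_nonsingular.1 h),
    WeierstrassCurve.Affine.Point.some_ne_zero _, rfl, ?_⟩
  rw [yCoord_some]
  field_simp
  ring

/-- The zeros of a generic combination of the functions `poleFn - poleFn Q`. -/
lemma exists_zeros_of_separable {r : ℕ} {d : ℕ → ℂ} (hd : ∀ j, r < j → d j = 0) (hr : d r ≠ 0)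
    {Q : W.toAffine.Point} (hQ : Q ≠ 0)
    (hsep : (normPoly W (secA W r d Q) (oddPart r d)).Separable) :
    ∃ w : Fin (r + 2) → W.toAffine.Point, w 0 = Q ∧ (∀ i, w i ≠ 0) ∧
      (Function.Injective fun i => xCoord W (w i)) ∧ ∑ i, w i = 0 ∧
      ∀ i, ∑ j ∈ Finset.range (r + 1), d j * (poleFn W j (w i) - poleFn W j Q) = 0 := by
  set N := normPoly W (secA W r d Q) (oddPart r d)
  have hdeg : N.natDegree = r + 2 := natDegree_normPoly_sec hd hr Q
  have hN0 : N ≠ 0 := hsep.ne_zero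
  have hcard : Fintype.card N.roots.toFinset = r + 2 := by
    rw [Fintype.card_coe, Multiset.toFinset_card_of_nodup (nodup_roots hsep),
      ← (IsAlgClosed.splits N).natDegree_eq_card_roots, hdeg]
  have hQN : N.eval (xCoord W Q) = 0 := eval_normPoly_eq_zero hQ (by
    rw [eval_sec hd]
    simp)
  have hQr : xCoord W Q ∈ N.roots.toFinset := by simpa [hN0] using hQN
  let e0 := (Fintype.equivFinOfCardEq hcard).symm
  -- An enumeration of the roots that begins with x(Q).
  let e := (Equiv.swap 0 (e0.symm ⟨_, hQr⟩)).trans e0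
  have he0 : (e 0).1 = xCoord W Q := by simp [e]
  have hroot : ∀ i, N.eval (e i).1 = 0 := fun i => by
    have := (e i).2
    rw [Multiset.mem_toFinset, mem_roots hN0] at this
    exact this
  have hB : ∀ i, (oddPart r d).eval (e i).1 ≠ 0 := fun i => eval_ne_zero_of_separable hsep (hroot i)
  choose w hw hwx hwv using fun i => exists_point_of_normPoly (hroot i) (hB i)
  have hinj : Function.Injective fun i => xCoord W (w i) := fun i j hij => by
    simp only [hwx] at hij
    exact e.injective (Subtype.ext hij)
  have hv : ∀ i, (secA W r d Q).eval (xCoord W (w i)) +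
      (oddPart r d).eval (xCoord W (w i)) * yCoord W (w i) = 0 := fun i => by
    rw [hwx]
    exact hwv i
  have hv' : ∀ i, ∑ j ∈ Finset.range (r + 1), d j * (poleFn W j (w i) - poleFn W j Q) = 0 :=
    fun i => (eval_sec hd _ _).symm.trans (hv i)
  obtain ⟨u, hu, hNu⟩ := normPoly_sec_eq hd hr hw hinj hv'
  refine ⟨w, ext_coords (hw 0) hQ ((hwx 0).trans he0) ?_, hw, hinj,
    sum_eq_zero_of_normPoly hw hinj hu hNu hv, hv'⟩
  have h1 := hwv 0
  have h2 : (secA W r d Q).eval (xCoord W Q) + (oddPart r d).eval (xCoord W Q) * yCoord W Q = 0 := by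
    rw [eval_sec hd]
    simp
  rw [← he0] at h2
  -- Since the coefficient of y does not vanish over x(Q), the section determines y there, so w 0 is
  -- Q and not −Q.
  refine mul_left_cancel₀ (hB 0) ?_
  linear_combination h1 - h2

end Sections

/-! ### Symmetric functions of varying roots -/

section SymmetricFunctions

open Polynomial

variable {X : SpaceWithFunctions} {p : X}

/-- Functions that are polynomial in `m` variables, with coefficients that are regular at `p`. -/
noncomputable def SpaceWithFunctions.polyReg (X : SpaceWithFunctions) (p : X) (m : ℕ) :
    Subalgebra ℂ (X → (Fin m → ℂ) → ℂ) :=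
  Algebra.adjoin ℂ ({f | ∃ g ∈ X.regRing p, f = fun q _ => g q} ∪
    {f | ∃ i, f = fun _ v => v i})

namespace SpaceWithFunctions

lemma reg_mem_polyReg {m : ℕ} {g : X → ℂ} (hg : X.RegAt g p) :
    (fun q _ => g q) ∈ X.polyReg p m := Algebra.subset_adjoin (Or.inl ⟨g, hg, rfl⟩)

lemma coord_mem_polyReg {m : ℕ} (i : Fin m) :
    (fun _ v => v i) ∈ X.polyReg p m := Algebra.subset_adjoin (Or.inr ⟨i, rfl⟩)

/-- Evaluation of the functions that are regular at `p`, at another point. -/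
noncomputable def regEval (X : SpaceWithFunctions) (p q : X) : X.regRing p →+* ℂ :=
  (Pi.evalRingHom (fun _ : X => ℂ) q).comp (X.regRing p).toSubring.subtype

lemma regEval_apply (q : X) (f : X.regRing p) : X.regEval p q f = f.1 q := rfl

/-- Passing to formal polynomials over `regRing` makes the fundamental theorem on symmetric
polynomials applicable. -/
lemma exists_eval₂_of_mem_polyReg {m : ℕ} {f : X → (Fin m → ℂ) → ℂ} (hf : f ∈ X.polyReg p m) :
    ∃ s : MvPolynomial (Fin m) (X.regRing p), ∀ q v, f q v = s.eval₂ (X.regEval p q) v := by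
  induction hf using Algebra.adjoin_induction with
  | mem f hf =>
    rcases hf with ⟨g, hg, rfl⟩ | ⟨i, rfl⟩
    · exact ⟨MvPolynomial.C ⟨g, hg⟩, fun q v => by rw [MvPolynomial.eval₂_C, regEval_apply]⟩
    · exact ⟨MvPolynomial.X i, fun q v => by rw [MvPolynomial.eval₂_X]⟩
  | algebraMap c =>
    exact ⟨MvPolynomial.C (algebraMap ℂ _ c), fun q v => by rw [MvPolynomial.eval₂_C]; rfl⟩
  | add f g _ _ hf hg =>
    obtain ⟨s, hs⟩ := hf
    obtain ⟨t, ht⟩ := hg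
    exact ⟨s + t, fun q v => by rw [MvPolynomial.eval₂_add, ← hs, ← ht]; rfl⟩
  | mul f g _ _ hf hg =>
    obtain ⟨s, hs⟩ := hf
    obtain ⟨t, ht⟩ := hg
    exact ⟨s * t, fun q v => by rw [MvPolynomial.eval₂_mul, ← hs, ← ht]; rfl⟩

/-- A symmetric function of numbers whose elementary symmetric functions are regular is regular. -/
lemma regAt_of_symmetric {m : ℕ} {ξ : X → Fin m → ℂ}
    (hξ : ∀ k, X.RegAt (fun q => (Finset.univ.val.map (ξ q)).esymm k) p)
    {f : X → (Fin m → ℂ) → ℂ} (hf : f ∈ X.polyReg p m) {Φ : X → ℂ}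
    (hΦ : ∀ᶠ q in 𝓝 p, ∀ τ : Equiv.Perm (Fin m), f q (ξ q ∘ τ) = Φ q) : X.RegAt Φ p := by
  classical
  obtain ⟨s, hs⟩ := exists_eval₂_of_mem_polyReg hf
  -- The sum over permutations is symmetric as a formal polynomial, even if s is not, so it is a
  -- polynomial in the elementary symmetric ones. Near p it evaluates at ξ to m! times Φ.
  let S : MvPolynomial (Fin m) (X.regRing p) := ∑ τ : Equiv.Perm (Fin m), MvPolynomial.rename τ s
  have hS : S.IsSymmetric := fun σ => by
    simp only [S, map_sum, MvPolynomial.rename_rename]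
    exact Fintype.sum_equiv (Equiv.mulLeft σ) _ _ fun τ => rfl
  obtain ⟨t, ht⟩ := MvPolynomial.esymmAlgHom_fin_surjective (X.regRing p) (le_refl m) ⟨S, hS⟩
  have ht' : MvPolynomial.aeval (fun i : Fin m => MvPolynomial.esymm (Fin m) (X.regRing p) (i + 1)) t = S := by
    rw [← MvPolynomial.esymmAlgHom_apply, ht]
  let g : Fin m → X.regRing p := fun k => ⟨_, hξ (k + 1)⟩
  have key : ∀ q, S.eval₂ (X.regEval p q) (ξ q) = (MvPolynomial.aeval g t : X.regRing p).1 q := by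
    intro q
    have h1 : (MvPolynomial.eval₂Hom (X.regEval p q) (ξ q)).comp
        (MvPolynomial.aeval (R := X.regRing p) fun i : Fin m =>
          MvPolynomial.esymm (Fin m) (X.regRing p) (i + 1)).toRingHom =
        (X.regEval p q).comp (MvPolynomial.aeval (R := X.regRing p) g).toRingHom := by
      refine MvPolynomial.ringHom_ext (fun a => ?_) fun i => ?_
      · simp
      · simp only [AlgHom.toRingHom_eq_coe, RingHom.coe_comp, RingHom.coe_coe,
          Function.comp_apply, MvPolynomial.aeval_X]
        rw [regEval_apply]
        simp only [g, MvPolynomial.esymm, map_sum, map_prod, MvPolynomial.coe_eval₂Hom,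
          MvPolynomial.eval₂_X]
        rw [Finset.esymm_map_val]
    have h2 := congrArg (fun h => h t) h1
    simp only [AlgHom.toRingHom_eq_coe, RingHom.coe_comp, RingHom.coe_coe, Function.comp_apply] at h2
    rw [ht', regEval_apply] at h2
    exact h2
  refine regAt_of_mul_eq (h := fun _ => (m.factorial : ℂ)) (MvPolynomial.aeval g t : X.regRing p).2
    (X.regAt_const _ p) (by exact_mod_cast m.factorial_ne_zero) ?_
  filter_upwards [hΦ] with q hq
  rw [← key q]
  simp only [S, MvPolynomial.eval₂_sum, MvPolynomial.eval₂_rename]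
  rw [Finset.sum_congr rfl fun (τ : Equiv.Perm (Fin m)) _ =>
    (hs q (ξ q ∘ τ)).symm.trans (hq τ), Finset.sum_const,
    Finset.card_univ, Fintype.card_perm, Fintype.card_fin, nsmul_eq_mul, mul_comm]

/-- The coefficients of the polynomials `f q` are regular at `p`. -/
def RegPoly (X : SpaceWithFunctions) (f : X → ℂ[X]) (p : X) : Prop :=
  ∀ k, X.RegAt (fun q => (f q).coeff k) p

lemma RegPoly.sub {f g : X → ℂ[X]} (hf : X.RegPoly f p) (hg : X.RegPoly g p) :
    X.RegPoly (fun q => f q - g q) p := fun k => by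
  simp only [coeff_sub]
  exact regAt_sub (hf k) (hg k)

lemma regAt_fun_sum {ι : Type*} {s : Finset ι} {f : ι → X → ℂ}
    (hf : ∀ i ∈ s, X.RegAt (f i) p) : X.RegAt (fun q => ∑ i ∈ s, f i q) p := by
  have := regAt_sum hf
  rwa [Finset.sum_fn] at this

lemma regAt_fun_prod {ι : Type*} {s : Finset ι} {f : ι → X → ℂ}
    (hf : ∀ i ∈ s, X.RegAt (f i) p) : X.RegAt (fun q => ∏ i ∈ s, f i q) p := by
  have := regAt_prod hf
  rwa [Finset.prod_fn] at this

lemma RegPoly.mul {f g : X → ℂ[X]} (hf : X.RegPoly f p) (hg : X.RegPoly g p) :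
    X.RegPoly (fun q => f q * g q) p := fun k => by
  simp only [coeff_mul]
  exact regAt_fun_sum fun i _ => X.regAt_mul (hf _) (hg _)

lemma RegPoly.const (f : ℂ[X]) : X.RegPoly (fun _ => f) p := fun _ => X.regAt_const _ p

lemma RegPoly.C {c : X → ℂ} (hc : X.RegAt c p) : X.RegPoly (fun q => C (c q)) p := fun k => by
  simp only [coeff_C]
  split_ifs
  exacts [hc, X.regAt_const _ p]

lemma RegPoly.sum {ι : Type*} {s : Finset ι} {f : ι → X → ℂ[X]} (hf : ∀ i ∈ s, X.RegPoly (f i) p) :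
    X.RegPoly (fun q => ∑ i ∈ s, f i q) p := fun k => by
  simp only [finsetSum_coeff]
  exact regAt_fun_sum fun i hi => hf i hi k

lemma RegPoly.derivative {f : X → ℂ[X]} (hf : X.RegPoly f p) :
    X.RegPoly (fun q => Polynomial.derivative (f q)) p := fun k => by
  simp only [coeff_derivative]
  exact X.regAt_mul (hf _) (X.regAt_const _ p)

lemma RegPoly.regAt_eval {f : X → ℂ[X]} (hf : X.RegPoly f p) {c : X → ℂ} (hc : X.RegAt c p) {n : ℕ}
    (hn : ∀ᶠ q in 𝓝 p, (f q).natDegree < n) : X.RegAt (fun q => (f q).eval (c q)) p := by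
  refine X.regAt_congr ?_ (regAt_fun_sum (s := Finset.range n)
    fun k _ => X.regAt_mul (hf k) (regAt_pow hc k))
  filter_upwards [hn] with q hq
  exact (eval_eq_sum_range' hq (c q)).symm

/-- Having no multiple zeros is an open condition on polynomials of fixed degree. -/
lemma RegPoly.eventually_separable {f : X → ℂ[X]} (hf : X.RegPoly f p) {n : ℕ}
    (hn : ∀ᶠ q in 𝓝 p, (f q).natDegree = n + 1) (h : (f p).Separable) :
    ∀ᶠ q in 𝓝 p, (f q).Separable := by
  have hnd : ∀ q, (f q).natDegree = n + 1 → (Polynomial.derivative (f q)).natDegree = n := fun q hq => by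
    rw [natDegree_derivative, hq, Nat.add_sub_cancel]
  -- The Sylvester matrix has fixed size n + 1 + n near p, so the resultant is a polynomial in the
  -- coefficients; it vanishes exactly when there is a multiple zero.
  have hreg : X.RegAt (fun q => resultant (f q) (Polynomial.derivative (f q)) (n + 1) n) p := by
    simp only [resultant, Matrix.det_apply]
    refine regAt_fun_sum fun σ _ => ?_
    have h1 : X.RegAt (fun q => ∏ i, sylvester (f q) (Polynomial.derivative (f q)) (n + 1) n (σ i) i) p := by
      refine regAt_fun_prod fun i _ => ?_
      simp only [sylvester, Matrix.of_apply]
      refine Fin.addCases (fun j => ?_) (fun j => ?_) i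
      · simp only [Fin.addCases_left]
        split_ifs
        exacts [hf.derivative _, X.regAt_const _ p]
      · simp only [Fin.addCases_right]
        split_ifs
        exacts [hf _, X.regAt_const _ p]
    simp only [Units.smul_def, zsmul_eq_mul]
    exact X.regAt_mul (X.regAt_const _ p) h1
  have hsep : ∀ q, (f q).natDegree = n + 1 →
      ((f q).Separable ↔ resultant (f q) (Polynomial.derivative (f q)) (n + 1) n ≠ 0) := fun q hq => by
    have h1 : resultant (f q) (Polynomial.derivative (f q)) (n + 1) n =
        resultant (f q) (Polynomial.derivative (f q)) := by rw [hnd q hq, hq]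
    have h0 : f q ≠ 0 := fun h => by rw [h, natDegree_zero] at hq; omega
    rw [h1, Ne, resultant_eq_zero_iff, Polynomial.Separable]
    tauto
  filter_upwards [hn, eventually_ne_zero hreg ((hsep p hn.self_of_nhds).1 h)] with q hq hq0
  exact (hsep q hq).2 hq0

/-- The elementary symmetric functions of the remaining zeros of a polynomial, if one zero is
regular. -/
lemma RegPoly.regAt_esymm {f : X → ℂ[X]} (hf : X.RegPoly f p) {m : ℕ} {u a : X → ℂ} {ξ : X → Fin m → ℂ}
    (ha : X.RegAt a p) (hu : ∀ᶠ q in 𝓝 p, u q ≠ 0)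
    (he : ∀ᶠ q in 𝓝 p, f q = Polynomial.C (u q) * ((Polynomial.X - Polynomial.C (a q)) *
      ∏ i, (Polynomial.X - Polynomial.C (ξ q i)))) (k : ℕ) :
    X.RegAt (fun q => (Finset.univ.val.map (ξ q)).esymm k) p := by
  by_cases hk : k ≤ m
  swap
  · have : (fun q => (Finset.univ.val.map (ξ q)).esymm k) = fun _ => 0 := by
      ext q
      rw [Finset.esymm_map_val, Finset.powersetCard_eq_empty.2 (by simpa using hk), Finset.sum_empty]
    rw [this]
    exact X.regAt_const _ p
  have hdeg : ∀ q, u q ≠ 0 → f q = Polynomial.C (u q) * ((Polynomial.X - Polynomial.C (a q)) *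
      ∏ i, (Polynomial.X - Polynomial.C (ξ q i))) → (f q).natDegree = m + 1 ∧ (f q).coeff (m + 1) = u q := by
    intro q hu h
    have hm := (monic_X_sub_C (a q)).mul (monic_prod_X_sub_C (ξ q) Finset.univ)
    have hn : ((Polynomial.X - Polynomial.C (a q)) *
        ∏ i, (Polynomial.X - Polynomial.C (ξ q i))).natDegree = m + 1 := by
      rw [(monic_X_sub_C (a q)).natDegree_mul (monic_prod_X_sub_C (ξ q) Finset.univ),
        natDegree_X_sub_C, natDegree_finsetProd_X_sub_C_eq_card, Finset.card_univ,
        Fintype.card_fin, add_comm]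
    have hc := hm.coeff_natDegree
    rw [hn] at hc
    rw [h, natDegree_C_mul hu, coeff_C_mul, hc, mul_one]
    exact ⟨hn, rfl⟩
  -- The sum is the coefficient of degree m − k of the quotient of f q by X − a q, in the closed
  -- form of synthetic division. By Vieta it equals (−1)^k times the leading coefficient u q times
  -- the k-th elementary symmetric function.
  refine regAt_of_mul_eq (h := fun q => (-1) ^ k * (f q).coeff (m + 1)) (g := fun q =>
    ∑ i ∈ Finset.Icc (m - k + 1) (m + 1), a q ^ (i - (m - k + 1)) * (f q).coeff i) ?_ ?_ ?_ ?_
  · exact regAt_fun_sum fun i _ => X.regAt_mul (regAt_pow ha _) (hf i)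
  · exact X.regAt_mul (X.regAt_const _ p) (hf _)
  · have h1 := he.self_of_nhds
    have h2 := hu.self_of_nhds
    rw [(hdeg p h2 h1).2]
    exact mul_ne_zero (pow_ne_zero _ (by norm_num)) h2
  · filter_upwards [he, hu] with q hq hu
    obtain ⟨h1, h2⟩ := hdeg q hu hq
    have h3 : f q /ₘ (Polynomial.X - Polynomial.C (a q)) =
        Polynomial.C (u q) * ∏ i, (Polynomial.X - Polynomial.C (ξ q i)) := by
      rw [hq, mul_left_comm, mul_divByMonic_cancel_left _ (monic_X_sub_C _)]
    have h4 := coeff_divByMonic_X_sub_C (f q) (a q) (m - k)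
    rw [h1, h3, coeff_C_mul] at h4
    have h5 := Multiset.prod_X_sub_C_coeff (Finset.univ.val.map (ξ q)) (k := m - k) (by simp)
    rw [Multiset.map_map] at h5
    have h6 : Multiset.card (Finset.univ.val.map (ξ q)) - (m - k) = k := by
      simp
      omega
    rw [h6] at h5
    change (∏ i, (Polynomial.X - Polynomial.C (ξ q i))).coeff (m - k) = _ at h5
    rw [← h4, h2, h5]
    ring

end SpaceWithFunctions

end SymmetricFunctions

/-! ### The correspondence between the diagonal divisor and a projective bundle -/

section Birational

variable {X Y : SpaceWithFunctions}

/-- A correspondence between nonempty open subsets of irreducible spaces that is bijective, with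
morphisms in both directions, gives a birational equivalence. -/
lemma birational_of_relation [PreirreducibleSpace X] [PreirreducibleSpace Y] (M : X → Y → Prop)
    (hne : ∃ x y, M x y) (h1 : ∀ x y y', M x y → M x y' → y = y')
    (h2 : ∀ x x' y, M x y → M x' y → x = x') (hU : IsOpen {x | ∃ y, M x y})
    (hV : IsOpen {y | ∃ x, M x y})
    (hF : ∀ f : X → Y, (∀ x y, M x y → f x = y) → ∀ x y, M x y → IsMorphismAt X Y f x)
    (hG : ∀ g : Y → X, (∀ x y, M x y → g y = x) → ∀ x y, M x y → IsMorphismAt Y X g y) :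
    Birational X Y := by
  classical
  obtain ⟨x0, y0, h0⟩ := hne
  -- The values outside the domains are arbitrary; `hF` and `hG` apply to all functions that extend
  -- the correspondence.
  let f : X → Y := fun x => if h : ∃ y, M x y then h.choose else y0
  let g : Y → X := fun y => if h : ∃ x, M x y then h.choose else x0
  have hf : ∀ x y, M x y → f x = y := fun x y h => by
    have hx : ∃ y, M x y := ⟨y, h⟩
    simp only [f, dif_pos hx]
    exact h1 _ _ _ hx.choose_spec h
  have hg : ∀ x y, M x y → g y = x := fun x y h => by
    have hx : ∃ x, M x y := ⟨x, h⟩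
    simp only [g, dif_pos hx]
    exact h2 _ _ _ hx.choose_spec h
  have hfM : ∀ x, (∃ y, M x y) → M x (f x) := fun x ⟨y, h⟩ => (hf x y h).symm ▸ h
  have hgM : ∀ y, (∃ x, M x y) → M (g y) y := fun y ⟨x, h⟩ => (hg x y h).symm ▸ h
  refine ⟨{x | ∃ y, M x y}, {y | ∃ x, M x y}, hU, hU.dense ⟨x0, y0, h0⟩, hV,
    hV.dense ⟨y0, x0, h0⟩, ⟨fun x => ⟨f x.1, x.1, hfM _ x.2⟩, fun y => ⟨g y.1, y.1, hgM _ y.2⟩,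
      fun x => Subtype.ext (hg _ _ (hfM _ x.2)), fun y => Subtype.ext (hf _ _ (hgM _ y.2))⟩, ?_, ?_⟩
  · refine isMorphism_iff.2 fun x => isMorphismAt_into_sub ?_
    exact (hF f hf x.1 _ (hfM _ x.2)).comp (isMorphismAt_val x)
  · refine isMorphism_iff.2 fun y => isMorphismAt_into_sub ?_
    exact (hG g hg _ y.1 (hgM _ y.2)).comp (isMorphismAt_val y)

lemma regAt_det {p : X} {n : ℕ} {M : X → Matrix (Fin n) (Fin n) ℂ}
    (hM : ∀ i j, X.RegAt (fun q => M q i j) p) : X.RegAt (fun q => (M q).det) p := by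
  simp only [Matrix.det_apply, Units.smul_def, zsmul_eq_mul]
  exact regAt_fun_sum fun σ _ => X.regAt_mul (X.regAt_const _ p) (regAt_fun_prod fun i _ => hM _ _)

/-- The solution of a linear system with regular coefficients is regular if it is unique. -/
lemma exists_regAt_solution {p : X} {m n : ℕ} {M : X → Matrix (Fin m) (Fin n) ℂ} {b : X → Fin m → ℂ}
    (hM : ∀ i j, X.RegAt (fun q => M q i j) p) (hb : ∀ i, X.RegAt (fun q => b q i) p)
    (hinj : ∀ c, (M p).mulVec c = 0 → c = 0) (j : Fin n) :
    ∃ φ, X.RegAt φ p ∧ ∀ᶠ q in 𝓝 p, ∀ c, (M q).mulVec c = b q → c j = φ q := by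
  -- L is a left inverse of M p. Near p the square matrix L M q stays invertible, and Cramer's rule
  -- for the system multiplied by L gives c.
  obtain ⟨L, hL⟩ := LinearMap.exists_leftInverse_of_injective (Matrix.toLin' (M p))
    (LinearMap.ker_eq_bot'.2 fun c hc => hinj c (by simpa using hc))
  let L' := LinearMap.toMatrix' L
  have hLM : L' * M p = 1 := by
    rw [← LinearMap.toMatrix'_toLin' (M p), ← LinearMap.toMatrix'_comp, hL, LinearMap.toMatrix'_id]
  have hK : ∀ i j, X.RegAt (fun q => (L' * M q) i j) p := fun i j => by
    simp only [Matrix.mul_apply]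
    exact regAt_fun_sum fun k _ => X.regAt_mul (X.regAt_const _ p) (hM _ _)
  have hdet := regAt_det hK
  have hdet0 : (L' * M p).det ≠ 0 := by rw [hLM, Matrix.det_one]; exact one_ne_zero
  refine ⟨fun q => ((L' * M q).adjugate.mulVec (L'.mulVec (b q))) j / (L' * M q).det, ?_, ?_⟩
  · refine regAt_div ?_ hdet hdet0
    simp only [Matrix.mulVec, dotProduct]
    refine regAt_fun_sum fun i _ => X.regAt_mul ?_
      (regAt_fun_sum fun k _ => X.regAt_mul (X.regAt_const _ p) (hb k))
    simp only [Matrix.adjugate_apply]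
    refine regAt_det fun a b => ?_
    by_cases h : a = i
    · subst h
      simp only [Matrix.updateRow_self]
      exact X.regAt_const _ p
    · simp only [Matrix.updateRow_ne h]
      exact hK _ _
  · filter_upwards [eventually_ne_zero hdet hdet0] with q hq c hc
    rw [eq_div_iff hq, ← hc, Matrix.mulVec_mulVec, Matrix.mulVec_mulVec, Matrix.mul_assoc, Matrix.adjugate_mul,
      Matrix.smul_mulVec, Matrix.one_mulVec, Pi.smul_apply, smul_eq_mul, mul_comm]

end Birational

/-! ### Tuples with a double entry, and sections vanishing at the rest -/

section Correspondence

open Polynomial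

variable {W : WeierstrassCurve ℂ} {r : ℕ}

/-- The tuple `(x₀ + x₁, x₂, x₃, …)`. -/
noncomputable def restTuple (x : Fin (r + 3) → W.toAffine.Point) : Fin (r + 2) → W.toAffine.Point :=
  Fin.cons (x 0 + x 1) fun i : Fin (r + 1) => x i.succ.succ

@[simp] lemma restTuple_zero (x : Fin (r + 3) → W.toAffine.Point) : restTuple x 0 = x 0 + x 1 := rfl

lemma sum_restTuple (x : Fin (r + 3) → W.toAffine.Point) : ∑ i, restTuple x i = ∑ i, x i := by
  rw [Fin.sum_univ_succ, Fin.sum_univ_succ (f := x), Fin.sum_univ_succ (f := fun i => x i.succ),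
    restTuple_zero, add_assoc]
  rfl

/-- The tuples for which we describe the correspondence. -/
structure GoodTuple (x : Fin (r + 3) → W.toAffine.Point) : Prop where
  ne_zero : ∀ i, x i ≠ 0
  rest_ne_zero : ∀ i, restTuple x i ≠ 0
  rest_injective : Function.Injective fun i => xCoord W (restTuple x i)
  ne_rest : ∀ i, xCoord W (x 0) ≠ xCoord W (restTuple x i)

lemma GoodTuple.xCoord_ne {x : Fin (r + 3) → W.toAffine.Point} (h : GoodTuple x) (h01 : x 0 = x 1)
    (k : Fin (r + 1)) (j : Fin (r + 3)) (hj : j ≠ k.succ.succ) :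
    xCoord W (x j) ≠ xCoord W (x k.succ.succ) := by
  refine Fin.cases (fun _ => ?_) (fun j => ?_) j hj
  · exact h.ne_rest k.succ
  · refine Fin.cases (fun _ => ?_) (fun j hj => ?_) j
    · change xCoord W (x 1) ≠ _
      rw [← h01]
      exact h.ne_rest k.succ
    · exact fun he => hj (congrArg Fin.succ (h.rest_injective he))

lemma GoodTuple.distinctExcept {x : Fin (r + 3) → W.toAffine.Point} (h : GoodTuple x)
    (h01 : x 0 = x 1) : DistinctExcept (k := r + 1) x := by
  intro i j hij hn
  refine Fin.cases (fun hij _ => absurd hij (Fin.not_lt_zero _)) (fun j hij hn => ?_) j hij hn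
  refine Fin.cases (fun hij hn => ?_) (fun j hij hn => ?_) j hij hn
  · refine absurd ⟨?_, rfl⟩ hn
    exact (Fin.lt_one_iff _).1 hij
  · exact h.xCoord_ne h01 j i hij.ne

lemma isMorphismAt_restTuple (i : Fin (r + 2)) (x : Fin (r + 3) → W.toAffine.Point) [W.IsElliptic] :
    IsMorphismAt ((ellipticCurve W).power (r + 3)) (ellipticCurve W)
      (fun x : Fin (r + 3) → W.toAffine.Point => restTuple x i) x := by
  refine Fin.cases ?_ (fun i => ?_) i
  · exact (isMorphismAt_coord 0 x).add (isMorphismAt_coord 1 x)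
  · exact isMorphismAt_coord i.succ.succ x

/-- The function with coefficients `d` vanishes at the points `w`. -/
structure IsSection (w : Fin (r + 2) → W.toAffine.Point) (d : ℕ → ℂ) : Prop where
  zero_of_lt : ∀ j, r < j → d j = 0
  leading : d r = 1
  vanish : ∀ i, ∑ j ∈ Finset.range (r + 1), d j * (poleFn W j (w i) - poleFn W j (w 0)) = 0

/-- The difference of two normalized sections has no term of index r, hence pole order at most r +
1, but it vanishes at r + 2 points. -/
lemma IsSection.unique {w : Fin (r + 2) → W.toAffine.Point} {d d' : ℕ → ℂ} (hw : ∀ i, w i ≠ 0)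
    (hx : Function.Injective fun i => xCoord W (w i)) (h : IsSection w d) (h' : IsSection w d') :
    d = d' := by
  refine sub_eq_zero.1 (eq_zero_of_eval_sec (r := r) (d := d - d') (Q := w 0) (fun j hj => ?_) hw hx fun i => ?_)
  · rcases hj.eq_or_lt with rfl | hj
    · rw [Pi.sub_apply, h.leading, h'.leading, sub_self]
    · rw [Pi.sub_apply, h.zero_of_lt j hj, h'.zero_of_lt j hj, sub_self]
  · simp only [Pi.sub_apply, sub_mul, Finset.sum_sub_distrib]
    have h1 := h.vanish i
    have h2 := h'.vanish i
    rw [h1, h2, sub_zero]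

/-- The double entry is the only repeated one, hence intrinsic to the class. The remaining entries
are merely permuted, and the conditions on a section do not depend on their order. -/
lemma GoodTuple.eq_of_toSym_eq {x y : Fin (r + 3) → W.toAffine.Point} (hx : GoodTuple x)
    (hx01 : x 0 = x 1) (hy : GoodTuple y) (hy01 : y 0 = y 1)
    (h : toSym W (r + 3) x = toSym W (r + 3) y) :
    y 0 = x 0 ∧ ∀ d, IsSection (restTuple x) d → IsSection (restTuple y) d := by
  obtain ⟨σ, rfl⟩ := toSym_eq_iff.1 h.symm
  have key : ∀ i j, i ≠ j → x (σ i) = x (σ j) → x (σ i) = x 0 := by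
    intro i j hij he
    have hij' : σ i ≠ σ j := fun h => hij (σ.injective h)
    revert hij' he
    refine Fin.cases (fun _ _ => rfl) (fun k => ?_) (σ i)
    refine Fin.cases (fun _ _ => hx01.symm) (fun k he hne => ?_) k
    exact absurd (congrArg (xCoord W) he).symm (hx.xCoord_ne hx01 k _ hne.symm)
  have h0 : x (σ 0) = x 0 := key 0 1 (by simp [Fin.ext_iff]) hy01
  refine ⟨h0, fun d hd => ⟨hd.zero_of_lt, hd.leading, fun i => ?_⟩⟩
  have hQ : restTuple (x ∘ σ) 0 = restTuple x 0 := by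
    rw [restTuple_zero, restTuple_zero, ← hy01, ← hx01, Function.comp_apply, h0]
  rw [hQ]
  refine Fin.cases ?_ (fun i => ?_) i
  · rw [hQ]
    exact hd.vanish 0
  · have hne : x (σ i.succ.succ) ≠ x 0 := fun he => by
      refine hy.ne_rest i.succ (congrArg (xCoord W) ?_)
      change x (σ 0) = x (σ i.succ.succ)
      rw [h0, he]
    change ∑ j ∈ Finset.range (r + 1), d j * (poleFn W j (x (σ i.succ.succ)) - _) = 0
    revert hne
    refine Fin.cases (fun hne => absurd rfl hne) (fun k => ?_) (σ i.succ.succ)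
    refine Fin.cases (fun hne => absurd hx01.symm hne) (fun k _ => ?_) k
    exact hd.vanish k.succ

variable [W.IsElliptic]

lemma regAt_poleFn {X : SpaceWithFunctions} {p : X} {φ : X → W.toAffine.Point}
    (hφ : IsMorphismAt X (ellipticCurve W) φ p) (h0 : φ p ≠ 0) (j : ℕ) :
    X.RegAt (fun q => poleFn W j (φ q)) p := by
  simp only [poleFn]
  split_ifs
  · exact regAt_pow (hφ.regAt_xCoord h0) _
  · exact X.regAt_mul (regAt_pow (hφ.regAt_xCoord h0) _) (hφ.regAt_yCoord h0)

lemma SpaceWithFunctions.IsMorphismAt.eventually_ne_zero {X : SpaceWithFunctions} {p : X}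
    {φ : X → W.toAffine.Point} (hφ : IsMorphismAt X (ellipticCurve W) φ p) (h0 : φ p ≠ 0) :
    ∀ᶠ q in 𝓝 p, φ q ≠ 0 :=
  hφ.1.eventually (eventually_ne_zero_point h0)

lemma GoodTuple.eventually {x : Fin (r + 3) → W.toAffine.Point} (h : GoodTuple x) :
    ∀ᶠ y : Fin (r + 3) → W.toAffine.Point in @nhds ((ellipticCurve W).power (r + 3)) _ x,
      GoodTuple y := by
  have h1 : ∀ᶠ y : Fin (r + 3) → W.toAffine.Point in @nhds ((ellipticCurve W).power (r + 3)) _ x,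
      ∀ i, y i ≠ 0 := eventually_all.2 fun i => (isMorphismAt_coord i x).eventually_ne_zero (h.ne_zero i)
  have h2 : ∀ᶠ y : Fin (r + 3) → W.toAffine.Point in @nhds ((ellipticCurve W).power (r + 3)) _ x,
      ∀ i, restTuple y i ≠ 0 :=
    eventually_all.2 fun i => (isMorphismAt_restTuple i x).eventually_ne_zero (h.rest_ne_zero i)
  have h3 : ∀ᶠ y : Fin (r + 3) → W.toAffine.Point in @nhds ((ellipticCurve W).power (r + 3)) _ x,
      ∀ i, xCoord W (y 0) - xCoord W (restTuple y i) ≠ 0 := eventually_all.2 fun i =>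
    SpaceWithFunctions.eventually_ne_zero (X := (ellipticCurve W).power (r + 3))
      (regAt_sub ((isMorphismAt_coord 0 x).regAt_xCoord (h.ne_zero 0))
      ((isMorphismAt_restTuple i x).regAt_xCoord (h.rest_ne_zero i))) (sub_ne_zero.2 (h.ne_rest i))
  have h4 : ∀ᶠ y : Fin (r + 3) → W.toAffine.Point in @nhds ((ellipticCurve W).power (r + 3)) _ x,
      ∀ i j, i ≠ j → xCoord W (restTuple y i) - xCoord W (restTuple y j) ≠ 0 :=
    eventually_all.2 fun i => eventually_all.2 fun j => by
      by_cases hij : i = j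
      · exact Eventually.of_forall fun _ h => absurd hij h
      · filter_upwards [SpaceWithFunctions.eventually_ne_zero (X := (ellipticCurve W).power (r + 3))
          (regAt_sub ((isMorphismAt_restTuple i x).regAt_xCoord (h.rest_ne_zero i))
          ((isMorphismAt_restTuple j x).regAt_xCoord (h.rest_ne_zero j)))
          (sub_ne_zero.2 (h.rest_injective.ne hij))] with y hy _ using hy
  filter_upwards [h1, h2, h3, h4] with y hy1 hy2 hy3 hy4
  refine ⟨hy1, hy2, fun i j hij => ?_, fun i => sub_ne_zero.1 (hy3 i)⟩
  by_contra hne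
  exact hy4 i j hne (sub_eq_zero.2 hij)

lemma GoodTuple.exists_isSection {x : Fin (r + 3) → W.toAffine.Point} (h : GoodTuple x)
    (hsum : ∑ i, x i = 0) : ∃ d, IsSection (restTuple x) d := by
  obtain ⟨d, h1, h2, h3⟩ := exists_coeff_of_sum_eq_zero h.rest_ne_zero h.rest_injective
    ((sum_restTuple x).trans hsum)
  exact ⟨d, h1, h2, h3⟩

/-- The coefficients other than the leading one solve an overdetermined linear system with regular
coefficients, and its matrix is injective by `eq_zero_of_eval_sec`. -/
lemma GoodTuple.exists_regAt_coeff {x : Fin (r + 3) → W.toAffine.Point} (h : GoodTuple x) (j : ℕ)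
    (hj : j < r) : ∃ φ, ((ellipticCurve W).power (r + 3)).RegAt φ x ∧
      ∀ᶠ y : Fin (r + 3) → W.toAffine.Point in @nhds ((ellipticCurve W).power (r + 3)) _ x,
        ∀ d, IsSection (restTuple y) d → d j = φ y := by
  have hreg : ∀ (i : Fin (r + 2)) (j : ℕ), ((ellipticCurve W).power (r + 3)).RegAt
      (fun y : Fin (r + 3) → W.toAffine.Point =>
        poleFn W j (restTuple y i) - poleFn W j (restTuple y 0)) x := fun i j =>
    regAt_sub (regAt_poleFn (isMorphismAt_restTuple i x) (h.rest_ne_zero i) j)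
      (regAt_poleFn (isMorphismAt_restTuple 0 x) (h.rest_ne_zero 0) j)
  have hinj : ∀ c : Fin r → ℂ, (Matrix.of fun (i : Fin (r + 2)) (j : Fin r) =>
      poleFn W j (restTuple x i) - poleFn W j (restTuple x 0)).mulVec c = 0 → c = 0 := by
    intro c hc
    have h1 := eq_zero_of_eval_sec (r := r) (d := fun k => if hk : k < r then c ⟨k, hk⟩ else 0)
      (Q := restTuple x 0) (fun k hk => dif_neg (not_lt.2 hk)) h.rest_ne_zero h.rest_injective
      fun i => by
        have h2 := congrFun hc i
        simp only [Matrix.mulVec, dotProduct, Matrix.of_apply] at h2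
        rw [Finset.sum_range_succ, dif_neg (lt_irrefl r), zero_mul, add_zero, Finset.sum_range]
        simp only [Fin.is_lt, dif_pos, Fin.eta]
        simp only [mul_comm (c _)]
        exact h2
    ext k
    have h3 := congrFun h1 k
    simpa using h3
  obtain ⟨φ, hφ, hev⟩ := exists_regAt_solution (X := (ellipticCurve W).power (r + 3)) (p := x)
    (M := fun (y : Fin (r + 3) → W.toAffine.Point) => Matrix.of fun (i : Fin (r + 2)) (j : Fin r) =>
      poleFn W j (restTuple y i) - poleFn W j (restTuple y 0))
    (b := fun (y : Fin (r + 3) → W.toAffine.Point) i =>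
      -(poleFn W r (restTuple y i) - poleFn W r (restTuple y 0)))
    (fun i j => hreg i j) (fun i => regAt_neg (hreg i r)) hinj ⟨j, hj⟩
  refine ⟨φ, hφ, ?_⟩
  filter_upwards [hev] with y hy d hd
  refine hy (fun k : Fin r => d k) (funext fun i => ?_)
  have h1 := hd.vanish i
  rw [Finset.sum_range_succ, hd.leading, one_mul, Finset.sum_range] at h1
  simp only [Matrix.mulVec, dotProduct, Matrix.of_apply]
  rw [eq_neg_iff_add_eq_zero, ← h1]
  simp only [mul_comm]

/-- Near a point of the diagonal divisor, the points of the divisor come from tuples near a given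
one. -/
lemma eventually_exists_toSym_eq {k : ℕ} {x : Fin (k + 2) → W.toAffine.Point} (hx : ∀ i, x i ≠ 0)
    (hd : DistinctExcept x) {s : diagonalSpace W (k + 2)}
    (hs : toSym W (k + 2) x = diagonalVal s) {P : (Fin (k + 2) → W.toAffine.Point) → Prop}
    (hP : ∀ᶠ y : Fin (k + 2) → W.toAffine.Point in @nhds ((ellipticCurve W).power (k + 2)) _ x, P y) :
    ∀ᶠ t in 𝓝 s, ∃ y, P y ∧ y 0 = y 1 ∧ toSym W (k + 2) y = diagonalVal t := by
  obtain ⟨l, hl, hl0, hsub⟩ := (isChart_affinePower (W := W) (k + 2)).exists_basic x hx _ hP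
  change (Fin (k + 2) → W.toAffine.Point) → ℂ at l
  obtain ⟨e, hem, he0, hev⟩ := exists_separating hx
  obtain ⟨δ, hδ, hδ0⟩ := exists_distinctExcept_fun (W := W) k
  have hs' : diagonalVal s ∈ {s : Sym W.toAffine.Point (k + 2) |
      ∀ x, toSym W (k + 2) x = s → ∀ i, x i ≠ 0} := by
    intro y hy i
    obtain ⟨σ, rfl⟩ := toSym_eq_iff.1 (hy.trans hs.symm)
    exact hx _
  -- The weights are those of `regAt_diagonalSpace`. Where the symmetrized function is nonzero, some
  -- ordering of the point has both l and δ nonzero.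
  have hG := (isMorphismAt_diagonalVal s).2 _ (isChart_symPower.reg _
    (symmetrize_mem (mul_mem hem (mul_mem hl hδ))) _ hs')
  have hG0 : symmetrize (e * (l * δ)) (diagonalVal s) ≠ 0 := by
    rw [← hs]
    exact symmetrize_mul_ne_zero he0 hev (mul_ne_zero hl0 ((hδ0 x).2 hd))
  filter_upwards [(isMorphismAt_diagonalVal s).1.eventually
    (isChart_symPower.isOpen.eventually_mem hs'), SpaceWithFunctions.eventually_ne_zero hG hG0] with t ht ht0
  obtain ⟨y, hy⟩ := toSym_surjective (diagonalVal t)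
  change symmetrize (e * (l * δ)) (diagonalVal t) ≠ 0 at ht0
  rw [← hy, symmetrize_toSym] at ht0
  obtain ⟨σ, -, hσ⟩ := Finset.exists_ne_zero_of_sum_ne_zero ht0
  have hyσ : toSym W (k + 2) (y ∘ σ) = diagonalVal t := (toSym_comp_perm σ y).trans hy
  have h1 := right_ne_zero_of_mul hσ
  obtain ⟨i, j, hij, hyij⟩ := (mem_diagonalDivisor_iff hyσ).1 t.2
  exact ⟨y ∘ σ, hsub _ (fun i => ht y hy _) (left_ne_zero_of_mul h1),
    ((hδ0 _).1 (right_ne_zero_of_mul h1)).eq hij hyij, hyσ⟩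

end Correspondence

/-! ### Parameters: a point of the curve and a section up to scaling -/

section Parameters

open Polynomial

variable {W : WeierstrassCurve ℂ} {r : ℕ}

/-- The coefficients given by a point of projective space, normalized so that the last is `1`. -/
noncomputable def coefOf (p : ℙ ℂ (Fin (r + 1) → ℂ)) (j : ℕ) : ℂ :=
  if h : j < r + 1 then projRatio (Fin.last r) ⟨j, h⟩ p else 0

lemma coefOf_of_lt (p : ℙ ℂ (Fin (r + 1) → ℂ)) (j : ℕ) (hj : r < j) : coefOf p j = 0 :=
  dif_neg (by omega)

lemma coefOf_self {p : ℙ ℂ (Fin (r + 1) → ℂ)} (h : p.rep (Fin.last r) ≠ 0) : coefOf p r = 1 := by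
  rw [coefOf, dif_pos (Nat.lt_succ_self r)]
  exact div_self h

lemma coefOf_val (p : ℙ ℂ (Fin (r + 1) → ℂ)) (j : Fin (r + 1)) :
    coefOf p j = projRatio (Fin.last r) j p := dif_pos j.2

lemma coefOf_mk {d : ℕ → ℂ} (hd : ∀ j, r < j → d j = 0) (hr : d r = 1)
    (hv : (fun j : Fin (r + 1) => d j) ≠ 0) : coefOf (Projectivization.mk ℂ _ hv) = d := by
  ext j
  by_cases h : j < r + 1
  · rw [coefOf, dif_pos h, projRatio_mk]
    simp [hr]
  · rw [coefOf, dif_neg h, hd j (by omega)]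

lemma eq_of_coefOf_eq {p p' : ℙ ℂ (Fin (r + 1) → ℂ)} (hp : p.rep (Fin.last r) ≠ 0)
    (hp' : p'.rep (Fin.last r) ≠ 0) (h : coefOf p = coefOf p') : p = p' := by
  rw [← p.mk_rep, ← p'.mk_rep, Projectivization.mk_eq_mk_iff']
  refine ⟨p.rep (Fin.last r) / p'.rep (Fin.last r), funext fun j => ?_⟩
  have h1 := congrFun h j
  rw [coefOf_val, coefOf_val, projRatio, projRatio, div_eq_div_iff hp hp'] at h1
  rw [Pi.smul_apply, smul_eq_mul, div_mul_eq_mul_div, div_eq_iff hp', h1]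
  ring

/-- The norm of the section of which the rest of the tuple are the zeros. -/
noncomputable def paramPoly (q : W.toAffine.Point × ℙ ℂ (Fin (r + 1) → ℂ)) : ℂ[X] :=
  normPoly W (secA W r (coefOf q.2) (q.1 + q.1)) (oddPart r (coefOf q.2))

/-- The parameters for which we describe the correspondence. -/
structure GoodParam (q : W.toAffine.Point × ℙ ℂ (Fin (r + 1) → ℂ)) : Prop where
  ne_zero : q.1 ≠ 0
  add_ne_zero : q.1 + q.1 ≠ 0
  rep_ne_zero : q.2.rep (Fin.last r) ≠ 0
  separable : (paramPoly q).Separable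
  eval_ne_zero : (paramPoly q).eval (xCoord W q.1) ≠ 0

/-- The tuple `x` has the parameter `q`. -/
structure HasParam (x : Fin (r + 3) → W.toAffine.Point)
    (q : W.toAffine.Point × ℙ ℂ (Fin (r + 1) → ℂ)) : Prop where
  good : GoodTuple x
  fst_eq : x 0 = q.1
  snd_eq : x 1 = q.1
  rep_ne_zero : q.2.rep (Fin.last r) ≠ 0
  isSection : IsSection (restTuple x) (coefOf q.2)

namespace HasParam

variable {x y : Fin (r + 3) → W.toAffine.Point} {q : W.toAffine.Point × ℙ ℂ (Fin (r + 1) → ℂ)}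

lemma rest_zero (h : HasParam x q) : restTuple x 0 = q.1 + q.1 := by
  rw [restTuple_zero, h.fst_eq, h.snd_eq]

lemma eval_eq_zero (h : HasParam x q) (i : Fin (r + 2)) :
    (secA W r (coefOf q.2) (q.1 + q.1)).eval (xCoord W (restTuple x i)) +
      (oddPart r (coefOf q.2)).eval (xCoord W (restTuple x i)) * yCoord W (restTuple x i) = 0 := by
  rw [eval_sec (coefOf_of_lt q.2), ← h.rest_zero]
  exact h.isSection.vanish i

lemma exists_paramPoly_eq (h : HasParam x q) : ∃ u : ℂ, u ≠ 0 ∧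
    paramPoly q = C u * ∏ i, (X - C (xCoord W (restTuple x i))) :=
  normPoly_sec_eq (coefOf_of_lt q.2) (by rw [coefOf_self h.rep_ne_zero]; exact one_ne_zero)
    h.good.rest_ne_zero h.good.rest_injective fun i => by
      rw [← h.rest_zero]
      exact h.isSection.vanish i

lemma separable (h : HasParam x q) : (paramPoly q).Separable := by
  obtain ⟨u, hu, he⟩ := h.exists_paramPoly_eq
  rw [he]
  exact (separable_prod_X_sub_C_iff.2 h.good.rest_injective).unit_mul (isUnit_C.2 hu.isUnit)

lemma eval_oddPart_ne_zero (h : HasParam x q) (i : Fin (r + 2)) :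
    (oddPart r (coefOf q.2)).eval (xCoord W (restTuple x i)) ≠ 0 :=
  eval_ne_zero_of_separable h.separable
    (eval_normPoly_eq_zero (h.good.rest_ne_zero i) (h.eval_eq_zero i))

lemma goodParam (h : HasParam x q) : GoodParam q := by
  refine ⟨h.fst_eq ▸ h.good.ne_zero 0, h.rest_zero ▸ h.good.rest_ne_zero 0, h.rep_ne_zero,
    h.separable, ?_⟩
  obtain ⟨u, hu, he⟩ := h.exists_paramPoly_eq
  rw [he, eval_C_mul, eval_prod]
  refine mul_ne_zero hu (Finset.prod_ne_zero_iff.2 fun i _ => ?_)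
  rw [eval_sub, eval_X, eval_C, ← h.fst_eq]
  exact sub_ne_zero.2 (h.good.ne_rest i)

lemma coe_toSym (x : Fin (r + 3) → W.toAffine.Point) : (toSym W (r + 3) x).1 =
    x 0 ::ₘ x 1 ::ₘ Finset.univ.val.map fun i : Fin (r + 1) => x i.succ.succ := by
  change Multiset.map x Finset.univ.val = _
  rw [Fin.univ_succ, Finset.cons_val, Multiset.map_cons, Finset.map_val, Multiset.map_map,
    Fin.univ_succ, Finset.cons_val, Multiset.map_cons, Finset.map_val, Multiset.map_map]
  rfl

lemma map_restTuple (x : Fin (r + 3) → W.toAffine.Point) : Finset.univ.val.map (restTuple x) =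
    (x 0 + x 1) ::ₘ Finset.univ.val.map fun i : Fin (r + 1) => x i.succ.succ := by
  rw [Fin.univ_succ, Finset.cons_val, Multiset.map_cons, Finset.map_val, Multiset.map_map]
  rfl

/-- The x-coordinates of both rest tuples are roots of the same polynomial, and the section
determines y at each root. Thus one rest tuple is a permutation of the other, with the same double
entry. -/
lemma toSym_eq (hx : HasParam x q) (hy : HasParam y q) : toSym W (r + 3) y = toSym W (r + 3) x := by
  obtain ⟨u, hu, he⟩ := hx.exists_paramPoly_eq
  have key : ∀ i, ∃ j, restTuple y i = restTuple x j := fun i => by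
    have h1 : (paramPoly q).eval (xCoord W (restTuple y i)) = 0 :=
      eval_normPoly_eq_zero (hy.good.rest_ne_zero i) (hy.eval_eq_zero i)
    rw [he, eval_C_mul, eval_prod] at h1
    obtain ⟨j, -, hj⟩ := Finset.prod_eq_zero_iff.1 ((mul_eq_zero.1 h1).resolve_left hu)
    rw [eval_sub, eval_X, eval_C, sub_eq_zero] at hj
    refine ⟨j, ext_coords (hy.good.rest_ne_zero i) (hx.good.rest_ne_zero j) hj ?_⟩
    refine mul_left_cancel₀ (hy.eval_oddPart_ne_zero i) ?_
    have h2 := hy.eval_eq_zero i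
    have h3 := hx.eval_eq_zero j
    rw [← hj] at h3
    linear_combination h2 - h3
  choose e he using key
  have hinj : Function.Injective e := fun i j hij => hy.good.rest_injective (by
    change xCoord W (restTuple y i) = xCoord W (restTuple y j)
    rw [he, he, hij])
  have h1 : restTuple y = restTuple x ∘ Equiv.ofBijective e (Finite.injective_iff_bijective.1 hinj) :=
    funext he
  have h2 : Finset.univ.val.map (restTuple y) = Finset.univ.val.map (restTuple x) := by
    rw [h1, ← Multiset.map_map, Multiset.map_univ_val_equiv]
  rw [map_restTuple, map_restTuple, hx.fst_eq, hx.snd_eq, hy.fst_eq, hy.snd_eq,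
    Multiset.cons_inj_right] at h2
  refine Subtype.ext ?_
  rw [coe_toSym, coe_toSym, h2, hx.fst_eq, hx.snd_eq, hy.fst_eq, hy.snd_eq]

end HasParam

variable [W.IsElliptic]

/-- Take the zeros of the section and replace the zero 2P by P, P. Separability keeps the zeros
apart, and the last condition of `GoodParam` keeps P apart from them. -/
lemma GoodParam.exists_hasParam {q : W.toAffine.Point × ℙ ℂ (Fin (r + 1) → ℂ)} (h : GoodParam q) :
    ∃ x : Fin (r + 3) → W.toAffine.Point, HasParam x q ∧ ∑ i, x i = 0 := by
  have hr : coefOf q.2 r = 1 := coefOf_self h.rep_ne_zero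
  obtain ⟨w, hw0, hw, hinj, hsum, hv⟩ := exists_zeros_of_separable (coefOf_of_lt q.2)
    (by rw [hr]; exact one_ne_zero) h.add_ne_zero h.separable
  have hrest : restTuple (Fin.cons q.1 (Fin.cons q.1 fun i => w i.succ) :
      Fin (r + 3) → W.toAffine.Point) = w := by
    ext i
    refine Fin.cases ?_ (fun i => rfl) i
    exact hw0.symm
  have hroot : ∀ i, (paramPoly q).eval (xCoord W (w i)) = 0 := fun i =>
    eval_normPoly_eq_zero (hw i) ((eval_sec (coefOf_of_lt q.2) _ _).trans (hv i))
  refine ⟨Fin.cons q.1 (Fin.cons q.1 fun i => w i.succ),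
    ⟨⟨?_, ?_, ?_, ?_⟩, rfl, rfl, h.rep_ne_zero, coefOf_of_lt q.2, hr, ?_⟩, ?_⟩
  · refine Fin.cases h.ne_zero fun i => Fin.cases h.ne_zero (fun i => hw _) i
  · rwa [hrest]
  · rwa [hrest]
  · rw [hrest]
    intro i he
    refine h.eval_ne_zero ?_
    rw [← hroot i, ← he]
    rfl
  · rw [hrest, hw0]
    exact hv
  · rw [← sum_restTuple, hrest, hsum]

section Regularity

variable {X : SpaceWithFunctions} {p : X} {d : X → ℕ → ℂ}

lemma regPoly_evenPart (hd : ∀ j, X.RegAt (fun q => d q j) p) :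
    X.RegPoly (fun q => evenPart r (d q)) p :=
  RegPoly.sum fun _ _ => (RegPoly.C (hd _)).mul (RegPoly.const _)

lemma regPoly_oddPart (hd : ∀ j, X.RegAt (fun q => d q j) p) :
    X.RegPoly (fun q => oddPart r (d q)) p :=
  RegPoly.sum fun _ _ => (RegPoly.C (hd _)).mul (RegPoly.const _)

lemma regAt_sum_poleFn (hd : ∀ j, X.RegAt (fun q => d q j) p) {φ : X → W.toAffine.Point}
    (hφ : IsMorphismAt X (ellipticCurve W) φ p) (h0 : φ p ≠ 0) :
    X.RegAt (fun q => ∑ j ∈ Finset.range (r + 1), d q j * poleFn W j (φ q)) p :=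
  regAt_fun_sum fun _ _ => X.regAt_mul (hd _) (regAt_poleFn hφ h0 _)

lemma regPoly_secA (hd : ∀ j, X.RegAt (fun q => d q j) p) {φ : X → W.toAffine.Point}
    (hφ : IsMorphismAt X (ellipticCurve W) φ p) (h0 : φ p ≠ 0) :
    X.RegPoly (fun q => secA W r (d q) (φ q)) p :=
  (regPoly_evenPart hd).sub (RegPoly.C (regAt_sum_poleFn hd hφ h0))

lemma SpaceWithFunctions.RegPoly.normPoly {A B : X → ℂ[X]} (hA : X.RegPoly A p)
    (hB : X.RegPoly B p) : X.RegPoly (fun q => normPoly W (A q) (B q)) p := by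
  simp only [_root_.normPoly, sq]
  exact ((hA.mul hA).sub ((hA.mul hB).mul (RegPoly.const _))).sub
    ((hB.mul hB).mul (RegPoly.const _))

lemma eval_oddPart_mem_polyReg (hd : ∀ j, X.RegAt (fun q => d q j) p) {m : ℕ} (i : Fin m) :
    (fun q v => (oddPart r (d q)).eval (v i)) ∈ X.polyReg p m := by
  have : (fun (q : X) (v : Fin m → ℂ) => (oddPart r (d q)).eval (v i)) =
      ∑ l ∈ Finset.range (r + 1), (fun q _ => d q (2 * l + 1)) * (fun _ v => v i) ^ l := by
    ext q v
    simp [oddPart, eval_finsetSum, Finset.sum_apply]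
  rw [this]
  exact Subalgebra.sum_mem _ fun l _ => Subalgebra.mul_mem _ (reg_mem_polyReg (hd _))
    (Subalgebra.pow_mem _ (coord_mem_polyReg i) _)

lemma eval_secA_mem_polyReg (hd : ∀ j, X.RegAt (fun q => d q j) p) {φ : X → W.toAffine.Point}
    (hφ : IsMorphismAt X (ellipticCurve W) φ p) (h0 : φ p ≠ 0) {m : ℕ} (i : Fin m) :
    (fun q v => (secA W r (d q) (φ q)).eval (v i)) ∈ X.polyReg p m := by
  have : (fun (q : X) (v : Fin m → ℂ) => (secA W r (d q) (φ q)).eval (v i)) =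
      ∑ l ∈ Finset.range (r + 1), (fun q _ => d q (2 * l)) * (fun _ v => v i) ^ (l + 1) -
        fun q _ => ∑ j ∈ Finset.range (r + 1), d q j * poleFn W j (φ q) := by
    ext q v
    simp [secA, evenPart, eval_finsetSum, Finset.sum_apply]
  rw [this]
  exact Subalgebra.sub_mem _ (Subalgebra.sum_mem _ fun l _ => Subalgebra.mul_mem _
    (reg_mem_polyReg (hd _)) (Subalgebra.pow_mem _ (coord_mem_polyReg i) _))
    (reg_mem_polyReg (regAt_sum_poleFn hd hφ h0))

lemma isMorphismAt_proj_of_coefOf {φ : X → ℙ ℂ (Fin (r + 1) → ℂ)}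
    (h0 : ∀ᶠ q in 𝓝 p, (φ q).rep (Fin.last r) ≠ 0)
    (h : ∀ j < r, X.RegAt (fun q => coefOf (φ q) j) p) : IsMorphismAt X (proj r) φ p := by
  refine (isChart_proj (Fin.last r)).isMorphismAt_adjoin h0 ?_
  rintro _ ⟨j, rfl⟩
  rcases (Nat.lt_succ_iff.1 j.2).eq_or_lt with hj | hj
  · refine X.regAt_congr ?_ (X.regAt_const 1 p)
    filter_upwards [h0] with q hq
    have : j = Fin.last r := Fin.ext hj
    subst this
    exact (div_self hq).symm
  · refine X.regAt_congr (Eventually.of_forall fun q => ?_) (h j hj)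
    exact coefOf_val _ _

lemma regAt_coefOf {φ : X → ℙ ℂ (Fin (r + 1) → ℂ)} (hφ : IsMorphismAt X (proj r) φ p)
    (h : (φ p).rep (Fin.last r) ≠ 0) (j : ℕ) : X.RegAt (fun q => coefOf (φ q) j) p := by
  by_cases hj : j < r + 1
  · have h1 := hφ.2 _ ((isChart_proj (Fin.last r)).reg _
      (Algebra.subset_adjoin ⟨⟨j, hj⟩, rfl⟩) _ h)
    refine X.regAt_congr (Eventually.of_forall fun q => ?_) h1
    exact (coefOf_val _ ⟨j, hj⟩).symm
  · simp only [coefOf, dif_neg hj]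
    exact X.regAt_const _ p

end Regularity

section OpenParam

variable {q : W.toAffine.Point × ℙ ℂ (Fin (r + 1) → ℂ)}

lemma isMorphismAt_add_fst (q : W.toAffine.Point × ℙ ℂ (Fin (r + 1) → ℂ)) :
    IsMorphismAt ((ellipticCurve W).prod (proj r)) (ellipticCurve W)
      (fun q : W.toAffine.Point × ℙ ℂ (Fin (r + 1) → ℂ) => q.1 + q.1) q :=
  (isMorphismAt_fst (X := ellipticCurve W) (Y := proj r) q).add
    (isMorphismAt_fst (X := ellipticCurve W) (Y := proj r) q)

lemma GoodParam.regAt_coefOf (h : GoodParam q) (j : ℕ) :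
    ((ellipticCurve W).prod (proj r)).RegAt
      (fun q : W.toAffine.Point × ℙ ℂ (Fin (r + 1) → ℂ) => coefOf q.2 j) q :=
  _root_.regAt_coefOf (isMorphismAt_snd (X := ellipticCurve W) (Y := proj r) q) h.rep_ne_zero j

lemma GoodParam.regPoly_paramPoly (h : GoodParam q) :
    ((ellipticCurve W).prod (proj r)).RegPoly
      (fun q : W.toAffine.Point × ℙ ℂ (Fin (r + 1) → ℂ) => paramPoly q) q :=
  (regPoly_secA h.regAt_coefOf (isMorphismAt_add_fst q) h.add_ne_zero).normPoly
    (regPoly_oddPart h.regAt_coefOf)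

/-- Separability is open here because `paramPoly` has the constant degree r + 2 wherever the last
homogeneous coordinate is nonzero. -/
lemma GoodParam.eventually (h : GoodParam q) :
    ∀ᶠ q' in @nhds ((ellipticCurve W).prod (proj r)) _ q, GoodParam q' := by
  have hrep : ∀ᶠ q' : W.toAffine.Point × ℙ ℂ (Fin (r + 1) → ℂ) in
      @nhds ((ellipticCurve W).prod (proj r)) _ q, q'.2.rep (Fin.last r) ≠ 0 :=
    (isMorphismAt_snd (X := ellipticCurve W) (Y := proj r) q).1.eventually
      ((isChart_proj (Fin.last r)).isOpen.eventually_mem h.rep_ne_zero)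
  have hdeg : ∀ᶠ q' : W.toAffine.Point × ℙ ℂ (Fin (r + 1) → ℂ) in
      @nhds ((ellipticCurve W).prod (proj r)) _ q, (paramPoly q').natDegree = r + 1 + 1 := by
    filter_upwards [hrep] with q' hq'
    exact natDegree_normPoly_sec (coefOf_of_lt q'.2)
      (by rw [coefOf_self hq']; exact one_ne_zero) _
  have hx := (isMorphismAt_fst (X := ellipticCurve W) (Y := proj r) q)
  filter_upwards [hrep, hx.eventually_ne_zero h.ne_zero,
    (isMorphismAt_add_fst q).eventually_ne_zero h.add_ne_zero,
    h.regPoly_paramPoly.eventually_separable hdeg h.separable,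
    SpaceWithFunctions.eventually_ne_zero (h.regPoly_paramPoly.regAt_eval (n := r + 3)
      (hx.regAt_xCoord h.ne_zero) (hdeg.mono fun q' hq' => by rw [hq']; omega)) h.eval_ne_zero]
    with q' h1 h2 h3 h4 h5
  exact ⟨h2, h3, h1, h4, h5⟩

end OpenParam

end Parameters

lemma SpaceWithFunctions.prod_mem_polyReg {X : SpaceWithFunctions} {p : X} {m : ℕ} {ι : Type*}
    {s : Finset ι} {f : ι → X → (Fin m → ℂ) → ℂ} (hf : ∀ i ∈ s, f i ∈ X.polyReg p m) :
    (fun q v => ∏ i ∈ s, f i q v) ∈ X.polyReg p m := by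
  have : (fun q v => ∏ i ∈ s, f i q v) = ∏ i ∈ s, f i := by
    ext q v
    simp [Finset.prod_apply]
  rw [this]
  exact Subalgebra.prod_mem _ hf

/-! ### The correspondence is one-to-one and regular in both directions -/

section Birationality

open Polynomial

variable {W : WeierstrassCurve ℂ} {r : ℕ}

/-- The point `t` of the diagonal divisor corresponds to the parameter `q`. -/
noncomputable def Corresponds (t : diagonalSpace W (r + 3)) (q : W.toAffine.Point × ℙ ℂ (Fin (r + 1) → ℂ)) : Prop :=
  ∃ x, HasParam x q ∧ toSym W (r + 3) x = diagonalVal t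

lemma Corresponds.eq_left {t t' : diagonalSpace W (r + 3)}
    {q : W.toAffine.Point × ℙ ℂ (Fin (r + 1) → ℂ)} (h : Corresponds t q) (h' : Corresponds t' q) :
    t = t' := by
  obtain ⟨x, hx, hxt⟩ := h
  obtain ⟨y, hy, hyt⟩ := h'
  exact diagonalVal_injective (by rw [← hxt, ← hyt, hx.toSym_eq hy])

/-- The parameter does not depend on the ordering: every good ordering of the same class has it. -/
lemma Corresponds.hasParam {t : diagonalSpace W (r + 3)}
    {q : W.toAffine.Point × ℙ ℂ (Fin (r + 1) → ℂ)} (h : Corresponds t q)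
    {y : Fin (r + 3) → W.toAffine.Point} (hy : GoodTuple y) (h01 : y 0 = y 1)
    (hyt : toSym W (r + 3) y = diagonalVal t) : HasParam y q := by
  obtain ⟨x, hx, hxt⟩ := h
  obtain ⟨h0, hs⟩ := hx.good.eq_of_toSym_eq (hx.fst_eq.trans hx.snd_eq.symm) hy h01 (hxt.trans hyt.symm)
  have h1 := h0.trans hx.fst_eq
  exact ⟨hy, h1, h01.symm.trans h1, hx.rep_ne_zero, hs _ hx.isSection⟩

lemma Corresponds.eq_right {t : diagonalSpace W (r + 3)}
    {q q' : W.toAffine.Point × ℙ ℂ (Fin (r + 1) → ℂ)} (h : Corresponds t q) (h' : Corresponds t q') :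
    q = q' := by
  obtain ⟨x, hx, hxt⟩ := h
  have hx' := h'.hasParam hx.good (hx.fst_eq.trans hx.snd_eq.symm) hxt
  exact Prod.ext (hx.fst_eq.symm.trans hx'.fst_eq) (eq_of_coefOf_eq hx.rep_ne_zero hx'.rep_ne_zero
    (hx.isSection.unique hx.good.rest_ne_zero hx.good.rest_injective hx'.isSection))

variable [W.IsElliptic]

lemma GoodTuple.exists_hasParam {x : Fin (r + 3) → W.toAffine.Point} (h : GoodTuple x)
    (h01 : x 0 = x 1) (hsum : ∑ i, x i = 0) : ∃ q, HasParam x q := by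
  obtain ⟨d, hd⟩ := h.exists_isSection hsum
  have hv : (fun j : Fin (r + 1) => d j) ≠ 0 := fun h0 => by
    have := congrFun h0 (Fin.last r)
    simp [hd.leading] at this
  have hc := coefOf_mk hd.zero_of_lt hd.leading hv
  refine ⟨(x 0, Projectivization.mk ℂ _ hv), h, rfl, h01.symm, ?_, hc.symm ▸ hd⟩
  refine (rep_mk_ne_zero_iff _ _ _).2 ?_
  simp [hd.leading]

lemma GoodTuple.exists_corresponds {x : Fin (r + 3) → W.toAffine.Point} (h : GoodTuple x)
    (h01 : x 0 = x 1) {t : diagonalSpace W (r + 3)} (ht : toSym W (r + 3) x = diagonalVal t) :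
    ∃ q, HasParam x q ∧ Corresponds t q := by
  obtain ⟨q, hq⟩ := h.exists_hasParam h01 (by
    rw [← symSum_toSym, ht]
    exact t.1.2)
  exact ⟨q, hq, x, hq, ht⟩

lemma exists_corresponds_iff {q : W.toAffine.Point × ℙ ℂ (Fin (r + 1) → ℂ)} :
    (∃ t, Corresponds t q) ↔ GoodParam q := by
  constructor
  · rintro ⟨t, x, hx, -⟩
    exact hx.goodParam
  · intro h
    obtain ⟨x, hx, h0⟩ := h.exists_hasParam
    exact ⟨diagonalPt (k := r + 1) x h0 (hx.fst_eq.trans hx.snd_eq.symm), x, hx, rfl⟩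

lemma isOpen_corresponds_right : IsOpen (X := (ellipticCurve W).prod (proj r))
    {q : W.toAffine.Point × ℙ ℂ (Fin (r + 1) → ℂ) | ∃ t, Corresponds t q} := by
  refine isOpen_iff_mem_nhds.2 fun q hq => ?_
  filter_upwards [(exists_corresponds_iff.1 hq).eventually] with q' hq'
  exact exists_corresponds_iff.2 hq'

lemma HasParam.eventually_exists {x : Fin (r + 3) → W.toAffine.Point}
    {q : W.toAffine.Point × ℙ ℂ (Fin (r + 1) → ℂ)} (hx : HasParam x q) {t : diagonalSpace W (r + 3)}
    (ht : toSym W (r + 3) x = diagonalVal t) : ∀ᶠ t' in 𝓝 t, ∃ q', Corresponds t' q' := by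
  filter_upwards [eventually_exists_toSym_eq (k := r + 1) hx.good.ne_zero
    (hx.good.distinctExcept (hx.fst_eq.trans hx.snd_eq.symm)) ht hx.good.eventually]
    with t' ⟨y, hy, h01, hyt⟩
  obtain ⟨q', -, hq'⟩ := hy.exists_corresponds h01 hyt
  exact ⟨q', hq'⟩

lemma isOpen_corresponds_left : IsOpen {t : diagonalSpace W (r + 3) |
    ∃ q : W.toAffine.Point × ℙ ℂ (Fin (r + 1) → ℂ), Corresponds t q} := by
  refine isOpen_iff_mem_nhds.2 fun t ht => ?_
  obtain ⟨q, x, hx, hxt⟩ := ht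
  exact hx.eventually_exists hxt

/-- The point P is the double entry, and the coefficients come from a linear system. Both are
regular functions of ordered tuples, which descend to the divisor by `regAt_diagonalSpace`. -/
lemma isMorphismAt_parameter {f : diagonalSpace W (r + 3) → W.toAffine.Point × ℙ ℂ (Fin (r + 1) → ℂ)}
    (hf : ∀ t q, Corresponds t q → f t = q) {t : diagonalSpace W (r + 3)}
    {q : W.toAffine.Point × ℙ ℂ (Fin (r + 1) → ℂ)} (h : Corresponds t q) :
    IsMorphismAt (diagonalSpace W (r + 3)) ((ellipticCurve W).prod (proj r)) f t := by
  obtain ⟨x, hx, hxt⟩ := h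
  have hd := hx.good.distinctExcept (hx.fst_eq.trans hx.snd_eq.symm)
  have hev := hx.eventually_exists hxt
  have hreg := fun {g : diagonalSpace W (r + 3) → ℂ} {φ : (Fin (r + 3) → W.toAffine.Point) → ℂ} =>
    regAt_diagonalSpace (k := r + 1) (f := g) (φ := φ) hx.good.ne_zero hd hxt
  have hpar : ∀ y : Fin (r + 3) → W.toAffine.Point, GoodTuple y → ∀ t : diagonalSpace W (r + 3),
      toSym W (r + 3) y = diagonalVal t → y 0 = y 1 → HasParam y (f t) := by
    intro y hy t ht h01
    obtain ⟨q', hq', hc⟩ := hy.exists_corresponds h01 ht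
    rwa [hf t q' hc]
  refine isMorphismAt_into_prod (X := ellipticCurve W) (Y := proj r) ?_ ?_
  · refine isMorphismAt_of_affine ?_ ?_ ?_
    · filter_upwards [hev] with t' ⟨q', hq'⟩
      rw [hf _ _ hq']
      exact (exists_corresponds_iff.1 ⟨t', hq'⟩).ne_zero
    · refine hreg ((isMorphismAt_coord 0 x).regAt_xCoord (hx.good.ne_zero 0)) ?_
      filter_upwards [hx.good.eventually] with y hy t ht h01
      rw [← (hpar y hy t ht h01).fst_eq]
    · refine hreg ((isMorphismAt_coord 0 x).regAt_yCoord (hx.good.ne_zero 0)) ?_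
      filter_upwards [hx.good.eventually] with y hy t ht h01
      rw [← (hpar y hy t ht h01).fst_eq]
  · refine isMorphismAt_proj_of_coefOf ?_ fun j hj => ?_
    · filter_upwards [hev] with t' ⟨q', hq'⟩
      rw [hf _ _ hq']
      exact (exists_corresponds_iff.1 ⟨t', hq'⟩).rep_ne_zero
    · obtain ⟨φ, hφ, he⟩ := hx.good.exists_regAt_coeff j hj
      refine hreg hφ ?_
      filter_upwards [hx.good.eventually, he] with y hy hye t ht h01
      exact hye _ (hpar y hy t ht h01).isSection

/-- Evaluated at `(P, P, z)`, where `z` are zeros of a section that depends on parameters, the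
functions on the power of the curve are polynomials in the `x`-coordinates of `z`. -/
lemma GoodParam.exists_mem_polyReg {q : W.toAffine.Point × ℙ ℂ (Fin (r + 1) → ℂ)} (h : GoodParam q)
    {x : W.toAffine.Point × ℙ ℂ (Fin (r + 1) → ℂ) → Fin (r + 3) → W.toAffine.Point}
    (hx : ∀ q, GoodParam q → HasParam (x q) q)
    (hξ : ∀ k, ((ellipticCurve W).prod (proj r)).RegAt
      (fun q : W.toAffine.Point × ℙ ℂ (Fin (r + 1) → ℂ) =>
        (Finset.univ.val.map fun i : Fin (r + 1) => xCoord W (x q i.succ.succ)).esymm k) q)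
    {a : (Fin (r + 3) → W.toAffine.Point) → ℂ} (ha : a ∈ affinePowerAlg W (r + 3)) :
    ∃ f ∈ ((ellipticCurve W).prod (proj r)).polyReg q (r + 1),
      ∀ q' : W.toAffine.Point × ℙ ℂ (Fin (r + 1) → ℂ), GoodParam q' →
        ∀ τ : Equiv.Perm (Fin (r + 1)), f q' ((fun i => xCoord W (x q' i.succ.succ)) ∘ τ) =
          a (Fin.cons q'.1 (Fin.cons q'.1 fun i => x q' (τ i).succ.succ)) := by
  have hfst := isMorphismAt_fst (X := ellipticCurve W) (Y := proj r) q
  let B : W.toAffine.Point × ℙ ℂ (Fin (r + 1) → ℂ) → ℂ[X] := fun q => oddPart r (coefOf q.2)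
  let A : W.toAffine.Point × ℙ ℂ (Fin (r + 1) → ℂ) → ℂ[X] := fun q => secA W r (coefOf q.2) (q.1 + q.1)
  have hB : ∀ i : Fin (r + 1), (fun q v => (B q).eval (v i)) ∈
      ((ellipticCurve W).prod (proj r)).polyReg q (r + 1) := fun i =>
    eval_oddPart_mem_polyReg h.regAt_coefOf i
  have hA : ∀ i : Fin (r + 1), (fun q v => (A q).eval (v i)) ∈
      ((ellipticCurve W).prod (proj r)).polyReg q (r + 1) := fun i =>
    eval_secA_mem_polyReg h.regAt_coefOf (isMorphismAt_add_fst q) h.add_ne_zero i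
  -- At a zero, y = −A(x) / B(x). Inverting B at a single root is avoided by writing 1 / B(v i) as
  -- the product of the other B(v j) divided by β, which is symmetric in the roots and hence regular
  -- in q.
  let β : W.toAffine.Point × ℙ ℂ (Fin (r + 1) → ℂ) → ℂ := fun q =>
    ∏ j : Fin (r + 1), (B q).eval (xCoord W (x q j.succ.succ))
  have hB0 : ∀ q, GoodParam q → ∀ j : Fin (r + 1), (B q).eval (xCoord W (x q j.succ.succ)) ≠ 0 :=
    fun q hq j => (hx q hq).eval_oddPart_ne_zero j.succ
  have hβ : ((ellipticCurve W).prod (proj r)).RegAt β q := by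
    refine regAt_of_symmetric (f := fun q v => ∏ j : Fin (r + 1), (B q).eval (v j)) hξ
      (prod_mem_polyReg fun j _ => hB j) (Eventually.of_forall fun q' τ => ?_)
    exact Equiv.prod_comp τ fun j => (B q').eval (xCoord W (x q' j.succ.succ))
  have hβ0 : β q ≠ 0 := Finset.prod_ne_zero_iff.2 fun j _ => hB0 q h j
  induction ha using Algebra.adjoin_induction with
  | mem a ha =>
    obtain ⟨i, a, ha, rfl⟩ := ha
    refine Fin.cases ?_ (fun i => Fin.cases ?_ (fun i => ?_) i) i
    · refine ⟨fun q _ => a q.1, reg_mem_polyReg ?_, fun q' _ τ => rfl⟩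
      rcases ha with rfl | rfl
      exacts [hfst.regAt_xCoord h.ne_zero, hfst.regAt_yCoord h.ne_zero]
    · refine ⟨fun q _ => a q.1, reg_mem_polyReg ?_, fun q' _ τ => rfl⟩
      rcases ha with rfl | rfl
      exacts [hfst.regAt_xCoord h.ne_zero, hfst.regAt_yCoord h.ne_zero]
    · rcases ha with rfl | rfl
      · exact ⟨fun _ v => v i, coord_mem_polyReg i, fun q' _ τ => rfl⟩
      · refine ⟨fun q v => -((β q)⁻¹ * ((A q).eval (v i) *
          ∏ j ∈ Finset.univ.erase i, (B q).eval (v j))), ?_, fun q' hq' τ => ?_⟩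
        · exact Subalgebra.neg_mem _ (Subalgebra.mul_mem _ (reg_mem_polyReg
            (((ellipticCurve W).prod (proj r)).regAt_inv hβ hβ0).2)
            (Subalgebra.mul_mem _ (hA i) (prod_mem_polyReg fun j _ => hB j)))
        · simp only [Function.comp_apply]
          change _ = yCoord W (x q' (τ i).succ.succ)
          have h1 : β q' = (B q').eval (xCoord W (x q' (τ i).succ.succ)) *
              ∏ j ∈ Finset.univ.erase i, (B q').eval (xCoord W (x q' (τ j).succ.succ)) := by
            rw [Finset.mul_prod_erase Finset.univ
              (fun j => (B q').eval (xCoord W (x q' (τ j).succ.succ))) (Finset.mem_univ i)]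
            exact (Equiv.prod_comp τ fun j => (B q').eval (xCoord W (x q' j.succ.succ))).symm
          have h2 := (hx q' hq').eval_eq_zero (τ i).succ
          have h3 : β q' ≠ 0 := Finset.prod_ne_zero_iff.2 fun j _ => hB0 q' hq' j
          change (A q').eval (xCoord W (x q' (τ i).succ.succ)) +
            (B q').eval (xCoord W (x q' (τ i).succ.succ)) * yCoord W (x q' (τ i).succ.succ) = 0 at h2
          refine mul_left_cancel₀ h3 ?_
          rw [mul_neg, mul_inv_cancel_left₀ h3, h1]
          linear_combination -(∏ j ∈ Finset.univ.erase i,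
            (B q').eval (xCoord W (x q' (τ j).succ.succ))) * h2
  | algebraMap c =>
    exact ⟨algebraMap ℂ _ c, Subalgebra.algebraMap_mem _ c, fun _ _ _ => rfl⟩
  | add a b _ _ ha hb =>
    obtain ⟨f, hf, hfe⟩ := ha
    obtain ⟨g, hg, hge⟩ := hb
    refine ⟨f + g, Subalgebra.add_mem _ hf hg, fun q' hq' τ => ?_⟩
    rw [Pi.add_apply, ← hfe q' hq', ← hge q' hq']
    rfl
  | mul a b _ _ ha hb =>
    obtain ⟨f, hf, hfe⟩ := ha
    obtain ⟨g, hg, hge⟩ := hb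
    refine ⟨f * g, Subalgebra.mul_mem _ hf hg, fun q' hq' τ => ?_⟩
    rw [Pi.mul_apply, ← hfe q' hq', ← hge q' hq']
    rfl

/-- Chart functions of the symmetric power become symmetric functions of the zeros. The
x-coordinates of these are the roots of `paramPoly` other than x(2P), so their elementary symmetric
functions are regular in q. -/
lemma isMorphismAt_of_parameter {g : W.toAffine.Point × ℙ ℂ (Fin (r + 1) → ℂ) → diagonalSpace W (r + 3)}
    (hg : ∀ t q, Corresponds t q → g q = t) {q : W.toAffine.Point × ℙ ℂ (Fin (r + 1) → ℂ)}
    (h : GoodParam q) :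
    IsMorphismAt ((ellipticCurve W).prod (proj r)) (diagonalSpace W (r + 3)) g q := by
  have hex : ∀ q : W.toAffine.Point × ℙ ℂ (Fin (r + 1) → ℂ), ∃ x : Fin (r + 3) → W.toAffine.Point,
      GoodParam q → HasParam x q ∧ ∑ i, x i = 0 := fun q => by
    by_cases hq : GoodParam q
    · obtain ⟨x, hx⟩ := hq.exists_hasParam
      exact ⟨x, fun _ => hx⟩
    · exact ⟨0, fun h => absurd h hq⟩
  choose x hx using hex
  have hgx : ∀ q, GoodParam q → diagonalVal (g q) = toSym W (r + 3) (x q) := fun q hq => by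
    obtain ⟨h1, h2⟩ := hx q hq
    rw [hg (diagonalPt (k := r + 1) (x q) h2 (h1.fst_eq.trans h1.snd_eq.symm)) q ⟨x q, h1, rfl⟩]
    rfl
  have hu : ∀ q, ∃ u : ℂ, GoodParam q → u ≠ 0 ∧ paramPoly q = C u *
      ((X - C (xCoord W (q.1 + q.1))) * ∏ i : Fin (r + 1), (X - C (xCoord W (x q i.succ.succ)))) := fun q => by
    by_cases hq : GoodParam q
    · obtain ⟨u, hu, he⟩ := (hx q hq).1.exists_paramPoly_eq
      refine ⟨u, fun _ => ⟨hu, ?_⟩⟩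
      rw [he, Fin.prod_univ_succ, (hx q hq).1.rest_zero]
      rfl
    · exact ⟨0, fun h => absurd h hq⟩
  choose u hu using hu
  have hξ := h.regPoly_paramPoly.regAt_esymm (u := u)
    (a := fun q : W.toAffine.Point × ℙ ℂ (Fin (r + 1) → ℂ) => xCoord W (q.1 + q.1))
    (ξ := fun (q : W.toAffine.Point × ℙ ℂ (Fin (r + 1) → ℂ)) (i : Fin (r + 1)) =>
      xCoord W (x q i.succ.succ)) ((isMorphismAt_add_fst q).regAt_xCoord h.add_ne_zero)
    (h.eventually.mono fun q hq => (hu q hq).1) (h.eventually.mono fun q hq => (hu q hq).2)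
  refine isMorphismAt_into_diagonalSpace (isChart_symPower.isMorphismAt ?_ fun a ha => ?_)
  · filter_upwards [h.eventually] with q' hq' y hy i
    obtain ⟨σ, rfl⟩ := toSym_eq_iff.1 (hy.trans (hgx q' hq'))
    exact (hx q' hq').1.good.ne_zero _
  · obtain ⟨f, hf, hfe⟩ := h.exists_mem_polyReg (fun q hq => (hx q hq).1) hξ ha
    refine regAt_of_symmetric hξ hf ?_
    filter_upwards [h.eventually] with q' hq' τ
    rw [hfe q' hq']
    refine congrArg a (Eq.trans (Subtype.ext ?_) (hgx q' hq').symm)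
    rw [HasParam.coe_toSym, HasParam.coe_toSym, (hx q' hq').1.fst_eq, (hx q' hq').1.snd_eq]
    refine congrArg (q'.1 ::ₘ q'.1 ::ₘ ·) ?_
    change Finset.univ.val.map ((fun i => x q' i.succ.succ) ∘ τ) = _
    rw [← Multiset.map_map, Multiset.map_univ_val_equiv]

end Birationality

/-! ### Existence of good tuples -/

section ExistsGoodTuple

variable {W : WeierstrassCurve ℂ} [W.IsElliptic]

variable (W) in
-- At a root of the 2-torsion polynomial, (2y + a₁x + a₃)² = 0, which means P = −P.
lemma exists_two_torsion : ∃ P : W.toAffine.Point, P ≠ 0 ∧ P + P = 0 := by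
  obtain ⟨x, hx⟩ := IsAlgClosed.exists_root W.twoTorsionPolynomial.toPoly (by
    rw [Cubic.degree_of_a_ne_zero (by simp [WeierstrassCurve.twoTorsionPolynomial])]
    norm_num)
  obtain ⟨P, hP, hPx⟩ := exists_xCoord_eq W x
  refine ⟨P, hP, ?_⟩
  have h1 := equation_coords hP
  simp only [WeierstrassCurve.twoTorsionPolynomial, Cubic.toPoly, Polynomial.IsRoot.def,
    Polynomial.eval_add, Polynomial.eval_mul, Polynomial.eval_C, Polynomial.eval_pow,
    Polynomial.eval_X, WeierstrassCurve.b₂, WeierstrassCurve.b₄, WeierstrassCurve.b₆] at hx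
  rw [hPx] at h1
  have h2 : (2 * yCoord W P + W.a₁ * x + W.a₃) ^ 2 = 0 := by linear_combination 4 * h1 + hx
  have h3 := pow_eq_zero_iff (two_ne_zero) |>.1 h2
  refine eq_neg_iff_add_eq_zero.1 (ext_coords hP (neg_ne_zero_point hP) (xCoord_neg P).symm ?_)
  rw [yCoord_neg hP, hPx]
  linear_combination h3

variable (W) in
-- A nonzero 2-torsion point satisfies 3P = P ≠ 0, so the open set where 3P ≠ 0 is nonempty and
-- therefore cofinite.
lemma finite_three_torsion : {P : W.toAffine.Point | P + P + P = 0}.Finite := by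
  obtain ⟨P, hP, h2⟩ := exists_two_torsion W
  have h := finite_compl_of_isOpen (W := W) (isOpen_ne_zero (X := ellipticCurve W)
    (φ := fun P : W.toAffine.Point => P + P + P) fun P =>
      ((IsMorphismAt.id (X := ellipticCurve W) P).add (IsMorphismAt.id (X := ellipticCurve W) P)).add
        (IsMorphismAt.id (X := ellipticCurve W) P)) ⟨P, by
        change P + P + P ≠ 0
        rwa [h2, zero_add]⟩
  refine h.subset fun Q hQ => ?_
  exact fun h' => h' hQ

lemma xCoord_ne_of_ne {P Q : W.toAffine.Point} (hP : P ≠ 0) (hQ : Q ≠ 0) (h : P ≠ Q) (h' : P + Q ≠ 0) :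
    xCoord W P ≠ xCoord W Q := fun he =>
  (eq_or_eq_neg_of_xCoord_eq hP hQ he).elim h fun h1 => h' (eq_neg_iff_add_eq_zero.1 h1)

/-- The points of `w` are affine, and their `x`-coordinates are distinct, and distinct from that of
`P`. -/
structure Separated {k : ℕ} (P : W.toAffine.Point) (w : Fin k → W.toAffine.Point) : Prop where
  ne_zero : ∀ i, w i ≠ 0
  injective : Function.Injective fun i => xCoord W (w i)
  ne : ∀ i, xCoord W P ≠ xCoord W (w i)

/-- The points that cannot be added to the tuple `w`. -/
noncomputable def forbidden {k : ℕ} (P : W.toAffine.Point) (w : Fin k → W.toAffine.Point) : Set W.toAffine.Point :=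
  {t | t = 0 ∨ xCoord W t = xCoord W P ∨ ∃ i, xCoord W t = xCoord W (w i)}

lemma finite_forbidden {k : ℕ} (P : W.toAffine.Point) (w : Fin k → W.toAffine.Point) :
    (forbidden P w).Finite := by
  refine (((Set.finite_singleton (0 : W.toAffine.Point)).union (finite_xCoord_fiber (xCoord W P))).union
    (Set.finite_iUnion fun i => finite_xCoord_fiber (xCoord W (w i)))).subset ?_
  intro t ht
  by_cases h0 : t = 0
  · exact Or.inl (Or.inl h0)
  rcases ht with h | h | ⟨i, h⟩
  · exact absurd h h0
  · exact Or.inl (Or.inr ⟨h0, h⟩)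
  · exact Or.inr (Set.mem_iUnion.2 ⟨i, h0, h⟩)

lemma Separated.snoc {k : ℕ} {P : W.toAffine.Point} {w : Fin k → W.toAffine.Point} (h : Separated P w)
    {t : W.toAffine.Point} (ht : t ∉ forbidden P w) :
    Separated P (Fin.snoc w t : Fin (k + 1) → W.toAffine.Point) := by
  simp only [forbidden, Set.mem_ofPred_eq, not_or, not_exists] at ht
  obtain ⟨h0, hP, hw⟩ := ht
  refine ⟨fun i => ?_, fun i j => ?_, fun i => ?_⟩
  · refine Fin.lastCases ?_ (fun i => ?_) i
    · rwa [Fin.snoc_last]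
    · rw [Fin.snoc_castSucc]
      exact h.ne_zero i
  · refine Fin.lastCases ?_ (fun i => ?_) i
    · refine Fin.lastCases (fun _ => rfl) (fun j => ?_) j
      simp only [Fin.snoc_last, Fin.snoc_castSucc]
      exact fun he => absurd he (hw j)
    · refine Fin.lastCases ?_ (fun j => ?_) j
      · simp only [Fin.snoc_last, Fin.snoc_castSucc]
        exact fun he => absurd he.symm (hw i)
      · simp only [Fin.snoc_castSucc]
        exact fun he => congrArg Fin.castSucc (h.injective he)
  · refine Fin.lastCases ?_ (fun i => ?_) i
    · rw [Fin.snoc_last]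
      exact fun he => hP he.symm
    · rw [Fin.snoc_castSucc]
      exact h.ne i

variable (W) in
lemma exists_point_generic : ∃ P : W.toAffine.Point, P ≠ 0 ∧ P + P ≠ 0 ∧ P + P + P ≠ 0 := by
  obtain ⟨P, hP⟩ := exists_notMem_of_finite (((Set.finite_singleton (0 : W.toAffine.Point)).union
    (finite_add_self_eq 0)).union (finite_three_torsion W))
  simp only [Set.mem_union, Set.mem_singleton_iff, Set.mem_ofPred_eq, not_or] at hP
  exact ⟨P, hP.1.1, hP.1.2, hP.2⟩

/-- Each new point has to avoid only finitely many others. The sum is kept nonzero so that it can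
later be cancelled by two points that are not opposite to each other. -/
lemma exists_separated_ne {P : W.toAffine.Point} (h1 : P ≠ 0) (h2 : P + P ≠ 0) (h3 : P + P + P ≠ 0)
    (k : ℕ) : ∃ w : Fin (k + 1) → W.toAffine.Point, w 0 = P + P ∧ Separated P w ∧ ∑ i, w i ≠ 0 := by
  induction k with
  | zero =>
    refine ⟨fun _ => P + P, rfl, ⟨fun _ => h2, fun i j _ => (Fin.fin_one_eq_zero i).trans (Fin.fin_one_eq_zero j).symm, fun _ => ?_⟩, ?_⟩
    · refine xCoord_ne_of_ne h1 h2 (fun h => h1 (by simpa using h)) ?_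
      rwa [← add_assoc]
    · simpa using h2
  | succ k ih =>
    obtain ⟨w, hw0, hw, hs⟩ := ih
    obtain ⟨t, ht⟩ := exists_notMem_of_finite ((finite_forbidden P w).union
      (Set.finite_singleton (-∑ i, w i)))
    rw [Set.mem_union, not_or] at ht
    refine ⟨Fin.snoc w t, ?_, hw.snoc ht.1, ?_⟩
    · change (Fin.snoc w t : Fin (k + 2) → W.toAffine.Point) (Fin.castSucc 0) = P + P
      rw [Fin.snoc_castSucc, hw0]
    · rw [Fin.sum_univ_castSucc]
      simp only [Fin.snoc_castSucc, Fin.snoc_last]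
      exact fun h => ht.2 (eq_neg_of_add_eq_zero_right h)

variable (W) in
-- The points t and c − t, with c minus the sum of the earlier points, complete the tuple. The index
-- k + 1 cannot be lowered to 0: a rest tuple of only two points with sum zero has equal
-- x-coordinates.
lemma exists_goodTuple (k : ℕ) : ∃ x : Fin (k + 1 + 3) → W.toAffine.Point,
    GoodTuple x ∧ x 0 = x 1 ∧ ∑ i, x i = 0 := by
  obtain ⟨P, h1, h2, h3⟩ := exists_point_generic W
  obtain ⟨w, hw0, hw, hs⟩ := exists_separated_ne h1 h2 h3 k
  set c := -∑ i, w i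
  have hc : c ≠ 0 := neg_ne_zero.2 hs
  obtain ⟨t, ht⟩ := exists_notMem_of_finite (((finite_forbidden P w).union
    ((finite_forbidden P w).preimage (f := fun t => c - t) (sub_right_injective.injOn))).union
    (finite_add_self_eq c))
  simp only [Set.mem_union, Set.mem_preimage, Set.mem_ofPred_eq, not_or] at ht
  obtain ⟨⟨ht1, ht2⟩, ht3⟩ := ht
  have hxt : xCoord W (c - t) ≠ xCoord W t := by
    refine xCoord_ne_of_ne (fun h => ht2 (Or.inl h)) (fun h => ht1 (Or.inl h)) (fun h => ht3 ?_) ?_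
    · nth_rewrite 1 [← h]
      rw [sub_add_cancel]
    · rwa [sub_add_cancel]
  have hw2 : Separated P (Fin.snoc (Fin.snoc w t : Fin (k + 2) → W.toAffine.Point) (c - t) :
      Fin (k + 3) → W.toAffine.Point) := by
    refine (hw.snoc ht1).snoc fun h => ?_
    rcases h with h | h | ⟨i, h⟩
    · exact ht2 (Or.inl h)
    · exact ht2 (Or.inr (Or.inl h))
    · revert h
      refine Fin.lastCases ?_ (fun i => ?_) i
      · rw [Fin.snoc_last]
        exact hxt
      · rw [Fin.snoc_castSucc]
        exact fun h => ht2 (Or.inr (Or.inr ⟨i, h⟩))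
  set w2 : Fin (k + 3) → W.toAffine.Point :=
    Fin.snoc (Fin.snoc w t : Fin (k + 2) → W.toAffine.Point) (c - t)
  have hw20 : w2 0 = P + P := by
    change w2 (Fin.castSucc (Fin.castSucc 0)) = P + P
    simp only [w2, Fin.snoc_castSucc, hw0]
  have hrest : restTuple (Fin.cons P (Fin.cons P fun i => w2 i.succ) :
      Fin (k + 1 + 3) → W.toAffine.Point) = w2 := by
    ext i
    refine Fin.cases ?_ (fun i => rfl) i
    exact hw20.symm
  refine ⟨Fin.cons P (Fin.cons P fun i => w2 i.succ), ⟨?_, ?_, ?_, ?_⟩, rfl, ?_⟩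
  · refine Fin.cases h1 fun i => Fin.cases h1 (fun i => hw2.ne_zero _) i
  · rw [hrest]
    exact hw2.ne_zero
  · rw [hrest]
    exact hw2.injective
  · rw [hrest]
    exact hw2.ne
  · rw [← sum_restTuple, hrest, Fin.sum_univ_castSucc, Fin.sum_univ_castSucc]
    simp only [w2, Fin.snoc_castSucc, Fin.snoc_last, c]
    abel

end ExistsGoodTuple

/-! ### The product with projective space as a fibration -/

section ProductFibration

variable {X Y : SpaceWithFunctions}

lemma isProjectiveFibration_prod (r : ℕ) (B : SpaceWithFunctions) :
    IsProjectiveFibration r (B.prod (proj r)) B (Prod.fst : B × proj r → B) := by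
  refine ⟨isMorphism_iff.2 isMorphismAt_fst, fun b => ⟨Set.univ, isOpen_univ, trivial,
    ⟨fun x => (⟨x.1.1, trivial⟩, x.1.2), fun x => ⟨(x.1.1, x.2), trivial⟩, fun x => rfl, fun x => rfl⟩,
    ⟨isMorphism_iff.2 fun x => ?_, isMorphism_iff.2 fun x => ?_⟩, fun x hx => rfl⟩⟩
  · refine isMorphismAt_into_prod (isMorphismAt_into_sub ?_) ?_
    · exact (isMorphismAt_fst (X := B) (Y := proj r) _).comp (isMorphismAt_val x)
    · exact (isMorphismAt_snd (X := B) (Y := proj r) _).comp (isMorphismAt_val x)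
  · refine isMorphismAt_into_sub (isMorphismAt_into_prod (X := B) (Y := proj r) ?_ ?_)
    · exact (isMorphismAt_val (A := Set.univ) _).comp (isMorphismAt_fst x)
    · exact isMorphismAt_snd x

lemma preirreducibleSpace_sub {A : Set X} (hA : IsPreirreducible A) : PreirreducibleSpace (X.sub A) := by
  refine ⟨fun u v hu hv hun hvn => ?_⟩
  obtain ⟨u, hu', rfl⟩ := isOpen_sub_iff.1 hu
  obtain ⟨v, hv', rfl⟩ := isOpen_sub_iff.1 hv
  obtain ⟨x, -, hx⟩ := hun
  obtain ⟨y, -, hy⟩ := hvn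
  obtain ⟨z, hz, hzu, hzv⟩ := hA u v hu' hv' ⟨x.1, x.2, hx⟩ ⟨y.1, y.2, hy⟩
  exact ⟨⟨z, hz⟩, trivial, hzu, hzv⟩

end ProductFibration

/-! ### The birational model of the diagonal divisor -/

section BirationalModel

variable {W : WeierstrassCurve ℂ} [W.IsElliptic]

instance preirreducibleSpace_diagonalSpace (k : ℕ) : PreirreducibleSpace (diagonalSpace W (k + 3)) :=
  preirreducibleSpace_sub (isIrreducible_diagonalDivisor k).2

lemma birational_diagonalSpace_succ (k : ℕ) :
    Birational (diagonalSpace W (k + 1 + 3)) ((ellipticCurve W).prod (proj (k + 1))) := by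
  refine birational_of_relation (X := diagonalSpace W (k + 1 + 3))
    (Y := (ellipticCurve W).prod (proj (k + 1))) Corresponds ?_
    (fun _ _ _ h h' => h.eq_right h') (fun _ _ _ h h' => h.eq_left h') isOpen_corresponds_left
    isOpen_corresponds_right (fun f hf t q h => isMorphismAt_parameter hf h)
    (fun g hg t q h => isMorphismAt_of_parameter hg (exists_corresponds_iff.1 ⟨t, h⟩))
  obtain ⟨x, hx, h01, h0⟩ := exists_goodTuple W k
  obtain ⟨q, hq⟩ := hx.exists_hasParam h01 h0
  exact ⟨diagonalPt (k := k + 1 + 1) x h0 h01, q, x, hq, rfl⟩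

/-- The triple `(P, P, -2 P)`. -/
noncomputable def diagonalTriple (P : W.toAffine.Point) : Fin 3 → W.toAffine.Point := ![P, P, -(P + P)]

lemma sum_diagonalTriple (P : W.toAffine.Point) : ∑ i, diagonalTriple P i = 0 := by
  rw [Fin.sum_univ_three]
  exact add_neg_cancel _

lemma eq_diagonalTriple {x : Fin 3 → W.toAffine.Point} (h01 : x 0 = x 1) (hs : ∑ i, x i = 0) :
    x = diagonalTriple (x 0) := by
  rw [Fin.sum_univ_three] at hs
  ext i
  fin_cases i
  · rfl
  · exact h01.symm
  · change x 2 = -(x 0 + x 0)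
    rw [eq_neg_iff_add_eq_zero, ← hs, ← h01]
    abel

/-- The condition on `P` that the triple `(P, P, -2 P)` is generic. -/
noncomputable def GenericPoint (P : W.toAffine.Point) : Prop := P ≠ 0 ∧ P + P ≠ 0 ∧ P + P + P ≠ 0

lemma GenericPoint.eventually {X : SpaceWithFunctions} {p : X} {φ : X → W.toAffine.Point}
    (hφ : IsMorphismAt X (ellipticCurve W) φ p) (h : GenericPoint (φ p)) :
    ∀ᶠ q in 𝓝 p, GenericPoint (φ q) := by
  filter_upwards [hφ.eventually_ne_zero h.1, (hφ.add hφ).eventually_ne_zero h.2.1,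
    ((hφ.add hφ).add hφ).eventually_ne_zero h.2.2] with q h1 h2 h3 using ⟨h1, h2, h3⟩

lemma GenericPoint.ne_zero {P : W.toAffine.Point} (h : GenericPoint P) (i : Fin 3) :
    diagonalTriple P i ≠ 0 := by
  fin_cases i
  exacts [h.1, h.1, neg_ne_zero.2 h.2.1]

lemma GenericPoint.xCoord_ne {P : W.toAffine.Point} (h : GenericPoint P) :
    xCoord W P ≠ xCoord W (-(P + P)) := by
  refine xCoord_ne_of_ne h.1 (neg_ne_zero.2 h.2.1) (fun he => h.2.2 ?_) fun he => h.1 ?_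
  · nth_rewrite 3 [he]
    exact add_neg_cancel _
  · simpa using he

lemma GenericPoint.distinctExcept {P : W.toAffine.Point} (h : GenericPoint P) :
    DistinctExcept (k := 1) (diagonalTriple P) := by
  intro i j hij hn
  fin_cases i <;> fin_cases j <;> first | exact absurd hij (by decide) | skip
  · exact absurd ⟨rfl, rfl⟩ hn
  · exact h.xCoord_ne
  · exact h.xCoord_ne

/-- Q occupies two of the three places, and only one place carries −2P. -/
lemma GenericPoint.eq_of_toSym_eq {P Q : W.toAffine.Point} (h : GenericPoint P)
    (he : toSym W 3 (diagonalTriple P) = toSym W 3 (diagonalTriple Q)) : Q = P := by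
  obtain ⟨σ, hσ⟩ := toSym_eq_iff.1 he.symm
  have h0 : diagonalTriple P (σ 0) = Q := congrFun hσ 0
  have h1 : diagonalTriple P (σ 1) = Q := congrFun hσ 1
  have hne : σ 0 ≠ σ 1 := fun h => by simpa using σ.injective h
  have h2 : P ≠ -(P + P) := fun h' => h.xCoord_ne (congrArg (xCoord W) h')
  revert h0 h1 hne
  generalize σ 0 = i
  generalize σ 1 = j
  intro h0 h1 hne
  fin_cases i
  · exact h0.symm
  · exact h0.symm
  · fin_cases j
    · exact h1.symm
    · exact h1.symm
    · exact absurd rfl hne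

/-- For n = 3 the rest tuple would be (2P, −2P), with equal x-coordinates, so no tuple is good.
Instead a generic P corresponds directly to {P, P, −2P}, and ℙ⁰ is a point. -/
lemma birational_diagonalSpace_zero :
    Birational (diagonalSpace W 3) ((ellipticCurve W).prod (proj 0)) := by
  have hsub : Subsingleton (ℙ ℂ (Fin (0 + 1) → ℂ)) := by
    have h0 : ∀ p : ℙ ℂ (Fin (0 + 1) → ℂ), p.rep (Fin.last 0) ≠ 0 := fun p => by
      obtain ⟨i, hi⟩ := exists_rep_ne_zero p
      rwa [Fin.fin_one_eq_zero i] at hi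
    refine ⟨fun p q => eq_of_coefOf_eq (r := 0) (h0 p) (h0 q) (funext fun j => ?_)⟩
    rcases j with _ | j
    · rw [coefOf_self (h0 p), coefOf_self (h0 q)]
    · rw [coefOf_of_lt _ _ (Nat.succ_pos j), coefOf_of_lt _ _ (Nat.succ_pos j)]
  have hfst := isMorphismAt_fst (X := ellipticCurve W) (Y := proj 0)
  have htriple : ∀ P : W.toAffine.Point, IsMorphismAt (ellipticCurve W)
      ((ellipticCurve W).power 3) diagonalTriple P := fun P => by
    refine isMorphismAt_into_power (Y := ellipticCurve W) fun i => ?_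
    have hid := IsMorphismAt.id (X := ellipticCurve W) P
    fin_cases i
    exacts [hid, hid, (hid.add hid).neg]
  let pt : W.toAffine.Point → diagonalSpace W 3 := fun P =>
    diagonalPt (k := 1) (diagonalTriple P) (sum_diagonalTriple P) rfl
  have hpt : ∀ P, diagonalVal (pt P) = toSym W 3 (diagonalTriple P) := fun P => rfl
  have hex : ∀ (t : diagonalSpace W 3) (y : Fin 3 → W.toAffine.Point), toSym W 3 y = diagonalVal t →
      y 0 = y 1 → t = pt (y 0) := fun t y hy h01 => by
    refine diagonalVal_injective ?_
    rw [hpt, ← hy, ← eq_diagonalTriple h01]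
    rw [← symSum_toSym, hy]
    exact t.1.2
  have hne : ∀ (t : diagonalSpace W 3) (P : W.toAffine.Point), t = pt P → GenericPoint P →
      ∀ᶠ t' in 𝓝 t, ∃ Q, t' = pt Q ∧ GenericPoint Q := fun t P ht hP => by
    have := eventually_exists_toSym_eq (k := 1) hP.ne_zero hP.distinctExcept (s := t)
      (by rw [ht]; rfl) (P := fun y => GenericPoint (y 0))
      (GenericPoint.eventually (isMorphismAt_coord 0 _) hP)
    filter_upwards [this] with t' ⟨y, hy, h01, hyt⟩
    exact ⟨y 0, hex t' y hyt h01, hy⟩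
  refine birational_of_relation (X := diagonalSpace W 3)
    (Y := (ellipticCurve W).prod (proj 0)) (fun t q => t = pt q.1 ∧ GenericPoint q.1) ?_ ?_ ?_ ?_ ?_ ?_ ?_
  · obtain ⟨P, hP⟩ := exists_point_generic W
    exact ⟨pt P, (P, Projectivization.mk ℂ (fun _ => 1) fun h => one_ne_zero (congrFun h 0)), rfl, hP⟩
  · rintro t ⟨P, p⟩ ⟨Q, q⟩ ⟨h1, h2⟩ ⟨h3, h4⟩
    exact Prod.ext (h2.eq_of_toSym_eq (congrArg diagonalVal (h1.symm.trans h3))).symm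
      (hsub.elim _ _)
  · rintro t t' q ⟨h1, -⟩ ⟨h2, -⟩
    rw [h1, h2]
  · refine isOpen_iff_mem_nhds.2 ?_
    rintro t ⟨⟨P, p⟩, h1, h2⟩
    filter_upwards [hne t P h1 h2] with t' ⟨Q, hQ⟩
    exact ⟨(Q, p), hQ⟩
  · refine isOpen_iff_mem_nhds.2 ?_
    rintro q ⟨t, h1, h2⟩
    filter_upwards [GenericPoint.eventually (hfst q) h2] with q' hq'
    exact ⟨pt q'.1, rfl, hq'⟩
  · rintro f hf t ⟨P, p⟩ ⟨h1, h2⟩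
    have hreg := fun {g : diagonalSpace W 3 → ℂ} {φ : (Fin 3 → W.toAffine.Point) → ℂ} =>
      regAt_diagonalSpace (k := 1) (f := g) (φ := φ) h2.ne_zero h2.distinctExcept (s := t)
        (by rw [h1]; rfl)
    have hfy : ∀ (t : diagonalSpace W 3) (y : Fin 3 → W.toAffine.Point), toSym W 3 y = diagonalVal t →
        y 0 = y 1 → GenericPoint (y 0) → (f t).1 = y 0 := fun t y hy h01 hgen => by
      rw [hf t (y 0, p) ⟨hex t y hy h01, hgen⟩]
    have hgen : ∀ᶠ y : Fin 3 → W.toAffine.Point in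
        @nhds ((ellipticCurve W).power 3) _ (diagonalTriple P), GenericPoint (y 0) :=
      GenericPoint.eventually (isMorphismAt_coord 0 _) h2
    refine isMorphismAt_into_prod (X := ellipticCurve W) (Y := proj 0) ?_ ?_
    · refine isMorphismAt_of_affine ?_ ?_ ?_
      · filter_upwards [hne t P h1 h2] with t' ⟨Q, hQ⟩
        rw [hf t' (Q, p) hQ]
        exact hQ.2.1
      · refine hreg ((isMorphismAt_coord 0 (diagonalTriple P)).regAt_xCoord h2.1) ?_
        filter_upwards [hgen] with y hy t ht h01
        rw [hfy t y ht h01 hy]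
      · refine hreg ((isMorphismAt_coord 0 (diagonalTriple P)).regAt_yCoord h2.1) ?_
        filter_upwards [hgen] with y hy t ht h01
        rw [hfy t y ht h01 hy]
    · exact (IsMorphismAt.const (Y := proj 0) p t).congr
        (Eventually.of_forall fun _ => hsub.elim _ _)
  · rintro g hg t q ⟨h1, h2⟩
    refine isMorphismAt_into_diagonalSpace ?_
    refine ((isMorphismAt_toSym _).comp ((htriple _).comp (hfst q))).congr ?_
    filter_upwards [GenericPoint.eventually (hfst q) h2] with q' hq'
    rw [hg (pt q'.1) q' ⟨rfl, hq'⟩]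
    rfl

/-- The diagonal divisor is birational to the product of the curve and a projective space. -/
theorem birational_diagonalSpace (k : ℕ) :
    Birational (diagonalSpace W (k + 3)) ((ellipticCurve W).prod (proj k)) := by
  rcases k with _ | k
  exacts [birational_diagonalSpace_zero, birational_diagonalSpace_succ k]

end BirationalModel

/-! ### Tangent vectors and forms under morphisms -/

namespace SpaceWithFunctions

variable {X Y Z : SpaceWithFunctions} {p : X}

lemma tangent_leibniz (v : X.TangentSpace p) (f g : X.regRing p) :
    v.1 (f * g) = f.1 p * v.1 g + g.1 p * v.1 f := v.2 f g

/-- Multiplying f by the indicator function χ of f ≠ 0 does not change it. As χ also vanishes near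
p, both terms of the product rule are zero. -/
lemma tangent_eq_zero (v : X.TangentSpace p) {f : X.regRing p} (h : ∀ᶠ q in 𝓝 p, f.1 q = 0) :
    v.1 f = 0 := by
  classical
  let χ : X.regRing p := ⟨fun q => if f.1 q = 0 then 0 else 1,
    X.regAt_congr (h.mono fun q hq => (if_pos hq).symm) (X.regAt_const 0 p)⟩
  have e : f * χ = f := Subtype.ext (funext fun q => by
    change f.1 q * (if f.1 q = 0 then 0 else 1) = f.1 q
    split_ifs with h
    · rw [h, zero_mul]
    · rw [mul_one])
  have h0 := h.self_of_nhds
  have hχ : χ.1 p = 0 := if_pos h0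
  rw [← e, tangent_leibniz, h0, hχ, zero_mul, zero_mul, add_zero]

lemma tangent_congr (v : X.TangentSpace p) {f g : X.regRing p} (h : f.1 =ᶠ[𝓝 p] g.1) :
    v.1 f = v.1 g := by
  rw [← sub_eq_zero, ← map_sub]
  exact tangent_eq_zero v (h.mono fun q hq => sub_eq_zero.2 hq)

lemma tangent_const (v : X.TangentSpace p) (c : ℂ) : v.1 (algebraMap ℂ _ c) = 0 := by
  have h : v.1 1 = 0 := by
    have := tangent_leibniz v 1 1
    rw [mul_one] at this
    change v.1 1 = 1 * v.1 1 + 1 * v.1 1 at this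
    linear_combination -this
  rw [Algebra.algebraMap_eq_smul_one, map_smul, h, smul_zero]

/-- A tangent vector is determined by its values on the generators of a chart. -/
lemma IsChart.tangent_ext {O : Set X} {G : Set (X → ℂ)} (hX : IsChart X O (Algebra.adjoin ℂ G))
    (hp : p ∈ O) {v w : X.TangentSpace p}
    (h : ∀ a (ha : a ∈ G), v.1 ⟨a, hX.reg a (Algebra.subset_adjoin ha) p hp⟩ =
      w.1 ⟨a, hX.reg a (Algebra.subset_adjoin ha) p hp⟩) : v = w := by
  have h1 : ∀ a (ha : a ∈ Algebra.adjoin ℂ G), v.1 ⟨a, hX.reg a ha p hp⟩ = w.1 ⟨a, hX.reg a ha p hp⟩ := by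
    intro a ha
    induction ha using Algebra.adjoin_induction with
    | mem a ha => exact h a ha
    | algebraMap c => exact (tangent_const v c).trans (tangent_const w c).symm
    | add a b ha hb hva hvb =>
      have e : (⟨a + b, hX.reg _ (add_mem ha hb) p hp⟩ : X.regRing p) =
        ⟨a, hX.reg a ha p hp⟩ + ⟨b, hX.reg b hb p hp⟩ := rfl
      rw [e, map_add, map_add, hva, hvb]
    | mul a b ha hb hva hvb =>
      have e : (⟨a * b, hX.reg _ (mul_mem ha hb) p hp⟩ : X.regRing p) =
        ⟨a, hX.reg a ha p hp⟩ * ⟨b, hX.reg b hb p hp⟩ := rfl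
      rw [e, tangent_leibniz, tangent_leibniz, hva, hvb]
  refine Subtype.ext (LinearMap.ext fun f => ?_)
  obtain ⟨g, hg, k, hk, hk0, he⟩ := hX.exists_frac p hp f.1 f.2
  -- From f k = g near p, the product rule determines the value of a tangent vector on f, since k p
  -- ≠ 0.
  have h2 : ∀ v : X.TangentSpace p, v.1 ⟨g, hX.reg g hg p hp⟩ =
      f.1 p * v.1 ⟨k, hX.reg k hk p hp⟩ + k p * v.1 f := fun v => by
    rw [← tangent_leibniz v f ⟨k, hX.reg k hk p hp⟩]
    refine tangent_congr v ?_
    filter_upwards [hX.isOpen.eventually_mem hp] with q hq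
    exact (he q hq).symm
  have h3 := h2 v
  rw [h1 g hg, h1 k hk, h2 w] at h3
  exact mul_left_cancel₀ hk0 (add_left_cancel h3).symm

/-- The composition of a regular function with a morphism. -/
noncomputable def IsMorphismAt.comap {φ : X → Y} (hφ : IsMorphismAt X Y φ p) {q : Y} (hq : φ p = q)
    (f : Y.regRing q) : X.regRing p := ⟨f.1 ∘ φ, hφ.2 f.1 (hq ▸ f.2)⟩

/-- The differential of a morphism, to the tangent space at a point that is the image. -/
noncomputable def IsMorphismAt.push {φ : X → Y} (hφ : IsMorphismAt X Y φ p) {q : Y} (hq : φ p = q) :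
    X.TangentSpace p →ₗ[ℂ] Y.TangentSpace q where
  toFun v := ⟨{
      toFun := fun f => v.1 (hφ.comap hq f)
      map_add' := fun f g => map_add v.1 (hφ.comap hq f) (hφ.comap hq g)
      map_smul' := fun a f => map_smul v.1 a (hφ.comap hq f) }, fun f g => by
        subst hq
        exact tangent_leibniz v (hφ.comap rfl f) (hφ.comap rfl g)⟩
  map_add' _ _ := rfl
  map_smul' _ _ := rfl

/-- The pull-back of a family of covectors, zero where the map is not a morphism. -/
noncomputable def pullback (φ : X → Y) (ω : ∀ q : Y, Module.Dual ℂ (Y.TangentSpace q)) (p : X) :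
    Module.Dual ℂ (X.TangentSpace p) :=
  open Classical in
  if h : IsMorphismAt X Y φ p then (ω (φ p)).comp (h.push rfl) else 0

lemma pullback_apply {φ : X → Y} (h : IsMorphismAt X Y φ p) {q : Y} (hq : φ p = q)
    (ω : ∀ q : Y, Module.Dual ℂ (Y.TangentSpace q)) (v : X.TangentSpace p) :
    pullback φ ω p v = ω q (h.push hq v) := by
  subst hq
  rw [pullback, dif_pos h]
  rfl

lemma isRegularForm_congr {ω η : ∀ p : X, Module.Dual ℂ (X.TangentSpace p)}
    (h : X.IsRegularForm ω p) (he : ∀ᶠ q in 𝓝 p, ω q = η q) : X.IsRegularForm η p := by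
  obtain ⟨m, f, g, h⟩ := h
  refine ⟨m, f, g, ?_⟩
  filter_upwards [h, he] with q ⟨hf, hg, hω⟩ hq
  exact ⟨hf, hg, hq ▸ hω⟩

lemma differential_apply (f : X.regRing p) (v : X.TangentSpace p) : X.differential p f v = v.1 f := rfl

lemma isRegularForm_pullback {φ : X → Y} {ω : ∀ q : Y, Module.Dual ℂ (Y.TangentSpace q)}
    (hφ : ∀ᶠ q in 𝓝 p, IsMorphismAt X Y φ q) (h : Y.IsRegularForm ω (φ p)) :
    X.IsRegularForm (pullback φ ω) p := by
  obtain ⟨m, f, g, h⟩ := h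
  refine ⟨m, fun i => f i ∘ φ, fun i => g i ∘ φ, ?_⟩
  filter_upwards [hφ, hφ.self_of_nhds.1.eventually h] with q hq ⟨hf, hg, hω⟩
  refine ⟨fun i => hq.2 _ (hf i), fun i => hq.2 _ (hg i), LinearMap.ext fun v => ?_⟩
  rw [pullback_apply hq rfl, hω]
  simp only [LinearMap.sum_apply, LinearMap.smul_apply, differential_apply]
  rfl

/-- A form can be written locally with functions that are regular near the point. -/
lemma isRegularForm_eventually {ω : ∀ p : X, Module.Dual ℂ (X.TangentSpace p)}
    (h : X.IsRegularForm ω p) : ∃ (m : ℕ) (f g : Fin m → X → ℂ), ∀ᶠ q in 𝓝 p,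
    (∀ i, X.RegAt (f i) q) ∧ ∃ hg : ∀ i, X.RegAt (g i) q,
      ∀ v, ω q v = ∑ i, f i q * v.1 ⟨g i, hg i⟩ := by
  obtain ⟨m, f, g, h⟩ := h
  refine ⟨m, f, g, h.mono fun q ⟨hf, hg, hω⟩ => ⟨hf, hg, fun v => ?_⟩⟩
  rw [hω]
  simp only [LinearMap.sum_apply, LinearMap.smul_apply, differential_apply, smul_eq_mul]

/-! ### Holomorphic curves -/

/-- The curve `c` is holomorphic at `t`. -/
structure HoloAt (X : SpaceWithFunctions) (c : ℂ → X) (t : ℂ) : Prop where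
  continuousAt : ContinuousAt c t
  analyticAt : ∀ f, X.RegAt f (c t) → AnalyticAt ℂ (f ∘ c) t

/-- The velocity of a holomorphic curve. -/
noncomputable def HoloAt.velocity {c : ℂ → X} {t : ℂ} (h : HoloAt X c t) (hp : c t = p) : X.TangentSpace p :=
  ⟨{ toFun := fun f => deriv (f.1 ∘ c) t
     map_add' := fun f g => by
      subst hp
      exact deriv_add (h.analyticAt _ f.2).differentiableAt (h.analyticAt _ g.2).differentiableAt
     map_smul' := fun a f => by
      subst hp
      exact deriv_const_mul a (h.analyticAt _ f.2).differentiableAt }, fun f g => by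
      subst hp
      change deriv ((f.1 ∘ c) * (g.1 ∘ c)) t = _
      rw [deriv_mul (h.analyticAt _ f.2).differentiableAt (h.analyticAt _ g.2).differentiableAt, add_comm,
        mul_comm (deriv _ t)]
      rfl⟩

lemma HoloAt.form_velocity {c : ℂ → X} {t : ℂ} (h : HoloAt X c t) (hp : c t = p)
    (ω : ∀ p : X, Module.Dual ℂ (X.TangentSpace p)) :
    ω p (h.velocity hp) = ω (c t) (h.velocity rfl) := by
  subst hp
  rfl

/-- The values of a form on the velocities of a curve are holomorphic. -/
lemma analyticAt_velocity {ω : ∀ p : X, Module.Dual ℂ (X.TangentSpace p)} {c : ℂ → X}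
    (hc : ∀ t, HoloAt X c t) {t : ℂ} (h : X.IsRegularForm ω (c t)) :
    AnalyticAt ℂ (fun t => ω (c t) ((hc t).velocity rfl)) t := by
  obtain ⟨m, f, g, h⟩ := isRegularForm_eventually h
  have h1 : AnalyticAt ℂ (fun t => ∑ i, f i (c t) * deriv (g i ∘ c) t) t := by
    refine Finset.analyticAt_fun_sum _ fun i _ => ?_
    obtain ⟨hf, hg, -⟩ := h.self_of_nhds
    exact ((hc t).analyticAt _ (hf i)).mul ((hc t).analyticAt _ (hg i)).deriv
  refine h1.congr ?_
  filter_upwards [(hc t).continuousAt.eventually h] with t' ⟨hf, hg, he⟩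
  rw [he]
  rfl

lemma IsChart.holoAt {O : Set X} {G : Set (X → ℂ)} (hX : IsChart X O (Algebra.adjoin ℂ G)) {c : ℂ → X}
    {t : ℂ} (hO : ∀ᶠ s in 𝓝 t, c s ∈ O) (hG : ∀ a ∈ G, AnalyticAt ℂ (a ∘ c) t) : HoloAt X c t := by
  have h1 : ∀ a ∈ Algebra.adjoin ℂ G, AnalyticAt ℂ (a ∘ c) t := by
    intro a ha
    induction ha using Algebra.adjoin_induction with
    | mem a ha => exact hG a ha
    | algebraMap z => exact analyticAt_const
    | add a b _ _ ha hb => exact ha.add hb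
    | mul a b _ _ ha hb => exact ha.mul hb
  refine ⟨fun s hs => ?_, fun f hf => ?_⟩
  · obtain ⟨h, hh, h0, hsub⟩ := hX.exists_basic _ hO.self_of_nhds s hs
    change ∀ᶠ t in 𝓝 t, c t ∈ s
    filter_upwards [hO, (h1 h hh).continuousAt.eventually_ne h0] with q hq hq0
    exact hsub _ hq hq0
  · obtain ⟨g, hg, h, hh, h0, he⟩ := hX.exists_frac _ hO.self_of_nhds f hf
    refine ((h1 g hg).div (h1 h hh) h0).congr ?_
    filter_upwards [hO, (h1 h hh).continuousAt.eventually_ne h0] with q hq hq0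
    exact (eq_div_iff hq0).2 (he _ hq) |>.symm

end SpaceWithFunctions

/-! ### Functions and forms on projective space -/

section ProjectiveSpace

variable {r : ℕ}

lemma line_ne_zero {v w : Fin (r + 1) → ℂ} (h : LinearIndependent ℂ ![v, w]) (t : ℂ) : v + t • w ≠ 0 := by
  intro h0
  have := LinearIndependent.pair_iff.1 h 1 t (by rwa [one_smul])
  exact one_ne_zero this.1

/-- The line through two points, without the second point. -/
noncomputable def projLine {v w : Fin (r + 1) → ℂ} (h : LinearIndependent ℂ ![v, w]) (t : ℂ) :
    ℙ ℂ (Fin (r + 1) → ℂ) := Projectivization.mk ℂ (v + t • w) (line_ne_zero h t)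

lemma holoAt_projLine {v w : Fin (r + 1) → ℂ} (h : LinearIndependent ℂ ![v, w]) (t : ℂ) :
    HoloAt (proj r) (projLine h) t := by
  obtain ⟨i, hi⟩ := Function.ne_iff.1 (line_ne_zero h t)
  have hc : ∀ j, AnalyticAt ℂ (fun s : ℂ => (v + s • w) j) t := fun j =>
    analyticAt_const.add (analyticAt_id.mul analyticAt_const)
  refine (isChart_proj i).holoAt ?_ ?_
  · filter_upwards [(hc i).continuousAt.eventually_ne hi] with s hs
    exact (rep_mk_ne_zero_iff _ _ _).2 hs
  · rintro _ ⟨j, rfl⟩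
    refine ((hc j).div (hc i) hi).congr (Eventually.of_forall fun s => ?_)
    exact (projRatio_mk _ _ _ _).symm

lemma linearIndependent_swap {v w : Fin (r + 1) → ℂ} (h : LinearIndependent ℂ ![v, w]) :
    LinearIndependent ℂ ![w, v] := by
  rw [LinearIndependent.pair_iff] at h ⊢
  intro s t hst
  exact (h t s ((add_comm _ _).trans hst)).symm

/-- Exchanging v and w is the change of coordinate t ↦ 1 / t, which gives a parametrization around
the point missed by the line. -/
lemma projLine_swap {v w : Fin (r + 1) → ℂ} (h : LinearIndependent ℂ ![v, w]) {t : ℂ} (ht : t ≠ 0) :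
    projLine (linearIndependent_swap h) t⁻¹ = projLine h t := by
  refine (Projectivization.mk_eq_mk_iff' ℂ _ _ _ _).2 ⟨t⁻¹, ?_⟩
  rw [smul_add, smul_smul, inv_mul_cancel₀ ht, one_smul]
  exact add_comm _ _

lemma projLine_zero {v w : Fin (r + 1) → ℂ} (h : LinearIndependent ℂ ![v, w]) (hv : v ≠ 0) :
    projLine h 0 = Projectivization.mk ℂ v hv := by
  simp [projLine]

lemma tendsto_inv_cocompact : Tendsto (fun t : ℂ => t⁻¹) (cocompact ℂ) (𝓝 0) :=
  Metric.cobounded_eq_cocompact (α := ℂ) ▸ tendsto_inv₀_cobounded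

lemma linearIndependent_rep {p q : ℙ ℂ (Fin (r + 1) → ℂ)} (hpq : p ≠ q) :
    LinearIndependent ℂ ![p.rep, q.rep] := by
  rw [← Projectivization.independent_pair_iff_ne, Projectivization.independent_iff] at hpq
  have e : Projectivization.rep ∘ ![p, q] = ![p.rep, q.rep] := by
    ext i
    fin_cases i <;> rfl
  rwa [e] at hpq

/-- Regular functions on projective space are constant. -/
lemma proj_const {f : ℙ ℂ (Fin (r + 1) → ℂ) → ℂ} (hf : ∀ p, (proj r).RegAt f p)
    (p q : ℙ ℂ (Fin (r + 1) → ℂ)) : f p = f q := by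
  by_cases hpq : p = q
  · rw [hpq]
  have hind := linearIndependent_rep hpq
  -- On the line through p and q the function is entire and tends to f q at infinity, so Liouville's
  -- theorem applies.
  have han : Differentiable ℂ (f ∘ projLine hind) := fun t =>
    ((holoAt_projLine hind t).analyticAt f (hf _)).differentiableAt
  have hk : Tendsto (f ∘ projLine (linearIndependent_swap hind)) (𝓝 0) (𝓝 (f q)) := by
    have := ((holoAt_projLine (linearIndependent_swap hind) 0).analyticAt f (hf _)).continuousAt
    have h0 : (f ∘ projLine (linearIndependent_swap hind)) 0 = f q := by
      rw [Function.comp_apply, projLine_zero _ q.rep_nonzero, q.mk_rep]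
    exact h0 ▸ this
  have hlim : Tendsto (f ∘ projLine hind) (cocompact ℂ) (𝓝 (f q)) := by
    refine (hk.comp tendsto_inv_cocompact).congr' ?_
    filter_upwards [(isCompact_singleton (x := (0 : ℂ))).compl_mem_cocompact] with t ht
    rw [Function.comp_apply, Function.comp_apply, Function.comp_apply, projLine_swap hind ht]
  have := han.apply_eq_of_tendsto_cocompact 0 hlim
  rwa [Function.comp_apply, projLine_zero _ p.rep_nonzero, p.mk_rep] at this

lemma velocity_projLine_swap {v w : Fin (r + 1) → ℂ} (h : LinearIndependent ℂ ![v, w]) {t : ℂ}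
    (ht : t ≠ 0) : (holoAt_projLine h t).velocity rfl =
      (-(t ^ 2)⁻¹) • (holoAt_projLine (linearIndependent_swap h) t⁻¹).velocity (projLine_swap h ht) := by
  refine Subtype.ext (LinearMap.ext fun f => ?_)
  change deriv (f.1 ∘ projLine h) t =
    -(t ^ 2)⁻¹ * deriv (f.1 ∘ projLine (linearIndependent_swap h)) t⁻¹
  have h1 : f.1 ∘ projLine h =ᶠ[𝓝 t] (f.1 ∘ projLine (linearIndependent_swap h)) ∘ fun s => s⁻¹ := by
    filter_upwards [eventually_ne_nhds ht] with s hs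
    exact congrArg f.1 (projLine_swap h hs).symm
  have h2 : (proj r).RegAt f.1 (projLine (linearIndependent_swap h) t⁻¹) := by
    rw [projLine_swap h ht]
    exact f.2
  have h3 := ((holoAt_projLine (linearIndependent_swap h) t⁻¹).analyticAt _ h2).differentiableAt
  rw [h1.deriv_eq, (h3.hasDerivAt.comp t (hasDerivAt_inv ht)).deriv, mul_comm]

/-- There are no forms on projective space. -/
lemma proj_form_eq_zero {ω : ∀ p, Module.Dual ℂ ((proj r).TangentSpace p)}
    (hω : ∀ p, (proj r).IsRegularForm ω p) (p : proj r) : ω p = 0 := by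
  refine LinearMap.ext fun v => ?_
  rw [LinearMap.zero_apply]
  change ℙ ℂ (Fin (r + 1) → ℂ) at p
  obtain ⟨i, hi⟩ := exists_rep_ne_zero p
  have hch := isChart_proj i
  -- The direction of a line through p with velocity v: since w i = 0, the j-th ratio along the line
  -- has derivative w j / p.rep i at 0.
  let w : Fin (r + 1) → ℂ := fun j =>
    p.rep i * v.1 ⟨projRatio i j, hch.reg _ (Algebra.subset_adjoin ⟨j, rfl⟩) p hi⟩
  have hwi : w i = 0 := by
    have : v.1 ⟨projRatio i i, hch.reg _ (Algebra.subset_adjoin ⟨i, rfl⟩) p hi⟩ =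
        v.1 (algebraMap ℂ _ 1) := tangent_congr v (by
      filter_upwards [hch.isOpen.eventually_mem hi] with q hq
      exact div_self hq)
    change p.rep i * _ = 0
    rw [this, tangent_const v 1, mul_zero]
  by_cases hw : w = 0
  · have hv : v = 0 := hch.tangent_ext hi (by
      rintro _ ⟨j, rfl⟩
      exact (mul_eq_zero.1 (congrFun hw j)).resolve_left hi)
    rw [hv, map_zero]
  have hind : LinearIndependent ℂ ![p.rep, w] := by
    rw [LinearIndependent.pair_iff]
    intro s t hst
    have h1 := congrFun hst i
    simp only [Pi.add_apply, Pi.smul_apply, smul_eq_mul, hwi, mul_zero, add_zero, Pi.zero_apply] at h1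
    have hs : s = 0 := (mul_eq_zero.1 h1).resolve_right hi
    subst hs
    rw [zero_smul, zero_add] at hst
    exact ⟨rfl, (smul_eq_zero.1 hst).resolve_right hw⟩
  have h0 : projLine hind 0 = p := by rw [projLine_zero _ p.rep_nonzero, p.mk_rep]
  have hvel : v = (holoAt_projLine hind 0).velocity h0 := hch.tangent_ext hi (by
    rintro _ ⟨j, rfl⟩
    change _ = deriv (projRatio i j ∘ projLine hind) 0
    have h2 : projRatio i j ∘ projLine hind = fun t => (p.rep j + t * w j) / p.rep i := by
      ext t
      rw [Function.comp_apply, projLine, projRatio_mk]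
      simp [hwi]
    rw [h2, deriv_div_const, deriv_const_add, deriv_mul_const differentiableAt_id, deriv_id'',
      one_mul, eq_div_iff hi, mul_comm])
  -- The form evaluated on the velocity of the line is entire. In terms of 1 / t it is −t⁻² k(1 /
  -- t), which tends to 0, so it vanishes by Liouville's theorem.
  let h : ℂ → ℂ := fun t => ω (projLine hind t) ((holoAt_projLine hind t).velocity rfl)
  let k : ℂ → ℂ := fun t => ω (projLine (linearIndependent_swap hind) t)
    ((holoAt_projLine (linearIndependent_swap hind) t).velocity rfl)
  have hh : Differentiable ℂ h := fun t =>
    (analyticAt_velocity (holoAt_projLine hind) (hω _)).differentiableAt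
  have hk : ContinuousAt k 0 :=
    (analyticAt_velocity (holoAt_projLine (linearIndependent_swap hind)) (hω _)).continuousAt
  have hhk : ∀ t ≠ 0, h t = -(t⁻¹ ^ 2) * k t⁻¹ := fun t ht => by
    simp only [h, k]
    rw [velocity_projLine_swap hind ht, map_smul, smul_eq_mul, inv_pow]
    congr 1
    exact HoloAt.form_velocity _ _ ω
  have hlim : Tendsto h (cocompact ℂ) (𝓝 0) := by
    have h1 : Tendsto (fun t : ℂ => -(t⁻¹ ^ 2) * k t⁻¹) (cocompact ℂ) (𝓝 (-(0 ^ 2) * k 0)) :=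
      ((tendsto_inv_cocompact.pow 2).neg).mul (hk.tendsto.comp tendsto_inv_cocompact)
    rw [zero_pow two_ne_zero, neg_zero, zero_mul] at h1
    refine h1.congr' ?_
    filter_upwards [(isCompact_singleton (x := (0 : ℂ))).compl_mem_cocompact] with t ht
    exact (hhk t ht).symm
  have h3 : h 0 = 0 := hh.apply_eq_of_tendsto_cocompact 0 hlim
  rw [hvel]
  exact ((holoAt_projLine hind 0).form_velocity h0 ω).trans h3

end ProjectiveSpace

/-! ### Functions on the elliptic curve -/

section EllipticFunctions

open Polynomial
open WeierstrassCurve.Affine (CoordinateRing)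

variable {W : WeierstrassCurve ℂ} [W.IsElliptic]

/-- Every maximal ideal of the coordinate ring is the ideal of a point. -/
lemma exists_evalHom_eq_zero {m : Ideal W.toAffine.CoordinateRing} (hm : m.IsMaximal) :
    ∃ (P : W.toAffine.Point) (hP : P ≠ 0), ∀ h ∈ m, evalHom hP h = 0 := by
  let _ : Field (W.toAffine.CoordinateRing ⧸ m) := Ideal.Quotient.field m
  have hfin : Module.Finite ℂ[X] W.toAffine.CoordinateRing := .of_basis (CoordinateRing.basis W.toAffine)
  have hft : Algebra.FiniteType ℂ W.toAffine.CoordinateRing :=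
    Algebra.FiniteType.trans (S := ℂ[X]) inferInstance inferInstance
  -- The Nullstellensatz: the residue field is finite over ℂ, hence equal to ℂ, and the images of x
  -- and y are the coordinates of the point.
  have hft' : Algebra.FiniteType ℂ (W.toAffine.CoordinateRing ⧸ m) := inferInstance
  have : Module.Finite ℂ (W.toAffine.CoordinateRing ⧸ m) := finite_of_finite_type_of_isJacobsonRing _ _
  have hbij := IsAlgClosed.algebraMap_bijective_of_isIntegral (k := ℂ) (K := W.toAffine.CoordinateRing ⧸ m)
  let e := RingEquiv.ofBijective (algebraMap ℂ (W.toAffine.CoordinateRing ⧸ m)) hbij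
  let ψ : W.toAffine.CoordinateRing →+* ℂ := e.symm.toRingHom.comp (Ideal.Quotient.mk m)
  have hψc : ∀ c : ℂ, ψ (algebraMap ℂ _ c) = c := fun c => e.symm_apply_apply c
  have hψm : ∀ h ∈ m, ψ h = 0 := fun h hh => by
    change e.symm (Ideal.Quotient.mk m h) = 0
    rw [Ideal.Quotient.eq_zero_iff_mem.2 hh, map_zero]
  let a := ψ (CoordinateRing.mk W.toAffine (C X))
  let b := ψ (CoordinateRing.mk W.toAffine X)
  have hψp : ∀ p : ℂ[X], ψ (CoordinateRing.mk W.toAffine (C p)) = p.eval a := fun p => by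
    have h1 : (ψ.comp ((CoordinateRing.mk W.toAffine).comp C)) = evalRingHom a := by
      refine Polynomial.ringHom_ext (fun c => ?_) ?_
      · rw [coe_evalRingHom, eval_C]
        exact hψc c
      · rw [coe_evalRingHom, eval_X]
        rfl
    exact congrArg (fun h => h p) h1
  have hψ : ∀ p q : ℂ[X], ψ (p • 1 + q • CoordinateRing.mk W.toAffine X) = p.eval a + q.eval a * b := by
    intro p q
    rw [map_add, CoordinateRing.smul, CoordinateRing.smul, mul_one, map_mul, hψp, hψp]
  have heq : W.toAffine.Equation a b := by
    have h1 : CoordinateRing.mk W.toAffine W.toAffine.polynomial = 0 := AdjoinRoot.mk_self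
    have h2 := congrArg ψ h1
    change ψ (CoordinateRing.mk W.toAffine (X ^ 2 + C (C W.a₁ * X + C W.a₃) * X -
      C (X ^ 3 + C W.a₂ * X ^ 2 + C W.a₄ * X + C W.a₆))) = ψ 0 at h2
    rw [map_sub, map_add, map_mul, map_pow, map_sub, map_add, map_mul, map_pow, hψp, hψp, map_zero] at h2
    change b ^ 2 + _ * b - _ = 0 at h2
    rw [WeierstrassCurve.Affine.equation_iff']
    simp only [eval_add, eval_mul, eval_C, eval_X, eval_pow] at h2
    linear_combination h2
  refine ⟨.some _ _ (WeierstrassCurve.Affine.equation_iff_nonsingular.1 heq),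
    WeierstrassCurve.Affine.Point.some_ne_zero _, fun h hh => ?_⟩
  obtain ⟨p, q, rfl⟩ := CoordinateRing.exists_smul_basis_eq h
  rw [evalHom_smul_basis]
  exact (hψ p q).symm.trans (hψm _ hh)

/-- A function that is regular at all affine points is a polynomial in the coordinates. -/
lemma exists_ring_of_regAt {f : W.toAffine.Point → ℂ}
    (hf : ∀ P : W.toAffine.Point, P ≠ 0 → (ellipticCurve W).RegAt f P) :
    ∃ ρ : W.toAffine.CoordinateRing, ∀ P (hP : P ≠ 0), f P = evalHom hP ρ := by
  -- The ideal of denominators of f. If it were proper, it would vanish at some point P, but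
  -- regularity at P provides a denominator that is nonzero there.
  let I : Ideal W.toAffine.CoordinateRing :=
    { carrier := {h | ∃ g, ∀ P (hP : P ≠ 0), f P * evalHom hP h = evalHom hP g}
      zero_mem' := ⟨0, fun P hP => by rw [map_zero, mul_zero]⟩
      add_mem' := by
        rintro h k ⟨g, hg⟩ ⟨g', hg'⟩
        exact ⟨g + g', fun P hP => by rw [map_add, map_add, mul_add, hg, hg']⟩
      smul_mem' := by
        rintro c h ⟨g, hg⟩
        exact ⟨c * g, fun P hP => by rw [smul_eq_mul, map_mul, map_mul, mul_left_comm, hg]⟩ }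
  by_cases hI : I = ⊤
  · obtain ⟨g, hg⟩ : (1 : W.toAffine.CoordinateRing) ∈ I := hI ▸ Submodule.mem_top
    exact ⟨g, fun P hP => by rw [← hg, map_one, mul_one]⟩
  obtain ⟨m, hm, hIm⟩ := Ideal.exists_le_maximal I hI
  obtain ⟨P, hP, hPm⟩ := exists_evalHom_eq_zero hm
  obtain ⟨g, hg, h, hh, h0, he⟩ := (isChart_affine W).exists_frac P hP f (hf P hP)
  obtain ⟨ρ, hρ⟩ := exists_ring_of_mem_affineAlg hg
  obtain ⟨σ, hσ⟩ := exists_ring_of_mem_affineAlg hh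
  refine absurd (hPm σ (hIm ⟨ρ, fun Q hQ => ?_⟩)) ?_
  · rw [← hρ, ← hσ]
    exact he Q hQ
  · rwa [← hσ]

/-- Regular functions on the elliptic curve are constant. -/
lemma elliptic_const {f : W.toAffine.Point → ℂ} (hf : ∀ P : W.toAffine.Point, (ellipticCurve W).RegAt f P)
    (P : W.toAffine.Point) : f P = f 0 := by
  obtain ⟨ρ, hρ⟩ := exists_ring_of_regAt fun P _ => hf P
  obtain ⟨A, B, rfl⟩ := CoordinateRing.exists_smul_basis_eq ρ
  have hlim := tendsto_of_regAt (hf 0)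
  have hneg : Tendsto (fun P => f (-P)) (atInfinity W) (𝓝 (f 0)) := by
    have h1 : (ellipticCurve W).RegAt (fun P : W.toAffine.Point => f (-P)) (0 : W.toAffine.Point) :=
      (isMorphismAt_neg (0 : W.toAffine.Point)).2 f (hf _)
    have h2 := tendsto_of_regAt h1
    rwa [neg_zero] at h2
  have hx : Tendsto (fun P => ‖xCoord W P‖) (atInfinity W) atTop :=
    tendsto_norm_cocompact_atTop.comp tendsto_comap
  have hne : ∀ᶠ P in atInfinity W, P ≠ 0 := eventually_atInfinity_ne_zero.mono fun P h h0 =>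
    h (by rw [h0]; rfl)
  -- The product f(P) f(−P) is a polynomial in x with a finite limit as x tends to infinity, hence
  -- constant. The degree formula for norms then forces B = 0 and A constant.
  have hN : Tendsto (fun P => (normPoly W A B).eval (xCoord W P)) (atInfinity W) (𝓝 (f 0 * f 0)) := by
    refine (hlim.mul hneg).congr' ?_
    filter_upwards [hne] with P hP
    rw [← normPoly_eq_norm, eval_norm hP, hρ P hP, hρ (-P) (neg_ne_zero_point hP)]
  have hdeg : (normPoly W A B).degree ≤ 0 := by
    by_contra! h
    exact not_tendsto_nhds_of_tendsto_atTop (tendsto_norm_atTop _ h hx) _ hN.norm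
  rw [degree_normPoly, max_le_iff] at hdeg
  have hB : B = 0 := by
    by_contra h0
    have h1 := hdeg.2
    rw [degree_eq_natDegree h0, ← Nat.cast_smul_eq_nsmul (WithBot ℕ), smul_eq_mul] at h1
    have h2 : 2 * B.natDegree + 3 ≤ 0 := by exact_mod_cast h1
    omega
  have hA : A.degree ≤ 0 := by
    by_cases h0 : A = 0
    · rw [h0, degree_zero]
      exact bot_le
    have h1 := hdeg.1
    rw [degree_eq_natDegree h0, ← Nat.cast_smul_eq_nsmul (WithBot ℕ), smul_eq_mul] at h1
    have h2 : 2 * A.natDegree ≤ 0 := by exact_mod_cast h1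
    rw [degree_eq_natDegree h0]
    exact_mod_cast (by omega : A.natDegree ≤ 0)
  have hc : ∀ P, P ≠ 0 → f P = A.coeff 0 := fun P hP => by
    rw [hρ P hP, evalHom_smul_basis, hB, eval_zero, zero_mul, add_zero, eq_C_of_degree_le_zero hA,
      eval_C, coeff_C_zero]
  have h0 : f 0 = A.coeff 0 := tendsto_nhds_unique hlim
    (tendsto_const_nhds.congr' (hne.mono fun P hP => (hc P hP).symm))
  by_cases hP : P = 0
  · rw [hP]
  · rw [hc P hP, h0]

end EllipticFunctions

/-! ### Slices of products -/

namespace SpaceWithFunctions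

variable {X Y : SpaceWithFunctions}

/-- Every point has an affine chart. -/
def Charted (Y : SpaceWithFunctions) : Prop :=
  ∀ y : Y, ∃ (O : Set Y) (G : Set (Y → ℂ)), y ∈ O ∧ IsChart Y O (Algebra.adjoin ℂ G)

lemma isMorphismAt_slice_left (y : Y) (p : X) : IsMorphismAt X (X.prod Y) (fun x => (x, y)) p :=
  isMorphismAt_into_prod (X := X) (Y := Y) (IsMorphismAt.id p) (IsMorphismAt.const y p)

lemma isMorphismAt_slice_right (x : X) (p : Y) : IsMorphismAt Y (X.prod Y) (fun y => (x, y)) p :=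
  isMorphismAt_into_prod (X := X) (Y := Y) (IsMorphismAt.const x p) (IsMorphismAt.id p)

/-- A tangent vector of a product is the sum of its components. -/
lemma tangent_prod (hX : Charted X) (hY : Charted Y) {x : X} {y : Y} (w : (X.prod Y).TangentSpace (x, y)) :
    w = (isMorphismAt_slice_left y x).push rfl ((isMorphismAt_fst (X := X) (Y := Y) (x, y)).push rfl w) +
      (isMorphismAt_slice_right x y).push rfl ((isMorphismAt_snd (X := X) (Y := Y) (x, y)).push rfl w) := by
  obtain ⟨O, G, hO, hG⟩ := hX x
  obtain ⟨O', G', hO', hG'⟩ := hY y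
  refine (isChart_prod hG hG').tangent_ext ⟨hO, hO'⟩ ?_
  -- A generator coming from one factor is constant along the slice in the direction of the other,
  -- so one summand vanishes on it.
  rintro _ (⟨a, ha, rfl⟩ | ⟨a, ha, rfl⟩)
  · exact ((congrArg _ (tangent_const _ (a x))).trans (add_zero _)).symm
  · exact ((congrArg (· + _) (tangent_const _ (a y))).trans (zero_add _)).symm

lemma charted_proj (r : ℕ) : Charted (proj r) := fun p => by
  obtain ⟨i, hi⟩ := exists_rep_ne_zero (p : ℙ ℂ (Fin (r + 1) → ℂ))
  exact ⟨_, _, hi, isChart_proj i⟩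

end SpaceWithFunctions

/-! ### Families of functions at the origin and the invariant form -/

section EllipticForms

variable {W : WeierstrassCurve ℂ} {Y : SpaceWithFunctions}

lemma charted_ellipticCurve : Charted (ellipticCurve W) := fun P => by
  change W.toAffine.Point at P
  by_cases hP : P = 0
  · exact ⟨_, {uCoord W, wCoord W}, Or.inl hP, isChart_inf W⟩
  · exact ⟨_, {xCoord W, yCoord W}, hP, isChart_affine W⟩

/-- In a family, the values of a function differ from the value at the origin by a multiple of `u`. -/
lemma exists_factor (hY : Charted Y) {F : W.toAffine.Point × Y → ℂ} {y : Y}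
    (hF : ((ellipticCurve W).prod Y).RegAt F ((0 : W.toAffine.Point), y)) :
    ∃ H : W.toAffine.Point × Y → ℂ, ((ellipticCurve W).prod Y).RegAt H ((0 : W.toAffine.Point), y) ∧
      ∀ᶠ z : W.toAffine.Point × Y in @nhds ((ellipticCurve W).prod Y) _ ((0 : W.toAffine.Point), y),
        F z = F (0, z.2) + uCoord W z.1 * H z := by
  obtain ⟨O, G, hO, hG⟩ := hY y
  have hch := isChart_prod (X := ellipticCurve W) (G := {uCoord W, wCoord W}) (isChart_inf W) hG
  set E := (ellipticCurve W).prod Y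
  set z₀ : E := ((0 : W.toAffine.Point), y)
  have hz₀ : z₀ ∈ {x : W.toAffine.Point × Y | (x.1 = 0 ∨ yCoord W x.1 ≠ 0) ∧ x.2 ∈ O} := ⟨Or.inl rfl, hO⟩
  have hfst : IsMorphismAt E (ellipticCurve W) (fun z : W.toAffine.Point × Y => z.1) z₀ :=
    isMorphismAt_fst z₀
  have hz : IsMorphismAt E E (fun z : W.toAffine.Point × Y => ((0 : W.toAffine.Point), z.2)) z₀ :=
    isMorphismAt_into_prod (X := ellipticCurve W) (Y := Y)
      (IsMorphismAt.const (X := E) (Y := ellipticCurve W) (0 : W.toAffine.Point) z₀) (isMorphismAt_snd z₀)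
  have hu : E.RegAt (fun z : W.toAffine.Point × Y => uCoord W z.1) z₀ := hfst.2 _ regAt_uCoord_zero
  obtain ⟨ε, hε, -, hw⟩ := exists_unit_at_zero (W := W)
  -- For u take H = 1, and for w = u³ ε take H = u² ε; functions on Y alone have H = 0. Sums and
  -- products follow by the rules for difference quotients.
  have key : ∀ a ∈ Algebra.adjoin ℂ ({g | ∃ a ∈ ({uCoord W, wCoord W} : Set (W.toAffine.Point → ℂ)),
      g = fun x : W.toAffine.Point × Y => a x.1} ∪ {g | ∃ a ∈ G, g = fun x : W.toAffine.Point × Y => a x.2}),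
      E.RegAt a z₀ ∧ ∃ H : W.toAffine.Point × Y → ℂ, E.RegAt H z₀ ∧
        ∀ᶠ z : W.toAffine.Point × Y in @nhds E _ z₀, a z = a (0, z.2) + uCoord W z.1 * H z := by
    intro a ha
    refine ⟨hch.reg a ha z₀ hz₀, ?_⟩
    induction ha using Algebra.adjoin_induction with
    | mem a ha =>
      rcases ha with ⟨a, rfl | rfl, rfl⟩ | ⟨a, ha, rfl⟩
      · refine ⟨fun _ => 1, E.regAt_const 1 _, Eventually.of_forall fun z => ?_⟩
        change uCoord W z.1 = uCoord W 0 + uCoord W z.1 * 1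
        rw [uCoord_zero, zero_add, mul_one]
      · refine ⟨_, E.regAt_mul (regAt_pow hu 2) (hfst.2 _ hε), ?_⟩
        filter_upwards [hfst.1.eventually hw] with z h
        refine Eq.trans h ?_
        change _ = wCoord W 0 + uCoord W z.1 * (uCoord W z.1 ^ 2 * ε z.1)
        rw [wCoord_zero]
        ring
      · exact ⟨fun _ => 0, E.regAt_const 0 _, Eventually.of_forall fun z => by rw [mul_zero, add_zero]⟩
    | algebraMap c =>
      exact ⟨fun _ => 0, E.regAt_const 0 _, Eventually.of_forall fun z => by rw [mul_zero, add_zero]; rfl⟩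
    | add a b _ _ ha hb =>
      obtain ⟨H, hH, h⟩ := ha
      obtain ⟨K, hK, k⟩ := hb
      refine ⟨H + K, E.regAt_add hH hK, ?_⟩
      filter_upwards [h, k] with z h k
      change _ = _ at h k
      change a z + b z = a (0, z.2) + b (0, z.2) + uCoord W z.1 * (H z + K z)
      rw [h, k]
      ring
    | mul a b ha' hb' ha hb =>
      obtain ⟨H, hH, h⟩ := ha
      obtain ⟨K, hK, k⟩ := hb
      refine ⟨_, E.regAt_add (E.regAt_mul hH (hch.reg b hb' z₀ hz₀))
        (E.regAt_mul (hz.2 a (hch.reg a ha' z₀ hz₀)) hK), ?_⟩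
      filter_upwards [h, k] with z h k
      change _ = _ at h k
      change a z * b z = a (0, z.2) * b (0, z.2) + uCoord W z.1 * (H z * b z + a (0, z.2) * K z)
      linear_combination b z * h + a (0, z.2) * k
  obtain ⟨g, hg, h, hh, h0, he⟩ := hch.exists_frac z₀ hz₀ F hF
  obtain ⟨-, H, hH, hH'⟩ := key g hg
  obtain ⟨hhr, K, hK, hK'⟩ := key h hh
  -- If F = g / h with g = g₀ + u H and h = h₀ + u K, where F₀, g₀, h₀ are the values over the
  -- origin, then F − F₀ = u (H − F₀ K) / h.
  refine ⟨fun z => (H z - F (0, z.2) * K z) / h z, regAt_div (regAt_sub hH (E.regAt_mul (hz.2 F hF) hK)) hhr h0,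
    ?_⟩
  have hzO : ∀ᶠ z : W.toAffine.Point × Y in @nhds E _ z₀, F ((0 : W.toAffine.Point), z.2) * h ((0 : W.toAffine.Point), z.2) =
      g ((0 : W.toAffine.Point), z.2) :=
    hz.1.eventually ((hch.isOpen.eventually_mem hz₀).mono he)
  filter_upwards [hH', hK', hch.isOpen.eventually_mem hz₀, hzO, eventually_ne_zero hhr h0]
    with z e1 e2 e3 e4 e5
  have e6 := he z e3
  change g z = g ((0 : W.toAffine.Point), z.2) + uCoord W z.1 * H z at e1
  change h z = h ((0 : W.toAffine.Point), z.2) + uCoord W z.1 * K z at e2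
  change F ((0 : W.toAffine.Point), z.2) * h ((0 : W.toAffine.Point), z.2) =
    g ((0 : W.toAffine.Point), z.2) at e4
  change h z ≠ 0 at e5
  change F z = F ((0 : W.toAffine.Point), z.2) + uCoord W z.1 *
    ((H z - F ((0 : W.toAffine.Point), z.2) * K z) / h z)
  rw [mul_div_assoc', ← sub_eq_iff_eq_add', eq_div_iff e5]
  linear_combination e6 + e1 - F (0, z.2) * e2 - e4

/-- The derivative at the origin of a family of functions is a regular multiple of the derivative
of `u`. -/
lemma exists_slice_derivative (hY : Charted Y) {F : W.toAffine.Point × Y → ℂ} {y : Y}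
    (hF : ((ellipticCurve W).prod Y).RegAt F ((0 : W.toAffine.Point), y)) :
    ∃ h : Y → ℂ, Y.RegAt h y ∧ ∀ᶠ y' in 𝓝 y,
      ∃ hF' : (ellipticCurve W).RegAt (fun q => F (q, y')) (0 : W.toAffine.Point),
      ∀ v : (ellipticCurve W).TangentSpace (0 : W.toAffine.Point),
        v.1 ⟨_, hF'⟩ = h y' * v.1 ⟨uCoord W, regAt_uCoord_zero⟩ := by
  obtain ⟨H, hH, he⟩ := exists_factor hY hF
  have hs := isMorphismAt_slice_right (X := ellipticCurve W) (0 : W.toAffine.Point) y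
  refine ⟨fun y' => H (0, y'), hs.2 H hH, ?_⟩
  filter_upwards [hs.1.eventually (eventually_eventually_nhds.2 he),
    hs.1.eventually (((ellipticCurve W).prod Y).eventually_regAt hF),
    hs.1.eventually (((ellipticCurve W).prod Y).eventually_regAt hH)] with y' h1 h2 h3
  have ht := isMorphismAt_slice_left (X := ellipticCurve W) y' (0 : W.toAffine.Point)
  refine ⟨ht.2 F h2, fun v => ?_⟩
  let g : (ellipticCurve W).regRing (0 : W.toAffine.Point) := ⟨_, ht.2 H h3⟩
  let u : (ellipticCurve W).regRing (0 : W.toAffine.Point) := ⟨uCoord W, regAt_uCoord_zero⟩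
  have e : v.1 ⟨_, ht.2 F h2⟩ = v.1 (algebraMap ℂ _ (F (0, y')) + u * g) := tangent_congr v (ht.1.eventually h1)
  refine e.trans ?_
  rw [map_add]
  refine (congrArg₂ (· + ·) (tangent_const v _) (tangent_leibniz v u g)).trans ?_
  change 0 + (uCoord W 0 * _ + H (0, y') * _) = _
  rw [uCoord_zero, zero_mul, zero_add, zero_add]

variable [W.IsElliptic]

/-- The origin is an accumulation point of the points with `u ≠ 0`. -/
lemma eq_of_uCoord_mul_eq {g g' : W.toAffine.Point → ℂ} (hg : (ellipticCurve W).RegAt g (0 : W.toAffine.Point))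
    (hg' : (ellipticCurve W).RegAt g' (0 : W.toAffine.Point))
    (h : ∀ᶠ P : W.toAffine.Point in @nhds (ellipticCurve W) _ (0 : W.toAffine.Point),
      uCoord W P * g P = uCoord W P * g' P) : g 0 = g' 0 := by
  by_contra hne
  have hd := SpaceWithFunctions.eventually_ne_zero (regAt_sub hg hg') (sub_ne_zero.2 hne)
  obtain ⟨U, hU, hUo, h0⟩ := mem_nhds_iff.1 (h.and (hd.and ((isChart_inf W).isOpen.mem_nhds (Or.inl rfl))))
  have hfin := (finite_compl_of_isOpen (W := W) hUo ⟨_, h0⟩).union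
    ((Set.finite_singleton (0 : W.toAffine.Point)).union (finite_xCoord_fiber (W := W) 0))
  obtain ⟨P, hP⟩ := exists_notMem_of_finite (W := W) hfin
  obtain ⟨hP, hP'⟩ := not_or.1 hP
  obtain ⟨hP0, hPx⟩ := not_or.1 hP'
  obtain ⟨h1, h2, h3⟩ := hU (not_not.1 hP)
  have hy : yCoord W P ≠ 0 := h3.resolve_left hP0
  have hu : uCoord W P ≠ 0 := div_ne_zero (fun hx => hPx ⟨hP0, hx⟩) hy
  exact h2 (sub_eq_zero.2 (mul_left_cancel₀ hu h1))

/-- The tangent space at the origin contains `d/du`. -/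
lemma exists_tangent_zero : ∃ v : (ellipticCurve W).TangentSpace (0 : W.toAffine.Point),
    v.1 ⟨uCoord W, regAt_uCoord_zero⟩ = 1 := by
  have hex : ∀ f : (ellipticCurve W).regRing (0 : W.toAffine.Point), ∃ g : W.toAffine.Point → ℂ,
      (ellipticCurve W).RegAt g (0 : W.toAffine.Point) ∧
      ∀ᶠ P : W.toAffine.Point in @nhds (ellipticCurve W) _ (0 : W.toAffine.Point),
        f.1 P = f.1 (0 : W.toAffine.Point) + uCoord W P * g P := fun f => by
    have hs := isMorphismAt_slice_left (X := ellipticCurve W) (Y := ellipticCurve W)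
      (0 : W.toAffine.Point) (0 : W.toAffine.Point)
    obtain ⟨H, hH, he⟩ := exists_factor (Y := ellipticCurve W) charted_ellipticCurve
      (F := fun z : W.toAffine.Point × W.toAffine.Point => f.1 z.1) (y := (0 : W.toAffine.Point))
      ((isMorphismAt_fst (X := ellipticCurve W) (Y := ellipticCurve W) _).2 f.1 f.2)
    exact ⟨_, hs.2 H hH, hs.1.eventually he⟩
  choose δ hδ hδ' using hex
  -- In f = f(0) + u g the value g(0) is determined by f. This makes f ↦ g(0) a point derivation,
  -- with value 1 on u.
  have huniq : ∀ (f : (ellipticCurve W).regRing (0 : W.toAffine.Point)) (g : W.toAffine.Point → ℂ),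
      (ellipticCurve W).RegAt g (0 : W.toAffine.Point) →
      (∀ᶠ P : W.toAffine.Point in @nhds (ellipticCurve W) _ (0 : W.toAffine.Point),
        f.1 P = f.1 (0 : W.toAffine.Point) + uCoord W P * g P) → δ f 0 = g 0 := fun f g hg h => by
    refine eq_of_uCoord_mul_eq (hδ f) hg ?_
    filter_upwards [h, hδ' f] with P h1 h2
    exact add_left_cancel (h2.symm.trans h1)
  refine ⟨⟨{ toFun := fun f => δ f 0, map_add' := fun f g => ?_, map_smul' := fun c f => ?_ }, fun f g => ?_⟩, ?_⟩
  · refine huniq _ (fun P => δ f P + δ g P) ((ellipticCurve W).regAt_add (hδ f) (hδ g)) ?_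
    filter_upwards [hδ' f, hδ' g] with P h1 h2
    change _ = _ at h1 h2
    change f.1 P + g.1 P = f.1 (0 : W.toAffine.Point) + g.1 (0 : W.toAffine.Point) + _
    linear_combination h1 + h2
  · refine huniq _ (fun P => c * δ f P)
      ((ellipticCurve W).regAt_mul ((ellipticCurve W).regAt_const c _) (hδ f)) ?_
    filter_upwards [hδ' f] with P h1
    change _ = _ at h1
    change c * f.1 P = c * f.1 (0 : W.toAffine.Point) + _
    linear_combination c * h1
  · have h3 := huniq (f * g) (fun P => f.1 P * δ g P + g.1 (0 : W.toAffine.Point) * δ f P)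
      ((ellipticCurve W).regAt_add ((ellipticCurve W).regAt_mul f.2 (hδ g))
        ((ellipticCurve W).regAt_mul ((ellipticCurve W).regAt_const _ _) (hδ f))) (by
      filter_upwards [hδ' f, hδ' g] with P h1 h2
      change _ = _ at h1 h2
      change f.1 P * g.1 P = f.1 (0 : W.toAffine.Point) * g.1 (0 : W.toAffine.Point) + _
      linear_combination f.1 P * h2 + g.1 (0 : W.toAffine.Point) * h1)
    exact h3
  · refine huniq _ (fun _ => 1) ((ellipticCurve W).regAt_const 1 _) (Eventually.of_forall fun P => ?_)
    change uCoord W P = uCoord W 0 + _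
    rw [uCoord_zero, zero_add, mul_one]

/-- The invariant form: `du` at the origin, extended by translation. -/
noncomputable def invariantForm (W : WeierstrassCurve ℂ) [W.IsElliptic] (P : W.toAffine.Point) :
    Module.Dual ℂ ((ellipticCurve W).TangentSpace P) :=
  ((ellipticCurve W).differential (0 : W.toAffine.Point) ⟨uCoord W, regAt_uCoord_zero⟩).comp
    ((isMorphismAt_translate (-P) P).push (add_neg_cancel P))

lemma invariantForm_push (P : W.toAffine.Point) (v : (ellipticCurve W).TangentSpace (0 : W.toAffine.Point)) :
    invariantForm W P ((isMorphismAt_translate P 0).push (zero_add P) v) =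
      v.1 ⟨uCoord W, regAt_uCoord_zero⟩ :=
  congrArg v.1 (Subtype.ext (funext fun q : W.toAffine.Point => congrArg (uCoord W) (add_neg_cancel_right q P)))

/-- The differential of a function is a regular multiple of the invariant form. -/
lemma exists_differential_eq {f : W.toAffine.Point → ℂ} {P : W.toAffine.Point} (hf : (ellipticCurve W).RegAt f P) :
    ∃ h : W.toAffine.Point → ℂ, (ellipticCurve W).RegAt h P ∧
      ∀ᶠ Q : W.toAffine.Point in @nhds (ellipticCurve W) _ P,
        ∀ (hQ : (ellipticCurve W).RegAt f Q) (v : (ellipticCurve W).TangentSpace Q),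
          v.1 ⟨f, hQ⟩ = h Q * invariantForm W Q v := by
  -- Applied to the family f(z.1 + z.2), the previous lemma gives as h(Q) the derivative at the
  -- origin of f translated by Q, and shows that it is regular in Q.
  have hadd : IsMorphismAt ((ellipticCurve W).prod (ellipticCurve W)) (ellipticCurve W)
      (fun z : W.toAffine.Point × W.toAffine.Point => z.1 + z.2) ((0 : W.toAffine.Point), P) :=
    (isMorphismAt_fst (X := ellipticCurve W) (Y := ellipticCurve W) _).add
      (isMorphismAt_snd (X := ellipticCurve W) (Y := ellipticCurve W) _)
  obtain ⟨h, hh, he⟩ := exists_slice_derivative (Y := ellipticCurve W) charted_ellipticCurve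
    (F := fun z : W.toAffine.Point × W.toAffine.Point => f (z.1 + z.2)) (y := P)
    (hadd.2 f ((zero_add P).symm ▸ hf))
  refine ⟨h, hh, he.mono fun (Q : W.toAffine.Point) ⟨hF, hQ⟩ hfQ v => ?_⟩
  refine Eq.trans ?_ (hQ ((isMorphismAt_translate (-Q) Q).push (add_neg_cancel Q) v))
  exact congrArg v.1 (Subtype.ext (funext fun q : W.toAffine.Point =>
    congrArg f (neg_add_cancel_right q Q).symm))

/-- Near P the differential of u(· − P) is h times the invariant form with h(P) ≠ 0, so the
invariant form is h⁻¹ times that differential. -/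
lemma isRegularForm_invariantForm (P : W.toAffine.Point) :
    (ellipticCurve W).IsRegularForm (invariantForm W) P := by
  have ht : (ellipticCurve W).RegAt (fun Q : W.toAffine.Point => uCoord W (Q + -P)) P :=
    (isMorphismAt_translate (-P) P).2 (uCoord W) ((congrArg ((ellipticCurve W).RegAt (uCoord W)) (add_neg_cancel P)).mpr
      regAt_uCoord_zero)
  obtain ⟨h, hh, he⟩ := exists_differential_eq ht
  obtain ⟨v, hv⟩ := exists_tangent_zero (W := W)
  have h0 : h P ≠ 0 := by
    intro h0
    have h1 := Filter.Eventually.self_of_nhds (X := ellipticCurve W) he ht ((isMorphismAt_translate P 0).push (zero_add P) v)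
    rw [h0, zero_mul] at h1
    refine one_ne_zero (hv.symm.trans (Eq.trans ?_ h1))
    exact congrArg v.1 (Subtype.ext (funext fun q : W.toAffine.Point =>
      congrArg (uCoord W) (add_neg_cancel_right q P).symm))
  refine ⟨1, fun _ => h⁻¹, fun _ (Q : W.toAffine.Point) => uCoord W (Q + -P), ?_⟩
  filter_upwards [he, (ellipticCurve W).eventually_regAt ((ellipticCurve W).regAt_inv hh h0).2,
    (ellipticCurve W).eventually_regAt ht, eventually_ne_zero hh h0] with Q h1 h2 h3 h4
  refine ⟨fun _ => h2, fun _ => h3, LinearMap.ext fun v => ?_⟩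
  rw [Fin.sum_univ_one, LinearMap.smul_apply, differential_apply, h1 h3 v]
  exact (inv_mul_cancel_left₀ h4 _).symm

/-- Every regular form on the elliptic curve is a multiple of the invariant form. -/
lemma exists_eq_smul_invariantForm {ω : ∀ P : ellipticCurve W, Module.Dual ℂ ((ellipticCurve W).TangentSpace P)}
    (hω : ∀ P, (ellipticCurve W).IsRegularForm ω P) :
    ∃ c : ℂ, ∀ P : W.toAffine.Point, ω P = c • invariantForm W P := by
  obtain ⟨v, hv⟩ := exists_tangent_zero (W := W)
  -- The value of ω on the translates of d/du is the coefficient of ω with respect to the invariant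
  -- form. It is regular everywhere, hence constant.
  let a : W.toAffine.Point → ℂ := fun P => ω P ((isMorphismAt_translate P 0).push (zero_add P) v)
  have hloc : ∀ P : W.toAffine.Point, ∃ h : W.toAffine.Point → ℂ, (ellipticCurve W).RegAt h P ∧
      ∀ᶠ Q : W.toAffine.Point in @nhds (ellipticCurve W) _ P, ω Q = h Q • invariantForm W Q := fun P => by
    obtain ⟨m, f, g, he⟩ := isRegularForm_eventually (hω P)
    obtain ⟨hf, hg, -⟩ := he.self_of_nhds
    choose h hh hd using fun i => exists_differential_eq (hg i)
    refine ⟨fun Q => ∑ i, f i Q * h i Q, regAt_fun_sum fun i _ => (ellipticCurve W).regAt_mul (hf i) (hh i), ?_⟩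
    filter_upwards [he, eventually_all.2 hd] with Q ⟨_, hgQ, hQ⟩ hdQ
    refine LinearMap.ext fun w => ?_
    rw [hQ, LinearMap.smul_apply, smul_eq_mul, Finset.sum_mul]
    exact Finset.sum_congr rfl fun i _ => by rw [hdQ i (hgQ i), mul_assoc]
  have ha : ∀ {P : W.toAffine.Point} {c : ℂ}, ω P = c • invariantForm W P → a P = c := fun {P c} h => by
    change ω P _ = c
    rw [h, LinearMap.smul_apply, invariantForm_push, hv, smul_eq_mul, mul_one]
  refine ⟨a 0, fun P => ?_⟩
  obtain ⟨h, -, he⟩ := hloc P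
  have h1 := Filter.Eventually.self_of_nhds (X := ellipticCurve W) he
  rw [← ha h1, elliptic_const (f := a) (fun Q => ?_) P] at h1
  · exact h1
  · obtain ⟨h, hh, he⟩ := hloc Q
    exact (ellipticCurve W).regAt_congr (he.mono fun R hR => (ha hR).symm) hh

end EllipticForms

/-! ### Forms on projective fibrations -/

namespace SpaceWithFunctions

variable {X B Y Z : SpaceWithFunctions} {r : ℕ} {π : X → B}

lemma IsMorphismAt.slice_left {Φ : X × Y → Z} {x : X} {y : Y} (h : IsMorphismAt (X.prod Y) Z Φ (x, y)) :
    IsMorphismAt X Z (fun x => Φ (x, y)) x :=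
  IsMorphismAt.comp (X := X) (Y := X.prod Y) (Z := Z) (ψ := Φ) (φ := fun x : X => ((x, y) : X × Y)) (p := x) h
    (isMorphismAt_slice_left y x)

lemma IsMorphismAt.slice_right {Φ : X × Y → Z} {x : X} {y : Y} (h : IsMorphismAt (X.prod Y) Z Φ (x, y)) :
    IsMorphismAt Y Z (fun y => Φ (x, y)) y := h.comp (isMorphismAt_slice_right x y)

/-- Extends the identity of U by a constant to all of Y, so that maps defined on U can be used
without subtypes. -/
lemma exists_retraction {U : Set Y} (hU : IsOpen U) (hne : U.Nonempty) : ∃ ρ : Y → Y.sub U,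
    (∀ y (hy : y ∈ U), ρ y = (⟨y, hy⟩ : U)) ∧ ∀ y ∈ U, IsMorphismAt Y (Y.sub U) ρ y := by
  classical
  obtain ⟨y₀, hy₀⟩ := hne
  let ρ : Y → U := fun y => if hy : y ∈ U then ⟨y, hy⟩ else ⟨y₀, hy₀⟩
  have hρ : ∀ y (hy : y ∈ U), ρ y = ⟨y, hy⟩ := fun y hy => dif_pos hy
  refine ⟨ρ, hρ, fun y hy => ?_⟩
  refine isMorphismAt_into_sub ((IsMorphismAt.id y).congr ?_)
  filter_upwards [hU.eventually_mem hy] with z hz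
  exact (congrArg Subtype.val (hρ z hz)).symm

/-- Local trivializations, as maps between the spaces themselves. -/
lemma IsProjectiveFibration.exists_trivialization (h : IsProjectiveFibration r X B π) (b : B) :
    ∃ (U : Set B) (Ψ : B × proj r → X) (ρ : X → proj r), IsOpen U ∧ b ∈ U ∧
      (∀ e ∈ U, ∀ p, IsMorphismAt (B.prod (proj r)) X Ψ (e, p)) ∧
      (∀ x, π x ∈ U → IsMorphismAt X (proj r) ρ x) ∧
      (∀ e ∈ U, ∀ p, π (Ψ (e, p)) = e) ∧ ∀ x, π x ∈ U → Ψ (π x, ρ x) = x := by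
  obtain ⟨hπ, h⟩ := h
  obtain ⟨U, hU, hb, φ, ⟨hφ, hφ'⟩, hφπ⟩ := h b
  rw [isMorphism_iff] at hφ hφ'
  obtain ⟨s, hs, hs'⟩ := exists_retraction hU ⟨b, hb⟩
  have hp : Nonempty (ℙ ℂ (Fin (r + 1) → ℂ)) := inferInstance
  obtain ⟨p₀⟩ := hp
  obtain ⟨t, ht, ht'⟩ := exists_retraction (hU.preimage hπ.1) ⟨_, (φ.symm ((⟨b, hb⟩ : U), p₀)).2⟩
  refine ⟨U, fun z => (φ.symm (s z.1, z.2)).1, fun x => (φ (t x)).2, hU, hb, fun e he p => ?_, fun x hx => ?_,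
    fun e he p => ?_, fun x hx => ?_⟩
  · have h1 : IsMorphismAt (B.prod (proj r)) ((B.sub U).prod (proj r))
        (fun z : B × proj r => (s z.1, z.2)) (e, p) :=
      isMorphismAt_into_prod ((hs' e he).comp (isMorphismAt_fst (X := B) (Y := proj r) (e, p)))
        (isMorphismAt_snd (X := B) (Y := proj r) (e, p))
    exact (isMorphismAt_val _).comp ((hφ' _).comp h1)
  · exact (isMorphismAt_snd (X := B.sub U) (Y := proj r) _).comp ((hφ _).comp (ht' x hx))
  · have h1 := hφπ (φ.symm (s e, p)).1 (φ.symm (s e, p)).2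
    have h2 : φ (⟨(φ.symm (s e, p)).1, (φ.symm (s e, p)).2⟩ : π ⁻¹' U) = (s e, p) := φ.apply_symm_apply _
    rw [h2] at h1
    exact (congrArg (fun w : B.sub U => w.1) h1).symm.trans (congrArg (fun w : B.sub U => w.1) (hs e he))
  · have h1 := hφπ x hx
    have h2 : ((s (π x), (φ (t x)).2) : (B.sub U) × proj r) = φ (t x) := by
      refine Prod.ext ?_ rfl
      change s (π x) = (φ (t x)).1
      rw [hs _ hx, ht x hx, h1]
    change (φ.symm (s (π x), (φ (t x)).2)).1 = x
    rw [h2, ht x hx]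
    exact congrArg Subtype.val (φ.symm_apply_apply _)

end SpaceWithFunctions

section EllipticFibration

variable {W : WeierstrassCurve ℂ} [W.IsElliptic] {X : SpaceWithFunctions} {r : ℕ} {π : X → ellipticCurve W}
  {ω : ∀ x : X, Module.Dual ℂ (X.TangentSpace x)}

/-- The values of a form on the lifts of a tangent vector along a family of sections parametrized by
a projective space are independent of the section. -/
lemma form_lift_eq (hω : ∀ x, X.IsRegularForm ω x) {Φ : W.toAffine.Point × proj r → X} {e : W.toAffine.Point}
    (hΦ : ∀ p, IsMorphismAt ((ellipticCurve W).prod (proj r)) X Φ (e, p))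
    (v : (ellipticCurve W).TangentSpace e) (p p' : proj r) :
    ω (Φ (e, p)) ((IsMorphismAt.slice_left (X := ellipticCurve W) (hΦ p)).push rfl v) =
      ω (Φ (e, p')) ((IsMorphismAt.slice_left (X := ellipticCurve W) (hΦ p')).push rfl v) := by
  -- As a function of p the value is regular on projective space, hence constant. For the
  -- regularity, e is translated to the origin, where `exists_slice_derivative` applies.
  refine proj_const (f := fun p => ω (Φ (e, p))
    ((IsMorphismAt.slice_left (X := ellipticCurve W) (hΦ p)).push rfl v)) (fun p₀ => ?_) p p'
  obtain ⟨m, f, g, he⟩ := isRegularForm_eventually (hω (Φ (e, p₀)))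
  obtain ⟨hf, hg, -⟩ := he.self_of_nhds
  have hs : IsMorphismAt (proj r) X (fun p => Φ (e, p)) p₀ :=
    IsMorphismAt.slice_right (X := ellipticCurve W) (hΦ p₀)
  have ht : IsMorphismAt ((ellipticCurve W).prod (proj r)) ((ellipticCurve W).prod (proj r))
      (fun z : W.toAffine.Point × proj r => (z.1 + e, z.2)) ((0 : W.toAffine.Point), p₀) :=
    isMorphismAt_into_prod (X := ellipticCurve W) (Y := proj r)
      (IsMorphismAt.comp (X := (ellipticCurve W).prod (proj r)) (Y := ellipticCurve W) (Z := ellipticCurve W)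
        (ψ := fun P : W.toAffine.Point => P + e) (φ := fun z : W.toAffine.Point × proj r => z.1)
        (p := ((0 : W.toAffine.Point), p₀)) (isMorphismAt_translate e 0)
        (isMorphismAt_fst (X := ellipticCurve W) (Y := proj r) _))
      (isMorphismAt_snd (X := ellipticCurve W) (Y := proj r) _)
  have hΦ0 : IsMorphismAt ((ellipticCurve W).prod (proj r)) X Φ ((0 + e : W.toAffine.Point), p₀) := by
    rw [zero_add]
    exact hΦ p₀
  have hg0 : ∀ i, X.RegAt (g i) (Φ ((0 + e : W.toAffine.Point), p₀)) := fun i => by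
    rw [zero_add]
    exact hg i
  choose h hh hd using fun i => exists_slice_derivative (charted_proj r)
    (F := fun z : W.toAffine.Point × proj r => g i (Φ (z.1 + e, z.2))) (y := p₀)
    (ht.2 (fun z => g i (Φ z)) (hΦ0.2 (g i) (hg0 i)))
  let v' := (isMorphismAt_translate (-e) e).push (add_neg_cancel e) v
  let c := v'.1 ⟨uCoord W, regAt_uCoord_zero⟩
  refine (proj r).regAt_congr (f := fun p => ∑ i, f i (Φ (e, p)) * (h i p * c)) ?_
    (regAt_fun_sum fun i _ => (proj r).regAt_mul (hs.2 _ (hf i))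
      ((proj r).regAt_mul (hh i) ((proj r).regAt_const c p₀)))
  filter_upwards [hs.1.eventually he, eventually_all.2 hd] with p ⟨_, hgp, hp⟩ hdp
  refine Eq.trans ?_ (hp _).symm
  refine Finset.sum_congr rfl fun i _ => congrArg (f i (Φ (e, p)) * ·) ?_
  obtain ⟨hF, hv⟩ := hdp i
  refine (hv v').symm.trans ?_
  exact congrArg v.1 (Subtype.ext (funext fun q : W.toAffine.Point =>
    congrArg (fun q => g i (Φ (q, p))) (neg_add_cancel_right q e)))

/-- A form on a projective fibration over an elliptic curve comes from the base. -/
lemma exists_form_eq (hfib : IsProjectiveFibration r X (ellipticCurve W) π) (hω : ∀ x, X.IsRegularForm ω x)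
    (hπ : ∀ x, IsMorphismAt X (ellipticCurve W) π x) (e : W.toAffine.Point) :
    ∃ η : Module.Dual ℂ ((ellipticCurve W).TangentSpace e), ∀ x (hx : π x = e) (v : X.TangentSpace x),
      ω x v = η ((hπ x).push hx v) := by
  obtain ⟨U, Ψ, ρ, hU, he, hΨ, hρ, hπΨ, hΨρ⟩ := hfib.exists_trivialization (e : ellipticCurve W)
  have hp : Nonempty (ℙ ℂ (Fin (r + 1) → ℂ)) := inferInstance
  obtain ⟨p₀⟩ := hp
  refine ⟨(ω (Ψ (e, p₀))).comp ((IsMorphismAt.slice_left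
    (X := ellipticCurve W) (hΨ e he p₀)).push rfl), fun x hx v => ?_⟩
  subst hx
  have hpr : IsMorphismAt X ((ellipticCurve W).prod (proj r)) (fun x => (π x, ρ x)) x :=
    isMorphismAt_into_prod (X := ellipticCurve W) (Y := proj r) (hπ x) (hρ x he)
  have hloc : ∀ᶠ y in 𝓝 x, Ψ (π y, ρ y) = y :=
    ((hπ x).1.eventually (hU.eventually_mem he)).mono fun y hy => hΨρ y hy
  -- The vector is carried to the product and back by the trivialization, and split there into a
  -- horizontal and a vertical part.
  have hv : v = (hΨ _ he (ρ x)).push (hΨρ x he) (hpr.push rfl v) :=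
    Subtype.ext (LinearMap.ext fun f => tangent_congr v (hloc.mono fun y hy => congrArg f.1 hy.symm))
  have hdec := tangent_prod charted_ellipticCurve (charted_proj r) (hpr.push rfl v)
  -- On a fibre, ω restricts to a form on projective space, which is zero.
  have hvert : ω x ((IsMorphismAt.slice_right (X := ellipticCurve W) (hΨ _ he (ρ x))).push
      (hΨρ x he) ((hρ x he).push rfl v)) = 0 := by
    have h1 : ∀ p, IsMorphismAt (proj r) X (fun p => Ψ (π x, p)) p := fun p =>
      IsMorphismAt.slice_right (X := ellipticCurve W) (hΨ _ he p)
    have h2 := proj_form_eq_zero (ω := pullback (fun p => Ψ (π x, p)) ω) (fun p =>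
      isRegularForm_pullback (Eventually.of_forall h1) (hω _)) (ρ x)
    rw [← pullback_apply (φ := fun p => Ψ (π x, p)) (h1 (ρ x)) (hΨρ x he) ω, h2, LinearMap.zero_apply]
  have hsum : ω x v = ω x ((IsMorphismAt.slice_left
      (X := ellipticCurve W) (hΨ _ he (ρ x))).push (hΨρ x he) ((hπ x).push rfl v)) := by
    conv_lhs => rw [hv, hdec, map_add, map_add]
    exact (congrArg (_ + ·) hvert).trans (add_zero _)
  rw [hsum]
  refine Eq.trans ?_ (form_lift_eq hω (hΨ _ he) ((hπ x).push rfl v) (ρ x) p₀)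
  have h3 := IsMorphismAt.slice_left (X := ellipticCurve W) (hΨ _ he (ρ x))
  exact (pullback_apply h3 (hΨρ x he) ω _).symm.trans (pullback_apply h3 rfl ω _)

/-- The Hodge number `h^{1,0}` of a projective fibration over an elliptic curve is one. -/
lemma hodgeNumberOneZero_eq_one (hfib : IsProjectiveFibration r X (ellipticCurve W) π) :
    X.hodgeNumberOneZero = 1 := by
  have hπ := isMorphism_iff.1 hfib.1
  have hp : Nonempty (ℙ ℂ (Fin (r + 1) → ℂ)) := inferInstance
  obtain ⟨p₀⟩ := hp
  let θ : X.oneForms := ⟨pullback π (invariantForm W), fun x =>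
    isRegularForm_pullback (Eventually.of_forall hπ) (isRegularForm_invariantForm _)⟩
  refine finrank_eq_one θ (fun h => ?_) fun ω => ?_
  · obtain ⟨U, Ψ, ρ, hU, he, hΨ, hρ, hπΨ, hΨρ⟩ := hfib.exists_trivialization (0 : W.toAffine.Point)
    obtain ⟨v, hv⟩ := exists_tangent_zero (W := W)
    have hs := IsMorphismAt.slice_left (X := ellipticCurve W) (hΨ _ he p₀)
    have h1 := congrArg (fun η : X.oneForms => η.1 (Ψ ((0 : W.toAffine.Point), p₀)) (hs.push rfl v)) h
    have h2 := (pullback_apply (hπ _) (hπΨ _ he p₀) (invariantForm W) (hs.push rfl v)).symm.trans h1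
    have h3 : (hπ _).push (hπΨ _ he p₀) (hs.push rfl v) =
        (isMorphismAt_translate (0 : W.toAffine.Point) 0).push (zero_add (0 : W.toAffine.Point)) v := by
      refine Subtype.ext (LinearMap.ext fun f => tangent_congr v ?_)
      filter_upwards [hU.eventually_mem he] with q hq
      exact congrArg f.1 ((hπΨ q hq p₀).trans (add_zero (M := W.toAffine.Point) q).symm)
    rw [h3, invariantForm_push, hv] at h2
    exact one_ne_zero h2
  · choose η hη using exists_form_eq hfib ω.2 hπ
    -- Locally η is the pull-back of ω along a section of π.
    have hreg : ∀ e, (ellipticCurve W).IsRegularForm η e := fun e => by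
      obtain ⟨U, Ψ, ρ, hU, he, hΨ, hρ, hπΨ, hΨρ⟩ := hfib.exists_trivialization e
      have hs : ∀ e' ∈ U, IsMorphismAt (ellipticCurve W) X (fun e => Ψ (e, p₀)) e' := fun e' he' =>
        IsMorphismAt.slice_left (X := ellipticCurve W) (hΨ _ he' p₀)
      refine isRegularForm_congr (isRegularForm_pullback (φ := fun e => Ψ (e, p₀))
        ((hU.eventually_mem he).mono hs) (ω.2 _)) ?_
      filter_upwards [hU.eventually_mem he] with e' he'
      refine LinearMap.ext fun v => ?_
      rw [pullback_apply (hs e' he') rfl, hη e' _ (hπΨ e' he' p₀)]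
      refine congrArg (η e') (Subtype.ext (LinearMap.ext fun f => tangent_congr v ?_))
      filter_upwards [hU.eventually_mem he'] with q hq
      exact congrArg f.1 (hπΨ q hq p₀)
    obtain ⟨c, hc⟩ := exists_eq_smul_invariantForm hreg
    refine ⟨c, Subtype.ext (funext fun x => LinearMap.ext fun v => ?_)⟩
    refine Eq.trans ?_ (hη _ x rfl v).symm
    refine Eq.trans ?_ (congrArg (fun η : Module.Dual ℂ _ => η ((hπ x).push rfl v)) (hc (π x))).symm
    exact congrArg (c * ·) (pullback_apply (hπ x) rfl (invariantForm W) v)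

end EllipticFibration

/-! ### Rational points over a rational function field are constant -/

section FunctionFieldPoints

open Polynomial

variable {α β γ : ℂ} {F G M A B D : ℂ[X]} {n : ℕ}

/-- The homogenized cubic `4 x³ + α x² + β x + γ`. -/
noncomputable def cubicForm {R : Type*} [CommRing R] (α β γ F G : R) : R :=
  4 * F ^ 3 + α * F ^ 2 * G + β * F * G ^ 2 + γ * G ^ 3

/-- Let H be the binary quartic G · `cubicForm`, so M² = H, and let P and Q be its partial
derivatives. By Euler's relation, P w = 4 H G' − G H' and Q w = F H' − 4 F' H, and both are
divisible by M. As P and Q are coprime, M divides w; but M has degree at least 2n, and a nonzero w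
has smaller degree. Geometrically, dx / y pulls back to a form on the projective line without poles.
-/
lemma wronskian_eq_zero_of_isCoprime (hsep : ∀ s : ℂ, cubicForm α β γ s 1 = 0 → 12 * s ^ 2 + 2 * α * s + β ≠ 0)
    (hco : IsCoprime F G) (hF : F.natDegree ≤ n) (hG : G.natDegree ≤ n)
    (h0 : cubicForm α β γ (F.coeff n) (G.coeff n) ≠ 0) (hG0 : G.coeff n ≠ 0)
    (hM : M ^ 2 = G * cubicForm (C α) (C β) (C γ) F G) : wronskian F G = 0 := by
  set w := wronskian F G with hw
  have hw' : w = F * derivative G - derivative F * G := rfl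
  have hd : 2 * M * derivative M = derivative G * cubicForm (C α) (C β) (C γ) F G +
      G * (12 * F ^ 2 * derivative F + C α * (2 * F * derivative F * G + F ^ 2 * derivative G) +
        C β * (derivative F * G ^ 2 + 2 * F * G * derivative G) + 3 * C γ * G ^ 2 * derivative G) := by
    have := congrArg derivative hM
    simp only [cubicForm, derivative_mul, derivative_add, derivative_pow, derivative_C, derivative_ofNat,
      Nat.cast_ofNat, C_ofNat] at this
    rw [cubicForm]
    linear_combination this
  let P := G * (12 * F ^ 2 + 2 * C α * F * G + C β * G ^ 2)
  let Q := 4 * F ^ 3 + 2 * C α * F ^ 2 * G + 3 * C β * F * G ^ 2 + 4 * C γ * G ^ 3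
  have h1 : M ∣ P * w := ⟨4 * M * derivative G - 2 * G * derivative M, by
    rw [cubicForm] at hM hd
    simp only [P, hw']
    linear_combination G * hd - 4 * derivative G * hM⟩
  have h2 : M ∣ Q * w := ⟨2 * F * derivative M - 4 * M * derivative F, by
    rw [cubicForm] at hM hd
    simp only [Q, hw']
    linear_combination -F * hd + 4 * derivative F * hM⟩
  -- At a common zero, G = 0 would force F = 0, against coprimality; otherwise F / G would be a
  -- multiple root of the cubic.
  have hPQ : IsCoprime P Q := by
    refine (isCoprime_iff_aeval_ne_zero_of_isAlgClosed (k := ℂ) ℂ P Q).2 fun t => ?_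
    by_contra! h
    obtain ⟨hP, hQ⟩ := h
    simp only [P, Q, map_mul, map_add, map_pow, aeval_C, map_ofNat, Algebra.algebraMap_self_apply] at hP hQ
    set a := aeval t F
    set c := aeval t G
    by_cases hc : c = 0
    · rw [hc] at hQ
      have ha : a = 0 := by
        have : a ^ 3 = 0 := by linear_combination hQ / 4
        exact pow_eq_zero_iff three_ne_zero |>.1 this
      obtain ⟨u, v, huv⟩ := hco
      have := congrArg (aeval t) huv
      rw [map_add, map_mul, map_mul, map_one] at this
      change _ * a + _ * c = 1 at this
      rw [ha, hc, mul_zero, mul_zero, add_zero] at this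
      exact zero_ne_one this
    · have hP' := (mul_eq_zero.1 hP).resolve_left hc
      refine hsep (a / c) ?_ ?_
      · rw [cubicForm]
        field_simp
        linear_combination (hQ + a * hP') / 4
      · field_simp
        linear_combination hP'
  have h3 : M ∣ w := by
    obtain ⟨u, v, huv⟩ := hPQ
    have e : w = u * (P * w) + v * (Q * w) := by linear_combination -w * huv
    rw [e]
    exact dvd_add (h1.mul_left u) (h2.mul_left v)
  by_contra hne
  have hdeg := natDegree_le_of_dvd h3 hne
  have hlt : w.natDegree < F.natDegree + G.natDegree := natDegree_wronskian_lt_add hne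
  -- This coefficient is the quartic evaluated at the coefficients of degree n, nonzero by the
  -- conditions at infinity.
  have hcoef : (M ^ 2).coeff (4 * n) ≠ 0 := by
    have e : ∀ i j, i + j = 4 → (F ^ i * G ^ j).coeff (4 * n) = F.coeff n ^ i * G.coeff n ^ j := fun i j hij => by
      rw [← hij, add_mul, coeff_mul_add_eq_of_natDegree_le (natDegree_pow_le_of_le i hF)
        (natDegree_pow_le_of_le j hG), coeff_pow_of_natDegree_le hF, coeff_pow_of_natDegree_le hG]
    have e' : M ^ 2 = C 4 * (F ^ 3 * G ^ 1) + C α * (F ^ 2 * G ^ 2) + C β * (F ^ 1 * G ^ 3) +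
        C γ * (F ^ 0 * G ^ 4) := by
      rw [hM, cubicForm, map_ofNat]
      ring
    rw [e', coeff_add, coeff_add, coeff_add, coeff_C_mul, coeff_C_mul, coeff_C_mul, coeff_C_mul, e _ _ rfl,
      e _ _ rfl, e _ _ rfl, e _ _ rfl]
    intro h
    refine mul_ne_zero hG0 h0 ?_
    rw [cubicForm]
    linear_combination h
  have hle := le_natDegree_of_ne_zero hcoef
  rw [natDegree_pow] at hle
  omega

/-- If `(F / G, B / D)` satisfies `y² = 4 x³ + α x² + β x + γ`, where the cubic is separable and does not
vanish at the value of `F / G` at infinity, then `F / G` is constant. -/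
lemma ratio_const (hsep : ∀ s : ℂ, cubicForm α β γ s 1 = 0 → 12 * s ^ 2 + 2 * α * s + β ≠ 0)
    (hF : F.natDegree ≤ n) (hG : G.natDegree ≤ n)
    (h0 : cubicForm α β γ (F.coeff n) (G.coeff n) ≠ 0) (hG0 : G.coeff n ≠ 0) (hD : D ≠ 0)
    (hrel : B ^ 2 * G ^ 3 = D ^ 2 * cubicForm (C α) (C β) (C γ) F G) : ∃ κ, F = C κ * G := by
  -- Dividing by the gcd g lowers n by the degree of g and changes the quantities at infinity only
  -- by powers of the leading coefficient of g.
  obtain ⟨F', G', hF', hG', hu⟩ := extract_gcd F G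
  rw [gcd_isUnit_iff] at hu
  set g := gcd F G
  clear_value g
  subst hF' hG'
  have hne : g * G' ≠ 0 := fun h => hG0 (by rw [h, coeff_zero])
  have hg : g ≠ 0 := left_ne_zero_of_mul hne
  have hG'0 : G' ≠ 0 := right_ne_zero_of_mul hne
  rw [natDegree_mul hg hG'0] at hG
  have hF'n : F'.natDegree ≤ n - g.natDegree := by
    by_cases h : F' = 0
    · rw [h, natDegree_zero]
      exact Nat.zero_le _
    · rw [natDegree_mul hg h] at hF
      omega
  have hG'n : G'.natDegree ≤ n - g.natDegree := by omega
  have hn : g.natDegree + (n - g.natDegree) = n := by omega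
  have hlc : g.coeff g.natDegree ≠ 0 := by rwa [coeff_natDegree, leadingCoeff_ne_zero]
  rw [← hn, coeff_mul_add_eq_of_natDegree_le le_rfl hF'n, coeff_mul_add_eq_of_natDegree_le le_rfl hG'n] at h0
  rw [← hn, coeff_mul_add_eq_of_natDegree_le le_rfl hG'n] at hG0
  have hrel' : (B * G' ^ 2) ^ 2 = D ^ 2 * (G' * cubicForm (C α) (C β) (C γ) F' G') := by
    refine mul_left_cancel₀ (pow_ne_zero 3 hg) ?_
    rw [cubicForm] at hrel ⊢
    linear_combination G' * hrel
  -- D² divides a square, so D divides its root, since ℂ[X] is integrally closed.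
  obtain ⟨M, hM⟩ := (IsIntegrallyClosed.pow_dvd_pow_iff two_ne_zero).1 (Dvd.intro _ hrel'.symm)
  have hM2 : M ^ 2 = G' * cubicForm (C α) (C β) (C γ) F' G' := by
    refine mul_left_cancel₀ (pow_ne_zero 2 hD) ?_
    rw [← hrel', hM]
    ring
  have hw := wronskian_eq_zero_of_isCoprime hsep hu hF'n hG'n (fun h => h0 (by
    rw [cubicForm] at h ⊢
    linear_combination (g.coeff g.natDegree) ^ 3 * h)) (right_ne_zero_of_mul hG0) hM2
  obtain ⟨h1, h2⟩ := hu.wronskian_eq_zero_iff.1 hw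
  have e1 := eq_C_of_derivative_eq_zero h1
  have e2 := eq_C_of_derivative_eq_zero h2
  have hc : G'.coeff 0 ≠ 0 := fun h => hG'0 (by rw [e2, h, C_0])
  refine ⟨F'.coeff 0 / G'.coeff 0, ?_⟩
  rw [e1, e2, coeff_C_zero, coeff_C_zero, mul_left_comm, ← C_mul, div_mul_cancel₀ _ hc]

end FunctionFieldPoints

/-! ### Rational maps from projective space to the elliptic curve -/

section RationalMaps

open Polynomial

variable {W : WeierstrassCurve ℂ} [W.IsElliptic]

/-- A multiple root would give a singular point of the curve with 2y + a₁x + a₃ = 0. -/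
lemma cubicForm_separable (s : ℂ) (hs : cubicForm W.b₂ (2 * W.b₄) W.b₆ s 1 = 0) :
    12 * s ^ 2 + 2 * W.b₂ * s + 2 * W.b₄ ≠ 0 := by
  simp only [cubicForm, WeierstrassCurve.b₂, WeierstrassCurve.b₄, WeierstrassCurve.b₆] at hs ⊢
  have he : W.toAffine.Equation s (-(W.a₁ * s + W.a₃) / 2) := by
    rw [WeierstrassCurve.Affine.equation_iff']
    linear_combination -hs / 4
  have hn := WeierstrassCurve.Affine.equation_iff_nonsingular.1 he
  rw [WeierstrassCurve.Affine.nonsingular_iff'] at hn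
  intro h
  rcases hn.2 with h1 | h1
  · exact h1 (by linear_combination -h / 4)
  · exact h1 (by ring)

lemma cubicForm_xCoord {P : W.toAffine.Point} (hP : P ≠ 0) :
    cubicForm W.b₂ (2 * W.b₄) W.b₆ (xCoord W P) 1 = (2 * yCoord W P + W.a₁ * xCoord W P + W.a₃) ^ 2 := by
  have h1 := equation_coords hP
  simp only [cubicForm, WeierstrassCurve.b₂, WeierstrassCurve.b₄, WeierstrassCurve.b₆]
  linear_combination -4 * h1

lemma eval_reflect {N : ℕ} {f : ℂ[X]} (hf : f.natDegree ≤ N) {t : ℂ} (ht : t ≠ 0) :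
    (reflect N f).eval t = t ^ N * f.eval t⁻¹ := by
  let _ : Invertible t⁻¹ := invertibleOfNonzero (inv_ne_zero ht)
  have h := eval₂_reflect_mul_pow (RingHom.id ℂ) t⁻¹ N f hf
  rw [invOf_eq_inv, inv_inv] at h
  change eval t (reflect N f) * t⁻¹ ^ N = eval t⁻¹ f at h
  rw [← h, mul_left_comm, inv_pow, mul_inv_cancel₀ (pow_ne_zero N ht), mul_one]

/-- A polynomial on a line. -/
noncomputable def linePoly {σ : Type*} (v w : σ → ℂ) (F : MvPolynomial σ ℂ) : ℂ[X] :=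
  MvPolynomial.aeval (fun i => C (v i) + X * C (w i)) F

lemma eval_linePoly {σ : Type*} (v w : σ → ℂ) (F : MvPolynomial σ ℂ) (s : ℂ) :
    (linePoly v w F).eval s = MvPolynomial.eval (v + s • w) F := by
  have h := MvPolynomial.comp_aeval (R := ℂ) (fun i => C (v i) + X * C (w i)) (aeval (R := ℂ) s)
  refine (DFunLike.congr_fun h F).trans ?_
  rw [MvPolynomial.aeval_eq_eval]
  congr 2
  ext i
  rw [map_add, map_mul, aeval_C, aeval_C, aeval_X]
  rfl

lemma natDegree_linePoly_le {σ : Type*} (v w : σ → ℂ) {F : MvPolynomial σ ℂ} {d : ℕ} (hF : F.IsHomogeneous d) :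
    (linePoly v w F).natDegree ≤ d := by
  have h := MvPolynomial.aeval_natDegree_le (n := 1) F hF.totalDegree_le (fun i => C (v i) + X * C (w i))
    fun i => by compute_degree
  rwa [mul_one] at h

/-- A fraction in homogeneous coordinates that do not come from the chosen representative. -/
lemma div_eval_rep_mk {m d : ℕ} {F H : MvPolynomial (Fin (m + 1)) ℂ} (hF : F.IsHomogeneous d)
    (hH : H.IsHomogeneous d) {v : Fin (m + 1) → ℂ} (hv : v ≠ 0)
    (h0 : MvPolynomial.eval (Projectivization.mk ℂ v hv).rep H ≠ 0) :
    MvPolynomial.eval v H ≠ 0 ∧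
    MvPolynomial.eval (Projectivization.mk ℂ v hv).rep F / MvPolynomial.eval (Projectivization.mk ℂ v hv).rep H =
      MvPolynomial.eval v F / MvPolynomial.eval v H := by
  obtain ⟨a, ha⟩ := Projectivization.exists_smul_eq_mk_rep ℂ v hv
  have e : (Projectivization.mk ℂ v hv).rep = (a : ℂ) • v := ha.symm
  rw [e, eval_smul_of_isHomogeneous hH] at h0 ⊢
  rw [eval_smul_of_isHomogeneous hF]
  exact ⟨right_ne_zero_of_mul h0, mul_div_mul_left _ _ (left_ne_zero_of_mul h0)⟩

lemma exists_homogeneous_fraction {m : ℕ} {f : ℙ ℂ (Fin (m + 1) → ℂ) → ℂ} {p : ℙ ℂ (Fin (m + 1) → ℂ)}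
    (hf : (proj m).RegAt f p) : ∃ (d : ℕ) (F H : MvPolynomial (Fin (m + 1)) ℂ), F.IsHomogeneous d ∧
      H.IsHomogeneous d ∧ MvPolynomial.eval p.rep H ≠ 0 ∧
      @IsOpen (proj m) _ {u : ℙ ℂ (Fin (m + 1) → ℂ) | MvPolynomial.eval u.rep H ≠ 0} ∧
      ∀ u, MvPolynomial.eval u.rep H ≠ 0 → f u = MvPolynomial.eval u.rep F / MvPolynomial.eval u.rep H := by
  obtain ⟨d, _, hF, _, hH, hp, he⟩ := hf
  have hO := @TopologicalSpace.IsTopologicalBasis.isOpen _ (projData m).topology _ _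
    (projData m).isBasis ⟨d, _, hH, rfl⟩
  obtain ⟨F, hF, rfl⟩ := mem_projData_A.1 hF
  obtain ⟨H, hH, rfl⟩ := mem_projData_A.1 hH
  have e : (projData m).basic d (fun p => MvPolynomial.eval p.rep H) =
      {u : ℙ ℂ (Fin (m + 1) → ℂ) | MvPolynomial.eval u.rep H ≠ 0} := Set.ext fun u => and_iff_right trivial
  exact ⟨d, F, H, by assumption, by assumption, hp.2, e ▸ hO, fun u hu => he u ⟨trivial, hu⟩⟩

/-- A rational map from projective space to the elliptic curve is locally constant. -/
lemma eventually_xCoord_eq {m : ℕ} {ψ : ℙ ℂ (Fin (m + 1) → ℂ) → W.toAffine.Point} {w : ℙ ℂ (Fin (m + 1) → ℂ)}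
    (hψ : IsMorphismAt (proj m) (ellipticCurve W) ψ w) (h0 : ψ w ≠ 0) (h2 : ψ w ≠ -ψ w) :
    ∀ᶠ u in @nhds (proj m) _ w, xCoord W (ψ u) = xCoord W (ψ w) := by
  have hx := hψ.regAt_xCoord h0
  have c := fun a => (proj m).regAt_const a w
  have hz : (proj m).RegAt (fun q => 2 * yCoord W (ψ q) + W.a₁ * xCoord W (ψ q) + W.a₃) w :=
    (proj m).regAt_add ((proj m).regAt_add ((proj m).regAt_mul (c 2) (hψ.regAt_yCoord h0))
      ((proj m).regAt_mul (c _) hx)) (c _)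
  have hz0 : 2 * yCoord W (ψ w) + W.a₁ * xCoord W (ψ w) + W.a₃ ≠ 0 := fun h => h2 (by
    refine ext_coords h0 (neg_ne_zero_point h0) (xCoord_neg _).symm ?_
    rw [yCoord_neg h0]
    linear_combination h)
  obtain ⟨d, F, H, hF, hH, hHw, hO, hxe⟩ := exists_homogeneous_fraction hx
  obtain ⟨d', F', H', hF', hH', hHw', hO', hze⟩ := exists_homogeneous_fraction hz
  filter_upwards [IsOpen.mem_nhds (X := proj m) hO hHw] with u hu
  change ℙ ℂ (Fin (m + 1) → ℂ) at u
  by_cases huw : u = w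
  · exact congrArg (fun u => xCoord W (ψ u)) huw
  have hind : LinearIndependent ℂ ![w.rep, u.rep - w.rep] := by
    have h := LinearIndependent.pair_iff.1 (linearIndependent_rep huw)
    refine LinearIndependent.pair_iff.2 fun s t hst => ?_
    obtain ⟨ht, hs⟩ := h t (s - t) (by rw [← hst, sub_smul, smul_sub]; abel)
    exact ⟨by rwa [ht, sub_zero] at hs, ht⟩
  have hL0 : projLine hind 0 = w := by rw [projLine_zero _ w.rep_nonzero, w.mk_rep]
  have hcont := (holoAt_projLine hind 0).continuousAt
  have hev : ∀ᶠ q in @nhds (proj m) _ w, ψ q ≠ 0 ∧ 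
      MvPolynomial.eval q.rep H ≠ 0 ∧ MvPolynomial.eval q.rep H' ≠ 0 :=
    (eventually_comp_ne_zero hψ h0).and ((IsOpen.eventually_mem (X := proj m) hO hHw).and (IsOpen.eventually_mem (X := proj m) hO' hHw'))
  rw [← hL0] at hev
  set a := linePoly w.rep (u.rep - w.rep) F
  set b := linePoly w.rep (u.rep - w.rep) H
  set a' := linePoly w.rep (u.rep - w.rep) F'
  set b' := linePoly w.rep (u.rep - w.rep) H'
  -- On the line from w to u, the function x ∘ ψ is a / b and 2y + a₁x + a₃ becomes a' / b'. Their
  -- relation holds for infinitely many parameters, hence between polynomials.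
  have hrel : a' ^ 2 * b ^ 3 = b' ^ 2 * cubicForm (C W.b₂) (C (2 * W.b₄)) (C W.b₆) a b := by
    refine eq_of_infinite_eval_eq _ _ ((infinite_of_mem_nhds (0 : ℂ) (hcont.eventually hev)).mono ?_)
    rintro s ⟨h1, h2, h3⟩
    have e1 := hxe _ h2
    have e2 := hze _ h3
    obtain ⟨n1, e1'⟩ := div_eval_rep_mk hF hH (line_ne_zero hind s) h2
    obtain ⟨n2, e2'⟩ := div_eval_rep_mk hF' hH' (line_ne_zero hind s) h3
    have e3 := cubicForm_xCoord h1
    rw [← eval_linePoly] at n1 n2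
    have e1'' := e1.trans e1'
    have e2'' := e2.trans e2'
    rw [← eval_linePoly, ← eval_linePoly] at e1'' e2''
    change eval s b ≠ 0 at n1
    change eval s b' ≠ 0 at n2
    change xCoord W (ψ (projLine hind s)) = eval s a / eval s b at e1''
    change 2 * yCoord W (ψ (projLine hind s)) + W.a₁ * xCoord W (ψ (projLine hind s)) + W.a₃ =
      eval s a' / eval s b' at e2''
    rw [e2'', e1'', cubicForm] at e3
    field_simp at e3
    change eval s (a' ^ 2 * b ^ 3) = eval s (b' ^ 2 * _)
    simp only [cubicForm, eval_mul, eval_add, eval_pow, eval_C, eval_ofNat]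
    linear_combination -e3
  have ha : a.natDegree ≤ d := natDegree_linePoly_le w.rep (u.rep - w.rep) hF
  have hb : b.natDegree ≤ d := natDegree_linePoly_le w.rep (u.rep - w.rep) hH
  have ha' : a'.natDegree ≤ d' := natDegree_linePoly_le w.rep (u.rep - w.rep) hF'
  have hb' : b'.natDegree ≤ d' := natDegree_linePoly_le w.rep (u.rep - w.rep) hH'
  -- Reversing the polynomials moves w from parameter 0 to infinity, where `ratio_const` needs the
  -- cubic to be nonzero; this is `hz0`. The point u stays at parameter 1.
  have hrel' : reflect d' a' ^ 2 * reflect d b ^ 3 =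
      reflect d' b' ^ 2 * cubicForm (C W.b₂) (C (2 * W.b₄)) (C W.b₆) (reflect d a) (reflect d b) := by
    refine eq_of_infinite_eval_eq _ _ ((Set.finite_singleton (0 : ℂ)).infinite_compl.mono fun t ht => ?_)
    have e := congrArg (eval t⁻¹) hrel
    change eval t _ = eval t _
    simp only [cubicForm, eval_mul, eval_add, eval_pow, eval_C, eval_ofNat, eval_reflect ha ht, eval_reflect hb ht,
      eval_reflect ha' ht, eval_reflect hb' ht] at e ⊢
    linear_combination (t ^ d') ^ 2 * (t ^ d) ^ 3 * e
  have hcoef : ∀ {N : ℕ} (P : MvPolynomial (Fin (m + 1)) ℂ),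
      (reflect N (linePoly w.rep (u.rep - w.rep) P)).coeff N = MvPolynomial.eval w.rep P := fun {N} P => by
    rw [coeff_reflect, revAt_le le_rfl, Nat.sub_self, coeff_zero_eq_eval_zero, eval_linePoly, zero_smul, add_zero]
  have hone : ∀ {N : ℕ} {P : MvPolynomial (Fin (m + 1)) ℂ}, P.IsHomogeneous N →
      (reflect N (linePoly w.rep (u.rep - w.rep) P)).eval 1 = MvPolynomial.eval u.rep P := fun {N P} hP => by
    rw [eval_reflect (natDegree_linePoly_le _ _ hP) one_ne_zero, one_pow, one_mul, inv_one, eval_linePoly, one_smul,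
      add_sub_cancel]
  have hxw : xCoord W (ψ w) = MvPolynomial.eval w.rep F / MvPolynomial.eval w.rep H := hxe w hHw
  obtain ⟨κ, hκ⟩ := ratio_const cubicForm_separable (natDegree_reflect_le.trans (max_le le_rfl ha))
    (natDegree_reflect_le.trans (max_le le_rfl hb)) (fun h => by
      rw [hcoef, hcoef] at h
      refine pow_ne_zero 2 hz0 ?_
      rw [← cubicForm_xCoord h0, hxw]
      rw [cubicForm] at h ⊢
      field_simp
      linear_combination h) (by rwa [hcoef]) (fun h => hHw' (by
      have h1 := hcoef (N := d') H'
      rw [h, coeff_zero] at h1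
      exact h1.symm)) hrel'
  have h3 := congrArg (fun P => P.coeff d) hκ
  have h4 := congrArg (eval 1) hκ
  rw [eval_mul, eval_C, hone hF, hone hH] at h4
  simp only [coeff_C_mul] at h3
  rw [hcoef, hcoef] at h3
  change xCoord W (ψ u) = xCoord W (ψ w)
  rw [hxw, h3, mul_div_cancel_right₀ _ hHw]
  refine (hxe u hu).trans ?_
  rw [h4, mul_div_cancel_right₀ _ hu]

end RationalMaps

namespace SpaceWithFunctions

/-- Birational spaces, in terms of maps between the spaces themselves. -/
lemma Birational.exists_maps {X Y : SpaceWithFunctions} [Nonempty Y] (h : Birational X Y) :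
    ∃ (U : Set X) (V : Set Y) (f : X → Y) (g : Y → X), IsOpen U ∧ U.Nonempty ∧ Dense U ∧ IsOpen V ∧
      (∀ x ∈ U, IsMorphismAt X Y f x ∧ f x ∈ V ∧ g (f x) = x) ∧
      ∀ y ∈ V, IsMorphismAt Y X g y ∧ g y ∈ U ∧ f (g y) = y := by
  obtain ⟨U, V, hU, hdU, hV, hdV, φ, hφ, hφ'⟩ := h
  rw [isMorphism_iff] at hφ hφ'
  obtain ⟨y, hy⟩ := hdV.nonempty
  have hne : U.Nonempty := ⟨_, (φ.symm (⟨y, hy⟩ : V)).2⟩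
  obtain ⟨s, hs, hs'⟩ := exists_retraction hU hne
  obtain ⟨t, ht, ht'⟩ := exists_retraction hV ⟨y, hy⟩
  refine ⟨U, V, fun x => (φ (s x)).1, fun y => (φ.symm (t y)).1, hU, hne, hdU, hV, fun x hx => ⟨?_, (φ (s x)).2, ?_⟩,
    fun y hy => ⟨?_, (φ.symm (t y)).2, ?_⟩⟩
  · exact (isMorphismAt_val _).comp ((hφ _).comp (hs' x hx))
  · change (φ.symm (t (φ (s x)).1)).1 = x
    rw [ht _ (φ (s x)).2, hs x hx]
    exact congrArg Subtype.val (φ.symm_apply_apply _)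
  · exact (isMorphismAt_val _).comp ((hφ' _).comp (ht' y hy))
  · change (φ (s (φ.symm (t y)).1)).1 = y
    rw [hs _ (φ.symm (t y)).2, ht y hy]
    exact congrArg Subtype.val (φ.apply_symm_apply _)

end SpaceWithFunctions

/-- A space that is birational to the product of the elliptic curve and a projective space is not
rational. -/
lemma not_isRational {W : WeierstrassCurve ℂ} [W.IsElliptic] {D : SpaceWithFunctions} {k : ℕ}
    (h : Birational D ((ellipticCurve W).prod (proj k))) : ¬ D.IsRational := by
  rintro ⟨m, h'⟩
  have hp : ∀ m, Nonempty (ℙ ℂ (Fin (m + 1) → ℂ)) := fun m => inferInstance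
  have : Nonempty ((ellipticCurve W).prod (proj k)) := ⟨((0 : W.toAffine.Point), (hp k).some)⟩
  have : Nonempty (proj m) := hp m
  obtain ⟨U₁, V₁, f₁, g₁, hU₁, hne, -, hV₁, hf₁, hg₁⟩ := h.exists_maps
  obtain ⟨U₂, V₂, f₂, g₂, hU₂, -, hd, hV₂, hf₂, hg₂⟩ := h'.exists_maps
  obtain ⟨x, hx₁, hx₂⟩ := hd.inter_open_nonempty U₁ hU₁ hne
  rcases hz₀ : f₁ x with ⟨e₀, p⟩
  have hslice : ∀ e : W.toAffine.Point, IsMorphismAt (ellipticCurve W) ((ellipticCurve W).prod (proj k))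
      (fun e => (e, p)) e := fun e => isMorphismAt_slice_left (X := ellipticCurve W) p e
  -- The points e for which (e, p) can be carried to D and on to projective space by the two
  -- birational maps; on N the composition ψ ∘ χ is the identity.
  let N : Set (ellipticCurve W) := {e | (e, p) ∈ V₁ ∧ g₁ (e, p) ∈ U₂}
  have hN : IsOpen N := isOpen_iff_eventually.2 fun e he =>
    (hslice e).1.eventually ((hV₁.eventually_mem he.1).and ((hg₁ _ he.1).1.1.eventually (hU₂.eventually_mem he.2)))
  have hN₀ : e₀ ∈ N := by
    constructor
    · rw [← hz₀]
      exact (hf₁ x hx₁).2.1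
    · rw [← hz₀, (hf₁ x hx₁).2.2]
      exact hx₂
  have hNfin := finite_compl_of_isOpen (W := W) hN ⟨_, hN₀⟩
  -- `eventually_xCoord_eq` requires an affine point that is not 2-torsion.
  obtain ⟨e, he⟩ := exists_notMem_of_finite (W := W) ((hNfin.union finite_two_torsion).union
    (Set.finite_singleton (0 : W.toAffine.Point)))
  obtain ⟨he, he0⟩ := not_or.1 he
  obtain ⟨he, he2⟩ := not_or.1 he
  have heN : e ∈ N := not_not.1 he
  let ψ : ℙ ℂ (Fin (m + 1) → ℂ) → W.toAffine.Point := fun q => Prod.fst (α := W.toAffine.Point) (β := proj k) (f₁ (g₂ q))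
  let χ : W.toAffine.Point → ℙ ℂ (Fin (m + 1) → ℂ) := fun e => f₂ (g₁ (e, p))
  have hψχ : ∀ e ∈ N, ψ (χ e) = e := fun e he => by
    change Prod.fst (α := W.toAffine.Point) (β := proj k) (f₁ (g₂ (f₂ (g₁ (e, p))))) = e
    rw [(hf₂ _ he.2).2.2, (hg₁ _ he.1).2.2]
  have hχ : IsMorphismAt (ellipticCurve W) (proj m) χ e :=
    (hf₂ _ heN.2).1.comp (IsMorphismAt.slice_left (X := ellipticCurve W) (Φ := g₁) (hg₁ _ heN.1).1)
  have hψ : IsMorphismAt (proj m) (ellipticCurve W) ψ (χ e) := by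
    have h2 := hg₂ _ (hf₂ _ heN.2).2.1
    have h1 : g₂ (χ e) ∈ U₁ := by
      change g₂ (f₂ (g₁ (e, p))) ∈ U₁
      rw [(hf₂ _ heN.2).2.2]
      exact (hg₁ _ heN.1).2.1
    exact (isMorphismAt_fst (X := ellipticCurve W) (Y := proj k) _).comp ((hf₁ _ h1).1.comp h2.1)
  -- Pulled back by χ, this makes x constant on a neighbourhood of e. But such a neighbourhood omits
  -- only finitely many points of E, and x takes each value finitely often.
  have hev := eventually_xCoord_eq hψ (by rwa [hψχ e heN]) (by rwa [hψχ e heN])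
  have hev' := hχ.1.eventually hev
  obtain ⟨O, hO, hOo, heO⟩ := mem_nhds_iff.1 (hev'.and (hN.eventually_mem heN))
  obtain ⟨e', he'⟩ := exists_notMem_of_finite (W := W) (((finite_compl_of_isOpen (W := W) hOo ⟨_, heO⟩).union
    (finite_xCoord_fiber (xCoord W e))).union (Set.finite_singleton (0 : W.toAffine.Point)))
  obtain ⟨he', he'0⟩ := not_or.1 he'
  obtain ⟨he', he'x⟩ := not_or.1 he'
  obtain ⟨h1, h2⟩ := hO (not_not.1 he')
  refine he'x ⟨he'0, ?_⟩
  change xCoord W (ψ (χ e')) = xCoord W (ψ (χ e)) at h1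
  rwa [hψχ e heN, hψχ e' h2] at h1

theorem mainTheorem9 (W : WeierstrassCurve ℂ) [W.IsElliptic] (n : ℕ) (hn : 3 ≤ n) :
    ((zeroFibre W n).IsIrreducibleDivisor (diagonalDivisor W n)) ∧
    (∃ (X : SpaceWithFunctions) (π : X → ellipticCurve W),
      SpaceWithFunctions.IsProjectiveFibration (n - 3) X (ellipticCurve W) π ∧
      SpaceWithFunctions.Birational ((zeroFibre W n).sub (diagonalDivisor W n)) X) ∧
    (∀ (X : SpaceWithFunctions) (π : X → ellipticCurve W),
      SpaceWithFunctions.IsProjectiveFibration (n - 3) X (ellipticCurve W) π →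
      SpaceWithFunctions.Birational ((zeroFibre W n).sub (diagonalDivisor W n)) X →
      X.hodgeNumberOneZero = 1) ∧
    ¬ ((zeroFibre W n).sub (diagonalDivisor W n)).IsRational := by
  obtain ⟨k, rfl⟩ := Nat.exists_eq_add_of_le' hn
  have hbir := birational_diagonalSpace (W := W) k
  exact ⟨isIrreducibleDivisor_diagonalDivisor k, ⟨_, _, isProjectiveFibration_prod k (ellipticCurve W), hbir⟩,
    fun X π hfib _ => hodgeNumberOneZero_eq_one hfib, not_isRational hbir⟩
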